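/- Let $\Bbbk$ be a field. Let $Ch$ be the category of unbounded chain complexes of $\Bbbk$-vector spaces and $Ch_+$ the category of non-negatively graded ones, with their usual model structures: weak equivalences are the quasi-isomorphisms, cofibrations the degreewise injections, and fibrations the maps that are surjective in every degree (for $Ch$), respectively in every positive degree (for $Ch_+$). Let $\mathcal{O}$ be a reduced operad in $Ch_+$ (that is, $\mathcal{O}(0)=0$ and $\mathcal{O}(1)=\Bbbk$) and let $\mathrm{Alg}_{\mathcal O}$ be the category of $\mathcal{O}$-algebras in $Ch_+$; weak equivalences and fibrations are those of the underlying complexes, and cofibrations are the maps with the left lifting property against trivial fibrations. Let $\mathcal{C}$ and $\mathcal{D}$ be any of $\mathrm{Alg}_{\mathcal O}$, $Ch_+$, $Ch$; if one of them is $\mathrm{Alg}_{\mathcal O}$ and $\Bbbk$ has positive characteristic, assume that the above classes make $\mathrm{Alg}_{\mathcal O}$ a model category. Write $\underline n=\{1,\dots,n\}$. An $n$-cube in $\mathcal C$ is a functor from the poset of subsets of $\underline n$ to $\mathcal{C}$. It is strongly cocartesian if each of its two-dimensional faces is a homotopy pushout square. An $n$-cube $\mathcal X$ is cartesian if $\mathcal{X}(\emptyset)\to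 \mathrm{holim}_{T\neq\emptyset}\mathcal X(T)$ is a weak equivalence, and its total homotopy fiber is the homotopy fiber of this map. A functor $F:\mathcal C\to\mathcal D$ is a homotopy functor if it preserves weak equivalences, and it is reduced if $F(0)\simeq 0$. A homotopy functor is $n$-excisive if it takes strongly cocartesian $(n+1)$-cubes to cartesian cubes. The $n$-th cross-effect $cr_nF(X_1,\dots,X_n)$ is the total homotopy fiber of the $n$-cube $T\mapsto F(\coprod_{i\in \underline n\setminus T}X_i)$, whose maps are induced by the projections that collapse summands; it is evaluated on cofibrant objects $X_1,\dots,X_n$ of $\mathcal C$ (every object of $Ch_+$ and of $Ch$ is cofibrant). For a finite set $T$ and a cofibrant $X$, let $X*T$ be the homotopy cofiber of the fold map $\coprod_T X\to X$. Let $T_{n-1}F(X)=\mathrm{holim}_{\emptyset\neq T\subseteq\underline n}F(X*T)$, with the natural map $t_{n-1}F:F(X)\simeq F(X*\emptyset)\to T_{n-1}F(X)$, and let $P_{n-1}F$ be the homotopy colimit of $F\xrightarrow{t_{n-1}F}T_{n-1}F\xrightarrow{T_{n-1}(t_{n-1}F)}T_{n-1}^2F\to\cdots$. A reduced homotopy functor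 $F$ is $n$-homogeneous if it is $n$-excisive and $P_{n-1}F\simeq 0$. Let $n\ge 1$. 1. If $H:\mathcal C\to\mathcal D$ is a reduced $n$-excisive homotopy functor such that $cr_nH\simeq 0$ (that is, $cr_nH(X_1,\dots,X_n)\simeq 0$ for all cofibrant $X_1,\dots,X_n$), then $H$ is $(n-1)$-excisive. 2. Let $F,G:\mathcal C\to\mathcal D$ be $n$-homogeneous functors and $J:F\to G$ a natural transformation. If $cr_nJ: cr_nF\to cr_nG$ is a weak equivalence (on all cofibrant $X_1,\dots,X_n$), then $J_X:F(X)\to G(X)$ is a weak equivalence for every object $X$ of $\mathcal C$. -/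

import Mathlib

open CategoryTheory CategoryTheory.Limits HomotopicalAlgebra

universe u

noncomputable section

/-! ### Chain complexes and their model structures -/

/-- `Ch`: unbounded chain complexes of `k`-vector spaces. -/
abbrev Ch (k : Type u) [Field k] : Type (u + 1) := ChainComplex (ModuleCat.{u} k) ℤ

/-- `Ch₊`: non-negatively graded chain complexes of `k`-vector spaces. -/
abbrev ChPlus (k : Type u) [Field k] : Type (u + 1) := ChainComplex (ModuleCat.{u} k) ℕ

section ChainComplexes

variable (k : Type u) [Field k]

/-- Weak equivalences of unbounded complexes are the quasi-isomorphisms. -/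
instance chWeakEquivalences : CategoryWithWeakEquivalences (Ch k) where
  weakEquivalences := HomologicalComplex.quasiIso _ _

/-- Fibrations of unbounded complexes are the degreewise surjections. -/
instance chFibrations : CategoryWithFibrations (Ch k) where
  fibrations := fun _ _ f => ∀ i : ℤ, Function.Surjective (f.f i)

/-- Cofibrations of unbounded complexes are the degreewise injections. -/
instance chCofibrations : CategoryWithCofibrations (Ch k) where
  cofibrations := fun _ _ f => ∀ i : ℤ, Function.Injective (f.f i)

/-- Weak equivalences of non-negative complexes are the quasi-isomorphisms. -/
instance chPlusWeakEquivalences : CategoryWithWeakEquivalences (ChPlus k) where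
  weakEquivalences := HomologicalComplex.quasiIso _ _

/-- Fibrations of non-negative complexes are the maps that are surjective in positive degrees. -/
instance chPlusFibrations : CategoryWithFibrations (ChPlus k) where
  fibrations := fun _ _ f => ∀ i : ℕ, 0 < i → Function.Surjective (f.f i)

/-- Cofibrations of non-negative complexes are the degreewise injections. -/
instance chPlusCofibrations : CategoryWithCofibrations (ChPlus k) where
  cofibrations := fun _ _ f => ∀ i : ℕ, Function.Injective (f.f i)

end ChainComplexes

/-! ### The total graded vector space of a non-negative complex -/

namespace ChPlus

variable {k : Type u} [Field k]

/-- The direct sum of the terms of a complex. Structure maps on complexes are written on these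
total spaces; that they respect the grading is then required separately. -/
abbrev Tot (X : ChPlus k) : Type u := DirectSum ℕ (fun i => X.X i)

/-- The inclusion of the degree `i` part: `hom X i x` is `x` seen as a homogeneous element. -/
abbrev hom (X : ChPlus k) (i : ℕ) : X.X i →ₗ[k] Tot X := DirectSum.lof k ℕ (fun i => X.X i) i

/-- The differential on the total space (on degree `0` it is zero, as `X.d 0 0 = 0`). -/
def diff (X : ChPlus k) : Tot X →ₗ[k] Tot X :=
  DirectSum.toModule k ℕ (Tot X) (fun i => (hom X (i - 1)).comp (X.d i (i - 1)).hom)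

/-- The sign involution: multiplication by `(-1) ^ i` on degree `i`. -/
def sgn (X : ChPlus k) : Module.End k (Tot X) :=
  DirectSum.lmap (fun i => ((-1 : k) ^ i) • (LinearMap.id : X.X i →ₗ[k] X.X i))

/-- The map induced on total spaces by a morphism of complexes. -/
def totMap {X Y : ChPlus k} (f : X ⟶ Y) : Tot X →ₗ[k] Tot Y :=
  DirectSum.lmap (fun i => (f.f i).hom)

theorem totMap_id (X : ChPlus k) (x : Tot X) : totMap (𝟙 X) x = x := by
  ext i
  simp [totMap]

theorem totMap_comp {X Y Z : ChPlus k} (f : X ⟶ Y) (g : Y ⟶ Z) (x : Tot X) :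
    totMap (f ≫ g) x = totMap g (totMap f x) := by
  ext i
  simp [totMap]

theorem totMap_zero {X Y : ChPlus k} (x : Tot X) : totMap (0 : X ⟶ Y) x = 0 := by
  ext i
  simp [totMap]

end ChPlus

/-! ### Operads in `Ch₊` -/

/-- The set of inputs of a partial composite `x ∘ₐ y`, where `x` has inputs `A`, `y` has
inputs `B`, and `a : A`: the inputs of `x` other than `a`, and those of `y`. -/
abbrev Ins (A : Type) (a : A) (B : Type) : Type := {x : A // x ≠ a} ⊕ B

namespace Ins

variable {A A' B B' C : Type}

/-- Relabelling of the inputs of a partial composite. -/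
def congr (e : A ≃ A') (f : B ≃ B') (a : A) : Ins A a B ≃ Ins A' (e a) B' :=
  Equiv.sumCongr (e.subtypeEquiv (fun x => not_congr (e.apply_eq_iff_eq (x := x) (y := a)).symm)) f

/-- The inputs of `1 ∘ y` are those of `y`. -/
def unitLeft (B : Type) : B ≃ Ins Unit () B where
  toFun b := .inr b
  invFun
    | .inl x => (x.2 (Subsingleton.elim _ _)).elim
    | .inr b => b
  left_inv _ := rfl
  right_inv
    | .inl x => (x.2 (Subsingleton.elim _ _)).elim
    | .inr _ => rfl

/-- The inputs of `x ∘ₐ 1` are those of `x`, with `a` replaced by the input of `1`. -/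
def unitRight (a : A) : A ≃ Ins A a Unit :=
  open Classical in
  { toFun := fun x => if h : x = a then .inr () else .inl ⟨x, h⟩
    invFun := fun
      | .inl x => x.1
      | .inr _ => a
    left_inv := fun x => by by_cases h : x = a <;> simp [h]
    right_inv := fun
      | .inl x => by simp [x.2]
      | .inr _ => by simp }

/-- The inputs of `(x ∘ₐ y) ∘_b z`, with `b` an input of `y`, are those of `x ∘ₐ (y ∘_b z)`. -/
def seq (a : A) (b : B) :
    Ins (Ins A a B) (.inr b) C ≃ Ins A a (Ins B b C) where
  toFun
    | .inl ⟨.inl x, _⟩ => .inl x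
    | .inl ⟨.inr y, h⟩ => .inr (.inl ⟨y, fun h' => h (congrArg Sum.inr h')⟩)
    | .inr c => .inr (.inr c)
  invFun
    | .inl x => .inl ⟨.inl x, Sum.inl_ne_inr⟩
    | .inr (.inl y) => .inl ⟨.inr y.1, fun h => y.2 (Sum.inr_injective h)⟩
    | .inr (.inr c) => .inr c
  left_inv
    | .inl ⟨.inl _, _⟩ => rfl
    | .inl ⟨.inr _, _⟩ => rfl
    | .inr _ => rfl
  right_inv
    | .inl _ => rfl
    | .inr (.inl _) => rfl
    | .inr (.inr _) => rfl

/-- The inputs of `(x ∘ₐ y) ∘_{a'} z`, with `a ≠ a'` inputs of `x`, are those of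
`(x ∘_{a'} z) ∘ₐ y`. -/
def par {a a' : A} (h : a ≠ a') :
    Ins (Ins A a B) (.inl ⟨a', h.symm⟩) C ≃ Ins (Ins A a' C) (.inl ⟨a, h⟩) B where
  toFun
    | .inl ⟨.inl x, hx⟩ =>
        .inl ⟨.inl ⟨x.1, fun h' => hx (congrArg Sum.inl (Subtype.ext h'))⟩,
          fun h' => x.2 (congrArg Subtype.val (Sum.inl_injective h'))⟩
    | .inl ⟨.inr y, _⟩ => .inr y
    | .inr c => .inl ⟨.inr c, Sum.inr_ne_inl⟩
  invFun
    | .inl ⟨.inl x, hx⟩ =>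
        .inl ⟨.inl ⟨x.1, fun h' => hx (congrArg Sum.inl (Subtype.ext h'))⟩,
          fun h' => x.2 (congrArg Subtype.val (Sum.inl_injective h'))⟩
    | .inl ⟨.inr c, _⟩ => .inr c
    | .inr y => .inl ⟨.inr y, Sum.inr_ne_inl⟩
  left_inv
    | .inl ⟨.inl _, _⟩ => rfl
    | .inl ⟨.inr _, _⟩ => rfl
    | .inr _ => rfl
  right_inv
    | .inl ⟨.inl _, _⟩ => rfl
    | .inl ⟨.inr _, _⟩ => rfl
    | .inr _ => rfl

end Ins

open ChPlus in
/-- An operad in `Ch₊`: a functor from finite sets and bijections to `Ch₊`, with a unit and partial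
compositions `x ∘ₐ y`, which are chain maps `O(A) ⊗ O(B) ⟶ O(A ∖ {a} ⊔ B)`, natural in the sets
of inputs, unital and associative, with the Koszul sign rule. -/
structure Operad (k : Type u) [Field k] where
  obj : ∀ (A : Type) [Finite A], ChPlus k
  map : ∀ {A B : Type} [Finite A] [Finite B], (A ≃ B) → (obj A ⟶ obj B)
  map_refl : ∀ (A : Type) [Finite A], map (Equiv.refl A) = 𝟙 (obj A)
  map_trans : ∀ {A B C : Type} [Finite A] [Finite B] [Finite C] (e : A ≃ B) (f : B ≃ C),
    map (e.trans f) = map e ≫ map f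
  one : (obj Unit).X 0
  circ : ∀ {A B : Type} [Finite A] [Finite B] (a : A),
    Tot (obj A) →ₗ[k] Tot (obj B) →ₗ[k] Tot (obj (Ins A a B))
  circ_mem : ∀ {A B : Type} [Finite A] [Finite B] (a : A) (p q : ℕ)
    (x : (obj A).X p) (y : (obj B).X q),
    circ a (hom _ p x) (hom _ q y) ∈ LinearMap.range (hom (obj (Ins A a B)) (p + q))
  circ_diff : ∀ {A B : Type} [Finite A] [Finite B] (a : A) (x : Tot (obj A)) (y : Tot (obj B)),
    diff _ (circ a x y) = circ a (diff _ x) y + circ a (sgn _ x) (diff _ y)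
  circ_map : ∀ {A A' B B' : Type} [Finite A] [Finite A'] [Finite B] [Finite B']
    (e : A ≃ A') (f : B ≃ B') (a : A) (x : Tot (obj A)) (y : Tot (obj B)),
    totMap (map (Ins.congr e f a)) (circ a x y) = circ (e a) (totMap (map e) x) (totMap (map f) y)
  one_circ : ∀ {B : Type} [Finite B] (y : Tot (obj B)),
    circ () (hom _ 0 one) y = totMap (map (Ins.unitLeft B)) y
  circ_one : ∀ {A : Type} [Finite A] (a : A) (x : Tot (obj A)),
    circ a x (hom _ 0 one) = totMap (map (Ins.unitRight a)) x
  circ_seq : ∀ {A B C : Type} [Finite A] [Finite B] [Finite C] (a : A) (b : B)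
    (x : Tot (obj A)) (y : Tot (obj B)) (z : Tot (obj C)),
    totMap (map (Ins.seq a b)) (circ (Sum.inr b : Ins A a B) (circ a x y) z) =
      circ a x (circ b y z)
  circ_par : ∀ {A B C : Type} [Finite A] [Finite B] [Finite C] {a a' : A} (h : a ≠ a')
    (x : Tot (obj A)) (q r : ℕ) (y : (obj B).X q) (z : (obj C).X r),
    totMap (map (Ins.par h))
        (circ (Sum.inl ⟨a', h.symm⟩ : Ins A a B) (circ a x (hom _ q y)) (hom _ r z)) =
      ((-1 : k) ^ (q * r)) •
        circ (Sum.inl ⟨a, h⟩ : Ins A a' C) (circ a' x (hom _ r z)) (hom _ q y)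

/-- A reduced operad: `O(0) = 0` and `O(1) = k`, concentrated in degree `0` and spanned by the
operadic unit. -/
structure ReducedOperad (k : Type u) [Field k] extends Operad k where
  isZero_arity_zero : ∀ (A : Type) [Finite A] [IsEmpty A], IsZero (obj A)
  bijective_one : Function.Bijective (fun c : k => c • one)
  isZero_arity_one : ∀ i : ℕ, 0 < i → IsZero ((obj Unit).X i)

/-! ### Algebras over an operad -/

/-- The Koszul sign of the reordering `x₁ ⋯ xₙ ↦ x_{σ 1} ⋯ x_{σ n}` of homogeneous elements
of degrees `deg 1, …, deg n`. -/
def koszulSign (k : Type u) [Field k] {n : ℕ} (σ : Equiv.Perm (Fin n)) (deg : Fin n → ℕ) : k :=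
  ∏ p : Fin n × Fin n,
    if p.1 < p.2 ∧ σ p.2 < σ p.1 then (-1 : k) ^ (deg (σ p.1) * deg (σ p.2)) else 1

/-- `e` is the ordering of the inputs of a partial composite in which those of the inner
operation, in their order, take the place of `a`. -/
def IsOrderedInsertion {n m l : ℕ} (a : Fin n) (e : Ins (Fin n) a (Fin m) ≃ Fin l) : Prop :=
  (∀ b b' : {x : Fin n // x ≠ a}, b.1 < b'.1 → e (.inl b) < e (.inl b')) ∧
  (∀ j j' : Fin m, j < j' → e (.inr j) < e (.inr j')) ∧
  (∀ (b : {x : Fin n // x ≠ a}) (j : Fin m), b.1 < a → e (.inl b) < e (.inr j)) ∧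
  (∀ (b : {x : Fin n // x ≠ a}) (j : Fin m), a < b.1 → e (.inr j) < e (.inl b))

open ChPlus in
/-- An algebra over the operad `O`: a complex `X` in `Ch₊` with chain maps
`O(n) ⊗_{Σₙ} X^{⊗ n} ⟶ X` compatible with the unit and the compositions of `O`. -/
structure OpAlg {k : Type u} [Field k] (O : ReducedOperad k) where
  cx : ChPlus k
  act : ∀ n : ℕ, Tot (O.obj (Fin n)) →ₗ[k] MultilinearMap k (fun _ : Fin n => Tot cx) (Tot cx)
  act_mem : ∀ (n p : ℕ) (o : (O.obj (Fin n)).X p) (deg : Fin n → ℕ) (x : ∀ j, cx.X (deg j)),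
    act n (hom _ p o) (fun j => hom cx (deg j) (x j)) ∈
      LinearMap.range (hom cx (p + ∑ j, deg j))
  act_diff : ∀ (n : ℕ) (o : Tot (O.obj (Fin n))) (x : Fin n → Tot cx),
    diff cx (act n o x) = act n (diff _ o) x +
      ∑ j, act n (sgn _ o)
        (fun l => if l < j then sgn cx (x l) else if l = j then diff cx (x l) else x l)
  act_perm : ∀ (n : ℕ) (σ : Equiv.Perm (Fin n)) (o : Tot (O.obj (Fin n)))
    (deg : Fin n → ℕ) (x : ∀ j, cx.X (deg j)),
    act n (totMap (O.map σ) o) (fun j => hom cx (deg j) (x j)) =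
      koszulSign k σ deg • act n o (fun j => hom cx (deg (σ j)) (x (σ j)))
  act_one : ∀ (e : Unit ≃ Fin 1) (x : Fin 1 → Tot cx),
    act 1 (totMap (O.map e) (hom _ 0 O.one)) x = x 0
  act_circ : ∀ (n m l : ℕ) (a : Fin n) (e : Ins (Fin n) a (Fin m) ≃ Fin l),
    IsOrderedInsertion a e →
    ∀ (o : Tot (O.obj (Fin n))) (q : ℕ) (o' : (O.obj (Fin m)).X q) (x : Fin l → Tot cx),
    act l (totMap (O.map e) (O.circ a o (hom _ q o'))) x =
      act n o (fun b =>
        if h : b = a then act m (hom _ q o') (fun j => x (e (.inr j)))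
        else if b < a then (sgn cx ^ q) (x (e (.inl ⟨b, h⟩)))
        else x (e (.inl ⟨b, h⟩)))

namespace OpAlg

variable {k : Type u} [Field k] {O : ReducedOperad k}

/-- Morphisms of algebras: chain maps that preserve the structure maps. -/
@[ext]
structure Hom (X Y : OpAlg O) where
  map : X.cx ⟶ Y.cx
  map_act : ∀ (n : ℕ) (o : ChPlus.Tot (O.obj (Fin n))) (x : Fin n → ChPlus.Tot X.cx),
    ChPlus.totMap map (X.act n o x) = Y.act n o (fun j => ChPlus.totMap map (x j))

instance : Category.{u} (OpAlg O) where
  Hom := Hom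
  id X := ⟨𝟙 X.cx, fun n o x => by simp only [ChPlus.totMap_id]⟩
  comp f g := ⟨f.map ≫ g.map, fun n o x => by
    simp only [ChPlus.totMap_comp, f.map_act, g.map_act]⟩
  id_comp f := Hom.ext (Category.id_comp f.map)
  comp_id f := Hom.ext (Category.comp_id f.map)
  assoc f g h := Hom.ext (Category.assoc f.map g.map h.map)

/-- The forgetful functor from algebras to non-negative complexes. -/
def forget (O : ReducedOperad k) : OpAlg O ⥤ ChPlus k where
  obj X := X.cx
  map f := f.map

theorem tot_subsingleton {X : ChPlus k} (hX : IsZero X) : Subsingleton (ChPlus.Tot X) :=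
  ⟨fun x y => by
    have h : 𝟙 X = 0 := hX.eq_of_src _ _
    rw [← ChPlus.totMap_id X x, ← ChPlus.totMap_id X y, h, ChPlus.totMap_zero, ChPlus.totMap_zero]⟩

/-- The zero map is a morphism of algebras, since there are no operations of arity `0`. -/
theorem act_zero (X : OpAlg O) (n : ℕ) (o : ChPlus.Tot (O.obj (Fin n))) :
    X.act n o (fun _ => 0) = 0 := by
  cases n with
  | zero =>
    have := tot_subsingleton (O.isZero_arity_zero (Fin 0))
    rw [Subsingleton.elim o 0]
    simp
  | succ n => exact (X.act (n + 1) o).map_coord_zero 0 rfl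

instance : HasZeroMorphisms (OpAlg O) where
  zero X Y := ⟨⟨0, fun n o x => by simp only [ChPlus.totMap_zero, act_zero]⟩⟩
  comp_zero f Z := Hom.ext (comp_zero (f := f.map))
  zero_comp X _ _ f := Hom.ext (zero_comp (f := f.map))

open scoped ZeroObject in
/-- The zero algebra. -/
def zeroAlg (O : ReducedOperad k) : OpAlg O :=
  haveI : Subsingleton (ChPlus.Tot (0 : ChPlus k)) := tot_subsingleton (isZero_zero _)
  { cx := 0
    act := 0
    act_mem := fun _ _ _ _ _ => ⟨0, Subsingleton.elim _ _⟩
    act_diff := fun _ _ _ => Subsingleton.elim _ _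
    act_perm := fun _ _ _ _ _ => Subsingleton.elim _ _
    act_one := fun _ _ => Subsingleton.elim _ _
    act_circ := fun _ _ _ _ _ _ _ _ _ _ => Subsingleton.elim _ _ }

instance : HasZeroObject (OpAlg O) where
  zero := ⟨zeroAlg O, by
    rw [IsZero.iff_id_eq_zero]
    exact Hom.ext ((isZero_zero (ChPlus k)).eq_of_src _ _)⟩

/-- Weak equivalences of algebras are those of the underlying complexes. -/
instance : CategoryWithWeakEquivalences (OpAlg O) where
  weakEquivalences := (weakEquivalences (ChPlus k)).inverseImage (forget O)

/-- Fibrations of algebras are those of the underlying complexes. -/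
instance : CategoryWithFibrations (OpAlg O) where
  fibrations := (fibrations (ChPlus k)).inverseImage (forget O)

/-- Cofibrations of algebras are the maps with the left lifting property against the
trivial fibrations. -/
instance : CategoryWithCofibrations (OpAlg O) where
  cofibrations := (trivialFibrations (OpAlg O)).llp

end OpAlg

/-- The classes of cofibrations, fibrations and weak equivalences of `C` satisfy the factorization
and lifting axioms of a (closed) model category. -/
def IsModelStructure (C : Type*) [Category* C] [CategoryWithWeakEquivalences C]
    [CategoryWithFibrations C] [CategoryWithCofibrations C] : Prop :=
  MorphismProperty.IsWeakFactorizationSystem (cofibrations C) (trivialFibrations C) ∧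
    MorphismProperty.IsWeakFactorizationSystem (trivialCofibrations C) (fibrations C)

/-! ### The three settings -/

/-- A name for each of the categories `Alg_O`, `Ch₊` and `Ch`. -/
inductive Setting : Type
  | alg | chPlus | ch

namespace Setting

variable {k : Type u} [Field k]

/-- The category `Alg_O`, `Ch₊` or `Ch`. -/
def Obj (O : ReducedOperad k) : Setting → Type (u + 1)
  | alg => OpAlg O
  | chPlus => ChPlus k
  | ch => Ch k

variable (O : ReducedOperad k)

instance : ∀ s : Setting, Category.{u} (s.Obj O)
  | alg => inferInstanceAs (Category (OpAlg O))
  | chPlus => inferInstanceAs (Category (ChPlus k))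
  | ch => inferInstanceAs (Category (Ch k))

instance : ∀ s : Setting, HasZeroMorphisms (s.Obj O)
  | alg => inferInstanceAs (HasZeroMorphisms (OpAlg O))
  | chPlus => inferInstanceAs (HasZeroMorphisms (ChPlus k))
  | ch => inferInstanceAs (HasZeroMorphisms (Ch k))

instance : ∀ s : Setting, HasZeroObject (s.Obj O)
  | alg => inferInstanceAs (HasZeroObject (OpAlg O))
  | chPlus => inferInstanceAs (HasZeroObject (ChPlus k))
  | ch => inferInstanceAs (HasZeroObject (Ch k))

instance : ∀ s : Setting, CategoryWithWeakEquivalences (s.Obj O)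
  | alg => inferInstanceAs (CategoryWithWeakEquivalences (OpAlg O))
  | chPlus => inferInstanceAs (CategoryWithWeakEquivalences (ChPlus k))
  | ch => inferInstanceAs (CategoryWithWeakEquivalences (Ch k))

instance : ∀ s : Setting, CategoryWithFibrations (s.Obj O)
  | alg => inferInstanceAs (CategoryWithFibrations (OpAlg O))
  | chPlus => inferInstanceAs (CategoryWithFibrations (ChPlus k))
  | ch => inferInstanceAs (CategoryWithFibrations (Ch k))

instance : ∀ s : Setting, CategoryWithCofibrations (s.Obj O)
  | alg => inferInstanceAs (CategoryWithCofibrations (OpAlg O))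
  | chPlus => inferInstanceAs (CategoryWithCofibrations (ChPlus k))
  | ch => inferInstanceAs (CategoryWithCofibrations (Ch k))

end Setting

/-! ### Homotopy pushouts, cubes, and total fibers

The notions below make sense in any pointed category with weak equivalences, fibrations and
cofibrations; they have their usual meaning when these form a model structure. -/

namespace Goodwillie

open scoped ZeroObject

section Cubes

variable {C : Type*} [Category* C]

/-- The poset of subsets of `{1, …, n}`; an `n`-cube in `C` is a functor `Subsets n ⥤ C`. -/
abbrev Subsets (n : ℕ) : Type := Finset (Fin n)

/-- The inclusion `S ⊆ S ∪ {i}` as a morphism of the poset of subsets. -/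
def toInsert {n : ℕ} (S : Subsets n) (i : Fin n) : S ⟶ insert i S :=
  homOfLE (Finset.subset_insert i S)

/-- The inclusion `S ∪ {j} ⊆ S ∪ {i, j}` as a morphism of the poset of subsets. -/
def insertTo {n : ℕ} (S : Subsets n) (i j : Fin n) : insert j S ⟶ insert j (insert i S) :=
  homOfLE (Finset.insert_subset_insert j (Finset.subset_insert i S))

/-- The inclusion `∅ ⊆ S` as a morphism of the poset of subsets. -/
def fromEmpty {n : ℕ} (S : Subsets n) : (∅ : Subsets n) ⟶ S := homOfLE (Finset.empty_subset S)

/-- The poset of subsets strictly containing `S`. For `S = ∅` these are the nonempty subsets. -/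
abbrev Above {n : ℕ} (S : Subsets n) : Type := {T : Subsets n // S < T}

/-- The restriction of a cube to the subsets strictly containing `S`. -/
abbrev above {n : ℕ} (X : Subsets n ⥤ C) (S : Subsets n) : Above S ⥤ C where
  obj T := X.obj T.1
  map f := X.map (homOfLE (leOfHom f))
  map_id T := X.map_id T.1
  map_comp f g := X.map_comp (homOfLE (leOfHom f)) (homOfLE (leOfHom g))

/-- The restriction of a map of cubes to the subsets strictly containing `S`. -/
def aboveMap {n : ℕ} {X Y : Subsets n ⥤ C} (f : X ⟶ Y) (S : Subsets n) :
    above X S ⟶ above Y S where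
  app T := f.app T.1
  naturality _ _ g := f.naturality (homOfLE (leOfHom g))

/-- The cone with apex `X(S)` over the restriction of `X` to the subsets strictly containing
`S`. -/
abbrev coneAt {n : ℕ} (X : Subsets n ⥤ C) (S : Subsets n) : Cone (above X S) where
  pt := X.obj S
  π :=
    { app := fun T => X.map (homOfLE T.2.le)
      naturality := fun T _ f => (Category.id_comp _).trans
        (X.map_comp (homOfLE T.2.le) (homOfLE (leOfHom f))) }

theorem aboveMap_id {n : ℕ} (X : Subsets n ⥤ C) (S : Subsets n) :
    aboveMap (𝟙 X) S = 𝟙 (above X S) := rfl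

theorem aboveMap_comp {n : ℕ} {X Y Z : Subsets n ⥤ C} (f : X ⟶ Y) (g : Y ⟶ Z) (S : Subsets n) :
    aboveMap (f ≫ g) S = aboveMap f S ≫ aboveMap g S := rfl

theorem lift_coneAt_naturality {n : ℕ} {X Y : Subsets n ⥤ C} (f : X ⟶ Y) (S : Subsets n)
    {c : Cone (above X S)} (hc : IsLimit c) {c' : Cone (above Y S)} (hc' : IsLimit c') :
    f.app S ≫ hc'.lift (coneAt Y S) = hc.lift (coneAt X S) ≫ hc'.map c (aboveMap f S) := by
  have h : ∀ T, f.app S ≫ (coneAt Y S).π.app T =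
      (coneAt X S).π.app T ≫ (aboveMap f S).app T := fun T => (f.naturality _).symm
  refine hc'.hom_ext fun T => ?_
  rw [Category.assoc, Category.assoc, IsLimit.map_π, IsLimit.fac, IsLimit.fac_assoc]
  exact h T

end Cubes

section Homotopical

variable {C : Type*} [Category* C] [HasZeroMorphisms C] [HasZeroObject C]
  [CategoryWithWeakEquivalences C] [CategoryWithFibrations C] [CategoryWithCofibrations C]

/-- `X ≃ 0`. -/
def IsContractible (X : C) : Prop := WeakEquivalence (0 : X ⟶ 0)

/-- A commutative square is a homotopy pushout if the span `c ⟵ a ⟶ b` has a cofibrant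
replacement (a weakly equivalent span of cofibrations with cofibrant source) whose pushout is weakly
equivalent to the remaining vertex by the induced map. -/
def IsHomotopyPushout {a b c d : C} (f : a ⟶ b) (g : a ⟶ c) (h : b ⟶ d) (i : c ⟶ d) : Prop :=
  CommSq f g h i ∧
  ∃ (a' b' c' d' : C) (f' : a' ⟶ b') (g' : a' ⟶ c') (h' : b' ⟶ d') (i' : c' ⟶ d')
    (α : a' ⟶ a) (β : b' ⟶ b) (γ : c' ⟶ c) (δ : d' ⟶ d),
    IsCofibrant a' ∧ Cofibration f' ∧ Cofibration g' ∧ IsPushout f' g' h' i' ∧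
    f' ≫ β = α ≫ f ∧ g' ≫ γ = α ≫ g ∧ h' ≫ δ = β ≫ h ∧ i' ≫ δ = γ ≫ i ∧
    WeakEquivalence α ∧ WeakEquivalence β ∧ WeakEquivalence γ ∧ WeakEquivalence δ

/-- A cube is strongly cocartesian if all its two-dimensional faces are homotopy pushouts. -/
def IsStronglyCocartesian {n : ℕ} (X : Subsets n ⥤ C) : Prop :=
  ∀ (S : Subsets n) (i j : Fin n), i ∉ S → j ∉ S → i ≠ j →
    IsHomotopyPushout (X.map (toInsert S i)) (X.map (toInsert S j))
      (X.map (toInsert (insert i S) j)) (X.map (insertTo S i j))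

/-- A cube is (Reedy) fibrant if all its matching maps `X(S) ⟶ lim_{T ⊋ S} X(T)` are fibrations. -/
def IsFibrantCube {n : ℕ} (X : Subsets n ⥤ C) : Prop :=
  ∀ S : Subsets n, ∃ (c : Cone (above X S)) (hc : IsLimit c), Fibration (hc.lift (coneAt X S))

/-- `ρ : X ⟶ Y` is a fibrant replacement of the cube `X`. -/
def IsFibrantReplacement {n : ℕ} {X Y : Subsets n ⥤ C} (ρ : X ⟶ Y) : Prop :=
  (∀ S, WeakEquivalence (ρ.app S)) ∧ IsFibrantCube Y

/-- A cube `X` is (homotopy) cartesian if `X(∅) ⟶ holim_{T ≠ ∅} X(T)` is a weak equivalence, the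
homotopy limit being computed by a fibrant replacement. -/
def IsCartesianCube {n : ℕ} (X : Subsets n ⥤ C) : Prop :=
  ∃ (Y : Subsets n ⥤ C) (ρ : X ⟶ Y), IsFibrantReplacement ρ ∧
    ∃ (c : Cone (above Y ∅)) (hc : IsLimit c), WeakEquivalence (hc.lift (coneAt Y ∅))

/-- `e : E ⟶ Y(∅)` is the kernel of `Y(∅) ⟶ lim_{T ≠ ∅} Y(T)`. When `Y` is fibrant, `E` is
the total homotopy fiber of `Y`. -/
def IsTotalFiber {n : ℕ} (Y : Subsets n ⥤ C) {E : C} (e : E ⟶ Y.obj ∅) : Prop :=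
  ∃ (c : Cone (above Y ∅)) (hc : IsLimit c) (w : e ≫ hc.lift (coneAt Y ∅) = 0),
    Nonempty (IsLimit (KernelFork.ofι e w))

/-- The total homotopy fiber of the cube `X` is contractible. -/
def HasContractibleTotalFiber {n : ℕ} (X : Subsets n ⥤ C) : Prop :=
  ∃ (Y : Subsets n ⥤ C) (ρ : X ⟶ Y), IsFibrantReplacement ρ ∧
    ∃ (E : C) (e : E ⟶ Y.obj ∅), IsTotalFiber Y e ∧ IsContractible E

/-- The map of cubes `φ : X ⟶ X'` induces a weak equivalence of total homotopy fibers. -/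
def IsTotalFiberEquivalence {n : ℕ} {X X' : Subsets n ⥤ C} (φ : X ⟶ X') : Prop :=
  ∃ (Y Y' : Subsets n ⥤ C) (ρ : X ⟶ Y) (ρ' : X' ⟶ Y') (ψ : Y ⟶ Y'),
    IsFibrantReplacement ρ ∧ IsFibrantReplacement ρ' ∧ ρ ≫ ψ = φ ≫ ρ' ∧
    ∃ (E E' : C) (e : E ⟶ Y.obj ∅) (e' : E' ⟶ Y'.obj ∅) (v : E ⟶ E'),
      IsTotalFiber Y e ∧ IsTotalFiber Y' e' ∧ v ≫ e' = e ≫ ψ.app ∅ ∧ WeakEquivalence v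

/-- The cube `T ↦ ∐_{i ∉ T} X i`, whose maps are the projections that collapse summands. -/
structure CoproductCube {n : ℕ} (X : Fin n → C) where
  cube : Subsets n ⥤ C
  incl : ∀ (T : Subsets n) (i : {i : Fin n // i ∉ T}), X i ⟶ cube.obj T
  isColimit : ∀ T : Subsets n,
    IsColimit (Cofan.mk (f := fun i : {i : Fin n // i ∉ T} => X i) (cube.obj T) (incl T))
  incl_map : ∀ {S T : Subsets n} (f : S ⟶ T) (i : {i : Fin n // i ∉ S}) (hi : i.1 ∉ T),
    incl S i ≫ cube.map f = incl T ⟨i.1, hi⟩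
  incl_map_zero : ∀ {S T : Subsets n} (f : S ⟶ T) (i : {i : Fin n // i ∉ S}), i.1 ∈ T →
    incl S i ≫ cube.map f = 0

end Homotopical

/-! ### Functors -/

section Functors

variable {C : Type*} [Category* C] [HasZeroMorphisms C] [HasZeroObject C]
  [CategoryWithWeakEquivalences C] [CategoryWithFibrations C] [CategoryWithCofibrations C]
  {D : Type*} [Category* D] [HasZeroMorphisms D] [HasZeroObject D]
  [CategoryWithWeakEquivalences D] [CategoryWithFibrations D] [CategoryWithCofibrations D]

/-- A homotopy functor preserves weak equivalences. -/
def IsHomotopyFunctor (F : C ⥤ D) : Prop :=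
  ∀ {X Y : C} (f : X ⟶ Y), WeakEquivalence f → WeakEquivalence (F.map f)

/-- A functor is reduced if `F(0) ≃ 0`. -/
def IsReduced (F : C ⥤ D) : Prop := IsContractible (F.obj 0)

/-- A functor is `n`-excisive if it takes strongly cocartesian `(n+1)`-cubes to cartesian cubes. -/
def IsExcisive (n : ℕ) (F : C ⥤ D) : Prop :=
  ∀ X : Subsets (n + 1) ⥤ C, IsStronglyCocartesian X → IsCartesianCube (X ⋙ F)

/-- `crₙF ≃ 0`, where `crₙF(X₁, …, Xₙ)` is the total homotopy fiber of `T ↦ F(∐_{i ∉ T} Xᵢ)`.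
The arguments are cofibrant, so that the coproducts are homotopy invariant. -/
def HasContractibleCrossEffect (n : ℕ) (F : C ⥤ D) : Prop :=
  ∀ (X : Fin n → C), (∀ i, IsCofibrant (X i)) → ∀ S : CoproductCube X,
    HasContractibleTotalFiber (S.cube ⋙ F)

/-- `crₙJ : crₙF ⟶ crₙG` is an equivalence. -/
def IsCrossEffectEquivalence (n : ℕ) {F G : C ⥤ D} (J : F ⟶ G) : Prop :=
  ∀ (X : Fin n → C), (∀ i, IsCofibrant (X i)) → ∀ S : CoproductCube X,
    IsTotalFiberEquivalence (Functor.whiskerLeft S.cube J)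

/-- Functorial models, for cofibrant `X` and `T ⊆ {1, …, n}`, of the join `X * T`, i.e. of the
homotopy cofiber of the fold map `∐_T X ⟶ X`: with `X ⟶ K X` a functorial cofibration to a
contractible object, `X * T` is the pushout of `X ⟵ ∐_T X ⟶ ∐_T K X`. -/
structure JoinModel (C : Type*) [Category* C] [HasZeroMorphisms C] [HasZeroObject C]
    [CategoryWithWeakEquivalences C] [CategoryWithFibrations C] [CategoryWithCofibrations C]
    (n : ℕ) where
  K : CofibrantObject C ⥤ CofibrantObject C
  toK : 𝟭 (CofibrantObject C) ⟶ K
  cofibration_toK : ∀ X, Cofibration (CofibrantObject.ι.map (toK.app X))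
  isContractible_K : ∀ X, IsContractible (CofibrantObject.ι.obj (K.obj X))
  join : CofibrantObject C ⥤ (Subsets n ⥤ CofibrantObject C)
  base : 𝟭 (CofibrantObject C) ⟶ join ⋙ (evaluation _ _).obj ∅
  arm : ∀ i : Fin n, K ⟶ join ⋙ (evaluation _ _).obj {i}
  isPushout : ∀ (X : CofibrantObject C) (T : Subsets n),
    ∃ (a : Cofan (fun _ : T => CofibrantObject.ι.obj X)) (ha : IsColimit a)
      (b : Cofan (fun _ : T => CofibrantObject.ι.obj (K.obj X))) (hb : IsColimit b),
      IsPushout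
        (Cofan.IsColimit.desc ha (fun _ => 𝟙 _))
        (Cofan.IsColimit.desc ha (fun i => CofibrantObject.ι.map (toK.app X) ≫ b.inj i))
        (CofibrantObject.ι.map (base.app X ≫ (join.obj X).map (fromEmpty T)))
        (Cofan.IsColimit.desc hb (fun i => CofibrantObject.ι.map
          ((arm i.1).app X ≫ (join.obj X).map (homOfLE (Finset.singleton_subset_iff.2 i.2)))))

/-- A functorial model of `Y ↦ holim_{T ≠ ∅} Y(T)` on `n`-cubes in `D`: the limit of a functorial
fibrant replacement. -/
structure HolimModel (D : Type*) [Category* D] [HasZeroMorphisms D] [HasZeroObject D]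
    [CategoryWithWeakEquivalences D] [CategoryWithFibrations D] [CategoryWithCofibrations D]
    (n : ℕ) where
  R : (Subsets n ⥤ D) ⥤ (Subsets n ⥤ D)
  toR : 𝟭 (Subsets n ⥤ D) ⟶ R
  isFibrantReplacement : ∀ Y, IsFibrantReplacement (toR.app Y)
  cone : ∀ Y : Subsets n ⥤ D, Cone (above (R.obj Y) ∅)
  isLimit : ∀ Y : Subsets n ⥤ D, IsLimit (cone Y)

namespace HolimModel

variable {n : ℕ} (h : HolimModel D n)

/-- The functor `Y ↦ holim_{T ≠ ∅} Y(T)`. -/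
def holim : (Subsets n ⥤ D) ⥤ D where
  obj Y := (h.cone Y).pt
  map {Y Y'} f := (h.isLimit Y').map (h.cone Y) (aboveMap (h.R.map f) ∅)
  map_id Y := (h.isLimit Y).hom_ext fun T => by
    rw [IsLimit.map_π, h.R.map_id, aboveMap_id, NatTrans.id_app, Category.comp_id, Category.id_comp]
  map_comp {Y Y' Y''} f g := (h.isLimit Y'').hom_ext fun T => by
    rw [IsLimit.map_π, Category.assoc, IsLimit.map_π, IsLimit.map_π_assoc, h.R.map_comp,
      aboveMap_comp, NatTrans.comp_app]

/-- The natural map `Y(∅) ⟶ holim_{T ≠ ∅} Y(T)`. -/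
def aug : (evaluation (Subsets n) D).obj ∅ ⟶ h.holim where
  app Y := (h.toR.app Y).app ∅ ≫ (h.isLimit Y).lift (coneAt (h.R.obj Y) ∅)
  naturality Y Y' f := by
    have e : f.app ∅ ≫ (h.toR.app Y').app ∅ = (h.toR.app Y).app ∅ ≫ (h.R.map f).app ∅ :=
      NatTrans.congr_app (h.toR.naturality f) ∅
    refine (Category.assoc _ _ _).symm.trans ((congrArg (· ≫ _) e).trans ?_)
    refine (Category.assoc _ _ _).trans (Eq.trans ?_ (Category.assoc _ _ _).symm)
    exact congrArg ((h.toR.app Y).app ∅ ≫ ·)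
      (lift_coneAt_naturality (h.R.map f) ∅ (h.isLimit Y) (h.isLimit Y'))

end HolimModel

variable {n : ℕ} (j : JoinModel C n) (h : HolimModel D n)

/-- The functor `F ↦ T_{n-1}F`, where `T_{n-1}F(X) = holim_{T ≠ ∅} F(X * T)`. Here and below a
homotopy functor is considered on the cofibrant objects, which determine it up to equivalence. -/
def taylorT : (CofibrantObject C ⥤ D) ⥤ (CofibrantObject C ⥤ D) :=
  Functor.whiskeringRight (Subsets n) (CofibrantObject C) D ⋙
    (Functor.whiskeringRight _ _ _).obj h.holim ⋙ (Functor.whiskeringLeft _ _ _).obj j.join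

/-- The natural map `t_{n-1}F : F(X) = F(X * ∅) ⟶ T_{n-1}F(X)`. -/
def taylorMap (F : CofibrantObject C ⥤ D) : F ⟶ (taylorT j h).obj F where
  app X := F.map (j.base.app X) ≫ h.aug.app (j.join.obj X ⋙ F)
  naturality X Y f := by
    have e₁ := h.aug.naturality (Functor.whiskerRight (j.join.map f) F)
    have e₂ := congrArg F.map (j.base.naturality f)
    dsimp [taylorT] at e₁ e₂ ⊢
    rw [F.map_comp, F.map_comp] at e₂
    rw [reassoc_of% e₂, Category.assoc, e₁]

/-- The iterates `Tⁱ_{n-1}F`. -/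
def taylorIter (F : CofibrantObject C ⥤ D) : ℕ → (CofibrantObject C ⥤ D)
  | 0 => F
  | i + 1 => (taylorT j h).obj (taylorIter F i)

/-- The maps `Tⁱ_{n-1}(t_{n-1}F) : Tⁱ_{n-1}F ⟶ Tⁱ⁺¹_{n-1}F`. -/
def taylorIterMap (F : CofibrantObject C ⥤ D) :
    ∀ i : ℕ, taylorIter j h F i ⟶ taylorIter j h F (i + 1)
  | 0 => taylorMap j h F
  | i + 1 => (taylorT j h).map (taylorIterMap F i)

/-- The sequence `F ⟶ T_{n-1}F ⟶ T²_{n-1}F ⟶ ⋯`. -/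
def taylorSequence (F : CofibrantObject C ⥤ D) : ℕ ⥤ (CofibrantObject C ⥤ D) :=
  Functor.ofSequence (taylorIterMap j h F)

/-- `P_{n-1}F ≃ 0`, where `P_{n-1}F` is the homotopy colimit of `F ⟶ T_{n-1}F ⟶ T²_{n-1}F ⟶ ⋯`.
In the categories considered here, sequential homotopy colimits are computed by colimits. The
index `n` is the size of the cubes that define `T_{n-1}`. -/
def HasContractibleTaylor (n : ℕ) (F : C ⥤ D) : Prop :=
  ∃ (j : JoinModel C n) (h : HolimModel D n), ∀ X : CofibrantObject C,
    ∃ (c : Cocone (taylorSequence j h (CofibrantObject.ι ⋙ F) ⋙ (evaluation _ _).obj X))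
      (_ : IsColimit c), IsContractible c.pt

/-- A homotopy functor is `n`-homogeneous if it is reduced, `n`-excisive and `P_{n-1}F ≃ 0`. -/
structure IsHomogeneous (n : ℕ) (F : C ⥤ D) : Prop where
  isHomotopyFunctor : IsHomotopyFunctor F
  isReduced : IsReduced F
  isExcisive : IsExcisive n F
  contractible : HasContractibleTaylor n F

end Functors

end Goodwillie

end

/-! ### Homology of complexes by elements: mapping fibers and short exact sequences. -/

noncomputable section

namespace Goodwillie

/-! ### Complexes of abelian groups, elementwise -/

/-! Everything is detected by homology. Each target category has a forgetful functor to unbounded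
complexes (`Realization`) that detects weak equivalences and computes limits. Total homotopy fibers
of cubes are computed there by an explicit model `tf`, made of iterated mapping fibers. A cube that
has a fibrant replacement is cartesian exactly when its `tf` is acyclic in a suitable range of
degrees, and the total fiber of an (n+1)-cube is the fiber of the map between the total fibers of
two opposite faces (`ex_tf_succ_iff`).

The core of both parts is `ex_tf_of_crossEffect`. A strongly cocartesian n-cube X is replaced by the
cube of pushouts of cofibrations A → B i, with A cofibrant. One more arm A → K, with K contractible,
enlarges it to a strongly cocartesian (n+1)-cube. One face of this cube is X; collapsing K shows
that the opposite face is equivalent to the cube T ↦ ∐_{i ∈ T} B i / A of inclusions of summands. If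
H makes total fibers of strongly cocartesian (n+1)-cubes acyclic, the homology of the total fiber of
H(X) injects into that of H on the inclusion cube. The cross-effect is the total fiber of the
projection cube instead; but projections split inclusions, so acyclicity for the projections implies
acyclicity for the inclusions (`PSet.ex_tf_incl`). Hence the total fiber of H(X) is acyclic, which
is part 1.

For part 2 the same lemma is applied to the homotopy fiber of J, formed in complexes. Its
cross-effect is acyclic because J is an equivalence on cross-effects, so its total fibers vanish on
strongly cocartesian n-cubes, in particular on the cubes of joins X * T. Therefore its homology
injects into that of all iterates of T_{n-1} (`eqv_toIter`). On the other hand every cycle of the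
fiber dies in some iterate: its image in F dies because P_{n-1}F is contractible, and the chain that
bounds it gives a cycle in an iterate of G, which dies further on. So the fiber is acyclic. The
towers of F and G may use different models of joins and limits, whence mixed iterates; `Dominates`
carries vanishing from the towers in the target to the towers of complexes.

One degree needs care. For non-negative complexes the unbounded total fiber can have homology in
degree -1, which the total fiber formed in the category itself does not see. Projection cubes
consist of split surjections and contribute nothing there (`PSet.ex_tf_proj`), so the cross-effect
hypothesis loses nothing.

The source enters only through cofibrations and weak equivalences (`IsCofCat`), from which the
gluing lemma and the invariance of homotopy pushouts follow. For complexes these axioms are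
elementary. For algebras, colimits and cell attachments come from formal expressions modulo their
values in all admissible algebras (`exists_universal`), and factorizations from countably many
rounds of cells. Over a field of characteristic zero, trivial cofibrations are stable under pushout
because a free extension by an acyclic complex is an equivalence (`weq_of_attached_free`): the
derivation that counts new generators is null-homotopic, so that dividing by the weight kills the
homology of positive weight. In positive characteristic this stability comes from the assumed model
structure. -/

/-- A `ℤ`-graded chain complex of abelian groups. -/
structure Cx : Type (u + 1) where
  X : ℤ → Type u
  [grp : ∀ i, AddCommGroup (X i)]
  d : ∀ i, X (i + 1) →+ X i
  d_d : ∀ i (x : X (i + 1 + 1)), d i (d (i + 1) x) = 0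

attribute [instance] Cx.grp
attribute [simp] Cx.d_d

namespace Cx

/-- Chain maps. -/
@[ext]
structure Hom (A B : Cx.{u}) where
  f : ∀ i, A.X i →+ B.X i
  comm : ∀ i x, f i (A.d i x) = B.d i (f (i + 1) x)

instance : Category Cx.{u} where
  Hom := Hom
  id A := ⟨fun _ => AddMonoidHom.id _, fun _ _ => rfl⟩
  comp φ ψ := ⟨fun i => (ψ.f i).comp (φ.f i), fun i x => by simp [φ.comm, ψ.comm]⟩

@[simp] theorem id_f (A : Cx.{u}) (i : ℤ) (x : A.X i) : Hom.f (𝟙 A) i x = x := rfl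

@[simp] theorem comp_f {A B C : Cx.{u}} (φ : A ⟶ B) (ψ : B ⟶ C) (i : ℤ) (x : A.X i) :
    Hom.f (φ ≫ ψ) i x = Hom.f ψ i (Hom.f φ i x) := rfl

theorem hom_ext {A B : Cx.{u}} {φ ψ : A ⟶ B} (h : ∀ i x, Hom.f φ i x = Hom.f ψ i x) : φ = ψ :=
  Hom.ext (funext fun i => AddMonoidHom.ext (h i))

theorem congr_f {A B : Cx.{u}} {φ ψ : A ⟶ B} (h : φ = ψ) (i : ℤ) (x : A.X i) :
    Hom.f φ i x = Hom.f ψ i x := by rw [h]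

theorem hom_d {A B : Cx.{u}} (φ : A ⟶ B) (i : ℤ) (x : A.X (i + 1)) :
    Hom.f φ i (A.d i x) = B.d i (Hom.f φ (i + 1) x) := φ.comm i x

variable {A B C A' B' C' : Cx.{u}}

/-- The homology of `A` vanishes in degree `i + 1`. -/
def Ex (A : Cx.{u}) (i : ℤ) : Prop :=
  ∀ x : A.X (i + 1), A.d i x = 0 → ∃ y, A.d (i + 1) y = x

/-- `f` is injective on homology in degree `i + 1`. -/
def Inj (f : A ⟶ B) (i : ℤ) : Prop :=
  ∀ x : A.X (i + 1), A.d i x = 0 → (∃ y, B.d (i + 1) y = Hom.f f (i + 1) x) →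
    ∃ y, A.d (i + 1) y = x

/-- `f` is surjective on homology in degree `i + 1`. -/
def Surj (f : A ⟶ B) (i : ℤ) : Prop :=
  ∀ y : B.X (i + 1), B.d i y = 0 →
    ∃ x, A.d i x = 0 ∧ ∃ z, y = Hom.f f (i + 1) x + B.d (i + 1) z

/-- `f` is bijective on homology in degree `i + 1`. -/
def HIso (f : A ⟶ B) (i : ℤ) : Prop := Inj f i ∧ Surj f i

/-- `f` is injective on homology in the degrees `i + 1` and surjective in the degrees `i + 2`,
for `i ∈ S`. -/
def Eqv (S : Set ℤ) (f : A ⟶ B) : Prop := ∀ i ∈ S, Inj f i ∧ Surj f (i + 1)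

theorem Ex.inj (h : Ex A i) (f : A ⟶ B) : Inj f i := fun x hx _ => h x hx

theorem Ex.surj (h : Ex B i) (f : A ⟶ B) : Surj f i := fun y hy => by
  obtain ⟨z, rfl⟩ := h y hy
  exact ⟨0, by simp, z, by simp⟩

theorem Inj.comp {f : A ⟶ B} {g : B ⟶ C} (hf : Inj f i) (hg : Inj g i) : Inj (f ≫ g) i :=
  fun x hx hy => hf x hx (hg _ (by rw [← hom_d, hx, map_zero]) hy)

theorem Surj.comp {f : A ⟶ B} {g : B ⟶ C} (hf : Surj f i) (hg : Surj g i) : Surj (f ≫ g) i := by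
  intro y hy
  obtain ⟨b, hb, z, rfl⟩ := hg y hy
  obtain ⟨a, ha, w, rfl⟩ := hf b hb
  exact ⟨a, ha, Hom.f g _ w + z, by simp [hom_d, add_assoc]⟩

theorem HIso.comp {f : A ⟶ B} {g : B ⟶ C} (hf : HIso f i) (hg : HIso g i) : HIso (f ≫ g) i :=
  ⟨hf.1.comp hg.1, hf.2.comp hg.2⟩

theorem Eqv.comp {S : Set ℤ} {f : A ⟶ B} {g : B ⟶ C} (hf : Eqv S f) (hg : Eqv S g) :
    Eqv S (f ≫ g) :=
  fun i hi => ⟨(hf i hi).1.comp (hg i hi).1, (hf i hi).2.comp (hg i hi).2⟩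

theorem Inj.of_comp {f : A ⟶ B} {g : B ⟶ C} (h : Inj (f ≫ g) i) : Inj f i :=
  fun x hx ⟨y, hy⟩ => h x hx ⟨Hom.f g _ y, by rw [← hom_d, hy, comp_f]⟩

theorem Surj.of_comp {f : A ⟶ B} {g : B ⟶ C} (h : Surj (f ≫ g) i) : Surj g i := fun y hy => by
  obtain ⟨x, hx, z, hz⟩ := h y hy
  exact ⟨Hom.f f _ x, by rw [← hom_d, hx, map_zero], z, hz⟩

/-- The cancellation rules are kept separate for injectivity and surjectivity and for single
degrees, because at the lower end of the relevant range only one of the two is available. -/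
theorem Inj.of_comp_of_surj {f : A ⟶ B} {g : B ⟶ C} (h : Inj (f ≫ g) i) (hf : Surj f i) :
    Inj g i := by
  rintro y hy ⟨w, hw⟩
  obtain ⟨x, hx, z, rfl⟩ := hf y hy
  obtain ⟨v, rfl⟩ := h x hx ⟨w - Hom.f g _ z, by simp [hw, hom_d]⟩
  exact ⟨Hom.f f _ v + z, by simp [hom_d]⟩

theorem Surj.of_comp_of_inj {f : A ⟶ B} {g : B ⟶ C} (h : Surj (f ≫ g) i) (hg : Inj g i) :
    Surj f i := by
  intro y hy
  obtain ⟨x, hx, z, hz⟩ := h (Hom.f g _ y) (by rw [← hom_d, hy, map_zero])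
  obtain ⟨w, hw⟩ := hg (y - Hom.f f _ x) (by simp [hy, ← hom_d, hx])
    ⟨z, by rw [map_sub, hz, comp_f, add_sub_cancel_left]⟩
  exact ⟨x, hx, w, by rw [hw, add_sub_cancel]⟩

theorem HIso.of_comp_right {f : A ⟶ B} {g : B ⟶ C} (h : HIso (f ≫ g) i) (hg : HIso g i) :
    HIso f i := ⟨h.1.of_comp, h.2.of_comp_of_inj hg.1⟩

theorem HIso.of_comp_left {f : A ⟶ B} {g : B ⟶ C} (h : HIso (f ≫ g) i) (hf : HIso f i) :
    HIso g i := ⟨h.1.of_comp_of_surj hf.2, h.2.of_comp⟩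

theorem hIso_id (A : Cx.{u}) (i : ℤ) : HIso (𝟙 A) i :=
  ⟨fun _ _ h => h, fun y hy => ⟨y, hy, 0, by simp⟩⟩

theorem hIso_of_isIso (f : A ⟶ B) [IsIso f] (i : ℤ) : HIso f i := by
  refine HIso.of_comp_right (g := inv f) ?_ (HIso.of_comp_left (f := f) ?_ ⟨?_, ?_⟩)
  · rw [IsIso.hom_inv_id]; exact hIso_id _ _
  · rw [IsIso.hom_inv_id]; exact hIso_id _ _
  · exact Inj.of_comp (g := inv f) (by rw [IsIso.hom_inv_id]; exact (hIso_id _ _).1)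
  · exact Surj.of_comp (f := inv f) (by rw [IsIso.inv_hom_id]; exact (hIso_id _ _).2)

theorem Ex.of_hIso {f : A ⟶ B} (h : Ex B i) (hf : Inj f i) : Ex A i :=
  fun x hx => hf x hx (h _ (by rw [← hom_d, hx, map_zero]))

theorem Ex.of_hIso' {f : A ⟶ B} (h : Ex A i) (hf : Surj f i) : Ex B i := fun y hy => by
  obtain ⟨x, hx, z, rfl⟩ := hf y hy
  obtain ⟨w, rfl⟩ := h x hx
  exact ⟨Hom.f f _ w + z, by simp [hom_d]⟩

/-! ### Products and homotopy fibers -/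

/-- The zero complex. -/
def zero : Cx.{u} where
  X _ := PUnit
  d _ := 0
  d_d _ _ := rfl

theorem ex_zero (i : ℤ) : Ex zero.{u} i := fun _ _ => ⟨0, rfl⟩

/-- The product of two complexes. -/
def prod (A B : Cx.{u}) : Cx.{u} where
  X i := A.X i × B.X i
  d i := (A.d i).prodMap (B.d i)
  d_d i x := Prod.ext (A.d_d i x.1) (B.d_d i x.2)

/-- The homotopy fiber of a chain map. -/
def Fib (f : A ⟶ B) : Cx.{u} where
  X i := A.X i × B.X (i + 1)
  d i :=
    { toFun := fun x => (A.d i x.1, Hom.f f (i + 1) x.1 - B.d (i + 1) x.2)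
      map_zero' := by simp
      map_add' := fun x y => by
        refine Prod.ext (map_add _ _ _) ?_
        change Hom.f f _ (_ + _) - B.d _ (_ + _) = _ - _ + (_ - _)
        rw [map_add, map_add, add_sub_add_comm] }
  d_d i x := by
    refine Prod.ext (A.d_d i x.1) ?_
    change Hom.f f (i + 1) (A.d (i + 1) x.1) -
      B.d (i + 1) (Hom.f f (i + 1 + 1) x.1 - B.d (i + 1 + 1) x.2) = 0
    rw [map_sub, hom_d, B.d_d, sub_zero, sub_self]

theorem Fib.d_mk (f : A ⟶ B) (i : ℤ) (a : A.X (i + 1)) (b : B.X (i + 1 + 1)) :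
    (Fib f).d i (a, b) = (A.d i a, Hom.f f (i + 1) a - B.d (i + 1) b) := rfl

/-- The long exact sequence: the homology of the fiber in degree i+1 is an extension of the kernel
of `f` in degree i+1 by its cokernel in degree i+2. -/
theorem ex_fib_iff {f : A ⟶ B} : Ex (Fib f) i ↔ Inj f i ∧ Surj f (i + 1) := by
  constructor
  · intro h
    constructor
    · rintro a ha ⟨b, hb⟩
      obtain ⟨⟨x, y⟩, hxy⟩ := h (a, b) (by rw [Fib.d_mk, ha, hb, sub_self]; rfl)
      exact ⟨x, congrArg Prod.fst hxy⟩
    · intro b hb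
      obtain ⟨⟨x, y⟩, hxy⟩ := h (0, b) (by rw [Fib.d_mk, hb]; simp; rfl)
      have h1 : A.d (i + 1) x = 0 := congrArg Prod.fst hxy
      have h2 : Hom.f f _ x - B.d _ y = b := congrArg Prod.snd hxy
      exact ⟨x, h1, -y, by rw [← h2, map_neg, sub_eq_add_neg]⟩
  · rintro ⟨h1, h2⟩ ⟨a, b⟩ hab
    have ha : A.d i a = 0 := congrArg Prod.fst hab
    have hb : Hom.f f _ a - B.d _ b = 0 := congrArg Prod.snd hab
    obtain ⟨x, rfl⟩ := h1 a ha ⟨b, (sub_eq_zero.1 hb).symm⟩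
    obtain ⟨c, hc, z, hz⟩ := h2 (b - Hom.f f _ x) (by
      rw [map_sub, ← hom_d, ← sub_eq_zero.1 hb, sub_self])
    refine ⟨(x + c, -z), ?_⟩
    rw [Fib.d_mk, map_add, hc, add_zero, map_add, map_neg]
    refine Prod.ext rfl ?_
    change Hom.f f _ x + Hom.f f _ c - -B.d _ z = b
    rw [eq_add_of_sub_eq' hz]
    abel

/-- The map of homotopy fibers induced by a commutative square. -/
def Fib.map {f : A ⟶ B} {f' : A' ⟶ B'} (α : A ⟶ A') (β : B ⟶ B') (w : f ≫ β = α ≫ f') :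
    Fib f ⟶ Fib f' where
  f i := (Hom.f α i).prodMap (Hom.f β (i + 1))
  comm i x := by
    refine Prod.ext (hom_d α i x.1) ?_
    change Hom.f β _ (Hom.f f _ x.1 - B.d _ x.2) =
      Hom.f f' _ (Hom.f α _ x.1) - B'.d _ (Hom.f β _ x.2)
    rw [map_sub, hom_d]
    exact congrArg (· - _) (congr_f w _ _)

theorem Fib.map_mk {f : A ⟶ B} {f' : A' ⟶ B'} (α : A ⟶ A') (β : B ⟶ B') (w : f ≫ β = α ≫ f')
    (i : ℤ) (a : A.X i) (b : B.X (i + 1)) :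
    Hom.f (Fib.map α β w) i (a, b) = (Hom.f α i a, Hom.f β (i + 1) b) := rfl

/-- One four lemma for the long exact sequence of the fiber, from degree i+2 of the source down to
its degree i+1. -/
theorem Fib.inj_map {f : A ⟶ B} {f' : A' ⟶ B'} {α : A ⟶ A'} {β : B ⟶ B'}
    (w : f ≫ β = α ≫ f') (h1 : Inj α i) (h2 : Surj α (i + 1)) (h3 : Inj β (i + 1)) :
    Inj (Fib.map α β w) i := by
  rintro ⟨a, b⟩ hab ⟨⟨z, y⟩, hzy⟩
  have ha : A.d i a = 0 := congrArg Prod.fst hab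
  have hb : Hom.f f _ a - B.d _ b = 0 := congrArg Prod.snd hab
  have hz : A'.d _ z = Hom.f α _ a := congrArg Prod.fst hzy
  have hy : Hom.f f' _ z - B'.d _ y = Hom.f β _ b := congrArg Prod.snd hzy
  obtain ⟨x, rfl⟩ := h1 a ha ⟨z, hz⟩
  -- The primitive `x` is determined only up to a cycle. Adding `c` makes its image homologous to
  -- `z`, so that the image of the remaining second coordinate becomes a boundary and `h3` applies.
  obtain ⟨c, hc, v, hv⟩ := h2 (z - Hom.f α _ x) (by rw [map_sub, hz, hom_d, sub_self])
  have hz' : z = Hom.f α _ (x + c) + A'.d _ v := by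
    rw [map_add, eq_add_of_sub_eq' hv]; abel
  obtain ⟨t, ht⟩ := h3 (b - Hom.f f _ (x + c))
    (by rw [map_sub, ← hom_d, map_add, hc, add_zero, ← sub_eq_zero.1 hb, sub_self])
    ⟨Hom.f f' _ v - y, by
      have e := congr_f w _ (x + c)
      rw [comp_f, comp_f] at e
      rw [map_sub, map_sub, ← hy, e, hz', map_add, ← hom_d]; abel⟩
  refine ⟨(x + c, -t), ?_⟩
  rw [Fib.d_mk, map_neg, ht, map_add (A.d _), hc]
  refine Prod.ext (add_zero _) ?_
  change _ - -_ = b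
  abel

/-- The other four lemma, for the part of the long exact sequence from degree i+2 to degree i+1 of
the target. -/
theorem Fib.surj_map {f : A ⟶ B} {f' : A' ⟶ B'} {α : A ⟶ A'} {β : B ⟶ B'}
    (w : f ≫ β = α ≫ f') (h1 : Surj α i) (h2 : Inj β i) (h3 : Surj β (i + 1)) :
    Surj (Fib.map α β w) i := by
  rintro ⟨a', b'⟩ hab
  have ha' : A'.d i a' = 0 := congrArg Prod.fst hab
  have hb' : Hom.f f' _ a' - B'.d _ b' = 0 := congrArg Prod.snd hab
  obtain ⟨a, ha, z, rfl⟩ := h1 a' ha'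
  have e := congr_f w _ a
  rw [comp_f, comp_f] at e
  obtain ⟨b, hb⟩ := h2 (Hom.f f _ a) (by rw [← hom_d, ha, map_zero])
    ⟨b' - Hom.f f' _ z, by rw [map_sub, ← sub_eq_zero.1 hb', map_add, hom_d, e]; abel⟩
  obtain ⟨c, hc, v, hv⟩ := h3 (b' - Hom.f f' _ z - Hom.f β _ b) (by
    rw [map_sub, map_sub, ← sub_eq_zero.1 hb', map_add, ← hom_d β, hb, hom_d f', e]; abel)
  refine ⟨(a, b + c), ?_, (z, -v), ?_⟩
  · rw [Fib.d_mk, ha, map_add, hb, hc, add_zero, sub_self]; rfl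
  · rw [Fib.map_mk, Fib.d_mk]
    refine Prod.ext rfl ?_
    change b' = Hom.f β _ (b + c) + (Hom.f f' _ z - B'.d _ (-v))
    rw [map_neg, map_add, eq_add_of_sub_eq' (eq_add_of_sub_eq' hv)]
    abel

/-- The map of products induced by two maps. -/
def prod.map (α : A ⟶ A') (β : B ⟶ B') : prod A B ⟶ prod A' B' where
  f i := (Hom.f α i).prodMap (Hom.f β i)
  comm i x := Prod.ext (hom_d α i x.1) (hom_d β i x.2)

theorem prod.inj_map {α : A ⟶ A'} {β : B ⟶ B'} (h1 : Inj α i) (h2 : Inj β i) :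
    Inj (prod.map α β) i := by
  rintro ⟨a, b⟩ hab ⟨⟨z, y⟩, hzy⟩
  obtain ⟨x, hx⟩ := h1 a (congrArg Prod.fst hab) ⟨z, congrArg Prod.fst hzy⟩
  obtain ⟨x', hx'⟩ := h2 b (congrArg Prod.snd hab) ⟨y, congrArg Prod.snd hzy⟩
  exact ⟨(x, x'), Prod.ext hx hx'⟩

theorem prod.surj_map {α : A ⟶ A'} {β : B ⟶ B'} (h1 : Surj α i) (h2 : Surj β i) :
    Surj (prod.map α β) i := by
  rintro ⟨a, b⟩ hab
  obtain ⟨x, hx, z, hz⟩ := h1 a (congrArg Prod.fst hab)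
  obtain ⟨x', hx', z', hz'⟩ := h2 b (congrArg Prod.snd hab)
  exact ⟨(x, x'), Prod.ext hx hx', (z, z'), Prod.ext hz hz'⟩

/-- The difference of two maps, as a map on the product. -/
def diffMap (f : A ⟶ C) (g : B ⟶ C) : prod A B ⟶ C where
  f i := (Hom.f f i).comp (AddMonoidHom.fst _ _) - (Hom.f g i).comp (AddMonoidHom.snd _ _)
  comm i x := by
    change Hom.f f i (A.d i x.1) - Hom.f g i (B.d i x.2) =
      C.d i (Hom.f f (i + 1) x.1 - Hom.f g (i + 1) x.2)
    rw [map_sub, hom_d, hom_d]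

theorem diffMap_mk (f : A ⟶ C) (g : B ⟶ C) (i : ℤ) (a : A.X i) (b : B.X i) :
    Hom.f (diffMap f g) i (a, b) = Hom.f f i a - Hom.f g i b := rfl

/-- The map to a product. -/
def prod.lift {K : Cx.{u}} (f : K ⟶ A) (g : K ⟶ B) : K ⟶ prod A B where
  f i := (Hom.f f i).prod (Hom.f g i)
  comm i x := Prod.ext (hom_d f i x) (hom_d g i x)

/-- The map to the homotopy fiber given by a map to the kernel. -/
def Fib.liftKer {K : Cx.{u}} {f : A ⟶ B} (φ : K ⟶ A) (h : ∀ i x, Hom.f f i (Hom.f φ i x) = 0) :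
    K ⟶ Fib f where
  f i := (Hom.f φ i).prod 0
  comm i x := Prod.ext (hom_d φ i x)
    ((congrArg₂ (· - ·) (h _ _) (map_zero (B.d (i + 1)))).trans (sub_zero 0)).symm

/-- If `f` is surjective in two degrees, `kernel f ⟶ Fib f` is bijective on homology. -/
theorem hIso_kernel_fib {K : Cx.{u}} {f : A ⟶ B} {κ : K ⟶ Fib f}
    (hκ : ∀ j x, (Hom.f κ j x).2 = 0) (inj : ∀ j, Function.Injective (Hom.f κ j))
    (ex : ∀ j a, Hom.f f j a = 0 → ∃ x, Hom.f κ j x = (a, 0))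
    (s1 : Function.Surjective (Hom.f f (i + 1 + 1)))
    (s2 : Function.Surjective (Hom.f f (i + 1 + 1 + 1))) : HIso κ i := by
  constructor
  · rintro x hx ⟨⟨a, b⟩, hab⟩
    -- The boundary of `(c, 0)` is `(d c, f c)`; subtracting it removes the second coordinate and
    -- leaves an element of the kernel of `f`. The second half of the proof uses the same correction
    -- one degree lower.
    obtain ⟨c, rfl⟩ := s2 b
    have h2 : Hom.f f _ a - B.d _ (Hom.f f _ c) = 0 :=
      (congrArg Prod.snd hab).trans (hκ _ _)
    obtain ⟨y, hy⟩ := ex _ (a - A.d _ c) (by rw [map_sub, hom_d, h2])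
    refine ⟨y, inj _ ?_⟩
    rw [hom_d, hy, ← hab, Fib.d_mk, Fib.d_mk, h2, map_sub, A.d_d, sub_zero, map_sub, hom_d, h2]
    exact Prod.ext rfl (by simp)
  · rintro ⟨a, b⟩ hab
    have ha : A.d i a = 0 := congrArg Prod.fst hab
    have hb : Hom.f f _ a - B.d _ b = 0 := congrArg Prod.snd hab
    obtain ⟨c, rfl⟩ := s1 b
    obtain ⟨x, hx⟩ := ex _ (a - A.d _ c) (by rw [map_sub, hom_d, hb])
    refine ⟨x, inj _ ?_, (c, 0), ?_⟩
    · rw [hom_d, hx, Fib.d_mk, map_zero, map_sub, ha, A.d_d, map_sub, hom_d, hb]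
      exact (Prod.ext (sub_self _) (sub_self _) : _ = (0 : (Fib f).X i)).trans (map_zero _).symm
    · rw [hx, Fib.d_mk]
      refine Prod.ext ?_ ?_
      · change a = a - _ + _
        abel
      · change _ = 0 + (_ - _)
        rw [map_zero]; abel

/-! ### Short exact sequences -/

/-- Degreewise short exact sequences. -/
structure SES (f : A ⟶ B) (g : B ⟶ C) : Prop where
  inj : ∀ i, Function.Injective (Hom.f f i)
  surj : ∀ i, Function.Surjective (Hom.f g i)
  zero : ∀ i x, Hom.f g i (Hom.f f i x) = 0
  ex : ∀ i b, Hom.f g i b = 0 → ∃ a, Hom.f f i a = b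

/-- The long exact sequence again: the kernel of a surjection has the same acyclicity criterion as
the mapping fiber in `ex_fib_iff`. -/
theorem SES.ex_iff {f : A ⟶ B} {g : B ⟶ C} (h : SES f g) :
    Ex A i ↔ Inj g i ∧ Surj g (i + 1) := by
  constructor
  · intro hA
    constructor
    · rintro b hb ⟨c, hc⟩
      obtain ⟨b', rfl⟩ := h.surj _ c
      obtain ⟨a, ha⟩ := h.ex _ (b - B.d _ b') (by rw [map_sub, hom_d, hc, sub_self])
      obtain ⟨y, rfl⟩ := hA a (h.inj _ (by rw [hom_d, ha, map_sub, hb, B.d_d, sub_zero, map_zero]))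
      exact ⟨b' + Hom.f f _ y, by rw [map_add, ← hom_d, ha, add_sub_cancel]⟩
    · intro c hc
      obtain ⟨b, rfl⟩ := h.surj _ c
      obtain ⟨a, ha⟩ := h.ex _ (B.d _ b) (by rw [hom_d, hc])
      obtain ⟨y, rfl⟩ := hA a (h.inj _ (by rw [hom_d, ha, B.d_d, map_zero]))
      exact ⟨b - Hom.f f _ y, by rw [map_sub, ← hom_d, ha, sub_self], 0, by
        rw [map_sub, h.zero]; simp⟩
  · rintro ⟨h1, h2⟩ a ha
    obtain ⟨b, hb⟩ := h1 (Hom.f f _ a) (by rw [← hom_d, ha, map_zero]) ⟨0, by rw [h.zero, map_zero]⟩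
    obtain ⟨x, hx, z, hz⟩ := h2 (Hom.f g _ b) (by rw [← hom_d, hb, h.zero])
    obtain ⟨w, rfl⟩ := h.surj _ z
    obtain ⟨y, hy⟩ := h.ex _ (b - x - B.d _ w) (by
      rw [map_sub, map_sub, hz, hom_d]; abel)
    exact ⟨y, h.inj _ (by rw [hom_d, hy, map_sub, map_sub, hx, B.d_d, hb]; simp)⟩

/-- In each degree the fiber is a product of terms of its source and target, so exactness is checked
on coordinates. -/
theorem SES.fib {f : A ⟶ B} {g : B ⟶ C} {f' : A' ⟶ B'} {g' : B' ⟶ C'} (h : SES f g)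
    (h' : SES f' g') {α : A ⟶ A'} {β : B ⟶ B'} {γ : C ⟶ C'} (w : α ≫ f' = f ≫ β)
    (w' : β ≫ g' = g ≫ γ) : SES (Fib.map f f' w) (Fib.map g g' w') where
  inj i x y e := Prod.ext (h.inj _ (congrArg Prod.fst e)) (h'.inj _ (congrArg Prod.snd e))
  surj i y := by
    obtain ⟨a, ha⟩ := h.surj _ y.1
    obtain ⟨b, hb⟩ := h'.surj _ y.2
    exact ⟨(a, b), Prod.ext ha hb⟩
  zero i x := Prod.ext (h.zero _ _) (h'.zero _ _)
  ex i b hb := by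
    obtain ⟨a, ha⟩ := h.ex _ b.1 (congrArg Prod.fst hb)
    obtain ⟨a', ha'⟩ := h'.ex _ b.2 (congrArg Prod.snd hb)
    exact ⟨(a, a'), Prod.ext ha ha'⟩

theorem SES.prod {f : A ⟶ B} {g : B ⟶ C} {f' : A' ⟶ B'} {g' : B' ⟶ C'} (h : SES f g)
    (h' : SES f' g') : SES (prod.map f f') (prod.map g g') where
  inj i x y e := Prod.ext (h.inj _ (congrArg Prod.fst e)) (h'.inj _ (congrArg Prod.snd e))
  surj i y := by
    obtain ⟨a, ha⟩ := h.surj _ y.1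
    obtain ⟨b, hb⟩ := h'.surj _ y.2
    exact ⟨(a, b), Prod.ext ha hb⟩
  zero i x := Prod.ext (h.zero _ _) (h'.zero _ _)
  ex i b hb := by
    obtain ⟨a, ha⟩ := h.ex _ b.1 (congrArg Prod.fst hb)
    obtain ⟨a', ha'⟩ := h'.ex _ b.2 (congrArg Prod.snd hb)
    exact ⟨(a, a'), Prod.ext ha ha'⟩

end Cx

end Goodwillie

end

/-! ### Faces of cubes and matching families. -/

noncomputable section

namespace Goodwillie

open Cx

/-! ### Functors to complexes -/

section Functors

variable {K : Type*} [Category* K]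

theorem Cx.map_comp_f (P : K ⥤ Cx.{u}) {X Y Z : K} (f : X ⟶ Y) (g : Y ⟶ Z) (i : ℤ)
    (x : (P.obj X).X i) :
    Hom.f (P.map (f ≫ g)) i x = Hom.f (P.map g) i (Hom.f (P.map f) i x) := by
  rw [P.map_comp, comp_f]

theorem Cx.map_id_f (P : K ⥤ Cx.{u}) {X : K} (i : ℤ) (x : (P.obj X).X i) :
    Hom.f (P.map (𝟙 X)) i x = x := by
  rw [P.map_id, id_f]

theorem Cx.naturality_f {P Q : K ⥤ Cx.{u}} (φ : P ⟶ Q) {X Y : K} (f : X ⟶ Y) (i : ℤ)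
    (x : (P.obj X).X i) :
    Hom.f (φ.app Y) i (Hom.f (P.map f) i x) = Hom.f (Q.map f) i (Hom.f (φ.app X) i x) :=
  congr_f (φ.naturality f) i x

variable {P Q P' Q' : K ⥤ Cx.{u}}

/-- The homotopy fiber of a natural transformation. -/
def fibF (φ : P ⟶ Q) : K ⥤ Cx.{u} where
  obj X := Fib (φ.app X)
  map f := Fib.map (P.map f) (Q.map f) (φ.naturality f).symm
  map_id X := hom_ext fun i x => Prod.ext (map_id_f P i x.1) (map_id_f Q _ x.2)
  map_comp f g := hom_ext fun i x => Prod.ext (map_comp_f P f g i x.1) (map_comp_f Q f g _ x.2)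

/-- The projection from the homotopy fiber. -/
def fibFst (φ : P ⟶ Q) : fibF φ ⟶ P where
  app X := ⟨fun i => AddMonoidHom.fst _ _, fun i x => rfl⟩
  naturality _ _ _ := rfl

/-- The product of two functors. -/
def prodF (P Q : K ⥤ Cx.{u}) : K ⥤ Cx.{u} where
  obj X := Cx.prod (P.obj X) (Q.obj X)
  map f := prod.map (P.map f) (Q.map f)
  map_id X := hom_ext fun i x => Prod.ext (map_id_f P i x.1) (map_id_f Q _ x.2)
  map_comp f g := hom_ext fun i x => Prod.ext (map_comp_f P f g i x.1) (map_comp_f Q f g _ x.2)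

/-- The difference of two natural transformations. -/
def diffF {R : K ⥤ Cx.{u}} (φ : P ⟶ R) (ψ : Q ⟶ R) : prodF P Q ⟶ R where
  app X := diffMap (φ.app X) (ψ.app X)
  naturality X Y f := hom_ext fun i x => by
    change Hom.f (φ.app Y) i (Hom.f (P.map f) i x.1) - Hom.f (ψ.app Y) i (Hom.f (Q.map f) i x.2) =
      Hom.f (R.map f) i (Hom.f (φ.app X) i x.1 - Hom.f (ψ.app X) i x.2)
    rw [map_sub, naturality_f, naturality_f]

end Functors

/-! ### Faces of cubes -/

/-- The inclusion of the subsets that do not contain the last element. -/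
def inc0 (n : ℕ) : Subsets n ⥤ Subsets (n + 1) :=
  Monotone.functor (f := fun S => S.map Fin.castSuccEmb) fun _ _ h => Finset.map_subset_map.2 h

/-- The inclusion of the subsets that contain the last element. -/
def inc1 (n : ℕ) : Subsets n ⥤ Subsets (n + 1) :=
  Monotone.functor (f := fun S => insert (Fin.last n) (S.map Fin.castSuccEmb)) fun _ _ h =>
    Finset.insert_subset_insert _ (Finset.map_subset_map.2 h)

/-- Adding the last element. -/
def inc01 (n : ℕ) : inc0 n ⟶ inc1 n where
  app _ := homOfLE (Finset.subset_insert _ _)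

theorem last_notMem_inc0 {n : ℕ} (S : Subsets n) : Fin.last n ∉ (inc0 n).obj S := by
  intro h
  obtain ⟨i, -, hi⟩ := Finset.mem_map.1 h
  exact (Fin.castSucc_lt_last i).ne hi

theorem last_mem_inc1 {n : ℕ} (S : Subsets n) : Fin.last n ∈ (inc1 n).obj S :=
  Finset.mem_insert_self _ _

theorem castSucc_mem_inc0 {n : ℕ} {S : Subsets n} {i : Fin n} :
    i.castSucc ∈ (inc0 n).obj S ↔ i ∈ S :=
  Finset.mem_map' Fin.castSuccEmb

theorem castSucc_mem_inc1 {n : ℕ} {S : Subsets n} {i : Fin n} :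
    i.castSucc ∈ (inc1 n).obj S ↔ i ∈ S := by
  refine Finset.mem_insert.trans ((or_iff_right ?_).trans castSucc_mem_inc0)
  exact (Fin.castSucc_lt_last i).ne

/-- The subset of the elements other than the last one. -/
def restr {n : ℕ} (T : Subsets (n + 1)) : Subsets n := Finset.univ.filter fun i => i.castSucc ∈ T

theorem mem_restr {n : ℕ} {T : Subsets (n + 1)} {i : Fin n} : i ∈ restr T ↔ i.castSucc ∈ T := by
  simp [restr]

theorem inc0_restr {n : ℕ} {T : Subsets (n + 1)} (h : Fin.last n ∉ T) :
    (inc0 n).obj (restr T) = T := by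
  ext i
  induction i using Fin.lastCases with
  | last => exact iff_of_false (last_notMem_inc0 _) h
  | cast i => rw [castSucc_mem_inc0, mem_restr]

theorem inc1_restr {n : ℕ} {T : Subsets (n + 1)} (h : Fin.last n ∈ T) :
    (inc1 n).obj (restr T) = T := by
  ext i
  induction i using Fin.lastCases with
  | last => exact iff_of_true (last_mem_inc1 _) h
  | cast i => rw [castSucc_mem_inc1, mem_restr]

theorem restr_inc0 {n : ℕ} (S : Subsets n) : restr ((inc0 n).obj S) = S := by
  ext i; rw [mem_restr, castSucc_mem_inc0]

theorem restr_inc1 {n : ℕ} (S : Subsets n) : restr ((inc1 n).obj S) = S := by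
  ext i; rw [mem_restr, castSucc_mem_inc1]

theorem inc0_le_iff {n : ℕ} {S : Subsets n} {T : Subsets (n + 1)} :
    (inc0 n).obj S ≤ T ↔ S ≤ restr T := by
  constructor
  · intro h i hi
    exact mem_restr.2 (h (castSucc_mem_inc0.2 hi))
  · intro h i hi
    induction i using Fin.lastCases with
    | last => exact (last_notMem_inc0 _ hi).elim
    | cast i => exact mem_restr.1 (h (castSucc_mem_inc0.1 hi))

theorem le_inc0_iff {n : ℕ} {S : Subsets n} {T : Subsets (n + 1)} :
    T ≤ (inc0 n).obj S ↔ restr T ≤ S ∧ Fin.last n ∉ T := by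
  constructor
  · intro h
    exact ⟨fun i hi => castSucc_mem_inc0.1 (h (mem_restr.1 hi)), fun h' => last_notMem_inc0 _ (h h')⟩
  · rintro ⟨h, hl⟩ i hi
    induction i using Fin.lastCases with
    | last => exact (hl hi).elim
    | cast i => exact castSucc_mem_inc0.2 (h (mem_restr.2 hi))

theorem le_inc1_iff {n : ℕ} {S : Subsets n} {T : Subsets (n + 1)} :
    T ≤ (inc1 n).obj S ↔ restr T ≤ S := by
  constructor
  · intro h i hi
    exact castSucc_mem_inc1.1 (h (mem_restr.1 hi))
  · rintro h i hi
    induction i using Fin.lastCases with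
    | last => exact last_mem_inc1 _
    | cast i => exact castSucc_mem_inc1.2 (h (mem_restr.2 hi))

theorem inc1_le_iff {n : ℕ} {S : Subsets n} {T : Subsets (n + 1)} :
    (inc1 n).obj S ≤ T ↔ S ≤ restr T ∧ Fin.last n ∈ T := by
  constructor
  · intro h
    exact ⟨fun i hi => mem_restr.2 (h (castSucc_mem_inc1.2 hi)), h (last_mem_inc1 _)⟩
  · rintro ⟨h, hl⟩ i hi
    induction i using Fin.lastCases with
    | last => exact hl
    | cast i => exact mem_restr.1 (h (castSucc_mem_inc1.1 hi))

theorem empty_lt_inc1 {n : ℕ} (S : Subsets n) : (∅ : Subsets (n + 1)) < (inc1 n).obj S :=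
  Finset.empty_ssubset.2 ⟨_, last_mem_inc1 S⟩

theorem inc0_lt {n : ℕ} {S T : Subsets n} (h : S < T) : (inc0 n).obj S < (inc0 n).obj T :=
  lt_of_le_not_ge ((inc0 n).map (homOfLE h.le)).le fun h' => h.not_ge (by
    rw [inc0_le_iff, restr_inc0] at h'; exact h')

theorem inc1_lt {n : ℕ} {S T : Subsets n} (h : S < T) : (inc1 n).obj S < (inc1 n).obj T :=
  lt_of_le_not_ge ((inc1 n).map (homOfLE h.le)).le fun h' => h.not_ge (by
    rw [le_inc1_iff, restr_inc1] at h'; exact h')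

theorem empty_lt_inc0 {n : ℕ} {S : Subsets n} (h : ∅ < S) :
    (∅ : Subsets (n + 1)) < (inc0 n).obj S :=
  (Finset.empty_subset _).trans_lt (inc0_lt h)

/-! ### Matching families -/

section Matching

variable {n : ℕ}

/-- The compatible families of elements of degree `i` of `Y(T)`, `T ≠ ∅`. -/
def matchSub (Y : Subsets n ⥤ Cx.{u}) (i : ℤ) :
    AddSubgroup (∀ T : Above (∅ : Subsets n), (Y.obj T.1).X i) where
  carrier := {y | ∀ (T T' : Above (∅ : Subsets n)) (h : T.1 ≤ T'.1),
    Hom.f (Y.map (homOfLE h)) i (y T) = y T'}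
  add_mem' ha hb T T' h := by simp [ha T T' h, hb T T' h]
  zero_mem' T T' h := by simp
  neg_mem' ha T T' h := by simp [ha T T' h]

/-- The complex of the compatible families of elements of `Y(T)`, `T ≠ ∅`. -/
def matchCx (Y : Subsets n ⥤ Cx.{u}) : Cx.{u} where
  X i := matchSub Y i
  d i :=
    { toFun := fun y => ⟨fun T => (Y.obj T.1).d i (y.1 T), fun T T' h => by
        rw [hom_d, y.2 T T' h]⟩
      map_zero' := Subtype.ext (funext fun T => map_zero _)
      map_add' := fun x y => Subtype.ext (funext fun T => map_add _ _ _) }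
  d_d i y := Subtype.ext (funext fun T => d_d _ _ _)

theorem matchCx.ext {Y : Subsets n ⥤ Cx.{u}} {i : ℤ} {x y : (matchCx Y).X i}
    (h : ∀ T, x.1 T = y.1 T) : x = y := Subtype.ext (funext h)

/-- The functor of matching families. -/
def matchF (n : ℕ) : (Subsets n ⥤ Cx.{u}) ⥤ Cx.{u} where
  obj Y := matchCx Y
  map {Y Z} φ :=
    { f := fun i =>
        { toFun := fun y => ⟨fun T => Hom.f (φ.app T.1) i (y.1 T), fun T T' h => by
            rw [← naturality_f, y.2 T T' h]⟩
          map_zero' := matchCx.ext fun T => map_zero _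
          map_add' := fun x y => matchCx.ext fun T => map_add _ _ _ }
      comm := fun i y => matchCx.ext fun T => hom_d _ _ _ }
  map_id Y := rfl
  map_comp φ ψ := rfl

/-- The map from `Y(∅)` to the matching families. -/
def toMatch (n : ℕ) : (evaluation (Subsets n) Cx.{u}).obj ∅ ⟶ matchF n where
  app Y :=
    { f := fun i =>
        { toFun := fun y => ⟨fun T => Hom.f (Y.map (homOfLE T.2.le)) i y, fun T T' h => by
            rw [← map_comp_f]; rfl⟩
          map_zero' := matchCx.ext fun T => map_zero _
          map_add' := fun x y => matchCx.ext fun T => map_add _ _ _ }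
      comm := fun i y => matchCx.ext fun T => hom_d _ _ _ }
  naturality Y Z φ := hom_ext fun i y => matchCx.ext fun T => (naturality_f φ _ i y).symm

/-- Restriction of matching families to the face of the subsets without the last element. -/
def matchRestr0 (Y : Subsets (n + 1) ⥤ Cx.{u}) :
    (matchF (n + 1)).obj Y ⟶ (matchF n).obj (inc0 n ⋙ Y) where
  f i :=
    { toFun := fun y => ⟨fun T => y.1 ⟨(inc0 n).obj T.1, empty_lt_inc0 T.2⟩, fun T T' h =>
        y.2 ⟨(inc0 n).obj T.1, empty_lt_inc0 T.2⟩ ⟨(inc0 n).obj T'.1, empty_lt_inc0 T'.2⟩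
          ((inc0 n).map (homOfLE h)).le⟩
      map_zero' := rfl
      map_add' := fun x y => rfl }
  comm i y := rfl

/-- The value of a matching family at the set of the last element. -/
def matchLast (Y : Subsets (n + 1) ⥤ Cx.{u}) :
    (matchF (n + 1)).obj Y ⟶ ((evaluation _ _).obj ∅).obj (inc1 n ⋙ Y) where
  f i :=
    { toFun := fun y => y.1 ⟨(inc1 n).obj ∅, empty_lt_inc1 ∅⟩
      map_zero' := rfl
      map_add' := fun x y => rfl }
  comm i y := rfl

/-- The map from the face without the last element to the one with it. -/
abbrev faceMap (Y : Subsets (n + 1) ⥤ Cx.{u}) : inc0 n ⋙ Y ⟶ inc1 n ⋙ Y :=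
  Functor.whiskerRight (inc01 n) Y

/-- A matching family has a single value at T ∪ {last}, reached both from T and from {last}. With
`exists_match` this presents the matching object of a cube as a pullback of data on two faces. -/
theorem match_square (Y : Subsets (n + 1) ⥤ Cx.{u}) :
    matchRestr0 Y ≫ (matchF n).map (faceMap Y) = matchLast Y ≫ (toMatch n).app (inc1 n ⋙ Y) :=
  hom_ext fun i y => matchCx.ext fun T => by
    have h1 := y.2 ⟨(inc0 n).obj T.1, empty_lt_inc0 T.2⟩ ⟨(inc1 n).obj T.1, empty_lt_inc1 _⟩
      ((inc01 n).app T.1).le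
    have h2 := y.2 ⟨(inc1 n).obj ∅, empty_lt_inc1 _⟩ ⟨(inc1 n).obj T.1, empty_lt_inc1 _⟩
      ((inc1 n).map (homOfLE T.2.le)).le
    change Hom.f (Y.map ((inc01 n).app T.1)) i (y.1 ⟨(inc0 n).obj T.1, empty_lt_inc0 T.2⟩) =
      Hom.f (Y.map ((inc1 n).map (homOfLE T.2.le))) i (y.1 ⟨(inc1 n).obj ∅, empty_lt_inc1 ∅⟩)
    exact h1.trans h2.symm

/-- Matching families on an `(n+1)`-cube are pairs of a matching family on a face and an element
at the set of the last element. -/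
theorem exists_match (Y : Subsets (n + 1) ⥤ Cx.{u}) (i : ℤ) (u : ((matchF n).obj (inc0 n ⋙ Y)).X i)
    (v : (Y.obj ((inc1 n).obj ∅)).X i)
    (h : Hom.f ((matchF n).map (faceMap Y)) i u = Hom.f ((toMatch n).app (inc1 n ⋙ Y)) i v) :
    ∃ y : ((matchF (n + 1)).obj Y).X i, Hom.f (matchRestr0 Y) i y = u ∧ Hom.f (matchLast Y) i y = v := by
  have hlt : ∀ T : Above (∅ : Subsets (n + 1)), Fin.last n ∉ T.1 → ∅ < restr T.1 := fun T hT => by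
    refine Finset.empty_ssubset.2 ?_
    obtain ⟨j, hj⟩ := Finset.empty_ssubset.1 T.2
    induction j using Fin.lastCases with
    | last => exact (hT hj).elim
    | cast j => exact ⟨j, mem_restr.2 hj⟩
  have hle : ∀ {T : Subsets (n + 1)}, Fin.last n ∈ T → (inc1 n).obj ∅ ≤ T := fun {T} hT =>
    inc1_le_iff.2 ⟨Finset.empty_subset _, hT⟩
  -- The hypothesis compares `u` and `v` only at the sets T ∪ {last}; functoriality transports the
  -- equality to every larger set.
  have hcomp : ∀ (T T' : Subsets (n + 1)) (hT : ∅ < restr T) (h0 : (inc0 n).obj (restr T) ≤ T')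
      (hT' : (inc1 n).obj ∅ ≤ T'), Hom.f (Y.map (homOfLE h0)) i (u.1 ⟨restr T, hT⟩) =
        Hom.f (Y.map (homOfLE hT')) i v := by
    intro T T' hT h0 hT'
    have e := congrArg (fun z => z.1 ⟨restr T, hT⟩) h
    have hle1 : (inc1 n).obj (restr T) ≤ T' :=
      inc1_le_iff.2 ⟨inc0_le_iff.1 h0, (inc1_le_iff.1 hT').2⟩
    replace e := congrArg (Hom.f (Y.map (homOfLE hle1)) i) e
    refine Eq.trans ?_ (e.trans ?_)
    · exact (congr_f (Y.map_comp ((inc01 n).app (restr T)) (homOfLE hle1)) i _)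
    · exact (congr_f (Y.map_comp ((inc1 n).map (homOfLE hT.le)) (homOfLE hle1)) i _).symm
  -- A set that contains the last element receives its value from {last}; any other set lies in the
  -- face on which `u` is given.
  refine ⟨⟨fun T => if hT : Fin.last n ∈ T.1 then Hom.f (Y.map (homOfLE (hle hT))) i v
    else Hom.f (Y.map (homOfLE (inc0_restr hT).le)) i (u.1 ⟨restr T.1, hlt T hT⟩), ?_⟩, ?_, ?_⟩
  · intro T T' hTT'
    beta_reduce
    by_cases hT : Fin.last n ∈ T.1
    · rw [dif_pos hT, dif_pos (hTT' hT), ← map_comp_f]; rfl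
    · rw [dif_neg hT, ← map_comp_f]
      by_cases hT' : Fin.last n ∈ T'.1
      · rw [dif_pos hT']
        exact hcomp _ _ _ _ _
      · rw [dif_neg hT']
        have hr : restr T.1 ≤ restr T'.1 := fun j hj => mem_restr.2 (hTT' (mem_restr.1 hj))
        rw [← u.2 ⟨_, hlt T hT⟩ ⟨_, hlt T' hT'⟩ hr]
        exact (congr_f (Y.map_comp ((inc0 n).map (homOfLE hr))
          (homOfLE (inc0_restr hT').le)) i _)
  · refine matchCx.ext fun T => ?_
    refine (dif_neg (last_notMem_inc0 _)).trans ?_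
    exact u.2 ⟨restr ((inc0 n).obj T.1), (restr_inc0 T.1).symm ▸ T.2⟩ T (restr_inc0 T.1).le
  · refine (dif_pos (last_mem_inc1 _)).trans ?_
    exact map_id_f Y i v

end Matching

end Goodwillie

end

/-! ### Punctured homotopy limits and total fibers as iterated mapping fibers. -/

noncomputable section

namespace Goodwillie

open Cx

/-! ### Punctured homotopy limits and total fibers of cubes -/

/-- A functor on `n`-cubes, with a map from the matching families. -/
structure HolimData (n : ℕ) where
  L : (Subsets n ⥤ Cx.{u}) ⥤ Cx.{u}
  lam : matchF n ⟶ L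

namespace HolimData

/-- The augmentation. -/
def aug {n : ℕ} (h : HolimData.{u} n) : (evaluation (Subsets n) Cx.{u}).obj ∅ ⟶ h.L :=
  toMatch n ≫ h.lam

/-- The zero functor. -/
def zero (n : ℕ) : HolimData.{u} n where
  L := (Functor.const _).obj Cx.zero
  lam :=
    { app := fun Y => ⟨fun _ => 0, fun _ _ => rfl⟩
      naturality := fun _ _ _ => rfl }

variable {n : ℕ} (h : HolimData.{u} n)

/-- Evaluation of an `(n+1)`-cube at the set of the last element. -/
abbrev evLast (n : ℕ) : (Subsets (n + 1) ⥤ Cx.{u}) ⥤ Cx.{u} :=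
  (evaluation _ _).obj ((inc1 n).obj ∅)

/-- Restriction of cubes to a face. -/
abbrev face0 (n : ℕ) : (Subsets (n + 1) ⥤ Cx.{u}) ⥤ (Subsets n ⥤ Cx.{u}) :=
  (Functor.whiskeringLeft _ _ _).obj (inc0 n)

/-- Restriction of cubes to a face. -/
abbrev face1 (n : ℕ) : (Subsets (n + 1) ⥤ Cx.{u}) ⥤ (Subsets n ⥤ Cx.{u}) :=
  (Functor.whiskeringLeft _ _ _).obj (inc1 n)

/-- The difference map whose homotopy fiber is the next functor. -/
def succDiff : prodF (face0 n ⋙ h.L) (evLast n) ⟶ face1 n ⋙ h.L :=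
  diffF (Functor.whiskerRight ((Functor.whiskeringLeft _ _ _).map (inc01 n)) h.L)
    (Functor.whiskerLeft (face1 n) h.aug)

theorem succDiff_lift (Y : Subsets (n + 1) ⥤ Cx.{u}) (i : ℤ) (y : ((matchF (n + 1)).obj Y).X i) :
    Hom.f (h.succDiff.app Y) i
      (Hom.f (prod.lift (matchRestr0 Y ≫ h.lam.app (inc0 n ⋙ Y)) (matchLast Y)) i y) = 0 := by
  change Hom.f (h.L.map (faceMap Y)) i (Hom.f (h.lam.app (inc0 n ⋙ Y)) i
      (Hom.f (matchRestr0 Y) i y)) - Hom.f (h.lam.app (inc1 n ⋙ Y)) i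
      (Hom.f ((toMatch n).app (inc1 n ⋙ Y)) i (Hom.f (matchLast Y) i y)) = 0
  rw [← naturality_f h.lam]
  exact sub_eq_zero.2 (congrArg _ (congr_f (match_square Y) i y))

/-- The map from matching families to the homotopy fiber. -/
def succLam (Y : Subsets (n + 1) ⥤ Cx.{u}) :
    (matchF (n + 1)).obj Y ⟶ Fib (h.succDiff.app Y) :=
  Fib.liftKer (prod.lift (matchRestr0 Y ≫ h.lam.app (inc0 n ⋙ Y)) (matchLast Y))
    (h.succDiff_lift Y)

/-- The recursion step. -/
def succ : HolimData.{u} (n + 1) where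
  L := fibF h.succDiff
  lam :=
    { app := fun Y => h.succLam Y
      naturality := fun Y Z φ => hom_ext fun i y => by
        refine Prod.ext (Prod.ext ?_ rfl)
          (map_zero (Hom.f (h.L.map (Functor.whiskerLeft (inc1 n) φ)) (i + 1))).symm
        exact naturality_f h.lam (Functor.whiskerLeft (inc0 n) φ) i (Hom.f (matchRestr0 Y) i y) }

end HolimData

/-- The model of the homotopy limit of a cube over the nonempty sets. -/
def holimData : ∀ n : ℕ, HolimData.{u} n
  | 0 => HolimData.zero 0
  | n + 1 => (holimData n).succ

/-- The homotopy limit of a cube over the nonempty sets. -/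
abbrev hl (n : ℕ) : (Subsets n ⥤ Cx.{u}) ⥤ Cx.{u} := (holimData n).L

/-- The map to the homotopy limit. -/
abbrev hlAug (n : ℕ) : (evaluation (Subsets n) Cx.{u}).obj ∅ ⟶ hl n := (holimData n).aug

/-- The total homotopy fiber. -/
def tf (n : ℕ) : (Subsets n ⥤ Cx.{u}) ⥤ Cx.{u} := fibF (hlAug n)

theorem ex_tf_iff {n : ℕ} {Y : Subsets n ⥤ Cx.{u}} {i : ℤ} :
    Ex ((tf n).obj Y) i ↔ Inj ((hlAug n).app Y) i ∧ Surj ((hlAug n).app Y) (i + 1) :=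
  ex_fib_iff

/-! ### Classes of maps preserved by homotopy limits -/

/-- A class of maps that is stable under products and homotopy fibers. -/
structure FibStable (W : MorphismProperty Cx.{u}) : Prop where
  zero : W (𝟙 Cx.zero)
  prod : ∀ {A B A' B' : Cx.{u}} (α : A ⟶ A') (β : B ⟶ B'), W α → W β → W (prod.map α β)
  fib : ∀ {A B A' B' : Cx.{u}} {f : A ⟶ B} {f' : A' ⟶ B'} (α : A ⟶ A') (β : B ⟶ B')
    (w : f ≫ β = α ≫ f'), W α → W β → W (Fib.map α β w)

/-- The model `hl` is built from evaluations, binary products and mapping fibers only, so every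
class stable under these passes to it. -/
theorem FibStable.hl {W : MorphismProperty Cx.{u}} (hW : FibStable W) {n : ℕ} :
    ∀ {Y Z : Subsets n ⥤ Cx.{u}} (φ : Y ⟶ Z), (∀ T, W (φ.app T)) → W ((hl n).map φ) := by
  induction n with
  | zero => exact fun _ _ => hW.zero
  | succ n ih =>
    intro Y Z φ hφ
    exact hW.fib _ _ ((holimData n).succDiff.naturality φ).symm (hW.prod _ _ (ih (Functor.whiskerLeft (inc0 n) φ) fun T => hφ _) (hφ _))
      (ih (Functor.whiskerLeft (inc1 n) φ) fun T => hφ _)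

theorem FibStable.tf {W : MorphismProperty Cx.{u}} (hW : FibStable W) {n : ℕ}
    {Y Z : Subsets n ⥤ Cx.{u}} (φ : Y ⟶ Z) (hφ : ∀ T, W (φ.app T)) : W ((tf n).map φ) :=
  hW.fib _ _ ((hlAug n).naturality φ).symm (hφ ∅) (hW.hl φ hφ)

/-- Bijectivity on homology in a set of degrees. -/
def hIsoOn (S : Set ℤ) : MorphismProperty Cx.{u} := fun _ _ f => ∀ i ∈ S, HIso f i

/-- A set of degrees is upward closed. -/
def UpClosed (S : Set ℤ) : Prop := ∀ i ∈ S, i + 1 ∈ S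

/-- The five lemma. Degree i of a fiber involves degree i+1 of the target, which is why the set of
degrees must be upward closed. -/
theorem fibStable_hIsoOn {S : Set ℤ} (hS : UpClosed S) : FibStable (hIsoOn.{u} S) where
  zero i _ := hIso_id _ _
  prod α β hα hβ i hi := ⟨prod.inj_map (hα i hi).1 (hβ i hi).1, prod.surj_map (hα i hi).2 (hβ i hi).2⟩
  fib α β w hα hβ i hi := ⟨Fib.inj_map w (hα i hi).1 (hα _ (hS i hi)).2 (hβ _ (hS i hi)).1,
    Fib.surj_map w (hα i hi).2 (hβ i hi).1 (hβ _ (hS i hi)).2⟩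

/-- The four lemmas also preserve the weaker condition that lacks surjectivity in the lowest degree.
This is exactly what acyclicity of a fiber in the degrees of `S` provides, by `ex_fib_iff`. -/
theorem fibStable_eqv {S : Set ℤ} (hS : UpClosed S) :
    FibStable (fun {A B : Cx.{u}} (f : A ⟶ B) => Eqv S f) where
  zero i _ := ⟨(hIso_id _ _).1, (hIso_id _ _).2⟩
  prod α β hα hβ i hi := ⟨prod.inj_map (hα i hi).1 (hβ i hi).1, prod.surj_map (hα i hi).2 (hβ i hi).2⟩
  fib α β w hα hβ i hi := ⟨Fib.inj_map w (hα i hi).1 (hα _ hi).2 (hβ _ (hS i hi)).1,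
    Fib.surj_map w (hα i hi).2 (hβ _ (hS i hi)).1 (hβ _ (hS i hi)).2⟩

theorem ses_hl {n : ℕ} : ∀ {Y Z W : Subsets n ⥤ Cx.{u}} {φ : Y ⟶ Z} {ψ : Z ⟶ W},
    (∀ T, SES (φ.app T) (ψ.app T)) → SES ((hl n).map φ) ((hl n).map ψ) := by
  induction n with
  | zero => exact fun _ => ⟨fun _ _ _ _ => rfl, fun _ y => ⟨y, rfl⟩, fun _ _ => rfl,
      fun _ b _ => ⟨b, rfl⟩⟩
  | succ n ih =>
    intro Y Z W φ ψ hφ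
    exact SES.fib (SES.prod (ih (φ := Functor.whiskerLeft (inc0 n) φ)
      (ψ := Functor.whiskerLeft (inc0 n) ψ) fun T => hφ _) (hφ _))
      (ih (φ := Functor.whiskerLeft (inc1 n) φ) (ψ := Functor.whiskerLeft (inc1 n) ψ)
        fun T => hφ _) ((holimData n).succDiff.naturality φ).symm
      ((holimData n).succDiff.naturality ψ).symm

theorem ses_tf {n : ℕ} {Y Z W : Subsets n ⥤ Cx.{u}} {φ : Y ⟶ Z} {ψ : Z ⟶ W}
    (h : ∀ T, SES (φ.app T) (ψ.app T)) : SES ((tf n).map φ) ((tf n).map ψ) :=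
  SES.fib (h ∅) (ses_hl h) ((hlAug n).naturality φ).symm ((hlAug n).naturality ψ).symm

/-- In a set of degrees, every cycle of the sequence eventually becomes a boundary. -/
def IsNull (S : Set ℤ) (A : ℕ ⥤ Cx.{u}) : Prop :=
  ∀ (l : ℕ), ∀ i ∈ S, ∀ x : (A.obj l).X (i + 1), (A.obj l).d i x = 0 →
    ∃ (l' : ℕ) (g : l ⟶ l') (y : (A.obj l').X (i + 1 + 1)),
      (A.obj l').d (i + 1) y = Hom.f (A.map g) (i + 1) x

theorem IsNull.prod {S : Set ℤ} {A B : ℕ ⥤ Cx.{u}} (hA : IsNull S A) (hB : IsNull S B) :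
    IsNull S (prodF A B) := by
  rintro l i hi ⟨a, b⟩ hab
  obtain ⟨l₁, g₁, y₁, h₁⟩ := hA l i hi a (congrArg Prod.fst hab)
  obtain ⟨l₂, g₂, y₂, h₂⟩ := hB l i hi b (congrArg Prod.snd hab)
  refine ⟨max l₁ l₂, g₁ ≫ homOfLE (le_max_left _ _), (Hom.f (A.map (homOfLE (le_max_left _ _))) _ y₁,
    Hom.f (B.map (homOfLE (le_max_right _ _))) _ y₂), Prod.ext ?_ ?_⟩
  · refine (hom_d _ _ _).symm.trans ?_
    rw [h₁, ← map_comp_f]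
    rfl
  · refine (hom_d _ _ _).symm.trans ?_
    rw [h₂, ← map_comp_f]
    rfl

/-- The first coordinate is killed at some stage by `x`. What then remains of the second coordinate
is a cycle one degree higher, and it dies at a later stage. -/
theorem IsNull.fib {S : Set ℤ} (hS : UpClosed S) {A B : ℕ ⥤ Cx.{u}} (φ : A ⟶ B)
    (hA : IsNull S A) (hB : IsNull S B) : IsNull S (fibF φ) := by
  rintro l i hi ⟨a, b⟩ hab
  obtain ⟨l₁, g₁, x, hx⟩ := hA l i hi a (congrArg Prod.fst hab)
  have hb : Hom.f (φ.app l) _ a - (B.obj l).d _ b = 0 := congrArg Prod.snd hab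
  obtain ⟨l₂, g₂, y, hy⟩ := hB l₁ _ (hS i hi) (Hom.f (B.map g₁) _ b - Hom.f (φ.app l₁) _ x) (by
    rw [map_sub, ← hom_d, ← hom_d, ← sub_eq_zero.1 hb, hx, naturality_f, sub_self])
  refine ⟨l₂, g₁ ≫ g₂, (Hom.f (A.map g₂) _ x, -y), Prod.ext ?_ ?_⟩
  · refine (hom_d _ _ _).symm.trans ?_
    rw [hx, ← map_comp_f]
    rfl
  · change Hom.f (φ.app l₂) _ (Hom.f (A.map g₂) _ x) - (B.obj l₂).d _ (-y) =
      Hom.f (B.map (g₁ ≫ g₂)) _ b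
    rw [map_neg, hy, map_sub, map_comp_f, naturality_f]
    abel

theorem isNull_hl {S : Set ℤ} (hS : UpClosed S) {n : ℕ} : ∀ (Y : ℕ ⥤ (Subsets n ⥤ Cx.{u})),
    (∀ T, IsNull S (Y ⋙ (evaluation _ _).obj T)) → IsNull S (Y ⋙ hl n) := by
  induction n with
  | zero => exact fun Y _ l i _ x _ => ⟨l, 𝟙 l, 0, rfl⟩
  | succ n ih =>
    intro Y hY
    exact IsNull.fib hS (Functor.whiskerLeft Y (holimData n).succDiff)
      (IsNull.prod (ih (Y ⋙ HolimData.face0 n) fun T => hY _) (hY _))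
      (ih (Y ⋙ HolimData.face1 n) fun T => hY _)

/-! ### Total fibers of faces -/

theorem hIso_of_bijective {A B : Cx.{u}} (f : A ⟶ B) (hf : ∀ i, Function.Bijective (Hom.f f i))
    (i : ℤ) : HIso f i := by
  constructor
  · rintro x - ⟨y, hy⟩
    obtain ⟨z, rfl⟩ := (hf _).2 y
    exact ⟨z, (hf _).1 (by rw [hom_d, hy])⟩
  · intro y hy
    obtain ⟨x, rfl⟩ := (hf _).2 y
    exact ⟨x, (hf _).1 (by rw [hom_d, hy, map_zero]), 0, by simp⟩

/-- The image of ∅ in the face is equal to ∅ only propositionally; the structure map between the two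
values is an isomorphism in any case. -/
theorem map_bot_bijective {n : ℕ} (Y : Subsets (n + 1) ⥤ Cx.{u}) (i : ℤ) :
    Function.Bijective (Hom.f (Y.map (homOfLE (Finset.empty_subset ((inc0 n).obj ∅)))) i) := by
  have hle : (inc0 n).obj ∅ ≤ ∅ := inc0_le_iff.2 (Finset.empty_subset _)
  refine Function.bijective_iff_has_inverse.2 ⟨Hom.f (Y.map (homOfLE hle)) i, fun x => ?_,
    fun x => ?_⟩
  · rw [← map_comp_f]; exact map_id_f Y i x
  · rw [← map_comp_f]; exact map_id_f Y i x

/-- The augmentation passes through strictly compatible families, so its path coordinate is zero. -/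
theorem hlAug_succ {n : ℕ} (Y : Subsets (n + 1) ⥤ Cx.{u}) (i : ℤ) (y : (Y.obj ∅).X i) :
    Hom.f ((hlAug (n + 1)).app Y) i y =
      ((Hom.f ((hlAug n).app (inc0 n ⋙ Y)) i
          (Hom.f (Y.map (homOfLE (Finset.empty_subset ((inc0 n).obj ∅)))) i y),
        Hom.f (Y.map (homOfLE (Finset.empty_subset ((inc1 n).obj ∅)))) i y), 0) := by
  refine Prod.ext (Prod.ext ?_ rfl) rfl
  refine congrArg (Hom.f ((holimData n).lam.app (inc0 n ⋙ Y)) i) (matchCx.ext fun T => ?_)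
  exact map_comp_f Y (homOfLE (Finset.empty_subset ((inc0 n).obj ∅)))
    ((inc0 n).map (homOfLE T.2.le)) i y

/-- The sign identity behind `tfShuffle`. Exchanging the two directions in which fibers are taken
reverses the sign of the coordinate at the far corner; `p` stands for the vanishing path coordinate
of the augmentation. -/
theorem shuffle_aux {G : Type*} [AddCommGroup G] {p q r s t : G} (hp : p = 0) (ht : t = -s) :
    -(p - (q - r - s)) = q - (r - t) := by
  rw [hp, ht]; abel

/-- The total fiber of a cube is the homotopy fiber of the total fibers of two opposite faces. -/
def tfShuffle {n : ℕ} (Y : Subsets (n + 1) ⥤ Cx.{u}) :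
    (tf (n + 1)).obj Y ⟶ Fib ((tf n).map (faceMap Y)) where
  f i :=
    { toFun := fun x => ((Hom.f (Y.map (homOfLE (Finset.empty_subset ((inc0 n).obj ∅)))) i x.1,
        x.2.1.1), (x.2.1.2, -x.2.2))
      map_zero' := Prod.ext (Prod.ext (map_zero _) rfl) (Prod.ext rfl neg_zero)
      map_add' := fun x y => Prod.ext (Prod.ext (map_add _ _ _) rfl)
        (Prod.ext rfl (neg_add _ _)) }
  comm i x := by
    obtain ⟨y, ⟨u, v⟩, w⟩ := x
    have e := hlAug_succ Y (i + 1) y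
    refine Prod.ext (Prod.ext (hom_d _ _ _) ?_) (Prod.ext ?_ ?_)
    · exact congrArg (fun z => z.1.1 - ((hl n).obj (inc0 n ⋙ Y)).d _ u) e
    · refine (congrArg (fun z => z.1.2 - (Y.obj ((inc1 n).obj ∅)).d _ v) e).trans ?_
      refine congrArg (· - _) ?_
      exact map_comp_f Y (homOfLE (Finset.empty_subset ((inc0 n).obj ∅)))
        ((inc01 n).app ∅) (i + 1) y
    · exact shuffle_aux (congrArg Prod.snd e) 
        (map_neg (((hl n).obj (inc1 n ⋙ Y)).d (i + 1 + 1)) (show ((hl n).obj (inc1 n ⋙ Y)).X _ from w))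

/-- Fibers in different directions commute (`tfShuffle` is bijective in every degree), so the
question reduces to the long exact sequence for the map between two opposite faces. -/
theorem ex_tf_succ_iff {n : ℕ} {Y : Subsets (n + 1) ⥤ Cx.{u}} {i : ℤ} :
    Ex ((tf (n + 1)).obj Y) i ↔
      Inj ((tf n).map (faceMap Y)) i ∧ Surj ((tf n).map (faceMap Y)) (i + 1) := by
  rw [← ex_fib_iff]
  have h := hIso_of_bijective (tfShuffle Y) (fun j => by
    obtain ⟨h1, h2⟩ := map_bot_bijective Y j
    constructor
    · rintro ⟨y, ⟨u, v⟩, w⟩ ⟨y', ⟨u', v'⟩, w'⟩ e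
      have e1 := congrArg (fun z => z.1.1) e
      have e2 := congrArg (fun z => z.1.2) e
      have e3 := congrArg (fun z => z.2.1) e
      have e4 := congrArg (fun z => z.2.2) e
      exact Prod.ext (h1 e1) (Prod.ext (Prod.ext e2 e3) (neg_injective e4))
    · rintro ⟨⟨y, u⟩, v, w⟩
      obtain ⟨z, rfl⟩ := h2 y
      exact ⟨(z, ((u, v), -w)), Prod.ext rfl (Prod.ext rfl (neg_neg w))⟩) i
  exact ⟨fun hx => hx.of_hIso' h.2, fun hx => hx.of_hIso h.1⟩

/-! ### Fibrant cubes -/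

/-- In the degrees `i + 2`, `i ∈ S`, the matching maps of the cube are surjective. -/
def SFib (S : Set ℤ) {n : ℕ} (Y : Subsets n ⥤ Cx.{u}) : Prop :=
  ∀ (U : Subsets n), ∀ i ∈ S, ∀ y : ∀ V : Above U, (Y.obj V.1).X (i + 1 + 1),
    (∀ (V V' : Above U) (h : V.1 ≤ V'.1), Hom.f (Y.map (homOfLE h)) _ (y V) = y V') →
    ∃ x : (Y.obj U).X (i + 1 + 1), ∀ V : Above U, Hom.f (Y.map (homOfLE V.2.le)) _ x = y V

theorem Cx.map_map {n : ℕ} (Y : Subsets n ⥤ Cx.{u}) {U V W : Subsets n} (h : U ≤ V) (h' : V ≤ W)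
    (i : ℤ) (x : (Y.obj U).X i) : Hom.f (Y.map (homOfLE h')) i (Hom.f (Y.map (homOfLE h)) i x) =
      Hom.f (Y.map (homOfLE (h.trans h'))) i x :=
  (map_comp_f Y (homOfLE h) (homOfLE h') i x).symm

theorem lt_restr_of_inc1_lt {n : ℕ} {U : Subsets n} {V : Subsets (n + 1)}
    (h : (inc1 n).obj U < V) : U < restr V :=
  lt_of_le_not_ge (inc1_le_iff.1 h.le).1 fun h' => h.not_ge (le_inc1_iff.2 h')

theorem lt_restr_of_inc0_lt {n : ℕ} {U : Subsets n} {V : Subsets (n + 1)}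
    (h : (inc0 n).obj U < V) (hV : Fin.last n ∉ V) : U < restr V :=
  lt_of_le_not_ge (inc0_le_iff.1 h.le) fun h' => h.not_ge (le_inc0_iff.2 ⟨h', hV⟩)

theorem restr_mono {n : ℕ} {T T' : Subsets (n + 1)} (h : T ≤ T') : restr T ≤ restr T' :=
  fun _ hj => mem_restr.2 (h (mem_restr.1 hj))

/-- All sets above U ∪ {last} contain the last element, so the matching problem on this face is the
one on the whole cube. -/
theorem SFib.face1 {S : Set ℤ} {n : ℕ} {Y : Subsets (n + 1) ⥤ Cx.{u}} (hY : SFib S Y) :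
    SFib S (inc1 n ⋙ Y) := by
  intro U i hi y hy
  have hle : ∀ V : Above ((inc1 n).obj U), (inc1 n).obj (restr V.1) ≤ V.1 := fun V =>
    inc1_le_iff.2 ⟨le_rfl, (inc1_le_iff.1 V.2.le).2⟩
  obtain ⟨x, hx⟩ := hY ((inc1 n).obj U) i hi
    (fun V => Hom.f (Y.map (homOfLE (hle V))) _ (y ⟨restr V.1, lt_restr_of_inc1_lt V.2⟩))
    (fun V V' h => by
      rw [← hy ⟨restr V.1, lt_restr_of_inc1_lt V.2⟩ ⟨restr V'.1, lt_restr_of_inc1_lt V'.2⟩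
        (restr_mono h), map_map]
      exact (map_map Y ((inc1 n).map (homOfLE (restr_mono h))).le (hle V') _ _).symm)
  refine ⟨x, fun V => (hx ⟨(inc1 n).obj V.1, inc1_lt V.2⟩).trans ?_⟩
  exact hy ⟨restr ((inc1 n).obj V.1), (restr_inc1 V.1).symm ▸ V.2⟩ V (restr_inc1 V.1).le

/-- Above U there are also the sets that contain the last element, where the given family has no
values. They are supplied by solving the matching problem at U ∪ {last} first. -/
theorem SFib.face0 {S : Set ℤ} {n : ℕ} {Y : Subsets (n + 1) ⥤ Cx.{u}} (hY : SFib S Y) :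
    SFib S (inc0 n ⋙ Y) := by
  intro U i hi y hy
  have hle : ∀ V : Subsets (n + 1), (inc0 n).obj (restr V) ≤ V := fun V => inc0_le_iff.2 le_rfl
  have hy' : ∀ (A B : Above U) (C : Subsets (n + 1)) (hA : (inc0 n).obj A.1 ≤ C)
      (hB : (inc0 n).obj B.1 ≤ C) (hAB : A.1 ≤ B.1),
      Hom.f (Y.map (homOfLE hA)) _ (y A) = Hom.f (Y.map (homOfLE hB)) _ (y B) := by
    intro A B C hA hB hAB
    rw [← hy A B hAB]
    exact (map_map Y ((inc0 n).map (homOfLE hAB)).le hB _ _).symm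
  -- The element `z` at U ∪ {last} extends the images of the given family; its own images serve as
  -- the values at the sets containing the last element.
  obtain ⟨z, hz⟩ := hY ((inc1 n).obj U) i hi
    (fun V => Hom.f (Y.map (homOfLE (hle V.1))) _ (y ⟨restr V.1, lt_restr_of_inc1_lt V.2⟩))
    (fun V V' h => by
      rw [map_map]
      exact hy' ⟨restr V.1, lt_restr_of_inc1_lt V.2⟩ ⟨restr V'.1, lt_restr_of_inc1_lt V'.2⟩ _ _ _
        (restr_mono h))
  have hle1 : ∀ V : Above ((inc0 n).obj U), Fin.last n ∈ V.1 → (inc1 n).obj U ≤ V.1 := fun V hV =>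
    inc1_le_iff.2 ⟨inc0_le_iff.1 V.2.le, hV⟩
  obtain ⟨x, hx⟩ := hY ((inc0 n).obj U) i hi
    (fun V => if hV : Fin.last n ∈ V.1 then Hom.f (Y.map (homOfLE (hle1 V hV))) _ z else
      Hom.f (Y.map (homOfLE (hle V.1))) _ (y ⟨restr V.1, lt_restr_of_inc0_lt V.2 hV⟩))
    (fun V V' h => by
      by_cases hV : Fin.last n ∈ V.1
      · rw [dif_pos hV, dif_pos (h hV), map_map]
      · rw [dif_neg hV, map_map]
        have hlt := lt_restr_of_inc0_lt V.2 hV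
        by_cases hV' : Fin.last n ∈ V'.1
        · rw [dif_pos hV']
          have hlt' : (inc1 n).obj U < V'.1 := lt_of_le_not_ge (hle1 V' hV') fun h' =>
            hlt.not_ge ((restr_mono h).trans (le_inc1_iff.1 h'))
          rw [hz ⟨V'.1, hlt'⟩]
          exact hy' ⟨restr V.1, hlt⟩ ⟨restr V'.1, lt_restr_of_inc1_lt hlt'⟩ _ _ _ (restr_mono h)
        · rw [dif_neg hV']
          exact hy' ⟨restr V.1, hlt⟩ ⟨restr V'.1, lt_restr_of_inc0_lt V'.2 hV'⟩ _ _ _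
            (restr_mono h))
  refine ⟨x, fun V => (hx ⟨(inc0 n).obj V.1, inc0_lt V.2⟩).trans ?_⟩
  rw [dif_neg (last_notMem_inc0 _)]
  exact hy ⟨restr ((inc0 n).obj V.1), (restr_inc0 V.1).symm ▸ V.2⟩ V (restr_inc0 V.1).le

theorem SFib.toMatch_surjective {S : Set ℤ} {n : ℕ} {Y : Subsets n ⥤ Cx.{u}} (hY : SFib S Y)
    {i : ℤ} (hi : i ∈ S) : Function.Surjective (Hom.f ((toMatch n).app Y) (i + 1 + 1)) := by
  intro y
  obtain ⟨x, hx⟩ := hY ∅ i hi y.1 y.2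
  exact ⟨x, matchCx.ext hx⟩

/-- For fibrant cubes the matching families compute the homotopy limit. -/
theorem SFib.hIso_lam {S : Set ℤ} (hS : UpClosed S) {n : ℕ} : ∀ {Y : Subsets n ⥤ Cx.{u}},
    SFib S Y → hIsoOn S ((holimData n).lam.app Y) := by
  induction n with
  | zero =>
    intro Y _ i _
    have h : Ex (matchCx Y) i := fun x _ => ⟨0, matchCx.ext fun T => by
      have := T.2.ne (Subsingleton.elim _ _)
      exact this.elim⟩
    exact ⟨h.inj _, (ex_zero i).surj _⟩
  | succ n ih =>
    intro Y hY i hi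
    -- Matching families are the kernel of the difference map, by `match_square` and `exists_match`.
    -- That map is surjective in the relevant degrees because the face containing the last element
    -- is fibrant, so its kernel computes its homotopy fiber. The remaining comparison of the two
    -- faces is the induction hypothesis.
    let κ : (matchF (n + 1)).obj Y ⟶
        Fib (diffMap ((matchF n).map (faceMap Y)) ((toMatch n).app (inc1 n ⋙ Y))) :=
      Fib.liftKer (prod.lift (matchRestr0 Y) (matchLast Y)) fun j y =>
        sub_eq_zero.2 (congr_f (match_square Y) j y)
    have hκ : HIso κ i := by
      have hs : ∀ j ∈ S, Function.Surjective (Hom.f (diffMap ((matchF n).map (faceMap Y))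
          ((toMatch n).app (inc1 n ⋙ Y))) (j + 1 + 1)) := fun j hj y => by
        obtain ⟨x, hx⟩ := hY.face1.toMatch_surjective hj (-y)
        exact ⟨(0, x), by rw [diffMap_mk, hx, map_zero, zero_sub, neg_neg]⟩
      refine hIso_kernel_fib (fun _ _ => rfl) (fun j x y e => ?_) (fun j a ha => ?_) (hs i hi)
        (hs _ (hS i hi))
      · have e0 := congrArg (fun z => z.1.1) e
        have e1 := congrArg (fun z => z.1.2) e
        refine matchCx.ext fun T => ?_
        by_cases hT : Fin.last n ∈ T.1
        · have hle : (inc1 n).obj ∅ ≤ T.1 := inc1_le_iff.2 ⟨Finset.empty_subset _, hT⟩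
          rw [← x.2 ⟨(inc1 n).obj ∅, empty_lt_inc1 ∅⟩ T hle,
            ← y.2 ⟨(inc1 n).obj ∅, empty_lt_inc1 ∅⟩ T hle]
          exact congrArg _ e1
        · have hT' : ∅ < restr T.1 := lt_restr_of_inc0_lt (lt_of_le_of_ne (inc0_le_iff.2
            (Finset.empty_subset _)) (by
              intro h
              exact T.2.not_ge (h ▸ inc0_le_iff.2 (Finset.empty_subset _)))) hT
          have hle := (inc0_restr hT).le
          rw [← x.2 ⟨(inc0 n).obj (restr T.1), empty_lt_inc0 hT'⟩ T hle,
            ← y.2 ⟨(inc0 n).obj (restr T.1), empty_lt_inc0 hT'⟩ T hle]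
          exact congrArg (fun z => Hom.f (Y.map (homOfLE hle)) j (z.1 ⟨restr T.1, hT'⟩)) e0
      · obtain ⟨y, hy0, hy1⟩ := exists_match Y j a.1 a.2 (sub_eq_zero.1 ha)
        exact ⟨y, Prod.ext (Prod.ext hy0 hy1) rfl⟩
    have w : diffMap ((matchF n).map (faceMap Y)) ((toMatch n).app (inc1 n ⋙ Y)) ≫
        (holimData n).lam.app (inc1 n ⋙ Y) =
        Cx.prod.map ((holimData n).lam.app (inc0 n ⋙ Y)) (𝟙 _) ≫ (holimData n).succDiff.app Y :=
      hom_ext fun j x => by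
        rw [comp_f]
        refine (map_sub _ _ _).trans ?_
        exact congrArg (· - _) (naturality_f (holimData n).lam (faceMap Y) j x.1)
    have e : (holimData (n + 1)).lam.app Y = κ ≫ Fib.map _ _ w :=
      hom_ext fun j x => Prod.ext rfl
        (map_zero (Hom.f ((holimData n).lam.app (inc1 n ⋙ Y)) (j + 1))).symm
    rw [e]
    refine hκ.comp ((fibStable_hIsoOn hS).fib _ _ w ((fibStable_hIsoOn hS).prod _ _
      (ih hY.face0) fun j _ => hIso_id _ j) (ih hY.face1) i hi)

end Goodwillie

end

/-! ### Mapping path spaces, and cubes of inclusions and of projections. -/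

noncomputable section

namespace Goodwillie

open Cx

/-! ### Mapping path spaces -/

section Path

variable {K : Type*} [Category* K]

/-- The product of `P` and the path space of `Q`. -/
def cocyl (P Q : K ⥤ Cx.{u}) : K ⥤ Cx.{u} := prodF P (fibF (𝟙 Q))

variable {P Q : K ⥤ Cx.{u}} (φ : P ⟶ Q)

/-- The inclusion of the source into the mapping path space. -/
def toCocyl (P Q : K ⥤ Cx.{u}) : P ⟶ cocyl P Q where
  app X :=
    { f := fun i => (AddMonoidHom.id _).prod 0
      comm := fun i x => by
        refine Prod.ext rfl (Prod.ext (map_zero ((Q.obj X).d i)).symm ?_)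
        refine (sub_eq_zero.2 ?_).symm
        exact (map_zero _).trans (map_zero ((Q.obj X).d (i + 1))).symm }
  naturality X Y f := hom_ext fun i x => Prod.ext rfl
    (Prod.ext (map_zero (Hom.f (Q.map f) i)).symm (map_zero (Hom.f (Q.map f) (i + 1))).symm)

/-- The projection of the mapping path space to the target. -/
def fromCocyl : cocyl P Q ⟶ Q := diffF φ (fibFst (𝟙 Q))

theorem toCocyl_fromCocyl : toCocyl P Q ≫ fromCocyl φ = φ :=
  NatTrans.ext (funext fun X => hom_ext fun i x => sub_zero _)

/-- The inclusion of the homotopy fiber into the mapping path space. -/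
def fibToCocyl : fibF φ ⟶ cocyl P Q where
  app X :=
    { f := fun i => (AddMonoidHom.fst _ _).prod
        (((Hom.f (φ.app X) i).comp (AddMonoidHom.fst _ _)).prod (AddMonoidHom.snd _ _))
      comm := fun i x => Prod.ext rfl (Prod.ext (hom_d (φ.app X) i x.1) rfl) }
  naturality X Y f := hom_ext fun i x => Prod.ext rfl
    (Prod.ext (naturality_f φ f i x.1) rfl)

theorem ex_path (A : Cx.{u}) (i : ℤ) : Ex (Fib (𝟙 A)) i :=
  ex_fib_iff.2 ⟨(hIso_id A i).1, (hIso_id A (i + 1)).2⟩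

theorem hIso_toCocyl (P Q : K ⥤ Cx.{u}) (X : K) (i : ℤ) : HIso ((toCocyl P Q).app X) i := by
  constructor
  · rintro x - ⟨y, hy⟩
    exact ⟨y.1, congrArg Prod.fst hy⟩
  · rintro ⟨x, p⟩ hx
    obtain ⟨q, hq⟩ := ex_path (Q.obj X) i p (congrArg Prod.snd hx)
    exact ⟨x, congrArg Prod.fst hx, (0, q), Prod.ext
      ((congrArg (x + ·) (map_zero ((P.obj X).d (i + 1)))).trans (add_zero x)).symm
      (hq.symm.trans (zero_add _).symm)⟩

/-- This makes the mapping fiber an honest kernel, of a surjection whose source is equivalent to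
`P`, so that exact functors of cubes can be applied. -/
theorem ses_cocyl (X : K) : SES ((fibToCocyl φ).app X) ((fromCocyl φ).app X) where
  inj i x y e := Prod.ext (congrArg (fun z : ((cocyl P Q).obj X).X i => z.1) e)
    (congrArg (fun z : ((cocyl P Q).obj X).X i => z.2.2) e)
  surj i y := ⟨(0, (-y, 0)), by
    refine (congrArg₂ (· - ·) (map_zero (Hom.f (φ.app X) i)) rfl).trans ?_
    exact (zero_sub (-y)).trans (neg_neg y)⟩
  zero i x := sub_self _
  ex i x hx := ⟨(x.1, x.2.2), Prod.ext rfl (Prod.ext (sub_eq_zero.1 hx) rfl)⟩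

end Path

theorem hIso_tf {n : ℕ} {P Q : Subsets n ⥤ Cx.{u}} (φ : P ⟶ Q)
    (h : ∀ T i, HIso (φ.app T) i) (i : ℤ) : HIso ((tf n).map φ) i :=
  (fibStable_hIsoOn (S := Set.univ) (fun _ _ => trivial)).tf φ (fun T i _ => h T i) i trivial

/-- `tf` preserves short exact sequences and equivalences, so the total fiber of a fiber is the
fiber of the map of total fibers; the path space sequence makes this precise. -/
theorem ex_tf_fibF_iff {n : ℕ} {P Q : Subsets n ⥤ Cx.{u}} (φ : P ⟶ Q) {i : ℤ} :
    Ex ((tf n).obj (fibF φ)) i ↔ Inj ((tf n).map φ) i ∧ Surj ((tf n).map φ) (i + 1) := by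
  rw [(ses_tf (ses_cocyl φ)).ex_iff]
  have h := hIso_tf (toCocyl P Q) (hIso_toCocyl P Q)
  have e : (tf n).map (toCocyl P Q) ≫ (tf n).map (fromCocyl φ) = (tf n).map φ := by
    rw [← Functor.map_comp, toCocyl_fromCocyl]
  rw [← e]
  exact ⟨fun ⟨h1, h2⟩ => ⟨(h i).1.comp h1, (h _).2.comp h2⟩,
    fun ⟨h1, h2⟩ => ⟨h1.of_comp_of_surj (h i).2, h2.of_comp⟩⟩

/-! ### Inclusion and projection cubes -/

/-- The category of subsets and partial identities. -/
structure PSet (n : ℕ) where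
  set : Subsets n

namespace PSet

variable {n : ℕ}

/-- A partial identity, determined by the set where it is defined. -/
@[ext]
structure Hom (S T : PSet n) where
  dom : Subsets n
  le_src : dom ≤ S.set
  le_tgt : dom ≤ T.set

/-- Coproducts of subfamilies of pointed objects form a functor on this category: a partial identity
keeps the summands in its domain and sends the others to zero. Inclusion and projection cubes are
then restrictions of a single functor. -/
instance : Category (PSet n) where
  Hom := Hom
  id S := ⟨S.set, le_rfl, le_rfl⟩
  comp f g := ⟨f.dom ∩ g.dom, Finset.inter_subset_left.trans f.le_src,
    Finset.inter_subset_right.trans g.le_tgt⟩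
  id_comp f := Hom.ext (Finset.inter_eq_right.2 f.le_src)
  comp_id f := Hom.ext (Finset.inter_eq_left.2 f.le_tgt)
  assoc f g h := Hom.ext (Finset.inter_assoc _ _ _)

/-- The cube of inclusions. -/
def incl (n : ℕ) : Subsets n ⥤ PSet n where
  obj T := ⟨T⟩
  map {T T'} f := ⟨T, le_rfl, leOfHom f⟩
  map_comp f g := Hom.ext (Finset.inter_eq_left.2 (leOfHom f)).symm

/-- The cube of projections. -/
def proj (n : ℕ) : Subsets n ⥤ PSet n where
  obj T := ⟨Tᶜ⟩
  map {T T'} f := ⟨T'ᶜ, Finset.compl_subset_compl.2 (leOfHom f), le_rfl⟩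
  map_comp f g := Hom.ext (Finset.inter_eq_right.2 (Finset.compl_subset_compl.2 (leOfHom g))).symm

theorem inc0_inter (S T : Subsets n) :
    (inc0 n).obj (S ∩ T) = (inc0 n).obj S ∩ (inc0 n).obj T := Finset.map_inter _ _

theorem inc1_inter (S T : Subsets n) :
    (inc1 n).obj (S ∩ T) = (inc1 n).obj S ∩ (inc1 n).obj T := by
  refine Eq.trans ?_ (Finset.insert_inter_distrib _ _ _)
  exact congrArg (insert _) (Finset.map_inter _ _)

theorem inc0_inter_inc1 (S T : Subsets n) :
    (inc0 n).obj S ∩ (inc1 n).obj T = (inc0 n).obj (S ∩ T) := by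
  rw [inc0_inter]
  exact Finset.inter_insert_of_notMem (last_notMem_inc0 S)

/-- Subsets without the last element. -/
def rho0 (n : ℕ) : PSet n ⥤ PSet (n + 1) where
  obj S := ⟨(inc0 n).obj S.set⟩
  map f := ⟨(inc0 n).obj f.dom, ((inc0 n).map (homOfLE f.le_src)).le,
    ((inc0 n).map (homOfLE f.le_tgt)).le⟩
  map_comp f g := Hom.ext (inc0_inter f.dom g.dom)

/-- Subsets with the last element. -/
def rho1 (n : ℕ) : PSet n ⥤ PSet (n + 1) where
  obj S := ⟨(inc1 n).obj S.set⟩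
  map f := ⟨(inc1 n).obj f.dom, ((inc1 n).map (homOfLE f.le_src)).le,
    ((inc1 n).map (homOfLE f.le_tgt)).le⟩
  map_comp f g := Hom.ext (inc1_inter f.dom g.dom)

/-- The inclusion of the subsets without the last element. -/
def rhoIn (n : ℕ) : rho0 n ⟶ rho1 n where
  app S := ⟨(inc0 n).obj S.set, le_rfl, ((inc01 n).app S.set).le⟩
  naturality S T f := Hom.ext <| by
    refine Eq.trans (Finset.inter_eq_left.2 ((inc0 n).map (homOfLE f.le_tgt)).le) ?_
    refine Eq.trans ?_ (inc0_inter_inc1 _ _).symm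
    exact congrArg (inc0 n).obj (Finset.inter_eq_right.2 f.le_src).symm

/-- The projection to the subsets without the last element. -/
def rhoOut (n : ℕ) : rho1 n ⟶ rho0 n where
  app S := ⟨(inc0 n).obj S.set, ((inc01 n).app S.set).le, le_rfl⟩
  naturality S T f := Hom.ext <| by
    refine Eq.trans (Finset.inter_comm _ _) (Eq.trans (inc0_inter_inc1 _ _) ?_)
    refine Eq.trans ?_ (Finset.inter_eq_right.2 ((inc0 n).map (homOfLE f.le_src)).le).symm
    exact congrArg _ (Finset.inter_eq_right.2 f.le_tgt)

/-- The projections split the inclusions. This relation is all that links the two kinds of cubes. -/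
theorem rhoIn_rhoOut (n : ℕ) : rhoIn n ≫ rhoOut n = 𝟙 _ :=
  NatTrans.ext (funext fun S => Hom.ext (Finset.inter_self _))

theorem compl_inc0 (S : Subsets n) : ((inc0 n).obj S)ᶜ = (inc1 n).obj Sᶜ := by
  ext i
  rw [Finset.mem_compl]
  induction i using Fin.lastCases with
  | last => exact iff_of_true (last_notMem_inc0 _) (last_mem_inc1 _)
  | cast i => rw [castSucc_mem_inc0, castSucc_mem_inc1, Finset.mem_compl]

theorem compl_inc1 (S : Subsets n) : ((inc1 n).obj S)ᶜ = (inc0 n).obj Sᶜ := by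
  ext i
  rw [Finset.mem_compl]
  induction i using Fin.lastCases with
  | last => exact iff_of_false (fun h => h (last_mem_inc1 _)) (last_notMem_inc0 _)
  | cast i => rw [castSucc_mem_inc0, castSucc_mem_inc1, Finset.mem_compl]

/-- Isomorphisms in the category of partial identities. -/
def isoOfEq {S T : PSet n} (h : S.set = T.set) : S ≅ T where
  hom := ⟨S.set, le_rfl, h.le⟩
  inv := ⟨T.set, le_rfl, h.ge⟩
  hom_inv_id := Hom.ext (Finset.inter_eq_left.2 h.le)
  inv_hom_id := Hom.ext (Finset.inter_eq_left.2 h.ge)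

/-- A face of the projection cube. -/
def projFace0 (n : ℕ) : inc0 n ⋙ proj (n + 1) ≅ proj n ⋙ rho1 n :=
  NatIso.ofComponents (fun T => isoOfEq (compl_inc0 T)) fun {T T'} f => Hom.ext <| by
    refine Eq.trans (Finset.inter_self _) ?_
    refine Eq.trans ?_ (Finset.inter_eq_right.2 ?_).symm
    · exact compl_inc0 T'
    · refine le_trans ?_ (compl_inc0 T).ge
      exact ((inc1 n).map (homOfLE (Finset.compl_subset_compl.2 (leOfHom f)))).le

/-- A face of the projection cube. -/
def projFace1 (n : ℕ) : inc1 n ⋙ proj (n + 1) ≅ proj n ⋙ rho0 n :=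
  NatIso.ofComponents (fun T => isoOfEq (compl_inc1 T)) fun {T T'} f => Hom.ext <| by
    refine Eq.trans (Finset.inter_self _) ?_
    refine Eq.trans ?_ (Finset.inter_eq_right.2 ?_).symm
    · exact compl_inc1 T'
    · refine le_trans ?_ (compl_inc1 T).ge
      exact ((inc0 n).map (homOfLE (Finset.compl_subset_compl.2 (leOfHom f)))).le

theorem projFace_comm (n : ℕ) : Functor.whiskerRight (inc01 n) (proj (n + 1)) ≫ (projFace1 n).hom =
    (projFace0 n).hom ≫ Functor.whiskerLeft (proj n) (rhoOut n) :=
  NatTrans.ext (funext fun T => Hom.ext <| by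
    refine Eq.trans (Finset.inter_self _) ?_
    refine Eq.trans ?_ (Finset.inter_eq_right.2 ?_).symm
    · exact compl_inc1 T
    · exact le_trans ((inc01 n).app Tᶜ).le (compl_inc0 T).ge)

variable (Φ : PSet (n + 1) ⥤ Cx.{u})

/-- The fiber of the projection away from the last element. -/
def fibLast : PSet n ⥤ Cx.{u} := fibF (Functor.whiskerRight (rhoOut n) Φ)

/-- Up to isomorphism, the two faces in the last direction are the smaller projection cube after
`rho1` and after `rho0`, joined by the projection. The fiber in that direction may be taken first.
-/
theorem ex_tf_proj_iff {i : ℤ} :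
    Ex ((tf (n + 1)).obj (proj (n + 1) ⋙ Φ)) i ↔ Ex ((tf n).obj (proj n ⋙ fibLast Φ)) i := by
  have e : (tf n).map (faceMap (proj (n + 1) ⋙ Φ)) ≫
      (tf n).map (Functor.whiskerRight (projFace1 n).hom Φ) =
      (tf n).map (Functor.whiskerRight (projFace0 n).hom Φ) ≫
      (tf n).map (Functor.whiskerLeft (proj n) (Functor.whiskerRight (rhoOut n) Φ)) := by
    rw [← Functor.map_comp, ← Functor.map_comp]
    refine congrArg _ (NatTrans.ext (funext fun T => ?_))
    refine (Φ.map_comp _ _).symm.trans (Eq.trans ?_ (Φ.map_comp _ _))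
    exact congrArg Φ.map (NatTrans.congr_app (projFace_comm n) T)
  have h1 := hIso_of_isIso ((tf n).map (Functor.whiskerRight (projFace1 n).hom Φ))
  have h0 := hIso_of_isIso ((tf n).map (Functor.whiskerRight (projFace0 n).hom Φ))
  rw [ex_tf_succ_iff]
  refine Iff.trans ?_ (ex_tf_fibF_iff
    (Functor.whiskerLeft (proj n) (Functor.whiskerRight (rhoOut n) Φ))).symm
  constructor
  · rintro ⟨a, b⟩
    exact ⟨Inj.of_comp_of_surj (e ▸ a.comp (h1 i).1) (h0 i).2,
      Surj.of_comp (e ▸ b.comp (h1 _).2)⟩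
  · rintro ⟨a, b⟩
    exact ⟨Inj.of_comp (g := (tf n).map (Functor.whiskerRight (projFace1 n).hom Φ))
      (e ▸ (h0 i).1.comp a), Surj.of_comp_of_inj
      (g := (tf n).map (Functor.whiskerRight (projFace1 n).hom Φ))
      (e ▸ (h0 _).2.comp b) (h1 _).1⟩

theorem ex_tf_zero_iff {Y : Subsets 0 ⥤ Cx.{u}} {i : ℤ} :
    Ex ((tf 0).obj Y) i ↔ Ex (Y.obj ∅) i := by
  rw [ex_tf_iff]
  exact ⟨fun h x hx => h.1 x hx ⟨0, rfl⟩, fun h => ⟨h.inj _, (ex_zero _).surj _⟩⟩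

/-- For a general cube acyclicity in degree i+1 would require surjectivity in degree i+2. Here that
is automatic since the projections are split, so vanishing of the homology of the values in a single
degree is enough. -/
theorem ex_tf_proj : ∀ {n : ℕ} (Φ : PSet n ⥤ Cx.{u}) {i : ℤ}, (∀ S, Ex (Φ.obj S) i) →
    Ex ((tf n).obj (proj n ⋙ Φ)) i := by
  intro n
  induction n with
  | zero => exact fun Φ i h => ex_tf_zero_iff.2 (h _)
  | succ n ih =>
    intro Φ i h
    refine (ex_tf_proj_iff Φ).2 (ih _ fun S => ex_fib_iff.2 ⟨(h _).inj _, ?_⟩)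
    refine Surj.of_comp (f := Φ.map ((rhoIn n).app S)) ?_
    have e : Φ.map ((rhoIn n).app S) ≫ Φ.map ((rhoOut n).app S) = 𝟙 _ := by
      rw [← Φ.map_comp]
      exact (congrArg Φ.map (NatTrans.congr_app (rhoIn_rhoOut n) S)).trans (Φ.map_id _)
    exact e ▸ (hIso_id _ _).2

/-- If the total fiber of the projection cube is acyclic, so is that of the inclusion cube. -/
theorem ex_tf_incl : ∀ {n : ℕ} (Φ : PSet n ⥤ Cx.{u}),
    (∀ i, Ex ((tf n).obj (proj n ⋙ Φ)) i) → ∀ i, Ex ((tf n).obj (incl n ⋙ Φ)) i := by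
  intro n
  induction n with
  | zero =>
    intro Φ h i
    refine ex_tf_zero_iff.2 ((ex_tf_zero_iff.1 (h i)).of_hIso (f := Φ.map (isoOfEq ?_).hom)
      (hIso_of_isIso _ _).1)
    exact Subsingleton.elim _ _
  | succ n ih =>
    intro Φ h i
    -- By induction the fiber of the projection has acyclic total fiber on inclusion cubes, so the
    -- projection is bijective on the homology of total fibers. The inclusion is a section of it by
    -- `e`, hence bijective too.
    have h' := fun i => (ex_tf_fibF_iff (Functor.whiskerLeft (incl n)
      (Functor.whiskerRight (rhoOut n) Φ))).1
      (ih (fibLast Φ) (fun i => (ex_tf_proj_iff Φ).1 (h i)) i)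
    have e : (tf n).map (faceMap (incl (n + 1) ⋙ Φ)) ≫
        (tf n).map (Functor.whiskerLeft (incl n) (Functor.whiskerRight (rhoOut n) Φ)) = 𝟙 _ := by
      refine ((tf n).map_comp (X := incl n ⋙ rho0 n ⋙ Φ) (Y := incl n ⋙ rho1 n ⋙ Φ) _ _).symm.trans ?_
      refine (congrArg (tf n).map (NatTrans.ext (funext fun T => ?_))).trans ((tf n).map_id _)
      refine (Φ.map_comp _ _).symm.trans ?_
      exact (congrArg Φ.map (NatTrans.congr_app (rhoIn_rhoOut n) ⟨T⟩)).trans (Φ.map_id _)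
    refine ex_tf_succ_iff.2 ⟨Inj.of_comp (e ▸ (hIso_id _ _).1), ?_⟩
    have h1 := (h' (i + 1)).1
    exact Surj.of_comp_of_inj (e ▸ (hIso_id _ _).2) h1

end PSet

end Goodwillie

end

/-! ### Cofibration categories and the gluing lemma. -/

noncomputable section

namespace Goodwillie

/-! ### Cofibration categories -/

/-- The properties of cofibrations and weak equivalences on which homotopy pushouts depend. -/
structure IsCofCat (C : Type*) [Category* C] [CategoryWithWeakEquivalences C]
    [CategoryWithCofibrations C] : Prop where
  hasPushouts : HasPushouts C
  weq_of_iso : ∀ {X Y : C} (f : X ⟶ Y), IsIso f → WeakEquivalence f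
  weq_comp : ∀ {X Y Z : C} (f : X ⟶ Y) (g : Y ⟶ Z), WeakEquivalence f → WeakEquivalence g →
    WeakEquivalence (f ≫ g)
  weq_right : ∀ {X Y Z : C} (f : X ⟶ Y) (g : Y ⟶ Z), WeakEquivalence f →
    WeakEquivalence (f ≫ g) → WeakEquivalence g
  weq_left : ∀ {X Y Z : C} (f : X ⟶ Y) (g : Y ⟶ Z), WeakEquivalence g →
    WeakEquivalence (f ≫ g) → WeakEquivalence f
  cof_of_iso : ∀ {X Y : C} (f : X ⟶ Y), IsIso f → Cofibration f
  cof_comp : ∀ {X Y Z : C} (f : X ⟶ Y) (g : Y ⟶ Z), Cofibration f → Cofibration g →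
    Cofibration (f ≫ g)
  cof_pushout : ∀ {A B X Y : C} {f : A ⟶ B} {g : A ⟶ X} {h : B ⟶ Y} {i : X ⟶ Y},
    IsPushout f g h i → Cofibration f → Cofibration i
  weq_pushout : ∀ {A B X Y : C} {f : A ⟶ B} {g : A ⟶ X} {h : B ⟶ Y} {i : X ⟶ Y},
    IsPushout f g h i → Cofibration f → WeakEquivalence f → WeakEquivalence i
  factor : ∀ {X Y : C} (f : X ⟶ Y), ∃ (Z : C) (i : X ⟶ Z) (p : Z ⟶ Y),
    Cofibration i ∧ WeakEquivalence p ∧ i ≫ p = f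

namespace IsCofCat

variable {C : Type*} [Category* C] [CategoryWithWeakEquivalences C] [CategoryWithCofibrations C]
  (hC : IsCofCat C)

include hC

theorem exists_isPushout {A X Y : C} (f : A ⟶ X) (g : A ⟶ Y) :
    ∃ (P : C) (h : X ⟶ P) (k : Y ⟶ P), IsPushout f g h k :=
  have := hC.hasPushouts
  ⟨_, _, _, IsPushout.of_hasPushout f g⟩

theorem weq_id (X : C) : WeakEquivalence (𝟙 X) := hC.weq_of_iso _ inferInstance

/-- Pushouts along a fixed map preserve weak equivalences between cofibrations. -/
theorem weq_of_isPushout_under {A X Y Z P Q : C} {a : A ⟶ X} {b : A ⟶ Y} {g : A ⟶ Z}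
    {h : X ⟶ P} {k : Z ⟶ P} {h' : Y ⟶ Q} {k' : Z ⟶ Q} (s : IsPushout a g h k)
    (s' : IsPushout b g h' k') (ha : Cofibration a) (hb : Cofibration b) {f : X ⟶ Y}
    (hf : WeakEquivalence f) {φ : P ⟶ Q} (w : a ≫ f = b) (w₁ : h ≫ φ = f ≫ h')
    (w₂ : k ≫ φ = k') : WeakEquivalence φ := by
  -- A mapping cylinder of `f` relative to `A`: the map from the pushout of X and Y under A to Y is
  -- factored, and both ends become trivial cofibrations into `W`.
  obtain ⟨R, l, r, sp⟩ := hC.exists_isPushout a b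
  obtain ⟨e, hl, hr⟩ := sp.exists_desc f (𝟙 Y) (by rw [w, Category.comp_id])
  obtain ⟨W, i, p, hi, hp, rfl⟩ := hC.factor e
  have cX : Cofibration (l ≫ i) := hC.cof_comp _ _ (hC.cof_pushout sp.flip hb) hi
  have cY : Cofibration (r ≫ i) := hC.cof_comp _ _ (hC.cof_pushout sp ha) hi
  rw [← Category.assoc] at hl hr
  have wX : WeakEquivalence (l ≫ i) := hC.weq_left _ p hp (by rw [hl]; exact hf)
  have wY : WeakEquivalence (r ≫ i) := hC.weq_left _ p hp (by rw [hr]; exact hC.weq_id _)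
  have hc : b ≫ r ≫ i = a ≫ l ≫ i := by rw [reassoc_of% sp.w]
  generalize l ≫ i = l at *
  generalize r ≫ i = r at *
  -- The cylinder is pushed out along `g`. The maps `u` and `v` are pushouts of the two trivial
  -- cofibrations, `v` is a section of `q`, and `φ` is `u ≫ q`.
  obtain ⟨T, x, y, t⟩ := hC.exists_isPushout (a ≫ l) g
  obtain ⟨u, hu₁, hu₂⟩ := s.exists_desc (l ≫ x) y (by rw [← t.w, Category.assoc])
  obtain ⟨v, hv₁, hv₂⟩ := s'.exists_desc (r ≫ x) y (by rw [← t.w, ← hc, Category.assoc])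
  have tu : IsPushout l h x u := IsPushout.of_left (by rw [hu₂]; exact t) hu₁.symm s
  have tv : IsPushout r h' x v := IsPushout.of_left (by rw [hv₂, hc]; exact t) hv₁.symm s'
  have hu := hC.weq_pushout tu cX wX
  have hv := hC.weq_pushout tv cY wY
  obtain ⟨q, hq₁, hq₂⟩ := t.exists_desc (p ≫ h') k' (by
    rw [Category.assoc, reassoc_of% hl, reassoc_of% w, s'.w])
  have hq : WeakEquivalence q := by
    refine hC.weq_right v q hv ?_
    have : v ≫ q = 𝟙 Q := s'.hom_ext
      (by rw [reassoc_of% hv₁, hq₁, reassoc_of% hr, Category.comp_id])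
      (by rw [reassoc_of% hv₂, hq₂, Category.comp_id])
    rw [this]
    exact hC.weq_id _
  have : u ≫ q = φ := s.hom_ext (by rw [reassoc_of% hu₁, hq₁, reassoc_of% hl, w₁])
    (by rw [reassoc_of% hu₂, hq₂, w₂])
  rw [← this]
  exact hC.weq_comp _ _ hu hq

section

variable [HasZeroObject C] [HasZeroMorphisms C]

open scoped ZeroObject

theorem isCofibrant_iff (X : C) : IsCofibrant X ↔ Cofibration (0 : (0 : C) ⟶ X) := by
  have e : initial.to X = initial.to (0 : C) ≫ (0 : (0 : C) ⟶ X) := Subsingleton.elim _ _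
  have e' : (0 : (0 : C) ⟶ X) = (0 : (0 : C) ⟶ ⊥_ C) ≫ initial.to X := (isZero_zero C).eq_of_src _ _
  have i1 : IsIso (initial.to (0 : C)) := ⟨0, Subsingleton.elim _ _, (isZero_zero C).eq_of_src _ _⟩
  have i2 : IsIso (0 : (0 : C) ⟶ ⊥_ C) :=
    ⟨initial.to (0 : C), (isZero_zero C).eq_of_src _ _, Subsingleton.elim _ _⟩
  constructor
  · intro h
    rw [e']
    exact hC.cof_comp _ _ (hC.cof_of_iso _ i2) h
  · intro h
    change Cofibration _
    rw [e]
    exact hC.cof_comp _ _ (hC.cof_of_iso _ i1) h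

theorem isCofibrant_of_cof {X Y : C} {f : X ⟶ Y} (hX : IsCofibrant X) (hf : Cofibration f) :
    IsCofibrant Y := by
  rw [hC.isCofibrant_iff] at hX ⊢
  rw [← zero_comp (f := f)]
  exact hC.cof_comp _ _ hX hf

/-- The pushout of a weak equivalence between cofibrant objects along a cofibration is a weak
equivalence. -/
theorem weq_pushout_along {A B X Y : C} {i : A ⟶ B} {f : A ⟶ X} {j : B ⟶ Y} {k : X ⟶ Y}
    (s : IsPushout i f j k) (hA : IsCofibrant A) (hX : IsCofibrant X) (hi : Cofibration i)
    (hf : WeakEquivalence f) : WeakEquivalence j := by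
  -- Ken Brown's factorization: `f` is a trivial cofibration `l` into a cylinder followed by a map
  -- `p` that has a trivial cofibration `r` as a section. Pushing out along `l` is harmless, so the
  -- matter is the pushout along `p`.
  obtain ⟨R, l, r, sp⟩ := hC.exists_isPushout (0 : (0 : C) ⟶ A) (0 : (0 : C) ⟶ X)
  obtain ⟨e, hl, hr⟩ := sp.exists_desc f (𝟙 X) ((isZero_zero C).eq_of_src _ _)
  obtain ⟨Z, q, p, hq, hp, rfl⟩ := hC.factor e
  rw [← Category.assoc] at hl hr
  have cl : Cofibration (l ≫ q) := hC.cof_comp _ _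
    (hC.cof_pushout sp.flip ((hC.isCofibrant_iff X).1 hX)) hq
  have cr : Cofibration (r ≫ q) :=
    hC.cof_comp _ _ (hC.cof_pushout sp ((hC.isCofibrant_iff A).1 hA)) hq
  have wl : WeakEquivalence (l ≫ q) := hC.weq_left _ p hp (by rw [hl]; exact hf)
  have wr : WeakEquivalence (r ≫ q) := hC.weq_left _ p hp (by rw [hr]; exact hC.weq_id _)
  generalize l ≫ q = l at *
  generalize r ≫ q = r at *
  obtain ⟨B', m, n, sB⟩ := hC.exists_isPushout i l
  have hm : WeakEquivalence m := hC.weq_pushout sB.flip cl wl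
  have cn : Cofibration n := hC.cof_pushout sB hi
  obtain ⟨t, ht₁, ht₂⟩ := sB.exists_desc j (p ≫ k) (by rw [← Category.assoc, hl, s.w])
  have sY : IsPushout n p t k := by
    refine IsPushout.of_left (h₁₁ := l) (v₁₁ := i) (h₂₁ := m) ?_ ht₂.symm sB.flip |>.flip
    rw [hl, ht₁]
    exact s.flip
  -- Since `r` is a section of `p`, the pushout of `e₂` along `p` is `B'` itself. So `t` is what the
  -- weak equivalence `g : E ⟶ B'` under the cylinder becomes after pushout along `p`, and the
  -- relative lemma applies to it.
  obtain ⟨E, e₁, e₂, sE⟩ := hC.exists_isPushout (r ≫ n) r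
  have ce₂ : Cofibration e₂ := hC.cof_pushout sE (hC.cof_comp _ _ cr cn)
  have we₁ : WeakEquivalence e₁ := hC.weq_pushout sE.flip cr wr
  obtain ⟨g, hg₁, hg₂⟩ := sE.exists_desc (𝟙 B') n (by simp)
  have hg : WeakEquivalence g := by
    refine hC.weq_right e₁ g we₁ ?_
    rw [hg₁]
    exact hC.weq_id _
  obtain ⟨d, hd₁, hd₂⟩ := sE.exists_desc (𝟙 B') (p ≫ r ≫ n) (by rw [reassoc_of% hr]; simp)
  have sD : IsPushout e₂ p d (r ≫ n) := by
    refine IsPushout.of_left (h₁₁ := r) (v₁₁ := r ≫ n) (h₂₁ := e₁) ?_ hd₂.symm sE.flip |>.flip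
    rw [hr, hd₁]
    exact IsPushout.of_horiz_isIso ⟨by simp⟩
  have wt : WeakEquivalence t := by
    refine hC.weq_of_isPushout_under sD sY ce₂ cn hg hg₂ (sE.hom_ext ?_ ?_) ?_
    · rw [reassoc_of% hd₁, reassoc_of% hg₁]
    · rw [reassoc_of% hd₂, reassoc_of% hg₂, ht₂, reassoc_of% hr]
    · rw [Category.assoc, ht₂, reassoc_of% hr]
  rw [← ht₁]
  exact hC.weq_comp _ _ hm wt

/-- The gluing lemma. -/
theorem gluing {A B X P A' B' X' P' : C} {i : A ⟶ B} {f : A ⟶ X} {j : B ⟶ P} {k : X ⟶ P}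
    {i' : A' ⟶ B'} {f' : A' ⟶ X'} {j' : B' ⟶ P'} {k' : X' ⟶ P'} (s : IsPushout i f j k)
    (s' : IsPushout i' f' j' k') (hA : IsCofibrant A) (hA' : IsCofibrant A') (hX : IsCofibrant X)
    (hX' : IsCofibrant X') (hi : Cofibration i) (hi' : Cofibration i') {α : A ⟶ A'} {β : B ⟶ B'}
    {ξ : X ⟶ X'} {φ : P ⟶ P'} (w₁ : i ≫ β = α ≫ i') (w₂ : f ≫ ξ = α ≫ f') (w₃ : j ≫ φ = β ≫ j')
    (w₄ : k ≫ φ = ξ ≫ k') (hα : WeakEquivalence α) (hβ : WeakEquivalence β)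
    (hξ : WeakEquivalence ξ) : WeakEquivalence φ := by
  -- Base change along `α` and `ξ` factors `φ` as P → E → P'. The first map is a pushout of `ξ`
  -- along a cofibration; the second compares two pushouts along the same map `f'`.
  obtain ⟨D, l, r, sB⟩ := hC.exists_isPushout i α
  obtain ⟨E, m, n, sP⟩ := hC.exists_isPushout k ξ
  obtain ⟨b, hb₁, hb₂⟩ := sB.exists_desc β i' w₁
  have hb : WeakEquivalence b := hC.weq_right l b
    (hC.weq_pushout_along sB hA hA' hi hα) (by rwa [hb₁])
  obtain ⟨q, hq₁, hq₂⟩ := sP.exists_desc φ k' w₄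
  have hl : WeakEquivalence m := hC.weq_pushout_along sP hX hX' (hC.cof_pushout s hi) hξ
  have sQ : IsPushout i (α ≫ f') (j ≫ m) n := by
    rw [← w₂]
    exact (s.flip.paste_horiz sP.flip).flip
  obtain ⟨c, hc₁, hc₂⟩ := sB.exists_desc (j ≫ m) (f' ≫ n) (by rw [sQ.w, Category.assoc])
  have sC : IsPushout r f' c n := by
    refine IsPushout.of_left (h₁₁ := α) (v₁₁ := i) (h₂₁ := l) ?_ hc₂.symm sB.flip |>.flip
    rw [hc₁]
    exact sQ.flip
  have hq : WeakEquivalence q := by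
    refine hC.weq_of_isPushout_under sC s' (hC.cof_pushout sB hi) hi' hb hb₂ (sB.hom_ext ?_ ?_) hq₂
    · rw [reassoc_of% hc₁, hq₁, w₃, reassoc_of% hb₁]
    · rw [reassoc_of% hc₂, hq₂, reassoc_of% hb₂, s'.w]
  rw [← hq₁]
  exact hC.weq_comp _ _ hl hq

end

end IsCofCat

end Goodwillie

end

/-! ### Invariance of homotopy pushouts, and cubes of iterated pushouts. -/

noncomputable section

namespace Goodwillie

open scoped ZeroObject

variable {C : Type*} [Category* C] [HasZeroMorphisms C] [HasZeroObject C]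
  [CategoryWithWeakEquivalences C] [CategoryWithCofibrations C]

namespace IsCofCat

variable (hC : IsCofCat C)

include hC

/-! ### Homotopy pushouts -/

theorem exists_cofibrant (X : C) : ∃ (A : C) (p : A ⟶ X), IsCofibrant A ∧ WeakEquivalence p := by
  obtain ⟨A, i, p, hi, hp, -⟩ := hC.factor (0 : (0 : C) ⟶ X)
  refine ⟨A, p, (hC.isCofibrant_iff A).2 ?_, hp⟩
  rwa [(isZero_zero C).eq_of_src 0 i]

theorem isHomotopyPushout_of_isPushout {a b c d : C} {f : a ⟶ b} {g : a ⟶ c} {h : b ⟶ d}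
    {i : c ⟶ d} (s : IsPushout f g h i) (ha : IsCofibrant a) (hf : Cofibration f)
    (hg : Cofibration g) : IsHomotopyPushout f g h i :=
  ⟨s.toCommSq, a, b, c, d, f, g, h, i, 𝟙 _, 𝟙 _, 𝟙 _, 𝟙 _, ha, hf, hg, s, by simp, by simp,
    by simp, by simp, hC.weq_id _, hC.weq_id _, hC.weq_id _, hC.weq_id _⟩

omit hC in
theorem _root_.Goodwillie.IsHomotopyPushout.flip {a b c d : C} {f : a ⟶ b} {g : a ⟶ c} {h : b ⟶ d}
    {i : c ⟶ d} (s : IsHomotopyPushout f g h i) : IsHomotopyPushout g f i h := by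
  obtain ⟨s, a', b', c', d', f', g', h', i', α, β, γ, δ, ha, hf, hg, p, e₁, e₂, e₃, e₄, hα, hβ, hγ,
    hδ⟩ := s
  exact ⟨s.flip, a', c', b', d', g', f', i', h', α, γ, β, δ, ha, hg, hf, p.flip, e₂, e₁, e₄, e₃,
    hα, hγ, hβ, hδ⟩

theorem isHomotopyPushout_of_isIso {a b c d : C} {f : a ⟶ b} {g : a ⟶ c} {h : b ⟶ d}
    {i : c ⟶ d} (w : f ≫ h = g ≫ i) (hf : IsIso f) (hi : IsIso i) : IsHomotopyPushout f g h i := by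
  obtain ⟨a', α, ha, hα⟩ := hC.exists_cofibrant a
  obtain ⟨c', g', γ, hg, hγ, e⟩ := hC.factor (α ≫ g)
  refine ⟨⟨w⟩, a', a', c', c', 𝟙 _, g', g', 𝟙 _, α, α ≫ f, γ, γ ≫ i, ha,
    hC.cof_of_iso _ inferInstance, hg, IsPushout.of_horiz_isIso ⟨by simp⟩, by simp, e, ?_, by simp,
    hα, hC.weq_comp _ _ hα (hC.weq_of_iso _ hf), hγ, hC.weq_comp _ _ hγ (hC.weq_of_iso _ hi)⟩
  rw [reassoc_of% e, Category.assoc, w]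

/-- Two cofibrant replacements embed in a third one, found by factoring the map from their coproduct
to X. -/
theorem exists_common {X A A' : C} (hA : IsCofibrant A) (hA' : IsCofibrant A') (α : A ⟶ X)
    (α' : A' ⟶ X) (hα : WeakEquivalence α) (hα' : WeakEquivalence α') :
    ∃ (Z : C) (u : A ⟶ Z) (u' : A' ⟶ Z) (p : Z ⟶ X), Cofibration u ∧ Cofibration u' ∧
      WeakEquivalence u ∧ WeakEquivalence u' ∧ WeakEquivalence p ∧ u ≫ p = α ∧ u' ≫ p = α' := by
  obtain ⟨R, l, r, sp⟩ := hC.exists_isPushout (0 : (0 : C) ⟶ A) (0 : (0 : C) ⟶ A')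
  obtain ⟨e, hl, hr⟩ := sp.exists_desc α α' ((isZero_zero C).eq_of_src _ _)
  obtain ⟨Z, q, p, hq, hp, rfl⟩ := hC.factor e
  rw [← Category.assoc] at hl hr
  exact ⟨Z, l ≫ q, r ≫ q, p,
    hC.cof_comp _ _ (hC.cof_pushout sp.flip ((hC.isCofibrant_iff _).1 hA')) hq,
    hC.cof_comp _ _ (hC.cof_pushout sp ((hC.isCofibrant_iff _).1 hA)) hq,
    hC.weq_left _ p hp (by rwa [hl]), hC.weq_left _ p hp (by rwa [hr]), hp, hl, hr⟩

/-- The version for maps: both cofibrations are pushed out to the common source `Z`, glued along it,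
and the resulting map to Y is factored. -/
theorem exists_common_extension {X Y A A' B B' Z : C} {f : X ⟶ Y} {u : A ⟶ Z} {u' : A' ⟶ Z}
    {p : Z ⟶ X} (cu : Cofibration u) (cu' : Cofibration u') (wu : WeakEquivalence u)
    (wu' : WeakEquivalence u') {a : A ⟶ B} {a' : A' ⟶ B'} (ca : Cofibration a)
    (ca' : Cofibration a') {β : B ⟶ Y} {β' : B' ⟶ Y} (hβ : WeakEquivalence β)
    (hβ' : WeakEquivalence β') (w : a ≫ β = u ≫ p ≫ f) (w' : a' ≫ β' = u' ≫ p ≫ f) :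
    ∃ (W : C) (g : Z ⟶ W) (v : B ⟶ W) (v' : B' ⟶ W) (q : W ⟶ Y), Cofibration g ∧
      WeakEquivalence v ∧ WeakEquivalence v' ∧ a ≫ v = u ≫ g ∧ a' ≫ v' = u' ≫ g ∧ v ≫ q = β ∧
      v' ≫ q = β' ∧ g ≫ q = p ≫ f := by
  obtain ⟨P, b, z, s⟩ := hC.exists_isPushout a u
  obtain ⟨P', b', z', s'⟩ := hC.exists_isPushout a' u'
  obtain ⟨R, l, r, t⟩ := hC.exists_isPushout z z'
  obtain ⟨e, he₁, he₂⟩ := s.exists_desc β (p ≫ f) w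
  obtain ⟨e', he₁', he₂'⟩ := s'.exists_desc β' (p ≫ f) w'
  obtain ⟨o, ho₁, ho₂⟩ := t.exists_desc e e' (by rw [he₂, he₂'])
  obtain ⟨W, i, q, hi, hq, rfl⟩ := hC.factor o
  refine ⟨W, z ≫ l ≫ i, b ≫ l ≫ i, b' ≫ r ≫ i, q, hC.cof_comp _ _ (hC.cof_pushout s ca)
    (hC.cof_comp _ _ (hC.cof_pushout t.flip (hC.cof_pushout s' ca')) hi), hC.weq_left _ q hq ?_,
    hC.weq_left _ q hq ?_, ?_, ?_, ?_, ?_, ?_⟩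
  · rwa [Category.assoc, Category.assoc, ho₁, he₁]
  · rwa [Category.assoc, Category.assoc, ho₂, he₁']
  · rw [reassoc_of% s.w]
  · rw [reassoc_of% s'.w, reassoc_of% t.w]
  · rw [Category.assoc, Category.assoc, ho₁, he₁]
  · rw [Category.assoc, Category.assoc, ho₂, he₁']
  · rw [Category.assoc, Category.assoc, ho₁, he₂]

/-- Homotopy pushouts do not depend on the replacement. -/
theorem weq_of_isHomotopyPushout {X Y Z W A B D P : C} {f : X ⟶ Y} {g : X ⟶ Z} {h : Y ⟶ W}
    {i : Z ⟶ W} (s : IsHomotopyPushout f g h i) {f' : A ⟶ B} {g' : A ⟶ D} {h' : B ⟶ P}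
    {i' : D ⟶ P} (s' : IsPushout f' g' h' i') (hA : IsCofibrant A) (hf : Cofibration f')
    (hg : Cofibration g') {α : A ⟶ X} {β : B ⟶ Y} {γ : D ⟶ Z} {δ : P ⟶ W} (w₁ : f' ≫ β = α ≫ f)
    (w₂ : g' ≫ γ = α ≫ g) (w₃ : h' ≫ δ = β ≫ h) (w₄ : i' ≫ δ = γ ≫ i) (hα : WeakEquivalence α)
    (hβ : WeakEquivalence β) (hγ : WeakEquivalence γ) : WeakEquivalence δ := by
  obtain ⟨t, A', B', D', P', a, b, c, d, α', β', γ', δ', hA', ha, hb, t', e₁, e₂, e₃, e₄, hα', hβ',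
    hγ', hδ'⟩ := s
  -- The given replacement of the span and the one from the definition of a homotopy pushout are
  -- both mapped to a third. The gluing lemma makes `φ` and `ψ` weak equivalences of pushouts, and
  -- two-out-of-three transfers the property from `δ'` to `δ`.
  obtain ⟨Q, u, u', p, cu, cu', wu, wu', wp, rfl, rfl⟩ := hC.exists_common hA hA' α α' hα hα'
  rw [Category.assoc] at w₁ w₂ e₁ e₂
  obtain ⟨E, x, v, v', q, cx, wv, wv', k₁, k₂, rfl, rfl, k₃⟩ :=
    hC.exists_common_extension cu cu' wu wu' hf ha hβ hβ' w₁ e₁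
  obtain ⟨F, y, z, z', r, cy, wz, wz', l₁, l₂, rfl, rfl, l₃⟩ :=
    hC.exists_common_extension cu cu' wu wu' hg hb hγ hγ' w₂ e₂
  obtain ⟨G, m, n, sG⟩ := hC.exists_isPushout x y
  have hQ := hC.isCofibrant_of_cof hA cu
  obtain ⟨φ, hφ₁, hφ₂⟩ := s'.exists_desc (v ≫ m) (z ≫ n)
    (by rw [reassoc_of% k₁, reassoc_of% l₁, sG.w])
  obtain ⟨ψ, hψ₁, hψ₂⟩ := t'.exists_desc (v' ≫ m) (z' ≫ n)
    (by rw [reassoc_of% k₂, reassoc_of% l₂, sG.w])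
  have hφ := hC.gluing s' sG hA hQ (hC.isCofibrant_of_cof hA hg) (hC.isCofibrant_of_cof hQ cy)
    hf cx k₁ l₁ hφ₁ hφ₂ wu wv wz
  have hψ := hC.gluing t' sG hA' hQ (hC.isCofibrant_of_cof hA' hb) (hC.isCofibrant_of_cof hQ cy)
    ha cx k₂ l₂ hψ₁ hψ₂ wu' wv' wz'
  obtain ⟨o, ho₁, ho₂⟩ := sG.exists_desc (q ≫ h) (r ≫ i)
    (by rw [reassoc_of% k₃, reassoc_of% l₃, t.w])
  have h₁ : φ ≫ o = δ := s'.hom_ext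
    (by rw [reassoc_of% hφ₁, ho₁, w₃, Category.assoc])
    (by rw [reassoc_of% hφ₂, ho₂, w₄, Category.assoc])
  have h₂ : ψ ≫ o = δ' := t'.hom_ext
    (by rw [reassoc_of% hψ₁, ho₁, e₃, Category.assoc])
    (by rw [reassoc_of% hψ₂, ho₂, e₄, Category.assoc])
  rw [← h₁]
  exact hC.weq_comp _ _ hφ (hC.weq_right ψ o hψ (by rwa [h₂]))

end IsCofCat

/-! ### Pushout cubes -/

section PushoutCube

variable {n : ℕ} {A : C} {B : Fin n → C}

/-- The inclusion of a singleton. -/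
abbrev fromSingle {T : Subsets n} {i : Fin n} (h : i ∈ T) : ({i} : Subsets n) ⟶ T :=
  homOfLE (Finset.singleton_subset_iff.2 h)

/-- `W(T)` is the colimit of the maps `a i : A ⟶ B i` for `i ∈ T`. -/
structure IsPushoutCube (a : ∀ i, A ⟶ B i) (W : Subsets n ⥤ C) (base : A ⟶ W.obj ∅)
    (arm : ∀ i, B i ⟶ W.obj {i}) : Prop where
  comm : ∀ i, a i ≫ arm i = base ≫ W.map (fromEmpty {i})
  exists_desc : ∀ (T : Subsets n) {Z : C} (x : A ⟶ Z) (y : ∀ i, i ∈ T → (B i ⟶ Z)),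
    (∀ i hi, a i ≫ y i hi = x) → ∃ d : W.obj T ⟶ Z, base ≫ W.map (fromEmpty T) ≫ d = x ∧
      ∀ i (hi : i ∈ T), arm i ≫ W.map (fromSingle hi) ≫ d = y i hi
  hom_ext : ∀ (T : Subsets n) {Z : C} (d d' : W.obj T ⟶ Z),
    base ≫ W.map (fromEmpty T) ≫ d = base ≫ W.map (fromEmpty T) ≫ d' →
    (∀ i (hi : i ∈ T), arm i ≫ W.map (fromSingle hi) ≫ d = arm i ≫ W.map (fromSingle hi) ≫ d') →
    d = d'

theorem Subsets.map_map (W : Subsets n ⥤ C) {S T U : Subsets n} (f : S ⟶ T) (g : T ⟶ U)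
    (h : S ⟶ U) : W.map f ≫ W.map g = W.map h := by
  rw [← W.map_comp]; rfl

theorem Subsets.map_map_assoc (W : Subsets n ⥤ C) {S T U : Subsets n} (f : S ⟶ T) (g : T ⟶ U)
    (h : S ⟶ U) {Z : C} (k : W.obj U ⟶ Z) : W.map f ≫ W.map g ≫ k = W.map h ≫ k := by
  rw [← Category.assoc, map_map W f g h]

theorem exists_isPushoutCube [HasFiniteColimits C] (a : ∀ i, A ⟶ B i) :
    ∃ (W : Subsets n ⥤ C) (base : A ⟶ W.obj ∅) (arm : ∀ i, B i ⟶ W.obj {i}),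
      IsPushoutCube a W base arm := by
  let o (T : Subsets n) : C := widePushout A (fun i : {i // i ∈ T} => B i.1) (fun i => a i.1)
  let he (T : Subsets n) : A ⟶ o T := WidePushout.head _
  let ar (T : Subsets n) (i : {i // i ∈ T}) : B i.1 ⟶ o T :=
    WidePushout.ι (fun i : {i // i ∈ T} => a i.1) i
  have hc (T : Subsets n) (i : {i // i ∈ T}) : a i.1 ≫ ar T i = he T :=
    WidePushout.arrow_ι (fun i : {i // i ∈ T} => a i.1) i
  have ed (T : Subsets n) {Z : C} (x : A ⟶ Z) (y : ∀ i : {i // i ∈ T}, B i.1 ⟶ Z)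
      (h : ∀ i, a i.1 ≫ y i = x) : ∃ d : o T ⟶ Z, he T ≫ d = x ∧ ∀ i, ar T i ≫ d = y i :=
    ⟨WidePushout.desc x y h, WidePushout.head_desc _ _ _ _, fun i => WidePushout.ι_desc _ _ _ _ _⟩
  have hx (T : Subsets n) {Z : C} (d d' : o T ⟶ Z) (h : he T ≫ d = he T ≫ d')
      (h' : ∀ i, ar T i ≫ d = ar T i ≫ d') : d = d' := WidePushout.hom_ext _ _ _ h' h
  clear_value o he ar
  choose m hm₁ hm₂ using fun (S T : Subsets n) (f : S ⟶ T) =>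
    ed S (he T) (fun i => ar T ⟨i.1, leOfHom f i.2⟩) (fun i => hc T ⟨i.1, leOfHom f i.2⟩)
  let W : Subsets n ⥤ C :=
    { obj := o
      map := fun {S T} f => m S T f
      map_id := fun S => hx _ _ _ (by rw [hm₁, Category.comp_id]) fun i => by
        rw [hm₂, Category.comp_id]
      map_comp := fun f g => hx _ _ _ (by rw [hm₁, reassoc_of% hm₁, hm₁]) fun i => by
        rw [hm₂, reassoc_of% hm₂, hm₂] }
  have hb (T : Subsets n) : he ∅ ≫ W.map (fromEmpty T) = he T := hm₁ _ _ _
  have ha (T : Subsets n) (i : Fin n) (hi : i ∈ T) :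
      ar {i} ⟨i, Finset.mem_singleton_self i⟩ ≫ W.map (fromSingle hi) = ar T ⟨i, hi⟩ := hm₂ _ _ _ _
  refine ⟨W, he ∅, fun i => ar {i} ⟨i, Finset.mem_singleton_self i⟩, fun i => ?_,
    fun T Z x y h => ?_, fun T Z d d' h h' => ?_⟩
  · rw [hb]
    exact hc {i} ⟨i, Finset.mem_singleton_self i⟩
  · obtain ⟨d, hd, hd'⟩ := ed T x (fun i => y i.1 i.2) (fun i => h i.1 i.2)
    refine ⟨d, ?_, fun i hi => ?_⟩
    · rw [reassoc_of% hb, hd]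
    · rw [reassoc_of% (ha T i hi), hd']
  · refine hx _ _ _ ?_ fun i => ?_
    · rwa [reassoc_of% hb, reassoc_of% hb] at h
    · have := h' i.1 i.2
      rwa [reassoc_of% (ha T i.1 i.2), reassoc_of% (ha T i.1 i.2)] at this

namespace IsPushoutCube

variable {a : ∀ i, A ⟶ B i} {W : Subsets n ⥤ C} {base : A ⟶ W.obj ∅}
  {arm : ∀ i, B i ⟶ W.obj {i}} (h : IsPushoutCube a W base arm)

include h

theorem comm_at {T : Subsets n} {i : Fin n} (hi : i ∈ T) :
    a i ≫ arm i ≫ W.map (fromSingle hi) = base ≫ W.map (fromEmpty T) := by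
  rw [reassoc_of% h.comm i, Subsets.map_map]

/-- Adjoining an index to a wide pushout is a pushout of the new arm along A. -/
theorem isPushout_insert {T : Subsets n} {i : Fin n} (hi : i ∉ T) :
    IsPushout (a i) (base ≫ W.map (fromEmpty T))
      (arm i ≫ W.map (fromSingle (Finset.mem_insert_self i T))) (W.map (toInsert T i)) := by
  have w : a i ≫ arm i ≫ W.map (fromSingle (Finset.mem_insert_self i T)) =
      (base ≫ W.map (fromEmpty T)) ≫ W.map (toInsert T i) := by
    rw [h.comm_at, Category.assoc, Subsets.map_map]
  have key : ∀ {Z : C} (y : B i ⟶ Z) (x : W.obj T ⟶ Z), a i ≫ y = (base ≫ W.map (fromEmpty T)) ≫ x →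
      ∃ d : W.obj (insert i T) ⟶ Z,
        (arm i ≫ W.map (fromSingle (Finset.mem_insert_self i T))) ≫ d = y ∧
        W.map (toInsert T i) ≫ d = x := by
    intro Z y x e
    obtain ⟨d, hd, hd'⟩ := h.exists_desc (insert i T) (base ≫ W.map (fromEmpty T) ≫ x)
      (fun j hj => if hji : j = i then eqToHom (congrArg B hji) ≫ y else
        arm j ≫ W.map (fromSingle ((Finset.mem_insert.1 hj).resolve_left hji)) ≫ x) (by
      intro j hj
      by_cases hji : j = i
      · subst hji
        rw [dif_pos rfl]
        simpa using e
      · rw [dif_neg hji]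
        rw [← Category.assoc (arm j), ← Category.assoc (a j), h.comm_at, Category.assoc])
    refine ⟨d, ?_, h.hom_ext T _ _ ?_ fun j hj => ?_⟩
    · rw [Category.assoc, hd', dif_pos rfl]
      simp
    · rw [← hd, Subsets.map_map_assoc]
    · rw [Subsets.map_map_assoc _ _ _ (fromSingle (Finset.mem_insert_of_mem hj)), hd',
        dif_neg (by rintro rfl; exact hi hj)]
  have uniq : ∀ {Z : C} (d d' : W.obj (insert i T) ⟶ Z),
      (arm i ≫ W.map (fromSingle (Finset.mem_insert_self i T))) ≫ d =
        (arm i ≫ W.map (fromSingle (Finset.mem_insert_self i T))) ≫ d' →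
      W.map (toInsert T i) ≫ d = W.map (toInsert T i) ≫ d' → d = d' := by
    intro Z d d' e e'
    refine h.hom_ext _ _ _ ?_ fun j hj => ?_
    · rw [← Subsets.map_map_assoc W (fromEmpty T) (toInsert T i), e', Subsets.map_map_assoc]
    · obtain rfl | hj' := Finset.mem_insert.1 hj
      · simpa using e
      · rw [← Subsets.map_map_assoc W (fromSingle hj') (toInsert T i), e', Subsets.map_map_assoc]
  choose d hd hd' using @key
  exact ⟨⟨w⟩, ⟨PushoutCocone.IsColimit.mk _ (fun s => d s.inl s.inr s.condition)
    (fun s => hd _ _ _) (fun s => hd' _ _ _) fun s m hm hm' =>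
      uniq _ _ (by rw [hm, hd]) (by rw [hm', hd'])⟩⟩

/-- Attaching the arm `j` before and after the arm `i` gives two pushouts from A; cancelling the
first leaves the face. -/
theorem isPushout_face {S : Subsets n} {i j : Fin n} (hi : i ∉ S) (hj : j ∉ S) (hij : i ≠ j) :
    IsPushout (W.map (toInsert S i)) (W.map (toInsert S j))
      (W.map (toInsert (insert i S) j)) (W.map (insertTo S i j)) := by
  have hj' : j ∉ insert i S := fun h' => (Finset.mem_insert.1 h').elim (hij ·.symm) hj
  have s := (h.isPushout_insert hj).flip
  have t := (h.isPushout_insert hj').flip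
  refine IsPushout.of_left (h₁₁ := base ≫ W.map (fromEmpty S)) (v₁₁ := a j)
    (h₂₁ := arm j ≫ W.map (fromSingle (Finset.mem_insert_self j S))) ?_ ?_ s
  · rw [Category.assoc, Category.assoc, Subsets.map_map _ _ _ (fromEmpty _),
      Subsets.map_map _ _ _ (fromSingle (Finset.mem_insert_self j _))]
    exact t
  · rw [Subsets.map_map _ _ _ (toInsert S i ≫ toInsert (insert i S) j), Subsets.map_map]

variable (hC : IsCofCat C) (ha : ∀ i, Cofibration (a i))

include hC ha

theorem cof_toInsert {T : Subsets n} {i : Fin n} (hi : i ∉ T) :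
    Cofibration (W.map (toInsert T i)) :=
  hC.cof_pushout (h.isPushout_insert hi) (ha i)

omit ha in
theorem isIso_base : IsIso base := by
  obtain ⟨d, hd, -⟩ := h.exists_desc ∅ (𝟙 A) (fun i hi => (Finset.notMem_empty i hi).elim)
    (fun i hi => (Finset.notMem_empty i hi).elim)
  rw [show fromEmpty (∅ : Subsets n) = 𝟙 _ from rfl, W.map_id, Category.id_comp] at hd
  refine ⟨d, hd, h.hom_ext ∅ _ _ ?_ fun i hi => (Finset.notMem_empty i hi).elim⟩
  rw [show fromEmpty (∅ : Subsets n) = 𝟙 _ from rfl, W.map_id, Category.id_comp, reassoc_of% hd]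
  simp

theorem cof_base (T : Subsets n) : Cofibration (base ≫ W.map (fromEmpty T)) := by
  induction T using Finset.induction_on with
  | empty =>
    rw [show fromEmpty (∅ : Subsets n) = 𝟙 _ from rfl, W.map_id, Category.comp_id]
    exact hC.cof_of_iso _ (h.isIso_base hC)
  | insert i T hi ih =>
    rw [← Subsets.map_map W (fromEmpty T) (toInsert T i), ← Category.assoc]
    exact hC.cof_comp _ _ ih (h.cof_toInsert hC ha hi)

theorem isCofibrant (hA : IsCofibrant A) (T : Subsets n) : IsCofibrant (W.obj T) :=
  hC.isCofibrant_of_cof hA (h.cof_base hC ha T)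

theorem isStronglyCocartesian (hA : IsCofibrant A) : IsStronglyCocartesian W := fun S _ _ hi hj hij =>
  hC.isHomotopyPushout_of_isPushout (h.isPushout_face hi hj hij) (h.isCofibrant hC ha hA S)
    (h.cof_toInsert hC ha hi) (h.cof_toInsert hC ha hj)

/-- A strongly cocartesian cube is weakly equivalent to a pushout cube. -/
theorem exists_weq (hA : IsCofibrant A) {X : Subsets n ⥤ C} (hX : IsStronglyCocartesian X)
    {α : A ⟶ X.obj ∅} {β : ∀ i, B i ⟶ X.obj {i}} (hα : WeakEquivalence α)
    (hβ : ∀ i, WeakEquivalence (β i)) (w : ∀ i, a i ≫ β i = α ≫ X.map (fromEmpty {i})) :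
    ∃ φ : W ⟶ X, ∀ T, WeakEquivalence (φ.app T) := by
  choose φ hφ hφ' using fun T : Subsets n => h.exists_desc T (α ≫ X.map (fromEmpty T))
    (fun i hi => β i ≫ X.map (fromSingle hi)) (fun i hi => by
      rw [reassoc_of% w i, Subsets.map_map])
  let Φ : W ⟶ X :=
    { app := φ
      naturality := fun S T f => by
        refine h.hom_ext S _ _ ?_ fun i hi => ?_
        · rw [Subsets.map_map_assoc _ _ _ (fromEmpty T), hφ, ← Category.assoc (W.map _),
            ← Category.assoc base, hφ, Category.assoc, Subsets.map_map]
        · rw [Subsets.map_map_assoc _ _ _ (fromSingle (leOfHom f hi)), hφ',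
            ← Category.assoc (W.map _), ← Category.assoc (arm i), hφ', Category.assoc,
            Subsets.map_map] }
  have h0 : WeakEquivalence (φ ∅) := by
    have := hφ ∅
    rw [show fromEmpty (∅ : Subsets n) = 𝟙 _ from rfl, W.map_id, Category.id_comp, X.map_id,
      Category.comp_id] at this
    refine hC.weq_right base _ (hC.weq_of_iso _ (h.isIso_base hC)) ?_
    rwa [this]
  have h1 : ∀ i, WeakEquivalence (φ {i}) := fun i => by
    have e := hφ' {i} i (Finset.mem_singleton_self i)
    rw [show fromSingle (Finset.mem_singleton_self i) = 𝟙 _ from rfl, W.map_id, Category.id_comp,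
      X.map_id, Category.comp_id] at e
    have hi : IsIso (arm i) := by
      obtain ⟨d, hd, hd'⟩ := h.exists_desc {i} (a i)
        (fun j hj => eqToHom (congrArg B (Finset.mem_singleton.1 hj))) (fun j hj => by
          obtain rfl := Finset.mem_singleton.1 hj
          simp)
      have hd' := hd' i (Finset.mem_singleton_self i)
      rw [show fromSingle (Finset.mem_singleton_self i) = 𝟙 _ from rfl, W.map_id, Category.id_comp,
        eqToHom_refl] at hd'
      refine ⟨d, hd', h.hom_ext {i} _ _ ?_ fun j hj => ?_⟩
      · rw [← Category.assoc (W.map _), ← Category.assoc base, hd, h.comm, Category.comp_id]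
      · obtain rfl := Finset.mem_singleton.1 hj
        rw [show fromSingle hj = 𝟙 _ from rfl, W.map_id, Category.id_comp, reassoc_of% hd']
        simp
    exact hC.weq_right (arm i) _ (hC.weq_of_iso _ hi) (by rw [e]; exact hβ i)
  refine ⟨Φ, fun T => ?_⟩
  change WeakEquivalence (φ T)
  -- A set with at least two elements is the far corner of a two-dimensional face whose three other
  -- corners are smaller. Homotopy pushouts extend the equivalence to that corner, so only ∅ and the
  -- singletons need the hypotheses.
  induction hk : T.card using Nat.strong_induction_on generalizing T with
  | _ k ih =>
    subst hk
    induction T using Finset.induction_on with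
    | empty => exact h0
    | insert j T hj _ =>
      induction T using Finset.induction_on with
      | empty => exact h1 j
      | insert i T hi _ =>
        have hij : i ≠ j := fun e => hj (e ▸ Finset.mem_insert_self _ _)
        have hj' : j ∉ T := fun e => hj (Finset.mem_insert_of_mem e)
        have c0 : T.card < (insert j (insert i T)).card := by
          rw [Finset.card_insert_of_notMem hj, Finset.card_insert_of_notMem hi]; omega
        have c1 : (insert i T).card < (insert j (insert i T)).card := by
          rw [Finset.card_insert_of_notMem hj]; omega
        have c2 : (insert j T).card < (insert j (insert i T)).card := by
          rw [Finset.card_insert_of_notMem hj, Finset.card_insert_of_notMem hi,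
            Finset.card_insert_of_notMem hj']; omega
        exact hC.weq_of_isHomotopyPushout (hX T i j hi hj' hij) (h.isPushout_face hi hj' hij)
          (h.isCofibrant hC ha hA T) (h.cof_toInsert hC ha hi) (h.cof_toInsert hC ha hj')
          (Φ.naturality _) (Φ.naturality _) (Φ.naturality _) (Φ.naturality _)
          (ih _ c0 T rfl) (ih _ c1 _ rfl) (ih _ c2 _ rfl)

end IsPushoutCube

end PushoutCube

/-- The restriction of a pushout cube to a face. -/
theorem IsPushoutCube.face0 {n : ℕ} {A : C} {B : Fin (n + 1) → C} {a : ∀ i, A ⟶ B i}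
    {W : Subsets (n + 1) ⥤ C} {base : A ⟶ W.obj ∅} {arm : ∀ i, B i ⟶ W.obj {i}}
    (h : IsPushoutCube a W base arm) : IsPushoutCube (fun i : Fin n => a i.castSucc) (inc0 n ⋙ W)
      (base ≫ W.map (fromEmpty _))
      (fun i => arm i.castSucc ≫ W.map (fromSingle (castSucc_mem_inc0.2 (Finset.mem_singleton_self i)))) where
  comm i := by
    rw [h.comm_at, Category.assoc]
    exact congrArg (base ≫ ·) (Subsets.map_map W _ _ _).symm
  exists_desc T Z x y e := by
    obtain ⟨y', hy'⟩ : ∃ y' : ∀ i, i ∈ (inc0 n).obj T → (B i ⟶ Z),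
        ∀ i hi, y' i.castSucc (castSucc_mem_inc0.2 hi) = y i hi :=
      ⟨Fin.lastCases (fun h => (last_notMem_inc0 _ h).elim)
        (fun i h => y i (castSucc_mem_inc0.1 h)), fun i hi => by beta_reduce; rw [Fin.lastCases_castSucc]⟩
    obtain ⟨d, hd, hd'⟩ := h.exists_desc ((inc0 n).obj T) x y' (fun i hi => by
      induction i using Fin.lastCases with
      | last => exact (last_notMem_inc0 _ hi).elim
      | cast i => rw [hy' i (castSucc_mem_inc0.1 hi), e])
    refine ⟨d, ?_, fun i hi => ?_⟩
    · rw [← hd, Category.assoc]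
      exact congrArg (base ≫ ·) (Subsets.map_map_assoc W _ _ _ _)
    · rw [Category.assoc, ← hy' i hi, ← hd']
      exact congrArg (arm i.castSucc ≫ ·) (Subsets.map_map_assoc W _ _ _ _)
  hom_ext T Z d d' e e' := by
    refine h.hom_ext _ _ _ ?_ fun i hi => ?_
    · have k := fun z : W.obj ((inc0 n).obj T) ⟶ Z => Subsets.map_map_assoc W
        (fromEmpty ((inc0 n).obj ∅)) ((inc0 n).map (fromEmpty T)) (fromEmpty _) z
      rw [Category.assoc, Category.assoc] at e
      exact (congrArg (base ≫ ·) (k d).symm).trans (e.trans (congrArg (base ≫ ·) (k d')))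
    · induction i using Fin.lastCases with
      | last => exact (last_notMem_inc0 _ hi).elim
      | cast i =>
        have e := e' i (castSucc_mem_inc0.1 hi)
        have k := fun z : W.obj ((inc0 n).obj T) ⟶ Z => Subsets.map_map_assoc W
          (fromSingle (castSucc_mem_inc0.2 (Finset.mem_singleton_self i)))
          ((inc0 n).map (fromSingle (castSucc_mem_inc0.1 hi))) (fromSingle hi) z
        rw [Category.assoc, Category.assoc] at e
        exact (congrArg (arm i.castSucc ≫ ·) (k d).symm).trans
          (e.trans (congrArg (arm i.castSucc ≫ ·) (k d')))

end Goodwillie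

end

/-! ### Total fibers on strongly cocartesian cubes from cross-effects. -/

noncomputable section

namespace Goodwillie

open scoped ZeroObject
open Cx

variable {C : Type*} [Category* C] [HasZeroMorphisms C] [HasZeroObject C]
  [CategoryWithWeakEquivalences C] [CategoryWithFibrations C] [CategoryWithCofibrations C]

/-! ### Coproducts and partial identities -/

/-- `Φ(S)` is the coproduct of the `Q i` for `i ∈ S`. -/
structure IsSigma {n : ℕ} (Q : Fin n → C) (Φ : PSet n ⥤ C)
    (ι : ∀ (S : PSet n) (i : Fin n), i ∈ S.set → (Q i ⟶ Φ.obj S)) : Prop where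
  exists_desc : ∀ (S : PSet n) {Z : C} (y : ∀ i, i ∈ S.set → (Q i ⟶ Z)),
    ∃ d : Φ.obj S ⟶ Z, ∀ i hi, ι S i hi ≫ d = y i hi
  hom_ext : ∀ (S : PSet n) {Z : C} (d d' : Φ.obj S ⟶ Z),
    (∀ i hi, ι S i hi ≫ d = ι S i hi ≫ d') → d = d'
  map_mem : ∀ {S T : PSet n} (f : S ⟶ T) (i : Fin n) (hi : i ∈ f.dom),
    ι S i (f.le_src hi) ≫ Φ.map f = ι T i (f.le_tgt hi)
  map_notMem : ∀ {S T : PSet n} (f : S ⟶ T) (i : Fin n) (hi : i ∈ S.set), i ∉ f.dom →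
    ι S i hi ≫ Φ.map f = 0

theorem exists_isSigma [HasFiniteCoproducts C] {n : ℕ} (Q : Fin n → C) :
    ∃ (Φ : PSet n ⥤ C) (ι : ∀ (S : PSet n) (i : Fin n), i ∈ S.set → (Q i ⟶ Φ.obj S)),
      IsSigma Q Φ ι := by
  let o (S : PSet n) : C := ∐ fun i : {i // i ∈ S.set} => Q i.1
  let j (S : PSet n) (i : Fin n) (hi : i ∈ S.set) : Q i ⟶ o S :=
    Sigma.ι (fun i : {i // i ∈ S.set} => Q i.1) ⟨i, hi⟩
  have ed (S : PSet n) {Z : C} (y : ∀ i, i ∈ S.set → (Q i ⟶ Z)) :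
      ∃ d : o S ⟶ Z, ∀ i hi, j S i hi ≫ d = y i hi :=
    ⟨Sigma.desc fun i => y i.1 i.2, fun i hi => Sigma.ι_desc _ _⟩
  have hx (S : PSet n) {Z : C} (d d' : o S ⟶ Z) (h : ∀ i hi, j S i hi ≫ d = j S i hi ≫ d') :
      d = d' := Sigma.hom_ext _ _ fun i => h i.1 i.2
  clear_value o j
  classical
  choose m hm using fun (S T : PSet n) (f : S ⟶ T) =>
    ed S (fun i hi => if h : i ∈ f.dom then j T i (f.le_tgt h) else 0)
  let Φ : PSet n ⥤ C :=
    { obj := o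
      map := fun {S T} f => m S T f
      map_id := fun S => hx _ _ _ fun i hi => by
        rw [hm, Category.comp_id, dif_pos]
        exact hi
      map_comp := fun {S T U} f g => hx _ _ _ fun i hi => by
        have e : (f ≫ g).dom = f.dom ∩ g.dom := rfl
        rw [hm, reassoc_of% hm]
        by_cases h : i ∈ f.dom
        · rw [dif_pos h, hm]
          by_cases h' : i ∈ g.dom
          · rw [dif_pos h', dif_pos (e ▸ Finset.mem_inter.2 ⟨h, h'⟩)]
          · rw [dif_neg h', dif_neg (fun h₁ => h' (Finset.mem_inter.1 (e ▸ h₁)).2)]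
        · rw [dif_neg h, dif_neg (fun h₁ => h (Finset.mem_inter.1 (e ▸ h₁)).1), zero_comp] }
  exact ⟨Φ, j, fun S Z y => ed S y, fun S Z d d' => hx S d d',
    fun f i hi => (hm _ _ _ _ _).trans (dif_pos hi),
    fun f i hi h => (hm _ _ _ _ _).trans (dif_neg h)⟩

namespace IsSigma

variable {n : ℕ} {Q : Fin n → C} {Φ : PSet n ⥤ C}
  {ι : ∀ (S : PSet n) (i : Fin n), i ∈ S.set → (Q i ⟶ Φ.obj S)} (h : IsSigma Q Φ ι)

/-- The cube of coproducts and projections. -/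
def coproductCube : CoproductCube Q where
  cube := PSet.proj n ⋙ Φ
  incl T i := ι ⟨Tᶜ⟩ i.1 (Finset.mem_compl.2 i.2)
  isColimit T := Cofan.IsColimit.mk _
    (fun s => (h.exists_desc ⟨Tᶜ⟩ fun i hi => s.inj ⟨i, Finset.mem_compl.1 hi⟩).choose)
    (fun s i => (h.exists_desc ⟨Tᶜ⟩ fun i hi => s.inj ⟨i, Finset.mem_compl.1 hi⟩).choose_spec
      i.1 (Finset.mem_compl.2 i.2))
    (fun s m hm => h.hom_ext ⟨Tᶜ⟩ _ _ fun i hi =>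
      (hm ⟨i, Finset.mem_compl.1 hi⟩).trans ((h.exists_desc ⟨Tᶜ⟩
        fun i hi => s.inj ⟨i, Finset.mem_compl.1 hi⟩).choose_spec i hi).symm)
  incl_map {S T} f i hi := h.map_mem ((PSet.proj n).map f) i.1 (Finset.mem_compl.2 hi)
  incl_map_zero {S T} f i hi := h.map_notMem ((PSet.proj n).map f) i.1 _
    fun h' => Finset.mem_compl.1 h' hi

end IsSigma

/-! ### Vanishing of total fibers of strongly cocartesian cubes -/

/-- Collapsing the last arm of a pushout cube. -/
theorem IsPushoutCube.exists_collapse (hC : IsCofCat C) {n : ℕ} {A : C} {B : Fin (n + 1) → C}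
    {a : ∀ i, A ⟶ B i} {W : Subsets (n + 1) ⥤ C} {base : A ⟶ W.obj ∅}
    {arm : ∀ i, B i ⟶ W.obj {i}} (h : IsPushoutCube a W base arm) (hA : IsCofibrant A)
    (ha : ∀ i, Cofibration (a i)) (hK : WeakEquivalence (0 : B (Fin.last n) ⟶ 0))
    {Q : Fin n → C} {q : ∀ i : Fin n, B i.castSucc ⟶ Q i}
    (hq : ∀ i, IsPushout (a i.castSucc) (0 : A ⟶ 0) (q i) 0) {Φ : PSet n ⥤ C}
    {ι : ∀ (S : PSet n) (i : Fin n), i ∈ S.set → (Q i ⟶ Φ.obj S)} (hΦ : IsSigma Q Φ ι) :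
    ∃ ψ : inc1 n ⋙ W ⟶ PSet.incl n ⋙ Φ, ∀ T, WeakEquivalence (ψ.app T) := by
  -- The map ψ collapses the last arm, and with it the copy of A inside. Each other arm B i becomes
  -- B i / A, and these are now glued along zero, which gives a coproduct.
  have hq0 : ∀ i, a i.castSucc ≫ q i = 0 := fun i => by rw [(hq i).w, zero_comp]
  have hy : ∀ T : Subsets n, ∃ y : ∀ i, i ∈ (inc1 n).obj T → (B i ⟶ Φ.obj ⟨T⟩),
      y (Fin.last n) (last_mem_inc1 T) = 0 ∧
      ∀ i (hi : i ∈ T), y i.castSucc (castSucc_mem_inc1.2 hi) = q i ≫ ι ⟨T⟩ i hi := fun T =>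
    ⟨Fin.lastCases (fun _ => 0) (fun i hi => q i ≫ ι ⟨T⟩ i (castSucc_mem_inc1.1 hi)),
      by beta_reduce; rw [Fin.lastCases_last], fun i hi => by
        beta_reduce; rw [Fin.lastCases_castSucc]⟩
  choose y hy₀ hy₁ using hy
  choose ψ hψ₀ hψ₁ using fun T : Subsets n => h.exists_desc ((inc1 n).obj T) 0 (y T) (by
    intro i hi
    induction i using Fin.lastCases with
    | last => rw [hy₀, comp_zero]
    | cast i => rw [hy₁ T i (castSucc_mem_inc1.1 hi), reassoc_of% hq0 i, zero_comp])
  have hψl : ∀ T : Subsets n, arm (Fin.last n) ≫ W.map (fromSingle (last_mem_inc1 T)) ≫ ψ T = 0 :=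
    fun T => by rw [hψ₁, hy₀]
  have hψc : ∀ (T : Subsets n) (i : Fin n) (hi : i ∈ T), arm i.castSucc ≫
      W.map (fromSingle (castSucc_mem_inc1.2 hi)) ≫ ψ T = q i ≫ ι ⟨T⟩ i hi :=
    fun T i hi => by rw [hψ₁, hy₁]
  have nat : ∀ {S T : Subsets n} (f : S ⟶ T) (g : (⟨S⟩ : PSet n) ⟶ ⟨T⟩), S ≤ PSet.Hom.dom g →
      W.map ((inc1 n).map f) ≫ ψ T = ψ S ≫ Φ.map g := by
    intro S T f g hg
    refine h.hom_ext _ _ _ ?_ fun i hi => ?_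
    · rw [Subsets.map_map_assoc W _ ((inc1 n).map f) (fromEmpty _), hψ₀,
        ← Category.assoc (W.map _), ← Category.assoc base, hψ₀, zero_comp]
    · rw [Subsets.map_map_assoc W _ ((inc1 n).map f) (fromSingle (leOfHom ((inc1 n).map f) hi))]
      induction i using Fin.lastCases with
      | last => rw [hψl, reassoc_of% (hψl S), zero_comp]
      | cast i =>
        have hi' := castSucc_mem_inc1.1 hi
        rw [hψc T i (leOfHom f hi'), reassoc_of% (hψc S i hi')]
        exact congrArg (q i ≫ ·) (hΦ.map_mem g i (hg hi')).symm
  let Ψ : inc1 n ⋙ W ⟶ PSet.incl n ⋙ Φ :=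
    { app := ψ
      naturality := fun S T f => nat f ((PSet.incl n).map f) le_rfl }
  refine ⟨Ψ, fun T => ?_⟩
  -- ψ T is the quotient by B(last). Since this arm is a cofibration with contractible source,
  -- collapsing it is a weak equivalence.
  have s : IsPushout (arm (Fin.last n) ≫ W.map (fromSingle (last_mem_inc1 T)))
      (0 : B (Fin.last n) ⟶ 0) (ψ T) 0 := by
    have w : (arm (Fin.last n) ≫ W.map (fromSingle (last_mem_inc1 T))) ≫ ψ T =
        (0 : B (Fin.last n) ⟶ 0) ≫ 0 := by rw [Category.assoc, hψl, zero_comp]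
    have key : ∀ {Z : C} (z : W.obj ((inc1 n).obj T) ⟶ Z),
        (arm (Fin.last n) ≫ W.map (fromSingle (last_mem_inc1 T))) ≫ z = 0 →
        ∃ d : Φ.obj ⟨T⟩ ⟶ Z, ψ T ≫ d = z := by
      intro Z z hz
      have hz₀ : base ≫ W.map (fromEmpty _) ≫ z = 0 := by
        rw [← Category.assoc, ← h.comm_at (last_mem_inc1 T), Category.assoc, hz, comp_zero]
      choose r hr₁ hr₂ using fun (i : Fin n) (hi : i ∈ T) => (hq i).exists_desc
        (arm i.castSucc ≫ W.map (fromSingle (castSucc_mem_inc1.2 hi)) ≫ z) (0 : 0 ⟶ Z) (by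
          rw [← hz₀.trans zero_comp.symm, ← Category.assoc base,
            ← h.comm_at (castSucc_mem_inc1.2 hi)]
          simp only [Category.assoc])
      obtain ⟨d, hd⟩ := hΦ.exists_desc ⟨T⟩ r
      refine ⟨d, h.hom_ext _ _ _ ?_ fun i hi => ?_⟩
      · rw [hz₀, ← Category.assoc (W.map _), ← Category.assoc base, hψ₀, zero_comp]
      · rw [← Category.assoc (W.map _), ← Category.assoc (arm i)]
        induction i using Fin.lastCases with
        | last => rw [hψl, zero_comp, ← hz, Category.assoc]
        | cast i =>
          have hi' := castSucc_mem_inc1.1 hi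
          rw [hψc T i hi', Category.assoc, hd, hr₁]
    have uniq : ∀ {Z : C} (d d' : Φ.obj ⟨T⟩ ⟶ Z), ψ T ≫ d = ψ T ≫ d' → d = d' := by
      intro Z d d' e
      refine hΦ.hom_ext _ _ _ fun i hi => (hq i).hom_ext ?_ ((isZero_zero C).eq_of_src _ _)
      rw [← Category.assoc, ← Category.assoc, ← hψc T i hi]
      simp only [Category.assoc, e]
    choose d hd using @key
    exact ⟨⟨w⟩, ⟨PushoutCocone.IsColimit.mk _
      (fun s => d s.inl (s.condition.trans (by rw [(isZero_zero C).eq_of_src s.inr 0, zero_comp])))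
      (fun s => hd _ _) (fun s => (isZero_zero C).eq_of_src _ _) fun s m hm _ =>
        uniq _ _ (by rw [hm, hd])⟩⟩
  refine hC.weq_pushout_along s (hC.isCofibrant_of_cof hA (ha _)) ?_ ?_ hK
  · exact (hC.isCofibrant_iff _).2 (hC.cof_of_iso _ ⟨0, (isZero_zero C).eq_of_src _ _,
      (isZero_zero C).eq_of_src _ _⟩)
  · exact hC.cof_pushout (h.isPushout_insert (last_notMem_inc0 T)).flip (h.cof_base hC ha _)

/-- If the total fibers of `H` on strongly cocartesian `(n+1)`-cubes and the cross-effects vanish,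
so do the total fibers on strongly cocartesian `n`-cubes. -/
theorem ex_tf_of_crossEffect (hC : IsCofCat C) (H : C ⥤ Cx.{u})
    (hH : ∀ {X Y : C} (f : X ⟶ Y), WeakEquivalence f → ∀ i, HIso (H.map f) i) {n : ℕ} {S : Set ℤ}
    (h₁ : ∀ W : Subsets (n + 1) ⥤ C, IsStronglyCocartesian W → ∀ i ∈ S,
      Ex ((tf (n + 1)).obj (W ⋙ H)) i)
    (h₂ : ∀ (Q : Fin n → C) (Φ : PSet n ⥤ C) (P : CoproductCube Q), (∀ i, IsCofibrant (Q i)) →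
      P.cube = PSet.proj n ⋙ Φ → ∀ i, Ex ((tf n).obj (PSet.proj n ⋙ Φ ⋙ H)) i)
    (X : Subsets n ⥤ C) (hX : IsStronglyCocartesian X) :
    ∀ i ∈ S, Ex ((tf n).obj (X ⋙ H)) i := by
  have := hC.hasPushouts
  have : HasInitial C := inferInstance
  have : HasFiniteColimits C := hasFiniteColimits_of_hasInitial_and_pushouts
  obtain ⟨A, α, hA, hα⟩ := hC.exists_cofibrant (X.obj ∅)
  -- The first n arms replace the edges of X at ∅; the last arm is a cone on A.
  have key : ∀ i : Fin (n + 1), ∃ (B : C) (a : A ⟶ B), Cofibration a ∧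
      (∀ j : Fin n, j.castSucc = i → ∃ β : B ⟶ X.obj {j}, WeakEquivalence β ∧
        a ≫ β = α ≫ X.map (fromEmpty {j})) ∧
      (i = Fin.last n → WeakEquivalence (0 : B ⟶ 0)) := by
    intro i
    induction i using Fin.lastCases with
    | last =>
      obtain ⟨B, a, p, ha, hp, -⟩ := hC.factor (0 : A ⟶ 0)
      exact ⟨B, a, ha, fun j hj => ((Fin.castSucc_lt_last j).ne hj).elim, fun _ => by
        rwa [(isZero_zero C).eq_of_tgt 0 p]⟩
    | cast i =>
      obtain ⟨B, a, p, ha, hp, e⟩ := hC.factor (α ≫ X.map (fromEmpty {i}))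
      refine ⟨B, a, ha, fun j hj => ?_, fun h => ((Fin.castSucc_lt_last i).ne h).elim⟩
      obtain rfl := Fin.castSucc_injective _ hj
      exact ⟨p, hp, e⟩
  choose B a ha hβ hK using key
  choose β hβ hβ' using fun j => hβ _ j rfl
  obtain ⟨W, base, arm, hW⟩ := exists_isPushoutCube a
  choose Q q z hq using fun i : Fin n => hC.exists_isPushout (a i.castSucc) (0 : A ⟶ 0)
  have hq' : ∀ i, IsPushout (a i.castSucc) (0 : A ⟶ 0) (q i) 0 := fun i =>
    (isZero_zero C).eq_of_src (z i) 0 ▸ hq i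
  obtain ⟨Φ, ι, hΦ⟩ := exists_isSigma Q
  obtain ⟨ψ, hψ⟩ := hW.exists_collapse hC hA ha (hK _ rfl) hq' hΦ
  obtain ⟨φ, hφ⟩ := hW.face0.exists_weq hC (fun i => ha _) hA hX hα hβ hβ'
  have hQ : ∀ i, IsCofibrant (Q i) := fun i => (hC.isCofibrant_iff _).2
    (hC.cof_pushout (hq' i) (ha _))
  -- The cross-effect of the quotients B i / A controls the projection cube, hence also the
  -- inclusion cube, which is the face through the cone.
  have e₁ := fun i => PSet.ex_tf_incl (Φ ⋙ H) (h₂ Q Φ hΦ.coproductCube hQ rfl) i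
  have e₂ := fun i => (e₁ i).of_hIso (hIso_tf (Functor.whiskerRight ψ H) (fun T => hH _ (hψ T)) i).1
  intro i hi
  -- Only injectivity from the face X to the face through the cone is needed, as the latter has
  -- acyclic total fiber in all degrees.
  have e₃ := ex_tf_succ_iff.1 (h₁ W (hW.isStronglyCocartesian hC ha hA) i hi)
  have e₄ := (e₂ i).of_hIso e₃.1
  exact e₄.of_hIso' (hIso_tf (Functor.whiskerRight φ H) (fun T => hH _ (hφ T)) i).2

/-! ### Doubled cubes and joins -/

theorem IsStronglyCocartesian.of_eq {n : ℕ} {X : Subsets n ⥤ C} (hX : IsStronglyCocartesian X)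
    {S S₁ S₂ S₃ : Subsets n} {i j : Fin n} (hi : i ∉ S) (hj : j ∉ S) (hij : i ≠ j)
    (h₁ : S₁ = insert i S) (h₂ : S₂ = insert j S) (h₃ : S₃ = insert j (insert i S)) (f₁ : S ⟶ S₁)
    (f₂ : S ⟶ S₂) (f₃ : S₁ ⟶ S₃) (f₄ : S₂ ⟶ S₃) :
    IsHomotopyPushout (X.map f₁) (X.map f₂) (X.map f₃) (X.map f₄) := by
  subst h₁ h₂ h₃
  exact hX S i j hi hj hij

/-- Forgetting the last element, as a functor. -/
def restrF (n : ℕ) : Subsets (n + 1) ⥤ Subsets n :=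
  Monotone.functor (f := restr) fun _ _ h => restr_mono h

theorem Subsets.isIso_map {n : ℕ} (X : Subsets n ⥤ C) {S T : Subsets n} (f : S ⟶ T) (h : T ≤ S) :
    IsIso (X.map f) :=
  ⟨X.map (homOfLE h), by rw [Subsets.map_map X _ _ (𝟙 S), X.map_id],
    by rw [Subsets.map_map X _ _ (𝟙 T), X.map_id]⟩

theorem restr_insert_last {n : ℕ} (S : Subsets (n + 1)) : restr (insert (Fin.last n) S) = restr S := by
  ext i
  rw [mem_restr, mem_restr, Finset.mem_insert, or_iff_right (Fin.castSucc_lt_last i).ne]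

theorem restr_insert_castSucc {n : ℕ} (S : Subsets (n + 1)) (i : Fin n) :
    restr (insert i.castSucc S) = insert i (restr S) := by
  ext j
  rw [mem_restr, Finset.mem_insert, Finset.mem_insert, mem_restr, Fin.castSucc_inj]

/-- Doubling a strongly cocartesian cube gives a strongly cocartesian cube. -/
theorem IsStronglyCocartesian.restr (hC : IsCofCat C) {n : ℕ} {X : Subsets n ⥤ C}
    (hX : IsStronglyCocartesian X) : IsStronglyCocartesian (restrF n ⋙ X) := by
  intro S i j hi hj hij
  have w : (restrF n ⋙ X).map (toInsert S i) ≫ (restrF n ⋙ X).map (toInsert (insert i S) j) =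
      (restrF n ⋙ X).map (toInsert S j) ≫ (restrF n ⋙ X).map (insertTo S i j) := by
    rw [← Functor.map_comp, ← Functor.map_comp]; rfl
  have hl : ∀ {A B : Subsets (n + 1)} (f : A ⟶ B), B = insert (Fin.last n) A →
      IsIso ((restrF n ⋙ X).map f) := fun {A B} f e =>
    Subsets.isIso_map X ((restrF n).map f) (by
      subst e
      exact (restr_insert_last A).le)
  -- In the doubled direction the maps are isomorphisms, and a square with two opposite isomorphisms
  -- is a homotopy pushout. Every other face is a face of X.
  induction i using Fin.lastCases with
  | last => exact hC.isHomotopyPushout_of_isIso w (hl _ rfl) (hl _ (Finset.insert_comm _ _ _))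
  | cast i =>
    induction j using Fin.lastCases with
    | last => exact (hC.isHomotopyPushout_of_isIso w.symm (hl _ rfl) (hl _ rfl)).flip
    | cast j =>
      refine hX.of_eq (S := Goodwillie.restr S) (i := i) (j := j) (fun h => hi (mem_restr.1 h))
        (fun h => hj (mem_restr.1 h)) (fun h => hij (congrArg _ h)) (restr_insert_castSucc _ _)
        (restr_insert_castSucc _ _) ?_ _ _ _ _
      exact (restr_insert_castSucc _ _).trans (congrArg _ (restr_insert_castSucc _ _))

/-- Joins are pushout cubes. -/
theorem JoinModel.isPushoutCube {n : ℕ} (j : JoinModel C n) (X : CofibrantObject C) :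
    IsPushoutCube (fun _ => CofibrantObject.ι.map (j.toK.app X)) (j.join.obj X ⋙ CofibrantObject.ι)
      (CofibrantObject.ι.map (j.base.app X)) (fun i => CofibrantObject.ι.map ((j.arm i).app X)) where
  comm i := by
    obtain ⟨a, ha, b, hb, s⟩ := j.isPushout X {i}
    have e := congrArg (a.inj ⟨i, Finset.mem_singleton_self i⟩ ≫ ·) s.w
    simp only [Cofan.IsColimit.fac_assoc, Category.assoc, Cofan.IsColimit.fac, Category.id_comp] at e
    rw [Functor.map_comp, Functor.map_comp] at e
    refine Eq.trans ?_ e.symm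
    refine congrArg (CofibrantObject.ι.map (j.toK.app X) ≫ ·) ((Category.comp_id _).symm.trans ?_)
    exact congrArg (CofibrantObject.ι.map ((j.arm i).app X) ≫ ·)
      ((j.join.obj X ⋙ CofibrantObject.ι).map_id _).symm
  exists_desc T Z x y e := by
    obtain ⟨a, ha, b, hb, s⟩ := j.isPushout X T
    obtain ⟨d, hd, hd'⟩ := s.exists_desc x (Cofan.IsColimit.desc hb fun i => y i.1 i.2)
      (Cofan.IsColimit.hom_ext ha _ _ fun i => by
        simp only [Cofan.IsColimit.fac_assoc, Category.assoc, Cofan.IsColimit.fac, Category.id_comp,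
          e])
    refine ⟨d, ?_, fun i hi => ?_⟩
    · rw [← hd, Functor.map_comp, Category.assoc]; rfl
    · have e' := congrArg (b.inj ⟨i, hi⟩ ≫ ·) hd'
      simp only [Cofan.IsColimit.fac_assoc, Cofan.IsColimit.fac] at e'
      rw [← e', Functor.map_comp, Category.assoc]; rfl
  hom_ext T Z d d' e e' := by
    obtain ⟨a, ha, b, hb, s⟩ := j.isPushout X T
    refine s.hom_ext ?_ (Cofan.IsColimit.hom_ext hb _ _ fun i => ?_)
    · rw [Functor.map_comp, Category.assoc, Category.assoc]
      exact e
    · simp only [Cofan.IsColimit.fac_assoc, Functor.map_comp, Category.assoc]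
      exact e' i.1 i.2

/-- The cube of joins is strongly cocartesian. -/
theorem JoinModel.isStronglyCocartesian (hC : IsCofCat C) {n : ℕ} (j : JoinModel C n)
    (X : CofibrantObject C) : IsStronglyCocartesian (j.join.obj X ⋙ CofibrantObject.ι) :=
  (j.isPushoutCube X).isStronglyCocartesian hC (fun _ => j.cofibration_toK X) X.property

end Goodwillie

end

/-! ### Realization of a model category in complexes. -/

noncomputable section

namespace Goodwillie

open scoped ZeroObject
open Cx

/-! ### Realization of a category in complexes -/

/-- The set of the successors of the elements of a set of degrees. -/
def succSet (S : Set ℤ) : Set ℤ := {i | ∃ j ∈ S, i = j + 1}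

theorem succSet_subset {S : Set ℤ} (hS : UpClosed S) : succSet S ⊆ S := by
  rintro _ ⟨j, hj, rfl⟩
  exact hS j hj

theorem mem_succSet {S : Set ℤ} {i : ℤ} (hi : i ∈ S) : i + 1 ∈ succSet S := ⟨i, hi, rfl⟩

theorem upClosed_succSet {S : Set ℤ} (hS : UpClosed S) : UpClosed (succSet S) := by
  rintro _ ⟨j, hj, rfl⟩
  exact mem_succSet (hS j hj)

/-- An underlying complex functor that detects the homotopical structure of `D`. -/
structure Realization (D : Type*) [Category* D] [HasZeroMorphisms D] [HasZeroObject D]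
    [CategoryWithWeakEquivalences D] [CategoryWithFibrations D] where
  V : D ⥤ Cx.{u}
  -- The index i stands for homology in degree i+1. `S` is the range in which total fibers are
  -- controlled; objects themselves can have homology only in the range `succSet S`, since fibers
  -- extend one degree lower.
  S : Set ℤ
  upClosed : UpClosed S
  weq_iff : ∀ {X Y : D} (f : X ⟶ Y), WeakEquivalence f ↔ ∀ i, HIso (V.map f) i
  ex : ∀ (X : D) (i : ℤ), i ∉ succSet S → Ex (V.obj X) i
  map_zero : ∀ (X Y : D) (i : ℤ) (x : (V.obj X).X i), Hom.f (V.map (0 : X ⟶ Y)) i x = 0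
  -- The shift to degree i+2 accommodates fibrations of non-negative complexes, which need not be
  -- surjective in degree 0. For the fiber in degree i+1 only the degrees i+2 and i+3 matter, by
  -- `hIso_kernel_fib`.
  surjective : ∀ {X Y : D} (f : X ⟶ Y), Fibration f → ∀ i ∈ succSet S,
    Function.Surjective (Hom.f (V.map f) (i + 1 + 1))
  limit_ext : ∀ {J : Type} [SmallCategory J] {F : J ⥤ D} {c : Cone F}, IsLimit c →
    ∀ (i : ℤ) (x y : (V.obj c.pt).X i),
      (∀ j, Hom.f (V.map (c.π.app j)) i x = Hom.f (V.map (c.π.app j)) i y) → x = y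
  limit_exists : ∀ {J : Type} [SmallCategory J] {F : J ⥤ D} {c : Cone F}, IsLimit c →
    ∀ (i : ℤ) (y : ∀ j, (V.obj (F.obj j)).X i),
      (∀ (j j' : J) (f : j ⟶ j'), Hom.f (V.map (F.map f)) i (y j) = y j') →
      ∃ x : (V.obj c.pt).X i, ∀ j, Hom.f (V.map (c.π.app j)) i x = y j
  isNull : ∀ (F : ℕ ⥤ D) (c : Cocone F), IsColimit c → IsContractible c.pt →
    IsNull (succSet S) (F ⋙ V)

namespace Realization

variable {D : Type*} [Category* D] [HasZeroMorphisms D] [HasZeroObject D]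
  [CategoryWithWeakEquivalences D] [CategoryWithFibrations D]
  (R : Realization.{u} D)

theorem weq_of_hIsoOn {X Y : D} (f : X ⟶ Y) (h : hIsoOn (succSet R.S) (R.V.map f)) :
    WeakEquivalence f := (R.weq_iff f).2 fun i => by
  by_cases hi : i ∈ succSet R.S
  · exact h i hi
  · exact ⟨(R.ex X i hi).inj _, (R.ex Y i hi).surj _⟩

theorem ex_of_isContractible {X : D} (h : IsContractible X) (i : ℤ) : Ex (R.V.obj X) i :=
  fun x hx => ((R.weq_iff _).1 h i).1 x hx ⟨0, by rw [R.map_zero, _root_.map_zero]⟩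

variable {n : ℕ}

theorem sFib {Y : Subsets n ⥤ D} (hY : IsFibrantCube Y) : SFib (succSet R.S) (Y ⋙ R.V) := by
  intro U i hi y hy
  obtain ⟨c, hc, hf⟩ := hY U
  obtain ⟨z, hz⟩ := R.limit_exists hc _ y fun V V' f => hy V V' (leOfHom f)
  obtain ⟨x, hx⟩ := R.surjective _ hf i hi z
  refine ⟨x, fun V => ?_⟩
  rw [← hz V, ← hx, ← map_comp_f, hc.fac]
  rfl

/-- The underlying complex of a limit maps to the matching families. -/
def limitToMatch {Y : Subsets n ⥤ D} (c : Cone (above Y ∅)) :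
    R.V.obj c.pt ⟶ (matchF n).obj (Y ⋙ R.V) where
  f i :=
    { toFun := fun x => ⟨fun T => Hom.f (R.V.map (c.π.app T)) i x, fun T T' h =>
        (map_comp_f R.V (c.π.app T) ((above Y ∅).map (homOfLE h : T ⟶ T')) i x).symm.trans
          (congr_f (congrArg R.V.map (c.w (homOfLE h : T ⟶ T'))) i x)⟩
      map_zero' := matchCx.ext fun T => _root_.map_zero _
      map_add' := fun x y => matchCx.ext fun T => map_add _ _ _ }
  comm i x := matchCx.ext fun T => hom_d _ _ _

theorem limitToMatch_bijective {Y : Subsets n ⥤ D} {c : Cone (above Y ∅)} (hc : IsLimit c) (i : ℤ) :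
    Function.Bijective (Hom.f (R.limitToMatch c) i) := by
  refine ⟨fun x y h => R.limit_ext hc i x y fun T => congrArg (fun z => z.1 T) h, fun y => ?_⟩
  obtain ⟨x, hx⟩ := R.limit_exists hc i y.1 fun T T' f => y.2 T T' (leOfHom f)
  exact ⟨x, matchCx.ext hx⟩

theorem lift_limitToMatch {Y : Subsets n ⥤ D} {c : Cone (above Y ∅)} (hc : IsLimit c) :
    R.V.map (hc.lift (coneAt Y ∅)) ≫ R.limitToMatch c = (toMatch n).app (Y ⋙ R.V) :=
  hom_ext fun i x => matchCx.ext fun T =>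
    (map_comp_f R.V (hc.lift (coneAt Y ∅)) (c.π.app T) i x).symm.trans
      (congr_f (congrArg R.V.map (hc.fac (coneAt Y ∅) T)) i x)

theorem hIso_lam {Y : Subsets n ⥤ D} (hY : IsFibrantCube Y) :
    hIsoOn (succSet R.S) ((holimData n).lam.app (Y ⋙ R.V)) :=
  (R.sFib hY).hIso_lam (upClosed_succSet R.upClosed)

theorem hIso_tf_of_weq {X Y : Subsets n ⥤ D} (ρ : X ⟶ Y) (h : ∀ T, WeakEquivalence (ρ.app T))
    (i : ℤ) : HIso ((tf n).map (Functor.whiskerRight ρ R.V)) i :=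
  hIso_tf (Functor.whiskerRight ρ R.V) (fun T i => (R.weq_iff _).1 (h T) i) i

/-- The total fiber of a cartesian cube is acyclic. -/
theorem ex_tf_of_isCartesianCube {X : Subsets n ⥤ D} (hX : IsCartesianCube X) :
    ∀ i ∈ R.S, Ex ((tf n).obj (X ⋙ R.V)) i := by
  obtain ⟨Y, ρ, ⟨hρ, hY⟩, c, hc, hw⟩ := hX
  intro i hi
  refine Ex.of_hIso ?_ (R.hIso_tf_of_weq ρ hρ i).1
  have h : hIsoOn (succSet R.S) ((hlAug n).app (Y ⋙ R.V)) := fun j hj => by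
    refine HIso.comp ?_ (R.hIso_lam hY j hj)
    rw [← R.lift_limitToMatch hc]
    exact ((R.weq_iff _).1 hw j).comp (hIso_of_bijective _ (R.limitToMatch_bijective hc) j)
  refine ex_tf_iff.2 ⟨?_, (h _ (mem_succSet hi)).2⟩
  -- At the bottom of `S` the source has no homology and injectivity is vacuous; the content there
  -- is surjectivity one degree higher.
  by_cases hi' : i ∈ succSet R.S
  · exact (h i hi').1
  · exact (R.ex (Y.obj ∅) i hi').inj _

/-- A cube with acyclic total fiber and a fibrant replacement is cartesian. -/
theorem isCartesianCube_of_ex_tf {X Y : Subsets n ⥤ D} {ρ : X ⟶ Y} (hρ : IsFibrantReplacement ρ)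
    {c : Cone (above Y ∅)} (hc : IsLimit c) (h : ∀ i ∈ R.S, Ex ((tf n).obj (X ⋙ R.V)) i) :
    IsCartesianCube X := by
  refine ⟨Y, ρ, hρ, c, hc, R.weq_of_hIsoOn _ fun i hi => ?_⟩
  have h' : ∀ i ∈ R.S, Inj ((hlAug n).app (Y ⋙ R.V)) i ∧ Surj ((hlAug n).app (Y ⋙ R.V)) (i + 1) :=
    fun i hi => ex_tf_iff.1 ((h i hi).of_hIso' (R.hIso_tf_of_weq ρ hρ.1 i).2)
  have h₁ : HIso ((hlAug n).app (Y ⋙ R.V)) i := by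
    refine ⟨(h' i (succSet_subset R.upClosed hi)).1, ?_⟩
    obtain ⟨j, hj, rfl⟩ := hi
    exact (h' j hj).2
  have h₂ : HIso ((toMatch n).app (Y ⋙ R.V)) i :=
    HIso.of_comp_right (g := (holimData n).lam.app (Y ⋙ R.V)) h₁ (R.hIso_lam hρ.2 i hi)
  rw [← R.lift_limitToMatch hc] at h₂
  exact h₂.of_comp_right (hIso_of_bijective _ (R.limitToMatch_bijective hc) i)

/-- The map from the total fiber of a fibrant cube to the homotopy fiber. -/
theorem exists_totalFiber {Y : Subsets n ⥤ D} (hY : IsFibrantCube Y) {E : D} {e : E ⟶ Y.obj ∅}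
    (he : IsTotalFiber Y e) : ∃ κ : R.V.obj E ⟶ (tf n).obj (Y ⋙ R.V),
      (∀ i x, Hom.f κ i x = (Hom.f (R.V.map e) i x, 0)) ∧ hIsoOn (succSet R.S) κ := by
  obtain ⟨c, hc, w, ⟨hk⟩⟩ := he
  have hz : ∀ i x, Hom.f ((toMatch n).app (Y ⋙ R.V)) i (Hom.f (R.V.map e) i x) = 0 := fun i x => by
    rw [← R.lift_limitToMatch hc, comp_f, ← map_comp_f, w, R.map_zero, _root_.map_zero]
  -- First from the strict kernel to the mapping fiber over the strict limit, then along `lam` to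
  -- the model of the homotopy limit. Fibrancy of the cube makes both maps bijective on homology in
  -- range.
  let κ : R.V.obj E ⟶ Fib ((toMatch n).app (Y ⋙ R.V)) := Fib.liftKer (R.V.map e) hz
  let μ : Fib ((toMatch n).app (Y ⋙ R.V)) ⟶ (tf n).obj (Y ⋙ R.V) :=
    Fib.map (f' := (hlAug n).app (Y ⋙ R.V)) (𝟙 _) ((holimData n).lam.app (Y ⋙ R.V)) rfl
  refine ⟨κ ≫ μ, fun i x => Prod.ext rfl
    (_root_.map_zero (Hom.f ((holimData n).lam.app (Y ⋙ R.V)) (i + 1))), fun i hi => ?_⟩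
  have hμ : HIso μ i := (fibStable_hIsoOn (upClosed_succSet R.upClosed)).fib
    (f' := (hlAug n).app (Y ⋙ R.V)) (𝟙 _) ((holimData n).lam.app (Y ⋙ R.V)) rfl
    (fun j _ => hIso_id _ j) (R.hIso_lam hY) i hi
  refine HIso.comp ?_ hμ
  refine hIso_kernel_fib (fun _ _ => rfl) (fun j x y h => ?_) (fun j a ha => ?_)
    ((R.sFib hY).toMatch_surjective hi)
    ((R.sFib hY).toMatch_surjective (upClosed_succSet R.upClosed i hi))
  · have h' : Hom.f (R.V.map e) j x = Hom.f (R.V.map e) j y := congrArg Prod.fst h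
    refine R.limit_ext hk j x y fun b => ?_
    cases b with
    | zero => exact h'
    | one =>
      have e₁ := KernelFork.app_one (KernelFork.ofι e w)
      rw [e₁, R.map_zero, R.map_zero]
  · have ha' : Hom.f (R.V.map (hc.lift (coneAt Y ∅))) j a = 0 := by
      refine (R.limitToMatch_bijective hc j).1 ?_
      rw [_root_.map_zero]
      exact (congr_f (R.lift_limitToMatch hc) j a).trans ha
    obtain ⟨x, hx⟩ := R.limit_exists hk j
      (fun b => match b with
        | .zero => a
        | .one => 0) (fun b b' f => by
          revert f
          change ∀ f : WalkingParallelPairHom b b', _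
          intro f
          cases f with
          | left => exact ha'
          | right => exact R.map_zero _ _ _ _
          | id => exact map_id_f R.V j _)
    exact ⟨x, Prod.ext (hx .zero) rfl⟩

/-- Only the degrees of `succSet` can be reached: the total fiber formed in the category need not
see the bottom degree of the unbounded one. -/
theorem ex_tf_of_hasContractibleTotalFiber {X : Subsets n ⥤ D} (hX : HasContractibleTotalFiber X) :
    ∀ i ∈ succSet R.S, Ex ((tf n).obj (X ⋙ R.V)) i := by
  obtain ⟨Y, ρ, ⟨hρ, hY⟩, E, e, he, hE⟩ := hX
  obtain ⟨κ, -, hκ⟩ := R.exists_totalFiber hY he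
  intro i hi
  exact ((R.ex_of_isContractible hE i).of_hIso' (hκ i hi).2).of_hIso (R.hIso_tf_of_weq ρ hρ i).1

/-- The strict total fibers of the fibrant replacements map to the models compatibly, so the
equivalence transfers, with the same loss of the bottom degree. -/
theorem hIso_tf_of_isTotalFiberEquivalence {X X' : Subsets n ⥤ D} {φ : X ⟶ X'}
    (h : IsTotalFiberEquivalence φ) :
    ∀ i ∈ succSet R.S, HIso ((tf n).map (Functor.whiskerRight φ R.V)) i := by
  obtain ⟨Y, Y', ρ, ρ', ψ, ⟨hρ, hY⟩, ⟨hρ', hY'⟩, w, E, E', e, e', v, he, he', hv, hv'⟩ := h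
  obtain ⟨κ, k, hκ⟩ := R.exists_totalFiber hY he
  obtain ⟨κ', k', hκ'⟩ := R.exists_totalFiber hY' he'
  intro i hi
  have w₁ : κ ≫ (tf n).map (Functor.whiskerRight ψ R.V) = R.V.map v ≫ κ' := hom_ext fun j x => by
    rw [comp_f, comp_f, k, k', ← map_comp_f, hv, map_comp_f]
    exact Prod.ext rfl (_root_.map_zero (Hom.f ((hl n).map (Functor.whiskerRight ψ R.V)) (j + 1)))
  have h₁ : HIso ((tf n).map (Functor.whiskerRight ψ R.V)) i :=
    HIso.of_comp_left (f := κ) (w₁ ▸ ((R.weq_iff v).1 hv' i).comp (hκ' i hi)) (hκ i hi)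
  have w₂ : (tf n).map (Functor.whiskerRight ρ R.V) ≫ (tf n).map (Functor.whiskerRight ψ R.V) =
      (tf n).map (Functor.whiskerRight φ R.V) ≫ (tf n).map (Functor.whiskerRight ρ' R.V) := by
    rw [← Functor.map_comp, ← Functor.map_comp, ← Functor.whiskerRight_comp,
      ← Functor.whiskerRight_comp, w]
  exact HIso.of_comp_right (g := (tf n).map (Functor.whiskerRight ρ' R.V))
    (w₂ ▸ (R.hIso_tf_of_weq ρ hρ i).comp h₁) (R.hIso_tf_of_weq ρ' hρ' i)

end Realization

end Goodwillie

end

/-! ### The two statements, for a source with cofibrations and a realized target. -/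

noncomputable section

namespace Goodwillie

open scoped ZeroObject
open Cx

/-! ### Fibrant replacements of faces -/

section Faces

/-- The nonempty extensions of `S` and those of its image in a face. -/
def aboveInc1 {n : ℕ} (S : Subsets n) : Above S ≌ Above ((inc1 n).obj S) where
  functor := Monotone.functor (f := fun T => ⟨(inc1 n).obj T.1, inc1_lt T.2⟩) fun _ _ h =>
    leOfHom ((inc1 n).map (homOfLE h))
  inverse := Monotone.functor (f := fun T => ⟨restr T.1, lt_restr_of_inc1_lt T.2⟩) fun _ _ h =>
    restr_mono h
  unitIso := NatIso.ofComponents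
    (fun T => eqToIso (Subtype.ext (restr_inc1 T.1).symm)) fun _ => Subsingleton.elim _ _
  counitIso := NatIso.ofComponents
    (fun T => eqToIso (Subtype.ext (inc1_restr (inc1_le_iff.1 T.2.le).2)))
    fun _ => Subsingleton.elim _ _
  functor_unitIso_comp _ := Subsingleton.elim _ _

variable {D : Type*} [Category* D] [HasZeroMorphisms D] [HasZeroObject D]
  [CategoryWithWeakEquivalences D] [CategoryWithFibrations D]

theorem IsFibrantCube.face1 {n : ℕ} {Y : Subsets (n + 1) ⥤ D} (hY : IsFibrantCube Y) :
    IsFibrantCube (inc1 n ⋙ Y) := by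
  intro S
  obtain ⟨c, hc, hf⟩ := hY ((inc1 n).obj S)
  let c' : Cone (above (inc1 n ⋙ Y) S) := c.whisker (aboveInc1 S).functor
  have hc' : IsLimit c' := hc.whiskerEquivalence (aboveInc1 S)
  refine ⟨c', hc', ?_⟩
  have e : hc'.lift (coneAt (inc1 n ⋙ Y) S) = hc.lift (coneAt Y ((inc1 n).obj S)) :=
    hc'.hom_ext fun T => (hc'.fac _ T).trans (hc.fac (coneAt Y ((inc1 n).obj S)) ((aboveInc1 S).functor.obj T)).symm
  rw [e]
  exact hf

/-- Cartesianness includes the existence of a fibrant replacement, and excision provides one only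
for cubes of one dimension more. The cube is therefore doubled, and the replacement of the double is
restricted to a face. -/
theorem exists_fibrantReplacement_of_restr [CategoryWithCofibrations D] (R : Realization.{u} D) {n : ℕ} {X : Subsets n ⥤ D}
    (h : IsCartesianCube (restrF n ⋙ X)) :
    ∃ (Y : Subsets n ⥤ D) (ρ : X ⟶ Y), IsFibrantReplacement ρ := by
  obtain ⟨Y, ρ, ⟨hρ, hY⟩, -⟩ := h
  let η : X ⟶ inc1 n ⋙ restrF n ⋙ X :=
    { app := fun T => X.map (homOfLE (restr_inc1 T).ge)
      naturality := fun S T f => by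
        refine (X.map_comp _ _).symm.trans (Eq.trans ?_ (X.map_comp _ _))
        exact congrArg X.map (Subsingleton.elim _ _) }
  refine ⟨inc1 n ⋙ Y, η ≫ Functor.whiskerLeft (inc1 n) ρ, fun T => ?_, hY.face1⟩
  refine (R.weq_iff _).2 fun i => ?_
  have : IsIso (η.app T) := Subsets.isIso_map X _ (restr_inc1 T).le
  have e : R.V.map ((η ≫ Functor.whiskerLeft (inc1 n) ρ).app T) =
    R.V.map (η.app T) ≫ R.V.map (ρ.app ((inc1 n).obj T)) := R.V.map_comp _ _
  rw [e]
  exact (hIso_of_isIso _ i).comp ((R.weq_iff _).1 (hρ _) i)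

end Faces

variable {C : Type*} [Category* C] [HasZeroMorphisms C] [HasZeroObject C]
  [CategoryWithWeakEquivalences C] [CategoryWithFibrations C] [CategoryWithCofibrations C]
  {D : Type*} [Category* D] [HasZeroMorphisms D] [HasZeroObject D]
  [CategoryWithWeakEquivalences D] [CategoryWithFibrations D] [CategoryWithCofibrations D]

/-- An excisive functor without cross-effect has a smaller degree of excision. -/
theorem isExcisive_of_hasContractibleCrossEffect (hC : IsCofCat C) (R : Realization.{u} D) {m : ℕ}
    {H : C ⥤ D} (hH : IsHomotopyFunctor H) (he : IsExcisive (m + 1) H)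
    (hcr : HasContractibleCrossEffect (m + 1) H) : IsExcisive m H := by
  intro X hX
  obtain ⟨Y, ρ, hρ⟩ := exists_fibrantReplacement_of_restr R (X := X ⋙ H) (he _ (hX.restr hC))
  obtain ⟨c, hc, -⟩ := hρ.2 ∅
  refine R.isCartesianCube_of_ex_tf hρ hc ?_
  refine ex_tf_of_crossEffect hC (H ⋙ R.V) (fun f hf => (R.weq_iff _).1 (hH f hf)) ?_ ?_ X hX
  · exact fun W hW => R.ex_tf_of_isCartesianCube (he W hW)
  · intro Q Φ P hQ e i
    -- Outside `succSet` the values have no homology, and split surjectivity of the projections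
    -- gives the missing bottom degree.
    by_cases hi : i ∈ succSet R.S
    · have h := hcr Q hQ P
      rw [e] at h
      exact R.ex_tf_of_hasContractibleTotalFiber h i hi
    · exact PSet.ex_tf_proj (Φ ⋙ H ⋙ R.V) fun S => R.ex _ i hi

/-! ### Taylor towers with values in complexes -/

section Tower

variable {n : ℕ} (j : JoinModel C n)

/-- The functor `U ↦ (X ↦ holim_{T ≠ ∅} U(X * T))`. -/
def cxT : (CofibrantObject C ⥤ Cx.{u}) ⥤ (CofibrantObject C ⥤ Cx.{u}) :=
  Functor.whiskeringRight (Subsets n) (CofibrantObject C) Cx.{u} ⋙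
    (Functor.whiskeringRight _ _ _).obj (hl n) ⋙ (Functor.whiskeringLeft _ _ _).obj j.join

/-- The natural map `U ⟶ T U`. -/
def cxt : 𝟭 (CofibrantObject C ⥤ Cx.{u}) ⟶ cxT j where
  app U :=
    { app := fun X => U.map (j.base.app X) ≫ (hlAug n).app (j.join.obj X ⋙ U)
      naturality := fun X Y f => by
        have e₁ := (hlAug n).naturality (Functor.whiskerRight (j.join.map f) U)
        have e₂ := congrArg U.map (j.base.naturality f)
        dsimp [cxT] at e₁ e₂ ⊢
        rw [U.map_comp, U.map_comp] at e₂
        rw [reassoc_of% e₂, Category.assoc, e₁] }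
  naturality U U' φ := by
    ext X : 2
    have e₁ := (hlAug n).naturality (Functor.whiskerLeft (j.join.obj X) φ)
    have e₂ := φ.naturality (j.base.app X)
    dsimp [cxT] at e₁ e₂ ⊢
    rw [← reassoc_of% e₂, Category.assoc, e₁]
    rfl

/-- The iterates of `T`. -/
def cxIter : ℕ → ((CofibrantObject C ⥤ Cx.{u}) ⥤ (CofibrantObject C ⥤ Cx.{u}))
  | 0 => 𝟭 _
  | p + 1 => cxIter p ⋙ cxT j

/-- The map to the iterates of `T`. -/
def toIter : ∀ p : ℕ, 𝟭 (CofibrantObject C ⥤ Cx.{u}) ⟶ cxIter j p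
  | 0 => 𝟙 _
  | p + 1 => toIter p ≫ Functor.whiskerLeft (cxIter j p) (cxt j)

/-- By naturality of t the new application of T may be placed first instead of last, which suits
induction through classes stable under T. -/
theorem toIter_succ_app (p : ℕ) (U : CofibrantObject C ⥤ Cx.{u}) :
    (toIter j (p + 1)).app U = (cxt j).app U ≫ (cxT j).map ((toIter j p).app U) :=
  (cxt j).naturality ((toIter j p).app U)

theorem FibStable.cxIter {W : MorphismProperty Cx.{u}} (hW : FibStable W)
    {U U' : CofibrantObject C ⥤ Cx.{u}} (φ : U ⟶ U') (hφ : ∀ X, W (φ.app X)) (p : ℕ) :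
    ∀ X, W (((cxIter j p).map φ).app X) := by
  induction p with
  | zero => exact hφ
  | succ p ih =>
    exact fun X => hW.hl (Functor.whiskerLeft (j.join.obj X) ((Goodwillie.cxIter j p).map φ))
      fun T => ih _

theorem ses_cxIter {U U' U'' : CofibrantObject C ⥤ Cx.{u}} {φ : U ⟶ U'} {ψ : U' ⟶ U''}
    (h : ∀ X, SES (φ.app X) (ψ.app X)) (p : ℕ) :
    ∀ X, SES (((cxIter j p).map φ).app X) (((cxIter j p).map ψ).app X) := by
  induction p with
  | zero => exact h
  | succ p ih =>
    exact fun X => ses_hl (φ := Functor.whiskerLeft (j.join.obj X) ((cxIter j p).map φ))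
      (ψ := Functor.whiskerLeft (j.join.obj X) ((cxIter j p).map ψ)) fun T => ih _

theorem isNull_cxIter {S : Set ℤ} (hS : UpClosed S) (Y : ℕ ⥤ (CofibrantObject C ⥤ Cx.{u}))
    (hY : ∀ X, IsNull S (Y ⋙ (evaluation _ _).obj X)) (p : ℕ) :
    ∀ X, IsNull S (Y ⋙ cxIter j p ⋙ (evaluation _ _).obj X) := by
  induction p with
  | zero => exact hY
  | succ p ih =>
    exact fun X => isNull_hl hS
      (Y ⋙ cxIter j p ⋙ (Functor.whiskeringLeft _ _ _).obj (j.join.obj X)) fun T => ih _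

/-- Acyclic total fibers on the cubes of joins say that U → T U lies in the class `Eqv S`. This
class is stable under T and composition, so it contains the maps to all iterates. -/
theorem eqv_toIter {S : Set ℤ} (hS : UpClosed S) {U : CofibrantObject C ⥤ Cx.{u}}
    (h : ∀ X, ∀ i ∈ S, Ex ((tf n).obj (j.join.obj X ⋙ U)) i)
    (hb : ∀ X i, HIso (U.map (j.base.app X)) i) (p : ℕ) :
    ∀ X, Eqv S (((toIter j p).app U).app X) := by
  have h₁ : ∀ X, Eqv S (((cxt j).app U).app X) := fun X =>
    Eqv.comp (fun i _ => ⟨(hb X i).1, (hb X (i + 1)).2⟩) fun i hi => ex_tf_iff.1 (h X i hi)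
  induction p with
  | zero => exact fun X i _ => ⟨(hIso_id _ _).1, (hIso_id _ _).2⟩
  | succ p ih =>
    intro X
    rw [toIter_succ_app]
    exact (h₁ X).comp ((fibStable_eqv hS).cxIter j _ ih 1 X)

/-- `β` is obtained from `α` by composition with maps, and by cancelling maps that are bijective on
homology in the degrees in `S`. -/
inductive Dominates (S : Set ℤ) {A B : CofibrantObject C ⥤ Cx.{u}} (α : A ⟶ B) :
    ∀ {B' : CofibrantObject C ⥤ Cx.{u}}, (A ⟶ B') → Prop
  | refl : Dominates S α α
  | post {B' B'' : CofibrantObject C ⥤ Cx.{u}} {β : A ⟶ B'} (f : B' ⟶ B'') :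
      Dominates S α β → Dominates S α (β ≫ f)
  | cancel {B' B'' : CofibrantObject C ⥤ Cx.{u}} {β : A ⟶ B'} (w : B' ⟶ B'') :
      (∀ X, hIsoOn S (w.app X)) → Dominates S α (β ≫ w) → Dominates S α β

namespace Dominates

variable {S : Set ℤ} {A B B' B'' : CofibrantObject C ⥤ Cx.{u}} {α : A ⟶ B} {β : A ⟶ B'}
  {γ : A ⟶ B''}

theorem trans (h : Dominates S α β) (h' : Dominates S β γ) : Dominates S α γ := by
  induction h' with
  | refl => exact h
  | post f _ ih => exact ih.post f
  | cancel w hw _ ih => exact ih.cancel w hw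

theorem precomp (h : Dominates S α β) {A' : CofibrantObject C ⥤ Cx.{u}} (f : A' ⟶ A) :
    Dominates S (f ≫ α) (f ≫ β) := by
  induction h with
  | refl => exact .refl
  | post g _ ih => rw [← Category.assoc]; exact ih.post g
  | cancel w hw _ ih => exact .cancel w hw (by rwa [Category.assoc])

theorem map (hS : UpClosed S) (h : Dominates S α β) (p : ℕ) :
    Dominates S ((cxIter j p).map α) ((cxIter j p).map β) := by
  induction h with
  | refl => exact .refl
  | post g _ ih => rw [Functor.map_comp]; exact ih.post _
  | cancel w hw _ ih =>
    exact .cancel _ ((fibStable_hIsoOn hS).cxIter j w hw p) (by rwa [Functor.map_comp] at ih)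

/-- This is the purpose of the relation: a cycle killed by `α` is killed by `β`. Postcomposition
keeps boundaries, and a cancelled map is injective on homology. -/
theorem exists_boundary (h : Dominates S α β) {X : CofibrantObject C} {i : ℤ} (hi : i ∈ S)
    {x : (A.obj X).X (i + 1)} (hx : (A.obj X).d i x = 0)
    (hα : ∃ y, (B.obj X).d (i + 1) y = Hom.f (α.app X) (i + 1) x) :
    ∃ y, (B'.obj X).d (i + 1) y = Hom.f (β.app X) (i + 1) x := by
  induction h with
  | refl => exact hα
  | post g _ ih =>
    obtain ⟨y, hy⟩ := ih
    exact ⟨Hom.f (g.app X) _ y, by rw [← hom_d, hy]; rfl⟩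
  | cancel w hw _ ih =>
    exact (hw X i hi).1 _ (by rw [← hom_d, hx, _root_.map_zero]) ih

end Dominates

variable (R : Realization.{u} D) (h : HolimModel D n)

theorem taylorMap_naturality {F G : CofibrantObject C ⥤ D} (φ : F ⟶ G) :
    φ ≫ taylorMap j h G = taylorMap j h F ≫ (taylorT j h).map φ := by
  ext X : 2
  have e₁ := h.aug.naturality (Functor.whiskerLeft (j.join.obj X) φ)
  have e₂ := φ.naturality (j.base.app X)
  dsimp [taylorT, taylorMap] at e₁ e₂ ⊢
  rw [← reassoc_of% e₂, Category.assoc, e₁]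
  rfl

/-- The map to the iterates of `T`. -/
def toTaylorIter (F : CofibrantObject C ⥤ D) (l : ℕ) : F ⟶ taylorIter j h F l :=
  (taylorSequence j h F).map (homOfLE (Nat.zero_le l))

theorem toTaylorIter_zero (F : CofibrantObject C ⥤ D) : toTaylorIter j h F 0 = 𝟙 F :=
  (taylorSequence j h F).map_id 0

theorem toTaylorIter_succ (F : CofibrantObject C ⥤ D) (l : ℕ) :
    toTaylorIter j h F (l + 1) = toTaylorIter j h F l ≫ taylorIterMap j h F l := by
  have e := Functor.ofSequence_map_homOfLE_succ (taylorIterMap j h F) l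
  rw [← e]
  exact (taylorSequence j h F).map_comp (homOfLE (Nat.zero_le l)) (homOfLE (Nat.le_add_right l 1))

/-- The tower is defined with the maps T^l(t), while induction needs t at T^l F. After
precomposition with F → T^l F the two agree by naturality. -/
theorem toTaylorIter_succ' (F : CofibrantObject C ⥤ D) (l : ℕ) :
    toTaylorIter j h F (l + 1) = toTaylorIter j h F l ≫ taylorMap j h (taylorIter j h F l) := by
  rw [taylorMap_naturality]
  induction l with
  | zero =>
    rw [toTaylorIter_succ, toTaylorIter_zero]
    refine (Category.id_comp (taylorMap j h F)).trans ?_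
    refine Eq.trans ?_ (congrArg (taylorMap j h F ≫ ·) ((taylorT j h).map_id F).symm)
    exact (Category.comp_id _).symm
  | succ l ih =>
    refine (toTaylorIter_succ j h F (l + 1)).trans ((congrArg (· ≫ _) ih).trans ?_)
    refine (Category.assoc _ _ _).trans (congrArg (taylorMap j h F ≫ ·) ?_)
    exact ((taylorT j h).map_comp _ _).symm.trans
      (congrArg (taylorT j h).map (toTaylorIter_succ j h F l).symm)

/-- The comparison of `T` with its analogue for complexes, after fibrant replacement. -/
theorem exists_comparison (U : CofibrantObject C ⥤ D) :
    ∃ (Z : CofibrantObject C ⥤ Cx.{u}) (w : (cxT j).obj (U ⋙ R.V) ⟶ Z)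
      (v : (taylorT j h).obj U ⋙ R.V ⟶ Z), (∀ X, hIsoOn (succSet R.S) (w.app X)) ∧
      Functor.whiskerRight (taylorMap j h U) R.V ≫ v = (cxt j).app (U ⋙ R.V) ≫ w := by
  let G : CofibrantObject C ⥤ (Subsets n ⥤ D) := j.join ⋙ (Functor.whiskeringRight _ _ _).obj U
  let VV : (Subsets n ⥤ D) ⥤ (Subsets n ⥤ Cx.{u}) := (Functor.whiskeringRight _ _ _).obj R.V
  -- The strict limit in `D` and the model in complexes both map to the model applied to the fibrant
  -- replacement. Only `w` needs to be invertible on homology.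
  let w : (cxT j).obj (U ⋙ R.V) ⟶ G ⋙ h.R ⋙ VV ⋙ hl n :=
    Functor.whiskerRight (Functor.whiskerLeft G h.toR) (VV ⋙ hl n)
  let v : (taylorT j h).obj U ⋙ R.V ⟶ G ⋙ h.R ⋙ VV ⋙ hl n :=
    { app := fun X => R.limitToMatch (h.cone (G.obj X)) ≫
        (holimData n).lam.app (h.R.obj (G.obj X) ⋙ R.V)
      naturality := fun X Y f => by
        have e := (holimData n).lam.naturality (Functor.whiskerRight (h.R.map (G.map f)) R.V)
        have e' : R.V.map (h.holim.map (G.map f)) ≫ R.limitToMatch (h.cone (G.obj Y)) =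
            R.limitToMatch (h.cone (G.obj X)) ≫
              (matchF n).map (Functor.whiskerRight (h.R.map (G.map f)) R.V) :=
          hom_ext fun i x => matchCx.ext fun T =>
            (map_comp_f R.V (h.holim.map (G.map f)) ((h.cone (G.obj Y)).π.app T) i x).symm.trans
              ((congr_f (congrArg R.V.map (IsLimit.map_π _ _ _ _)) i x).trans
                (map_comp_f R.V _ _ i x))
        refine (Category.assoc _ _ _).symm.trans ((congrArg (· ≫ _) e').trans ?_)
        refine (Category.assoc _ _ _).trans (Eq.trans ?_ (Category.assoc _ _ _).symm)
        exact congrArg (R.limitToMatch (h.cone (G.obj X)) ≫ ·) e }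
  refine ⟨_, w, v, fun X => ?_, ?_⟩
  · exact (fibStable_hIsoOn (upClosed_succSet R.upClosed)).hl
      (Functor.whiskerRight (h.toR.app (G.obj X)) R.V)
      fun T i _ => (R.weq_iff _).1 ((h.isFibrantReplacement (G.obj X)).1 T) i
  · ext X : 2
    have e := R.lift_limitToMatch (h.isLimit (G.obj X))
    have e₂ := (hlAug n).naturality (Functor.whiskerRight (h.toR.app (G.obj X)) R.V)
    change R.V.map (U.map (j.base.app X) ≫ (h.toR.app (G.obj X)).app ∅ ≫
        (h.isLimit (G.obj X)).lift (coneAt (h.R.obj (G.obj X)) ∅)) ≫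
        R.limitToMatch (h.cone (G.obj X)) ≫ (holimData n).lam.app (h.R.obj (G.obj X) ⋙ R.V) =
      (R.V.map (U.map (j.base.app X)) ≫ (hlAug n).app (j.join.obj X ⋙ U ⋙ R.V)) ≫
        (hl n).map (Functor.whiskerRight (h.toR.app (G.obj X)) R.V)
    rw [R.V.map_comp, R.V.map_comp, Category.assoc, Category.assoc, Category.assoc,
      reassoc_of% e]
    exact congrArg (R.V.map (U.map (j.base.app X)) ≫ ·) e₂

/-- The comparison of the two towers is a zigzag that lengthens with each stage. The relation
records just enough of it to transport vanishing of classes, without inverting any map. -/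
theorem dominates_toIter (F : CofibrantObject C ⥤ D) (l : ℕ) :
    Dominates (succSet R.S) (Functor.whiskerRight (toTaylorIter j h F l) R.V)
      ((toIter j l).app (F ⋙ R.V)) := by
  induction l with
  | zero =>
    have e : Functor.whiskerRight (toTaylorIter j h F 0) R.V = (toIter j 0).app (F ⋙ R.V) :=
      (congrArg (Functor.whiskerRight · R.V) (toTaylorIter_zero j h F)).trans
        (Functor.whiskerRight_id' R.V)
    rw [← e]
    exact Dominates.refl
  | succ l ih =>
    obtain ⟨Z, w, v, hw, e⟩ := exists_comparison j R h (taylorIter j h F l)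
    have h₁ : Dominates (succSet R.S) (Functor.whiskerRight (toTaylorIter j h F (l + 1)) R.V)
        (Functor.whiskerRight (toTaylorIter j h F l) R.V ≫
          (cxt j).app (taylorIter j h F l ⋙ R.V)) := by
      refine .cancel w hw ?_
      rw [Category.assoc, ← e, ← Category.assoc, ← Functor.whiskerRight_comp, ← toTaylorIter_succ']
      exact .post v .refl
    have e₁ : Functor.whiskerRight (toTaylorIter j h F l) R.V ≫
        (cxt j).app (taylorIter j h F l ⋙ R.V) = (cxt j).app (F ⋙ R.V) ≫
          (cxT j).map (Functor.whiskerRight (toTaylorIter j h F l) R.V) :=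
      (cxt j).naturality (Functor.whiskerRight (toTaylorIter j h F l) R.V)
    rw [e₁] at h₁
    rw [toIter_succ_app]
    exact h₁.trans ((ih.map j (upClosed_succSet R.upClosed) 1).precomp _)

/-- If the Taylor tower of `F` is contractible, cycles die in iterates of the tower. -/
theorem exists_boundary_of_hasContractibleTaylor {m : ℕ} (j₀ : JoinModel C m)
    {F : CofibrantObject C ⥤ D}
    (hF : ∀ X, ∃ (c : Cocone (taylorSequence j h F ⋙ (evaluation _ _).obj X))
      (_ : IsColimit c), IsContractible c.pt) (p : ℕ) {X : CofibrantObject C} {i : ℤ}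
    (hi : i ∈ succSet R.S) {x : (((cxIter j₀ p).obj (F ⋙ R.V)).obj X).X (i + 1)}
    (hx : (((cxIter j₀ p).obj (F ⋙ R.V)).obj X).d i x = 0) :
    ∃ l y, (((cxIter j₀ p).obj ((cxIter j l).obj (F ⋙ R.V))).obj X).d (i + 1) y =
      Hom.f (((cxIter j₀ p).map ((toIter j l).app (F ⋙ R.V))).app X) (i + 1) x := by
  have hS := upClosed_succSet R.upClosed
  -- Applying a fixed iterate of T involves finitely many products and fibers, and these preserve
  -- eventual vanishing in a sequence.
  obtain ⟨l, g, y, hy⟩ := isNull_cxIter j₀ hS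
    (taylorSequence j h F ⋙ (Functor.whiskeringRight _ _ _).obj R.V) (fun X => by
      obtain ⟨c, hc, hc'⟩ := hF X
      exact R.isNull _ c hc hc') p X 0 i hi x hx
  refine ⟨l, ((dominates_toIter j R h F l).map j₀ hS p).exists_boundary hi hx ⟨y, hy.trans ?_⟩⟩
  rw [Subsingleton.elim g (homOfLE (Nat.zero_le l))]
  rfl

end Tower

/-- A map of homogeneous functors that is an equivalence on cross-effects is an equivalence. -/
theorem weq_of_isCrossEffectEquivalence (hC : IsCofCat C) (R : Realization.{u} D) {n : ℕ}
    {F G : C ⥤ D} (J : F ⟶ G) (hF : IsHomogeneous n F) (hG : IsHomogeneous n G)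
    (hJ : IsCrossEffectEquivalence n J) (X : C) : WeakEquivalence (J.app X) := by
  let φ : F ⋙ R.V ⟶ G ⋙ R.V := Functor.whiskerRight J R.V
  have hFV : ∀ {X Y : C} (f : X ⟶ Y), WeakEquivalence f → ∀ i, HIso ((F ⋙ R.V).map f) i :=
    fun f hf => (R.weq_iff _).1 (hF.isHomotopyFunctor f hf)
  have hGV : ∀ {X Y : C} (f : X ⟶ Y), WeakEquivalence f → ∀ i, HIso ((G ⋙ R.V).map f) i :=
    fun f hf => (R.weq_iff _).1 (hG.isHomotopyFunctor f hf)
  -- The fiber of J is formed in complexes, where mapping fibers are functorial; it need not come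
  -- from a functor to `D`.
  have hH : ∀ {X Y : C} (f : X ⟶ Y), WeakEquivalence f → ∀ i, HIso ((fibF φ).map f) i :=
    fun f hf i => (fibStable_hIsoOn (S := Set.univ) fun _ _ => trivial).fib _ _
      (φ.naturality f).symm (fun i _ => hFV f hf i) (fun i _ => hGV f hf i) i trivial
  have core : ∀ X : Subsets n ⥤ C, IsStronglyCocartesian X → ∀ i ∈ R.S,
      Ex ((tf n).obj (X ⋙ fibF φ)) i := by
    refine ex_tf_of_crossEffect hC (fibF φ) hH (fun W hW i hi => ?_) fun Q Φ P hQ e i => ?_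
    -- Excision of F gives degree i and excision of G degree i+1, as the long exact sequence
    -- requires.
    · refine (ex_tf_fibF_iff (Functor.whiskerLeft W φ)).2 ⟨?_, ?_⟩
      · exact (R.ex_tf_of_isCartesianCube (hF.isExcisive W hW) i hi).inj _
      · exact (R.ex_tf_of_isCartesianCube (hG.isExcisive W hW) _ (R.upClosed i hi)).surj _
    · have h := hJ Q hQ P
      rw [e] at h
      have h' : ∀ i, HIso ((tf n).map (Functor.whiskerLeft (PSet.proj n ⋙ Φ) φ)) i := fun i => by
        -- Below the range that the hypothesis covers, both projection cubes have acyclic total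
        -- fibers.
        by_cases hi : i ∈ succSet R.S
        · exact R.hIso_tf_of_isTotalFiberEquivalence h i hi
        · have h₁ : Ex ((tf n).obj (PSet.proj n ⋙ Φ ⋙ F ⋙ R.V)) i :=
            PSet.ex_tf_proj (Φ ⋙ F ⋙ R.V) fun S => R.ex _ i hi
          have h₂ : Ex ((tf n).obj (PSet.proj n ⋙ Φ ⋙ G ⋙ R.V)) i :=
            PSet.ex_tf_proj (Φ ⋙ G ⋙ R.V) fun S => R.ex _ i hi
          exact ⟨h₁.inj _, h₂.surj _⟩
      exact (ex_tf_fibF_iff (Functor.whiskerLeft (PSet.proj n ⋙ Φ) φ)).2 ⟨(h' i).1, (h' _).2⟩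
  obtain ⟨jF, hF', cF⟩ := hF.contractible
  obtain ⟨jG, hG', cG⟩ := hG.contractible
  let ι : CofibrantObject C ⥤ C := CofibrantObject.ι
  let A : CofibrantObject C ⥤ Cx.{u} := ι ⋙ F ⋙ R.V
  let B : CofibrantObject C ⥤ Cx.{u} := ι ⋙ G ⋙ R.V
  let χ : A ⟶ B := Functor.whiskerLeft ι φ
  have hbase : ∀ (j : JoinModel C n) (X : CofibrantObject C) (i : ℤ),
      HIso ((fibF χ).map (j.base.app X)) i := fun j X i => by
    have := (j.isPushoutCube X).isIso_base
    exact hH _ (hC.weq_of_iso _ (this hC)) i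
  -- Cubes of joins are strongly cocartesian, so `core` makes the fiber behave like an
  -- (n-1)-excisive functor: its homology injects into every iterate, for either model of the joins.
  have heqv : ∀ (j : JoinModel C n) (p : ℕ) (X : CofibrantObject C),
      Eqv R.S (((toIter j p).app (fibF χ)).app X) := fun j p =>
    eqv_toIter j R.upClosed (U := fibF χ) (fun X => core (j.join.obj X ⋙ ι) (j.isStronglyCocartesian hC X))
      (hbase j) p
  have hex : ∀ (X : CofibrantObject C), ∀ i ∈ R.S, Ex ((fibF χ).obj X) i := by
    intro X i hi x hx
    have ses := ses_cocyl χ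
    -- the image of `x` in the mapping path space dies in the tower of `F`
    obtain ⟨p, y, hy⟩ : ∃ p y, (((cxIter jF p).obj (cocyl A B)).obj X).d (i + 1) y =
        Hom.f (((toIter jF p).app (cocyl A B)).app X) (i + 1)
          (Hom.f ((fibToCocyl χ).app X) (i + 1) x) := by
      -- The path space is equivalent to the complex of F, so up to a boundary the class comes from
      -- a cycle `a` there.
      obtain ⟨a, ha, b, hb⟩ := (hIso_toCocyl A B X i).2 (Hom.f ((fibToCocyl χ).app X) (i + 1) x)
        (by rw [← hom_d, hx, _root_.map_zero])
      obtain ⟨p, z, hz⟩ : ∃ p z, (((cxIter jF p).obj A).obj X).d (i + 1) z =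
          Hom.f (((toIter jF p).app A).app X) (i + 1) a := by
        -- Outside `succSet` the cycle is already a boundary, and no iteration is needed.
        by_cases hi' : i ∈ succSet R.S
        · exact exists_boundary_of_hasContractibleTaylor jF R hF' jF cF 0 hi' ha
        · obtain ⟨z, hz⟩ := R.ex _ i hi' a ha
          exact ⟨0, z, hz⟩
      refine ⟨p, Hom.f (((cxIter jF p).map (toCocyl A B)).app X) _ z +
        Hom.f (((toIter jF p).app (cocyl A B)).app X) _ b, ?_⟩
      rw [map_add, ← hom_d, ← hom_d, hz, hb, map_add]
      refine congrArg (· + _) ?_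
      exact (congr_f (NatTrans.congr_app ((toIter jF p).naturality (toCocyl A B)) X) (i + 1) a).symm
    -- the image of `y` in the tower of `G`
    have hyB : (((cxIter jF p).obj B).obj X).d (i + 1)
        (Hom.f (((cxIter jF p).map (fromCocyl χ)).app X) (i + 1 + 1) y) = 0 := by
      rw [← hom_d, hy]
      refine (congr_f (NatTrans.congr_app ((toIter jF p).naturality (fromCocyl χ)) X) (i + 1)
        _).symm.trans ?_
      exact (congrArg (Hom.f (((toIter jF p).app B).app X) (i + 1))
        ((ses X).zero (i + 1) x)).trans (_root_.map_zero _)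
    obtain ⟨l, z, hz⟩ := exists_boundary_of_hasContractibleTaylor jG R hG' jF cG p
      (mem_succSet hi) hyB
    have ses' := ses_cxIter jF (ses_cxIter jG ses l) p X
    -- Iterates for the joins of F, applied to iterates for the joins of G. Both comparison maps are
    -- natural in U, and the iterates preserve the path space sequence.
    let τ (U : CofibrantObject C ⥤ Cx.{u}) : U ⟶ (cxIter jF p).obj ((cxIter jG l).obj U) :=
      (toIter jF p).app U ≫ (cxIter jF p).map ((toIter jG l).app U)
    have hτ : ∀ {U U' : CofibrantObject C ⥤ Cx.{u}} (f : U ⟶ U'),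
        f ≫ τ U' = τ U ≫ (cxIter jF p).map ((cxIter jG l).map f) := fun {U U'} f => by
      have e₁ := (toIter jF p).naturality f
      have e₂ := congrArg (cxIter jF p).map ((toIter jG l).naturality f)
      simp only [Functor.map_comp, Functor.id_map] at e₁ e₂
      simp only [τ, Category.assoc]
      rw [reassoc_of% e₁, e₂]
    obtain ⟨z', hz'⟩ := ses'.surj _ z
    let y' := Hom.f (((cxIter jF p).map ((toIter jG l).app (cocyl A B))).app X) _ y
    -- `z'` lifts the chain that kills the image of `y` in the tower of G. After its boundary is
    -- subtracted, `y'` lies in the iterate of the fiber, where it bounds the image of `x`.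
    obtain ⟨v, hv⟩ := ses'.ex (i + 1 + 1) (y' - (((cxIter jF p).obj ((cxIter jG l).obj
        (cocyl A B))).obj X).d _ z') (by
      rw [map_sub, hom_d, hz', sub_eq_zero]
      refine Eq.trans ?_ hz.symm
      have e := congrArg (cxIter jF p).map ((toIter jG l).naturality (fromCocyl χ))
      simp only [Functor.map_comp, Functor.id_map] at e
      exact (congr_f (NatTrans.congr_app e X) _ y).symm)
    refine ((heqv jF p X).comp ((fibStable_eqv R.upClosed).cxIter jF _ (heqv jG l) p X) i hi).1 x hx
      ⟨v, ?_⟩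
    refine ses'.inj _ ?_
    rw [hom_d, hv, map_sub, d_d, sub_zero, ← hom_d]
    refine (congrArg (Hom.f (((cxIter jF p).map ((toIter jG l).app (cocyl A B))).app X) (i + 1))
      hy).trans ?_
    exact congr_f (NatTrans.congr_app (hτ (fibToCocyl χ)) X) (i + 1) x
  have hcof : ∀ X : CofibrantObject C, WeakEquivalence (J.app (ι.obj X)) := fun X => by
    refine R.weq_of_hIsoOn _ fun i hi => ?_
    refine ⟨(ex_fib_iff.1 (hex X i (succSet_subset R.upClosed hi))).1, ?_⟩
    obtain ⟨j, hj, rfl⟩ := hi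
    exact (ex_fib_iff.1 (hex X j hj)).2
  -- The towers live on cofibrant objects; homotopy invariance of F and G extends the conclusion to
  -- all objects.
  obtain ⟨X', p, hX', hp⟩ := hC.exists_cofibrant X
  refine (R.weq_iff _).2 fun i => ?_
  have e := congrArg R.V.map (J.naturality p)
  rw [R.V.map_comp, R.V.map_comp] at e
  refine HIso.of_comp_left (f := R.V.map (F.map p)) ?_ (hFV p hp i)
  rw [e]
  exact ((R.weq_iff _).1 (hcof (CofibrantObject.mk X')) i).comp (hGV p hp i)

end Goodwillie

end

/-! ### Quasi-isomorphisms, pushouts and cylinders of module complexes by elements. -/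

noncomputable section

namespace Goodwillie

open scoped ZeroObject
open Cx

/-! ### Elements of complexes of modules -/

section Elements

variable {k : Type u} [Field k]

/-- In modules homology is the kernel modulo the range, and the two clauses are injectivity and
surjectivity of the map between these quotients. -/
theorem quasiIso_iff_elements {S₁ S₂ : ShortComplex (ModuleCat.{u} k)} (φ : S₁ ⟶ S₂) :
    ShortComplex.QuasiIso φ ↔
      (∀ x : S₁.X₂, S₁.g x = 0 → (∃ y, S₂.f y = φ.τ₂ x) → ∃ y, S₁.f y = x) ∧
      (∀ y : S₂.X₂, S₂.g y = 0 → ∃ x, S₁.g x = 0 ∧ ∃ z, y = φ.τ₂ x + S₂.f z) := by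
  let h₁ := S₁.moduleCatLeftHomologyData
  let h₂ := S₂.moduleCatLeftHomologyData
  let γ : ShortComplex.LeftHomologyMapData φ h₁ h₂ := default
  rw [γ.quasiIso_iff, ConcreteCategory.isIso_iff_bijective]
  have hK : ∀ z : LinearMap.ker S₁.g.hom, (γ.φK z).1 = φ.τ₂ z.1 := fun z =>
    congrArg (fun m : h₁.K ⟶ S₂.X₂ => m z) γ.commi
  have hH : ∀ z : LinearMap.ker S₁.g.hom,
      γ.φH (Submodule.Quotient.mk z) = Submodule.Quotient.mk (γ.φK z) := fun z =>
    congrArg (fun m : h₁.K ⟶ h₂.H => m z) γ.commπ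
  have q₁ : ∀ z : LinearMap.ker S₁.g.hom, (Submodule.Quotient.mk z : h₁.H) = 0 ↔
      ∃ y, S₁.f y = z.1 := fun z => (Submodule.Quotient.mk_eq_zero _).trans
    ⟨fun ⟨y, hy⟩ => ⟨y, congrArg Subtype.val hy⟩, fun ⟨y, hy⟩ => ⟨y, Subtype.ext hy⟩⟩
  have q₂ : ∀ z : LinearMap.ker S₂.g.hom, (Submodule.Quotient.mk z : h₂.H) = 0 ↔
      ∃ y, S₂.f y = z.1 := fun z => (Submodule.Quotient.mk_eq_zero _).trans
    ⟨fun ⟨y, hy⟩ => ⟨y, congrArg Subtype.val hy⟩, fun ⟨y, hy⟩ => ⟨y, Subtype.ext hy⟩⟩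
  refine and_congr ?_ ?_
  · refine (injective_iff_map_eq_zero γ.φH.hom).trans ⟨fun h x hx hy => ?_, fun h z hz => ?_⟩
    · refine (q₁ ⟨x, hx⟩).1 (h _ ((hH _).trans ((q₂ _).2 ?_)))
      rw [hK]
      exact hy
    · obtain ⟨z, rfl⟩ := Submodule.Quotient.mk_surjective _ z
      refine (q₁ z).2 (h z.1 z.2 ?_)
      have := (q₂ _).1 ((hH z).symm.trans hz)
      rwa [hK] at this
  · refine ⟨fun h y hy => ?_, fun h z => ?_⟩
    · obtain ⟨x, hx⟩ := h (Submodule.Quotient.mk ⟨y, hy⟩)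
      obtain ⟨x, rfl⟩ := Submodule.Quotient.mk_surjective _ x
      obtain ⟨z, hz⟩ := (q₂ ((⟨y, hy⟩ : LinearMap.ker S₂.g.hom) - (show LinearMap.ker S₂.g.hom from γ.φK x))).1 (by
        refine (Submodule.Quotient.mk_sub _).trans ?_
        exact sub_eq_zero.2 (hx.symm.trans (hH x)))
      refine ⟨x.1, x.2, z, ?_⟩
      rw [hz, ← hK]
      exact (add_sub_cancel _ _).symm
    · obtain ⟨y, rfl⟩ := Submodule.Quotient.mk_surjective _ z
      obtain ⟨x, hx, w, hw⟩ := h y.1 y.2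
      refine ⟨Submodule.Quotient.mk ⟨x, hx⟩, (hH _).trans ?_⟩
      refine sub_eq_zero.1 ((Submodule.Quotient.mk_sub _).symm.trans ((q₂ _).2 ⟨-w, ?_⟩))
      rw [map_neg]
      refine Eq.trans ?_ (congrArg₂ (· - ·) (hK ⟨x, hx⟩) hw).symm
      abel

variable {ι : Type} {c : ComplexShape ι} {X Y A B : HomologicalComplex (ModuleCat.{u} k) c}

theorem mono_iff_injective (f : X ⟶ Y) : Mono f ↔ ∀ i, Function.Injective (f.f i) :=
  ⟨fun _ i => (ModuleCat.mono_iff_injective (f.f i)).1 inferInstance, fun h =>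
    HomologicalComplex.mono_of_mono_f f fun i => (ModuleCat.mono_iff_injective _).2 (h i)⟩

theorem injective_of_isPushout {f : A ⟶ B} {g : A ⟶ X} {h : B ⟶ Y} {i : X ⟶ Y}
    (s : IsPushout f g h i) (hf : ∀ j, Function.Injective (f.f j)) (j) :
    Function.Injective (i.f j) :=
  (mono_iff_injective i).1 (MorphismProperty.of_isPushout (P := MorphismProperty.monomorphisms _)
    s.flip ((mono_iff_injective f).2 hf)) j

/-- Two tests of the universal property: the quotient of Y by the sum of the two images must vanish,
and the quotient of B × X by the elements (f a, -g a) detects every coincidence of images. -/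
theorem ModuleCat.exists_of_isPushout {A B X Y : ModuleCat.{u} k} {f : A ⟶ B} {g : A ⟶ X}
    {h : B ⟶ Y} {i : X ⟶ Y} (s : IsPushout f g h i) :
    (∀ y, ∃ b x, y = h b + i x) ∧ ∀ b x, h b = i x → ∃ a, f a = b ∧ g a = x := by
  constructor
  · let I : Submodule k Y := LinearMap.range h.hom ⊔ LinearMap.range i.hom
    have e : ModuleCat.ofHom I.mkQ = 0 := s.hom_ext
      (ModuleCat.hom_ext (LinearMap.ext fun b => (Submodule.Quotient.mk_eq_zero _).2
        (Submodule.mem_sup_left ⟨b, rfl⟩)))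
      (ModuleCat.hom_ext (LinearMap.ext fun b => (Submodule.Quotient.mk_eq_zero _).2
        (Submodule.mem_sup_right ⟨b, rfl⟩)))
    intro y
    have hy : y ∈ I := (Submodule.Quotient.mk_eq_zero _).1
      (congrArg (fun m : Y ⟶ ModuleCat.of k (Y ⧸ I) => m y) e)
    obtain ⟨_, ⟨b, rfl⟩, _, ⟨x, rfl⟩, rfl⟩ := Submodule.mem_sup.1 hy
    exact ⟨b, x, rfl⟩
  · intro b x e
    let I : Submodule k (B × X) := LinearMap.range (f.hom.prod (-g.hom))
    obtain ⟨d, hd₁, hd₂⟩ := s.exists_desc (ModuleCat.ofHom (I.mkQ.comp (LinearMap.inl k B X)))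
      (ModuleCat.ofHom (I.mkQ.comp (LinearMap.inr k B X))) (by
        refine ModuleCat.hom_ext (LinearMap.ext fun a => ?_)
        refine (Submodule.Quotient.eq _).2 ⟨a, Prod.ext ?_ ?_⟩
        · exact (sub_zero _).symm
        · exact (zero_sub _).symm)
    have e₁ : I.mkQ (b, 0) = d (h b) := congrArg (fun m => m.hom b) hd₁.symm
    have e₂ : I.mkQ (0, x) = d (i x) := congrArg (fun m => m.hom x) hd₂.symm
    rw [e, ← e₂] at e₁
    obtain ⟨a, ha⟩ := (Submodule.Quotient.eq _).1 e₁
    refine ⟨a, (congrArg Prod.fst ha).trans (sub_zero b), neg_injective ?_⟩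
    exact (congrArg Prod.snd ha).trans (zero_sub x)

theorem exists_of_isPushout {f : A ⟶ B} {g : A ⟶ X} {h : B ⟶ Y} {i : X ⟶ Y}
    (s : IsPushout f g h i) (j : ι) :
    (∀ y, ∃ b x, y = h.f j b + i.f j x) ∧
      ∀ b x, h.f j b = i.f j x → ∃ a, f.f j a = b ∧ g.f j a = x :=
  ModuleCat.exists_of_isPushout (s.map (HomologicalComplex.eval _ c j))

/-- The terms of the product of `Y` and a contractible complex that contains `X`. -/
abbrev CylX (X Y : HomologicalComplex (ModuleCat.{u} k) c) (i : ι) : Type u :=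
  Y.X i × X.X i × ∀ j : {j // c.Rel i j}, X.X j.1

open Classical in
/-- The product of `Y` and a contractible complex that contains `X`. -/
def cylCx (X Y : HomologicalComplex (ModuleCat.{u} k) c) : HomologicalComplex (ModuleCat.{u} k) c where
  X i := ModuleCat.of k (CylX X Y i)
  d i j := ModuleCat.ofHom ((Y.d i j).hom.prodMap (LinearMap.prod
    (if h : c.Rel i j then (LinearMap.proj (R := k) (φ := fun j : {j // c.Rel i j} => X.X j.1)
      ⟨j, h⟩).comp (LinearMap.snd k _ _) else 0) 0))
  shape i j h := by
    refine ModuleCat.hom_ext (LinearMap.ext fun z => Prod.ext ?_ (Prod.ext ?_ rfl))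
    · exact congrArg (fun m => m.hom z.1) (Y.shape i j h)
    · simp [h]
  d_comp_d' i j l _ _ := by
    refine ModuleCat.hom_ext (LinearMap.ext fun z => Prod.ext ?_ (Prod.ext ?_ rfl))
    · exact congrArg (fun m => m.hom z.1) (Y.d_comp_d i j l)
    · by_cases h : c.Rel j l <;> simp [h]

theorem cylCx_d {i j : ι} (h : c.Rel i j) (z : CylX X Y i) :
    (cylCx X Y).d i j z = ((Y.d i j z.1, z.2.2 ⟨j, h⟩, 0) : CylX X Y j) := by
  refine Prod.ext rfl (Prod.ext ?_ rfl)
  simp [cylCx, h]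
  rfl

/-- The inclusion of `X`. -/
def toCylCx (f : X ⟶ Y) : X ⟶ cylCx X Y where
  f i := ModuleCat.ofHom (Y := CylX X Y i) ((f.f i).hom.prod (LinearMap.id.prod
    (LinearMap.pi fun j => (X.d i j.1).hom)))
  comm' i j h := by
    refine ModuleCat.hom_ext (LinearMap.ext fun x => ?_)
    refine (cylCx_d h _).trans (Prod.ext ?_ (Prod.ext rfl ?_))
    · exact congrArg (fun m => m.hom x) (f.comm i j)
    · funext l
      exact congrArg (fun m => m.hom x) (X.d_comp_d i j l.1).symm

/-- The projection to `Y`. -/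
def fromCylCx (X Y : HomologicalComplex (ModuleCat.{u} k) c) : cylCx X Y ⟶ Y where
  f i := ModuleCat.ofHom (X := CylX X Y i) (LinearMap.fst k _ _)
  comm' i j h := rfl

theorem toCylCx_fromCylCx (f : X ⟶ Y) : toCylCx f ≫ fromCylCx X Y = f := rfl

theorem toCylCx_injective (f : X ⟶ Y) (i : ι) : Function.Injective ((toCylCx f).f i) :=
  fun x y e => congrArg (fun z : CylX X Y i => z.2.1) e

/-- The second factor is a cone: a cycle (x, w) has w = 0 and is the boundary of (0, x), which lives
one degree higher. This is where a predecessor of every degree is needed. -/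
theorem quasiIso_fromCylCx (X Y : HomologicalComplex (ModuleCat.{u} k) c)
    (hc : ∀ j, ∃ i, c.Rel i j) : QuasiIso (fromCylCx X Y) := by
  rw [quasiIso_iff]
  intro j
  obtain ⟨i, hi⟩ := hc j
  rw [quasiIsoAt_iff' _ i j (c.next j) (c.prev_eq' hi) rfl, quasiIso_iff_elements]
  constructor
  · change ∀ z : CylX X Y j, (cylCx X Y).d j (c.next j) z = 0 → (∃ y : Y.X i, Y.d i j y = z.1) →
      ∃ v : CylX X Y i, (cylCx X Y).d i j v = z
    rintro ⟨y, x, w⟩ hz ⟨y', hy'⟩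
    refine ⟨(y', 0, fun l => c.next_eq hi l.2 ▸ x), (cylCx_d hi _).trans ?_⟩
    refine Prod.ext hy' (Prod.ext rfl (funext fun l => ?_))
    obtain ⟨l, hl⟩ := l
    obtain rfl := c.next_eq' hl
    exact (congrArg (fun z : CylX X Y (c.next j) => z.2.1) ((cylCx_d hl _).symm.trans hz)).symm
  · change ∀ y : Y.X j, Y.d j (c.next j) y = 0 → ∃ z : CylX X Y j,
      (cylCx X Y).d j (c.next j) z = 0 ∧ ∃ v : Y.X i, y = z.1 + Y.d i j v
    intro y hy
    refine ⟨(y, 0, 0), ?_, 0, by rw [map_zero, add_zero]⟩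
    by_cases h : c.Rel j (c.next j)
    · exact (cylCx_d h _).trans (Prod.ext hy rfl)
    · exact congrArg (fun m => m.hom ((y, 0, 0) : CylX X Y j)) ((cylCx X Y).shape _ _ h)

/-! ### Pushouts along injective maps -/

end Elements

/-- The Mayer–Vietoris argument: an element of Y is a sum from B and X, well defined up to A, and
the injectivity of `f` turns the ambiguity of boundaries into cycles of A. -/
theorem Cx.hIso_of_pushout {A B X Y : Cx.{u}} {f : A ⟶ B} {g : A ⟶ X} {h : B ⟶ Y} {i : X ⟶ Y}
    (w : f ≫ h = g ≫ i) (hf : ∀ j, Function.Injective (Hom.f f j))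
    (hs : ∀ j y, ∃ b x, y = Hom.f h j b + Hom.f i j x)
    (he : ∀ j b x, Hom.f h j b = Hom.f i j x → ∃ a, Hom.f f j a = b ∧ Hom.f g j a = x)
    (hq : ∀ j, HIso f j) (j : ℤ) : HIso i j := by
  have w' : ∀ j a, Hom.f h j (Hom.f f j a) = Hom.f i j (Hom.f g j a) := fun j a => congr_f w j a
  constructor
  · rintro x hx ⟨y, hy⟩
    obtain ⟨b, x', rfl⟩ := hs _ y
    obtain ⟨a, ha, ha'⟩ := he (j + 1) (B.d _ b) (x - X.d _ x') (by
      rw [map_sub, hom_d, hom_d, ← hy, map_add, add_sub_cancel_right])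
    obtain ⟨a', rfl⟩ := (hq j).1 a (hf _ (by rw [hom_d, ha, d_d, map_zero])) ⟨b, ha.symm⟩
    exact ⟨Hom.f g _ a' + x', by rw [map_add, ← hom_d, ha', sub_add_cancel]⟩
  -- The ambiguity cycle `a` lives one degree below, so injectivity of `f` on homology is used
  -- there. Then `a₂` accounts for the cycle left over in B.
  · obtain ⟨l, rfl⟩ : ∃ l, j = l + 1 := ⟨j - 1, by ring⟩
    intro y hy
    obtain ⟨b, x, rfl⟩ := hs _ y
    obtain ⟨a, ha, ha'⟩ := he (l + 1) (B.d _ b) (-X.d _ x) (by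
      rw [map_neg, hom_d, hom_d, eq_neg_iff_add_eq_zero, ← map_add, hy])
    obtain ⟨a₁, rfl⟩ := (hq l).1 a (hf _ (by rw [hom_d, ha, d_d, map_zero])) ⟨b, ha.symm⟩
    obtain ⟨a₂, ha₂, b', hb'⟩ := (hq _).2 (b - Hom.f f _ a₁) (by
      rw [map_sub, ← hom_d, ha, sub_self])
    refine ⟨Hom.f g _ a₁ + Hom.f g _ a₂ + x, ?_, Hom.f h _ b', ?_⟩
    · rw [map_add, map_add, ← hom_d, ← hom_d, ha', ha₂, map_zero, add_zero, neg_add_cancel]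
    · rw [sub_eq_iff_eq_add.1 hb', map_add, map_add, map_add, map_add, w', w', hom_d]
      abel

/-! ### Unbounded complexes -/

section Ch

variable (k : Type u) [Field k]

/-- The realization of unbounded complexes. -/
def chV : Ch k ⥤ Cx.{u} where
  obj X :=
    { X := fun i => X.X i
      d := fun i => (X.d (i + 1) i).hom.toAddMonoidHom
      d_d := fun i x => congrArg (fun m => m.hom x) (X.d_comp_d (i + 1 + 1) (i + 1) i) }
  map f :=
    { f := fun i => (f.f i).hom.toAddMonoidHom
      comm := fun i x => congrArg (fun m => m.hom x) (f.comm (i + 1) i).symm }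

variable {k}

theorem ch_weq_iff {X Y : Ch k} (f : X ⟶ Y) :
    WeakEquivalence f ↔ ∀ i, HIso ((chV k).map f) i := by
  rw [weakEquivalence_iff]
  change QuasiIso f ↔ _
  rw [quasiIso_iff]
  have h : ∀ i : ℤ, QuasiIsoAt f (i + 1) ↔ HIso ((chV k).map f) i := fun i => by
    rw [quasiIsoAt_iff' f (i + 1 + 1) (i + 1) i (by simp) (by simp), quasiIso_iff_elements]
    rfl
  refine ⟨fun H i => (h i).1 (H _), fun H i => ?_⟩
  obtain ⟨l, rfl⟩ : ∃ l, i = l + 1 := ⟨i - 1, by ring⟩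
  exact (h l).2 (H l)

end Ch

/-! ### Non-negative complexes -/

section ChPlus

variable (k : Type u) [Field k]

/-- The extension by zero of the terms of a non-negative complex. -/
def plusX (X : ChPlus k) : ℤ → Type u
  | .ofNat n => X.X n
  | .negSucc _ => PUnit

instance (X : ChPlus k) : ∀ i : ℤ, AddCommGroup (plusX k X i)
  | .ofNat n => inferInstanceAs (AddCommGroup (X.X n))
  | .negSucc _ => inferInstanceAs (AddCommGroup PUnit)

/-- The realization of non-negative complexes. -/
def chPlusV : ChPlus k ⥤ Cx.{u} where
  obj X :=
    { X := plusX k X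
      d := fun i => match i with
        | .ofNat n => (X.d (n + 1) n).hom.toAddMonoidHom
        | .negSucc _ => 0
      d_d := fun i x => match i with
        | .ofNat n => congrArg (fun m => m.hom x) (X.d_comp_d (n + 1 + 1) (n + 1) n)
        | .negSucc _ => rfl }
  map f :=
    { f := fun i => match i with
        | .ofNat n => (f.f n).hom.toAddMonoidHom
        | .negSucc _ => 0
      comm := fun i x => match i with
        | .ofNat n => congrArg (fun m => m.hom x) (f.comm (n + 1) n).symm
        | .negSucc _ => rfl }
  map_id X := hom_ext fun i x => match i with
    | .ofNat n => rfl
    | .negSucc _ => rfl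
  map_comp f g := hom_ext fun i x => match i with
    | .ofNat n => rfl
    | .negSucc _ => rfl

variable {k}

/-- Homology in degree 0 has index -1. There the zero differential from degree 0 to itself is
replaced by the map to the zero term in degree -1, and both impose no condition on cycles. -/
theorem chPlus_weq_iff {X Y : ChPlus k} (f : X ⟶ Y) :
    WeakEquivalence f ↔ ∀ i, HIso ((chPlusV k).map f) i := by
  rw [weakEquivalence_iff]
  change QuasiIso f ↔ _
  rw [quasiIso_iff]
  have h : ∀ n : ℕ, QuasiIsoAt f (n + 1) ↔ HIso ((chPlusV k).map f) (.ofNat n) := fun n => by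
    rw [quasiIsoAt_iff' f (n + 1 + 1) (n + 1) n (by simp) (by simp), quasiIso_iff_elements]
    rfl
  have h₀ : QuasiIsoAt f 0 ↔ HIso ((chPlusV k).map f) (.negSucc 0) := by
    rw [quasiIsoAt_iff' f 1 0 0 (by simp) (by simp), quasiIso_iff_elements]
    have e : ∀ (Z : ChPlus k) (x : Z.X 0), Z.d 0 0 x = 0 := fun Z x =>
      congrArg (fun m => m.hom x) (Z.shape 0 0 (by simp))
    refine and_congr ?_ ?_
    · exact ⟨fun H x _ => H x (e X x), fun H x _ => H x rfl⟩
    · constructor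
      · intro H y _
        obtain ⟨x, -, z, hz⟩ := H y (e Y y)
        exact ⟨x, rfl, z, hz⟩
      · intro H y _
        obtain ⟨x, -, z, hz⟩ := H y rfl
        exact ⟨x, e X x, z, hz⟩
  constructor
  · intro H i
    match i with
    | .ofNat n => exact (h n).1 (H _)
    | .negSucc 0 => exact h₀.1 (H 0)
    | .negSucc (n + 1) => exact ⟨fun _ _ _ => ⟨0, rfl⟩, fun _ _ => ⟨0, rfl, 0, rfl⟩⟩
  · intro H n
    match n with
    | 0 => exact h₀.2 (H _)
    | n + 1 => exact (h n).2 (H _)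

end ChPlus

end Goodwillie

end

/-! ### The two categories of complexes: cofibration axioms and realizations. -/

noncomputable section

namespace Goodwillie

open scoped ZeroObject
open Cx

theorem IsCofCat.of_functor {C : Type*} [Category* C] [CategoryWithWeakEquivalences C]
    [CategoryWithCofibrations C] (V : C ⥤ Cx.{u})
    (hV : ∀ {X Y : C} (f : X ⟶ Y), WeakEquivalence f ↔ ∀ i, HIso (V.map f) i)
    (h₁ : HasPushouts C) (h₂ : ∀ {X Y : C} (f : X ⟶ Y), IsIso f → Cofibration f)
    (h₃ : ∀ {X Y Z : C} (f : X ⟶ Y) (g : Y ⟶ Z), Cofibration f → Cofibration g →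
      Cofibration (f ≫ g))
    (h₄ : ∀ {A B X Y : C} {f : A ⟶ B} {g : A ⟶ X} {h : B ⟶ Y} {i : X ⟶ Y},
      IsPushout f g h i → Cofibration f → Cofibration i)
    (h₅ : ∀ {A B X Y : C} {f : A ⟶ B} {g : A ⟶ X} {h : B ⟶ Y} {i : X ⟶ Y},
      IsPushout f g h i → Cofibration f → WeakEquivalence f → WeakEquivalence i)
    (h₆ : ∀ {X Y : C} (f : X ⟶ Y), ∃ (Z : C) (i : X ⟶ Z) (p : Z ⟶ Y),
      Cofibration i ∧ WeakEquivalence p ∧ i ≫ p = f) : IsCofCat C where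
  hasPushouts := h₁
  weq_of_iso f _ := (hV f).2 fun i => hIso_of_isIso _ i
  weq_comp f g hf hg := (hV _).2 fun i => by
    rw [V.map_comp]
    exact ((hV f).1 hf i).comp ((hV g).1 hg i)
  weq_right f g hf hg := (hV _).2 fun i => by
    have h := (hV _).1 hg i
    rw [V.map_comp] at h
    exact h.of_comp_left ((hV f).1 hf i)
  weq_left f g hg hfg := (hV _).2 fun i => by
    have h := (hV _).1 hfg i
    rw [V.map_comp] at h
    exact h.of_comp_right ((hV g).1 hg i)
  cof_of_iso := h₂
  cof_comp := h₃
  cof_pushout := h₄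
  weq_pushout := h₅
  factor := h₆

section Elements

variable {k : Type u} [Field k] {ι : Type} {c : ComplexShape ι}

theorem injective_of_isIso {X Y : HomologicalComplex (ModuleCat.{u} k) c} (f : X ⟶ Y) [IsIso f]
    (i : ι) : Function.Injective (f.f i) := (mono_iff_injective f).1 inferInstance i

variable {J : Type} [SmallCategory J]

theorem isLimit_ext {F : J ⥤ HomologicalComplex (ModuleCat.{u} k) c} {s : Cone F} (hs : IsLimit s)
    (i : ι) (x y : s.pt.X i) (h : ∀ j, (s.π.app j).f i x = (s.π.app j).f i y) : x = y := by
  have hs' := isLimitOfPreserves (HomologicalComplex.eval _ c i ⋙ forget (ModuleCat.{u} k)) hs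
  exact (Types.isLimitEquivSections hs').injective (Subtype.ext (funext h))

theorem isLimit_exists {F : J ⥤ HomologicalComplex (ModuleCat.{u} k) c} {s : Cone F}
    (hs : IsLimit s) (i : ι) (y : ∀ j, (F.obj j).X i)
    (hy : ∀ (j j' : J) (f : j ⟶ j'), (F.map f).f i (y j) = y j') :
    ∃ x : s.pt.X i, ∀ j, (s.π.app j).f i x = y j := by
  have hs' := isLimitOfPreserves (HomologicalComplex.eval _ c i ⋙ forget (ModuleCat.{u} k)) hs
  obtain ⟨x, hx⟩ := (Types.isLimitEquivSections hs').surjective ⟨y, fun f => hy _ _ f⟩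
  exact ⟨x, fun j => congrArg (fun s => s.1 j) hx⟩

theorem preservesColimit_forget (F : ℕ ⥤ ModuleCat.{u} k) :
    PreservesColimit F (forget (ModuleCat.{u} k)) := by
  have : PreservesFilteredColimitsOfSize.{0, 0} (forget (ModuleCat.{u} k)) :=
    preservesFilteredColimitsOfSize_shrink.{0, u, 0, u} _
  infer_instance

variable {F : ℕ ⥤ HomologicalComplex (ModuleCat.{u} k) c} {s : Cocone F}

theorem isColimit_exists_rep (hs : IsColimit s) (i : ι) (x : s.pt.X i) :
    ∃ (l : ℕ) (y : (F.obj l).X i), (s.ι.app l).f i y = x := by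
  have := preservesColimit_forget (F ⋙ HomologicalComplex.eval _ c i)
  exact Concrete.isColimit_exists_rep _ (isColimitOfPreserves (HomologicalComplex.eval _ c i) hs) x

theorem isColimit_exists_of_eq (hs : IsColimit s) (i : ι) {l l' : ℕ} (x : (F.obj l).X i)
    (y : (F.obj l').X i) (h : (s.ι.app l).f i x = (s.ι.app l').f i y) :
    ∃ (m : ℕ) (f : l ⟶ m) (g : l' ⟶ m), (F.map f).f i x = (F.map g).f i y := by
  have := preservesColimit_forget (F ⋙ HomologicalComplex.eval _ c i)
  exact Concrete.isColimit_exists_of_rep_eq _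
    (isColimitOfPreserves (HomologicalComplex.eval _ c i) hs) x y h

/-- A bounding chain in the colimit comes from a finite stage, and the equation that says it bounds
holds at a later one. -/
theorem isColimit_exists_boundary (hs : IsColimit s) {i j : ι} (l : ℕ) (x : (F.obj l).X j)
    (h : ∃ y, s.pt.d i j y = (s.ι.app l).f j x) :
    ∃ (m : ℕ) (f : l ⟶ m) (y : (F.obj m).X i), (F.obj m).d i j y = (F.map f).f j x := by
  obtain ⟨y, hy⟩ := h
  obtain ⟨l', y, rfl⟩ := isColimit_exists_rep hs i y
  have e : ∀ {X Y : HomologicalComplex (ModuleCat.{u} k) c} (φ : X ⟶ Y) (z : X.X i),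
    Y.d i j (φ.f i z) = φ.f j (X.d i j z) := fun φ z => congrArg (fun m => m.hom z) (φ.comm i j)
  rw [e] at hy
  obtain ⟨m, f, g, h⟩ := isColimit_exists_of_eq hs j _ _ hy.symm
  exact ⟨m, f, (F.map g).f i y, (e _ _).trans h.symm⟩

end Elements

variable (k : Type u) [Field k]

theorem isCofCat_ch : IsCofCat (Ch k) := by
  refine IsCofCat.of_functor (chV k) ch_weq_iff inferInstance ?_ ?_ ?_ ?_ ?_
  · intro X Y f _
    exact (cofibration_iff f).2 (injective_of_isIso f)
  · intro X Y Z f g hf hg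
    rw [cofibration_iff] at *
    exact fun i => (hg i).comp (hf i)
  · intro A B X Y f g h i s hf
    rw [cofibration_iff] at *
    exact injective_of_isPushout s hf
  · intro A B X Y f g h i s hf hw
    rw [cofibration_iff] at hf
    rw [ch_weq_iff] at *
    exact Cx.hIso_of_pushout (f := (chV k).map f) (g := (chV k).map g) (h := (chV k).map h) (by rw [← Functor.map_comp, s.w, Functor.map_comp])
      hf (fun j => (exists_of_isPushout s j).1) (fun j => (exists_of_isPushout s j).2) hw
  · intro X Y f
    refine ⟨cylCx X Y, toCylCx f, fromCylCx X Y, (cofibration_iff _).2 (toCylCx_injective f),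
      (weakEquivalence_iff _).2 (quasiIso_fromCylCx X Y fun j => ⟨j + 1, rfl⟩),
      toCylCx_fromCylCx f⟩

theorem isCofCat_chPlus : IsCofCat (ChPlus k) := by
  refine IsCofCat.of_functor (chPlusV k) chPlus_weq_iff inferInstance ?_ ?_ ?_ ?_ ?_
  · intro X Y f _
    exact (cofibration_iff f).2 (injective_of_isIso f)
  · intro X Y Z f g hf hg
    rw [cofibration_iff] at *
    exact fun i => (hg i).comp (hf i)
  · intro A B X Y f g h i s hf
    rw [cofibration_iff] at *
    exact injective_of_isPushout s hf
  · intro A B X Y f g h i s hf hw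
    rw [cofibration_iff] at hf
    rw [chPlus_weq_iff] at *
    refine Cx.hIso_of_pushout (f := (chPlusV k).map f)
      (by rw [← Functor.map_comp, s.w, Functor.map_comp]) ?_ ?_ ?_ hw
    · exact fun | .ofNat n => hf n | .negSucc n => fun _ _ _ => rfl
    · exact fun | .ofNat n => (exists_of_isPushout s n).1 | .negSucc n => fun _ => ⟨0, 0, rfl⟩
    · exact fun | .ofNat n => (exists_of_isPushout s n).2 | .negSucc n => fun _ _ _ => ⟨0, rfl, rfl⟩
  · intro X Y f
    refine ⟨cylCx X Y, toCylCx f, fromCylCx X Y, (cofibration_iff _).2 (toCylCx_injective f),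
      (weakEquivalence_iff _).2 (quasiIso_fromCylCx X Y fun j => ⟨j + 1, rfl⟩),
      toCylCx_fromCylCx f⟩

/-- A cycle at a stage becomes a boundary in the acyclic colimit, hence already at some later stage.
-/
theorem isNull_of_boundary {D : Type*} [Category* D] (V : D ⥤ Cx.{u}) {F : ℕ ⥤ D} {c : Cocone F}
    (hx : ∀ i, Ex (V.obj c.pt) i)
    (h : ∀ (i : ℤ) (l : ℕ) (x : (V.obj (F.obj l)).X i),
      (∃ y, (V.obj c.pt).d i y = Hom.f (V.map (c.ι.app l)) i x) →
      ∃ (m : ℕ) (f : l ⟶ m) (y : (V.obj (F.obj m)).X (i + 1)),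
        (V.obj (F.obj m)).d i y = Hom.f (V.map (F.map f)) i x) (S : Set ℤ) : IsNull S (F ⋙ V) :=
  fun l i _ x hx' => h (i + 1) l x (hx i _ (by
    rw [← hom_d]
    exact (congrArg _ hx').trans (map_zero _)))

/-- The realization of unbounded complexes. -/
def chRealization : Realization.{u} (Ch k) where
  V := chV k
  S := Set.univ
  upClosed _ _ := trivial
  weq_iff := ch_weq_iff
  ex X i hi := (hi ⟨i - 1, trivial, by ring⟩).elim
  map_zero X Y i x := rfl
  surjective f hf i _ := (fibration_iff f).1 hf (i + 1 + 1)
  limit_ext hc i := isLimit_ext hc i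
  limit_exists hc i := isLimit_exists hc i
  isNull F c hc h := isNull_of_boundary (chV k) (fun i x hx =>
    ((ch_weq_iff _).1 h i).1 x hx ⟨0, (map_zero _)⟩) (fun i => isColimit_exists_boundary hc) _

theorem chPlusV_map_zero (X Y : ChPlus k) (i : ℤ) (x : ((chPlusV k).obj X).X i) :
    Hom.f ((chPlusV k).map (0 : X ⟶ Y)) i x = 0 :=
  match i with
  | .ofNat _ => rfl
  | .negSucc _ => rfl

/-- The realization of non-negative complexes. -/
def chPlusRealization : Realization.{u} (ChPlus k) where
  V := chPlusV k
  -- Index -2 is homology in degree -1, where the total fiber records the failure of surjectivity on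
  -- degree 0. Then `succSet S` is the set of indices of the degrees ≥ 0.
  S := {i | -2 ≤ i}
  upClosed i hi := by
    change -2 ≤ i at hi
    change -2 ≤ i + 1
    omega
  weq_iff := chPlus_weq_iff
  ex X i hi := by
    match i with
    | .ofNat n => exact (hi ⟨n - 1, by change -2 ≤ (n : ℤ) - 1; omega, by simp⟩).elim
    | .negSucc 0 => exact (hi ⟨-2, le_refl (-2 : ℤ), rfl⟩).elim
    | .negSucc (n + 1) => exact fun _ _ => ⟨0, rfl⟩
  map_zero := chPlusV_map_zero k
  surjective f hf i hi := by
    have h := (fibration_iff f).1 hf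
    match i with
    | .ofNat n => exact h (n + 1 + 1) (Nat.succ_pos _)
    | .negSucc 0 => exact h 1 Nat.one_pos
    | .negSucc (n + 1) =>
      obtain ⟨j, hj, e⟩ := hi
      change -2 ≤ j at hj
      omega
  limit_ext hc i := match i with
    | .ofNat n => isLimit_ext hc n
    | .negSucc n => fun _ _ _ => rfl
  limit_exists hc i := match i with
    | .ofNat n => isLimit_exists hc n
    | .negSucc n => fun _ _ => ⟨PUnit.unit, fun _ => rfl⟩
  isNull F c hc h := isNull_of_boundary (chPlusV k) (fun i x hx =>
    ((chPlus_weq_iff _).1 h i).1 x hx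
      ⟨0, (map_zero _).trans (chPlusV_map_zero k _ _ _ x).symm⟩) (fun i => match i with
      | .ofNat n => isColimit_exists_boundary hc
      | .negSucc n => fun l x _ => ⟨l, 𝟙 l, 0, rfl⟩) _

end Goodwillie

end

/-! ### Algebras as the homogeneous parts of ungraded modules with operations. -/

noncomputable section

namespace Goodwillie

open ChPlus

variable {k : Type u} [Field k]

/-! ### Total spaces -/

section Tot

variable {X Y Z : ChPlus k}

/-- The projection of the total space to the terms of degree `i`. -/
def pr (X : ChPlus k) (i : ℕ) : Tot X →ₗ[k] Tot X :=
  (hom X i).comp (DirectSum.component k ℕ (fun i => X.X i) i)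

theorem pr_apply (i : ℕ) (x : Tot X) : pr X i x = hom X i (x i) := rfl

theorem hom_apply_same (i : ℕ) (x : X.X i) : (hom X i x) i = x :=
  DFinsupp.single_eq_same

theorem hom_apply_ne {i j : ℕ} (h : i ≠ j) (x : X.X i) : (hom X i x) j = 0 :=
  DFinsupp.single_eq_of_ne h.symm

theorem hom_injective (i : ℕ) : Function.Injective (hom X i) := fun x y e => by
  rw [← hom_apply_same i x, e, hom_apply_same]

theorem pr_hom (i : ℕ) (x : X.X i) : pr X i (hom X i x) = hom X i x := by
  rw [pr_apply, hom_apply_same]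

theorem pr_hom_ne {i j : ℕ} (h : i ≠ j) (x : X.X i) : pr X j (hom X i x) = 0 := by
  rw [pr_apply, hom_apply_ne h, map_zero]

theorem pr_pr (i : ℕ) (x : Tot X) : pr X i (pr X i x) = pr X i x := pr_hom i _

theorem pr_pr_ne {i j : ℕ} (h : i ≠ j) (x : Tot X) : pr X i (pr X j x) = 0 := pr_hom_ne h.symm _

theorem tot_ext {M : Type*} [AddCommMonoid M] [Module k M] {f g : Tot X →ₗ[k] M}
    (h : ∀ i x, f (hom X i x) = g (hom X i x)) (x : Tot X) : f x = g x := by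
  rw [DirectSum.linearMap_ext k (fun i => LinearMap.ext (h i))]

theorem tot_induction {S : Submodule k (Tot X)} (h : ∀ i x, hom X i x ∈ S) (x : Tot X) : x ∈ S := by
  induction x using DirectSum.induction_on with
  | zero => exact S.zero_mem
  | of i x => exact h i x
  | add x y hx hy => exact S.add_mem hx hy

theorem exists_sum_hom (x : Tot X) : ∃ s : Finset ℕ, x = ∑ i ∈ s, hom X i (x i) := by
  classical
  exact ⟨_, (DirectSum.sum_support_of x).symm⟩

theorem mem_of_pr_mem {S : Submodule k (Tot X)} {x : Tot X} (h : ∀ i, pr X i x ∈ S) : x ∈ S := by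
  obtain ⟨s, hs⟩ := exists_sum_hom x
  rw [hs]
  exact S.sum_mem fun i _ => h i

theorem diff_hom_succ (i : ℕ) (x : X.X (i + 1)) :
    diff X (hom X (i + 1) x) = hom X i (X.d (i + 1) i x) := DirectSum.toModule_lof _ _ _

theorem diff_hom_zero (x : X.X 0) : diff X (hom X 0 x) = 0 := by
  refine (DirectSum.toModule_lof _ _ _).trans ?_
  refine (congrArg (hom X 0) ?_).trans (map_zero _)
  exact congrArg (fun m => m.hom x) (X.shape 0 0 (by simp))

theorem sgn_hom (i : ℕ) (x : X.X i) : sgn X (hom X i x) = (-1 : k) ^ i • hom X i x := by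
  refine (DirectSum.lmap_lof _ _ _).trans ?_
  rw [LinearMap.smul_apply, map_smul]
  rfl

theorem totMap_hom (f : X ⟶ Y) (i : ℕ) (x : X.X i) :
    totMap f (hom X i x) = hom Y i (f.f i x) := DirectSum.lmap_lof _ _ _

theorem totMap_apply (f : X ⟶ Y) (i : ℕ) (x : Tot X) : (totMap f x) i = f.f i (x i) :=
  DirectSum.lmap_apply _ _ _

theorem totMap_pr (f : X ⟶ Y) (i : ℕ) (x : Tot X) : totMap f (pr X i x) = pr Y i (totMap f x) := by
  rw [pr_apply, pr_apply, totMap_hom, totMap_apply]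

theorem totMap_diff (f : X ⟶ Y) (x : Tot X) : totMap f (diff X x) = diff Y (totMap f x) :=
  tot_ext (f := (totMap f).comp (diff X)) (g := (diff Y).comp (totMap f)) (fun i x => by
    change totMap f (diff X (hom X i x)) = diff Y (totMap f (hom X i x))
    cases i with
    | zero => rw [diff_hom_zero, totMap_hom, diff_hom_zero, map_zero]
    | succ i =>
      rw [diff_hom_succ, totMap_hom, totMap_hom, diff_hom_succ]
      exact congrArg (hom Y i) (congrArg (fun m => m.hom x) (f.comm (i + 1) i).symm)) x

theorem totMap_sgn (f : X ⟶ Y) (x : Tot X) : totMap f (sgn X x) = sgn Y (totMap f x) :=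
  tot_ext (f := (totMap f).comp (sgn X)) (g := (sgn Y).comp (totMap f)) (fun i x => by
    change totMap f (sgn X (hom X i x)) = sgn Y (totMap f (hom X i x))
    rw [sgn_hom, map_smul, totMap_hom, sgn_hom]) x

theorem diff_diff (x : Tot X) : diff X (diff X x) = 0 :=
  tot_ext (f := (diff X).comp (diff X)) (g := 0) (fun i x => by
    change diff X (diff X (hom X i x)) = 0
    match i with
    | 0 => rw [diff_hom_zero, map_zero]
    | 1 => rw [diff_hom_succ, diff_hom_zero]
    | i + 2 =>
      rw [diff_hom_succ, diff_hom_succ]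
      refine (congrArg (hom X i) ?_).trans (map_zero _)
      exact congrArg (fun m => m.hom x) (X.d_comp_d (i + 1 + 1) (i + 1) i)) x

theorem pr_diff {i : ℕ} {x : Tot X} (h : pr X (i + 1) x = x) : pr X i (diff X x) = diff X x := by
  rw [pr_apply] at h
  rw [← h, diff_hom_succ, pr_hom]

theorem sgn_of_pr {i : ℕ} {x : Tot X} (h : pr X i x = x) : sgn X x = (-1 : k) ^ i • x := by
  rw [pr_apply] at h
  rw [← h, sgn_hom]

theorem diff_apply (i : ℕ) (x : Tot X) : (diff X x) i = X.d (i + 1) i (x (i + 1)) :=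
  tot_ext (f := (DirectSum.component k ℕ (fun i => X.X i) i).comp (diff X))
    (g := (X.d (i + 1) i).hom.comp (DirectSum.component k ℕ (fun i => X.X i) (i + 1)))
    (fun j x => by
      change (diff X (hom X j x)) i = X.d (i + 1) i ((hom X j x) (i + 1))
      cases j with
      | zero =>
        rw [diff_hom_zero, hom_apply_ne (Nat.succ_ne_zero i).symm, map_zero]
        rfl
      | succ j =>
        rw [diff_hom_succ]
        by_cases h : j = i
        · subst h
          rw [hom_apply_same, hom_apply_same]
        · rw [hom_apply_ne h, hom_apply_ne (fun e => h (Nat.succ_injective e)), map_zero]) x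

/-- A linear map on total spaces that respects the grading and the differentials. -/
def ofTot (φ : Tot X →ₗ[k] Tot Y) (h : ∀ i x, pr Y i (φ (hom X i x)) = φ (hom X i x))
    (hd : ∀ x, φ (diff X x) = diff Y (φ x)) : X ⟶ Y where
  f i := ModuleCat.ofHom (((DirectSum.component k ℕ (fun i => Y.X i) i).comp φ).comp (hom X i))
  comm' i j hij := by
    obtain rfl : j + 1 = i := hij
    refine ModuleCat.hom_ext (LinearMap.ext fun x => ?_)
    change Y.d (j + 1) j ((φ (hom X (j + 1) x)) (j + 1)) = (φ (hom X j (X.d (j + 1) j x))) j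
    rw [← diff_hom_succ, hd, diff_apply]

theorem totMap_ofTot (φ : Tot X →ₗ[k] Tot Y) (h : ∀ i x, pr Y i (φ (hom X i x)) = φ (hom X i x))
    (hd : ∀ x, φ (diff X x) = diff Y (φ x)) (x : Tot X) : totMap (ofTot φ h hd) x = φ x :=
  tot_ext (f := totMap (ofTot φ h hd)) (g := φ) (fun i x => by
    rw [totMap_hom]
    exact h i x) x

theorem hom_ext_totMap {f g : X ⟶ Y} (h : ∀ x, totMap f x = totMap g x) : f = g := by
  ext i x
  refine hom_injective i ?_
  rw [← totMap_hom, ← totMap_hom, h]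

end Tot

/-! ### Graded modules with operations -/

variable {O : ReducedOperad k}

/-- A module with homogeneous parts, with the operations of an algebra over `O`. -/
structure PreAlg (O : ReducedOperad k) where
  V : Type u
  [grp : AddCommGroup V]
  [mod : Module k V]
  p : ℕ → V →ₗ[k] V
  d : V →ₗ[k] V
  sgn : V →ₗ[k] V
  act : ∀ n : ℕ, Tot (O.obj (Fin n)) →ₗ[k] MultilinearMap k (fun _ : Fin n => V) V
  p_p : ∀ i v, p i (p i v) = p i v
  p_p_ne : ∀ {i j : ℕ} (_ : i ≠ j) (v), p i (p j v) = 0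
  d_d : ∀ v, d (d v) = 0
  p_d : ∀ {i : ℕ} {v}, p (i + 1) v = v → p i (d v) = d v
  sgn_p : ∀ {i : ℕ} {v}, p i v = v → sgn v = (-1 : k) ^ i • v
  act_p : ∀ (n q : ℕ) (o : (O.obj (Fin n)).X q) (deg : Fin n → ℕ) (x : Fin n → V),
    (∀ j, p (deg j) (x j) = x j) →
    p (q + ∑ j, deg j) (act n (hom _ q o) x) = act n (hom _ q o) x
  act_diff : ∀ (n : ℕ) (o : Tot (O.obj (Fin n))) (x : Fin n → V),
    d (act n o x) = act n (diff _ o) x +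
      ∑ j, act n (ChPlus.sgn _ o)
        (fun l => if l < j then sgn (x l) else if l = j then d (x l) else x l)
  act_perm : ∀ (n : ℕ) (σ : Equiv.Perm (Fin n)) (o : Tot (O.obj (Fin n)))
    (deg : Fin n → ℕ) (x : Fin n → V), (∀ j, p (deg j) (x j) = x j) →
    act n (totMap (O.map σ) o) x = koszulSign k σ deg • act n o (fun j => x (σ j))
  act_one : ∀ (e : Unit ≃ Fin 1) (x : Fin 1 → V),
    act 1 (totMap (O.map e) (hom _ 0 O.one)) x = x 0
  act_circ : ∀ (n m l : ℕ) (a : Fin n) (e : Ins (Fin n) a (Fin m) ≃ Fin l),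
    IsOrderedInsertion a e →
    ∀ (o : Tot (O.obj (Fin n))) (q : ℕ) (o' : (O.obj (Fin m)).X q) (x : Fin l → V),
    act l (totMap (O.map e) (O.circ a o (hom _ q o'))) x =
      act n o (fun b =>
        if h : b = a then act m (hom _ q o') (fun j => x (e (.inr j)))
        else if b < a then (sgn ^ q) (x (e (.inl ⟨b, h⟩)))
        else x (e (.inl ⟨b, h⟩)))

attribute [instance] PreAlg.grp PreAlg.mod

namespace PreAlg

variable (A : PreAlg O)

/-- The homogeneous elements; in degree `0` only the cycles. -/
def part : ℕ → Submodule k A.V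
  -- The differential may leave degree 0 downwards, as it does in the algebra of triples. Taking
  -- cycles is the good truncation, so that no negative degrees are needed.
  | 0 => LinearMap.ker (A.p 0 - LinearMap.id) ⊓ LinearMap.ker A.d
  | i + 1 => LinearMap.ker (A.p (i + 1) - LinearMap.id)

theorem p_of_mem {i : ℕ} {v : A.V} (h : v ∈ A.part i) : A.p i v = v := by
  cases i with
  | zero => exact sub_eq_zero.1 h.1
  | succ i => exact sub_eq_zero.1 h

theorem mem_part {i : ℕ} {v : A.V} (h : A.p i v = v) (h' : i = 0 → A.d v = 0) : v ∈ A.part i := by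
  cases i with
  | zero => exact ⟨sub_eq_zero.2 h, h' rfl⟩
  | succ i => exact sub_eq_zero.2 h

theorem d_mem {i : ℕ} {v : A.V} (h : v ∈ A.part (i + 1)) : A.d v ∈ A.part i :=
  A.mem_part (A.p_d (A.p_of_mem h)) fun _ => A.d_d v

/-- The underlying complex. -/
def cx : ChPlus k :=
  ChainComplex.of (fun i => ModuleCat.of k (A.part i))
    (fun i => ModuleCat.ofHom (A.d.restrict fun _ h => A.d_mem h))
    (fun i => ModuleCat.hom_ext (LinearMap.ext fun v => Subtype.ext (A.d_d v.1)))

/-- The underlying element of a homogeneous element. -/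
def val (i : ℕ) : A.cx.X i →ₗ[k] A.V := (A.part i).subtype

theorem val_injective (i : ℕ) : Function.Injective (A.val i) := Subtype.val_injective

theorem val_mem {i : ℕ} (v : A.cx.X i) : A.val i v ∈ A.part i := v.2

theorem exists_val {i : ℕ} {v : A.V} (h : v ∈ A.part i) : ∃ w : A.cx.X i, A.val i w = v :=
  ⟨⟨v, h⟩, rfl⟩

theorem val_d (i : ℕ) (v : A.cx.X (i + 1)) : A.val i (A.cx.d (i + 1) i v) = A.d (A.val (i + 1) v) :=
  congrArg (fun m : ModuleCat.of k (A.part (i + 1)) ⟶ ModuleCat.of k (A.part i) =>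
    (m.hom v : A.V)) (ChainComplex.of_d (fun i => ModuleCat.of k (A.part i))
    (fun i => ModuleCat.ofHom (A.d.restrict fun _ h => A.d_mem h)) i)

/-- The inclusion of the total space of the underlying complex. -/
def toV : Tot A.cx →ₗ[k] A.V := DirectSum.toModule k ℕ A.V fun i => A.val i

theorem toV_hom (i : ℕ) (v : A.cx.X i) : A.toV (hom A.cx i v) = A.val i v :=
  DirectSum.toModule_lof _ _ _

theorem p_toV_apply (i : ℕ) (x : Tot A.cx) : A.p i (A.toV x) = A.val i (x i) :=
  tot_ext (f := (A.p i).comp A.toV)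
    (g := (A.val i).comp (DirectSum.component k ℕ (fun i => A.cx.X i) i)) (fun j v => by
      change A.p i (A.toV (hom A.cx j v)) = A.val i ((hom A.cx j v) i)
      rw [toV_hom]
      by_cases h : j = i
      · subst h
        rw [hom_apply_same]
        exact A.p_of_mem (A.val_mem v)
      · rw [hom_apply_ne h, ← A.p_of_mem (A.val_mem v), A.p_p_ne (Ne.symm h), map_zero]) x

theorem toV_pr (i : ℕ) (x : Tot A.cx) : A.toV (pr A.cx i x) = A.p i (A.toV x) := by
  rw [p_toV_apply, pr_apply, toV_hom]

theorem toV_injective : Function.Injective A.toV := fun x y h => by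
  refine DFinsupp.ext fun i => A.val_injective i ?_
  refine (p_toV_apply A i x).symm.trans (Eq.trans ?_ (p_toV_apply A i y))
  rw [h]

theorem toV_diff (x : Tot A.cx) : A.toV (diff A.cx x) = A.d (A.toV x) :=
  tot_ext (f := A.toV.comp (diff A.cx)) (g := A.d.comp A.toV) (fun i x => by
    change A.toV (diff A.cx (hom A.cx i x)) = A.d (A.toV (hom A.cx i x))
    cases i with
    | zero =>
      rw [diff_hom_zero, toV_hom, map_zero]
      exact x.2.2.symm
    | succ i => rw [diff_hom_succ, toV_hom, toV_hom, val_d]) x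

theorem toV_sgn (x : Tot A.cx) : A.toV (ChPlus.sgn A.cx x) = A.sgn (A.toV x) :=
  tot_ext (f := A.toV.comp (ChPlus.sgn A.cx)) (g := A.sgn.comp A.toV) (fun i x => by
    change A.toV (ChPlus.sgn A.cx (hom A.cx i x)) = A.sgn (A.toV (hom A.cx i x))
    rw [sgn_hom, map_smul, toV_hom, A.sgn_p (A.p_of_mem (A.val_mem x))]) x

theorem toV_sgn_pow (q : ℕ) (x : Tot A.cx) :
    A.toV ((ChPlus.sgn A.cx ^ q) x) = (A.sgn ^ q) (A.toV x) := by
  induction q with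
  | zero => rfl
  | succ q ih =>
    rw [pow_succ', pow_succ', Module.End.mul_apply, Module.End.mul_apply, toV_sgn, ih]

theorem mem_range_toV {i : ℕ} {v : A.V} (h : v ∈ A.part i) : v ∈ LinearMap.range A.toV :=
  ⟨hom A.cx i ⟨v, h⟩, A.toV_hom i _⟩

/-- In total degree 0 the operation and all arguments have degree 0. The arguments are then cycles
and every term of the Leibniz formula vanishes. -/
theorem act_mem_part {n q : ℕ} {o : (O.obj (Fin n)).X q} {deg : Fin n → ℕ} {x : Fin n → A.V}
    (h : ∀ j, x j ∈ A.part (deg j)) : A.act n (hom _ q o) x ∈ A.part (q + ∑ j, deg j) := by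
  refine A.mem_part (A.act_p n q o deg x fun j => A.p_of_mem (h j)) fun h0 => ?_
  obtain ⟨rfl, h1⟩ := Nat.add_eq_zero_iff.1 h0
  rw [act_diff, diff_hom_zero, map_zero, zero_apply, zero_add]
  refine Finset.sum_eq_zero fun j _ => (A.act n _).map_coord_zero j ?_
  rw [if_neg (lt_irrefl j), if_pos rfl]
  have hj : deg j = 0 := Finset.sum_eq_zero_iff.1 h1 j (Finset.mem_univ j)
  have := h j
  rw [hj] at this
  exact this.2

end PreAlg

/-- A multilinear map on total spaces takes values in a submodule if it does so on homogeneous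
elements. -/
theorem multilinear_mem {X : ChPlus k} {n : ℕ} {M : Type*} [AddCommGroup M] [Module k M]
    (f : MultilinearMap k (fun _ : Fin n => Tot X) M) {S : Submodule k M}
    (h : ∀ (deg : Fin n → ℕ) (x : ∀ j, X.X (deg j)), f (fun j => hom X (deg j) (x j)) ∈ S)
    (x : Fin n → Tot X) : f x ∈ S := by
  choose s hs using fun j => exists_sum_hom (x j)
  have : x = fun j => ∑ i ∈ s j, hom X i (x j i) := funext hs
  rw [this, MultilinearMap.map_sum_finset]
  exact S.sum_mem fun r _ => h r fun j => x j (r j)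

namespace PreAlg

variable (A : PreAlg O)

theorem act_mem_range (n : ℕ) (o : Tot (O.obj (Fin n))) (x : Fin n → Tot A.cx) :
    A.act n o (fun j => A.toV (x j)) ∈ LinearMap.range A.toV := by
  refine multilinear_mem ((A.act n o).compLinearMap fun _ => A.toV) (fun deg x => ?_) x
  obtain ⟨s, hs⟩ := exists_sum_hom o
  rw [hs, map_sum]
  change (∑ q ∈ s, A.act n (hom _ q (o q))) (fun j => A.toV (hom A.cx (deg j) (x j))) ∈ _
  rw [sum_apply]
  refine Submodule.sum_mem _ fun q _ => A.mem_range_toV (A.act_mem_part (deg := deg) fun j => ?_)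
  rw [toV_hom]
  exact A.val_mem _

/-- The operations on the underlying complex. -/
def toAlgAct (n : ℕ) (o : Tot (O.obj (Fin n))) :
    MultilinearMap k (fun _ : Fin n => Tot A.cx) (Tot A.cx) :=
  (LinearEquiv.ofInjective A.toV A.toV_injective).symm.toLinearMap.compMultilinearMap
    (((A.act n o).compLinearMap fun _ => A.toV).codRestrict _ (A.act_mem_range n o))

theorem toV_toAlgAct (n : ℕ) (o : Tot (O.obj (Fin n))) (x : Fin n → Tot A.cx) :
    A.toV (A.toAlgAct n o x) = A.act n o (fun j => A.toV (x j)) :=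
  congrArg Subtype.val ((LinearEquiv.ofInjective A.toV A.toV_injective).apply_symm_apply
    ⟨A.act n o (fun j => A.toV (x j)), A.act_mem_range n o x⟩)

/-- The algebra of the homogeneous elements. -/
def toAlg : OpAlg O where
  cx := A.cx
  act n :=
    { toFun := A.toAlgAct n
      map_add' := fun o o' => MultilinearMap.ext fun x => A.toV_injective (by
        rw [add_apply, map_add, toV_toAlgAct, toV_toAlgAct, toV_toAlgAct, map_add,
          add_apply])
      map_smul' := fun c o => MultilinearMap.ext fun x => A.toV_injective (by
        rw [smul_apply, map_smul, toV_toAlgAct, toV_toAlgAct, map_smul,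
          smul_apply]; rfl) }
  act_mem n q o deg x := by
    have h := A.act_mem_part (o := o) (deg := deg) (fun j => A.val_mem (x j))
    refine ⟨⟨_, h⟩, A.toV_injective ((A.toV_hom _ _).trans ?_)⟩
    refine Eq.trans ?_ (A.toV_toAlgAct _ _ _).symm
    simp only [toV_hom]
    rfl
  act_diff n o x := by
    refine A.toV_injective ?_
    change A.toV (diff _ (A.toAlgAct n o x)) = A.toV (A.toAlgAct n _ x + ∑ j, A.toAlgAct n _ _)
    rw [toV_diff, toV_toAlgAct, act_diff, map_add, toV_toAlgAct, map_sum]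
    refine congrArg _ (Finset.sum_congr rfl fun j _ => ?_)
    rw [toV_toAlgAct]
    refine congrArg _ (funext fun l => ?_)
    split_ifs
    · exact (A.toV_sgn _).symm
    · exact (A.toV_diff _).symm
    · rfl
  act_perm n σ o deg x := by
    refine A.toV_injective ?_
    change A.toV (A.toAlgAct n _ _) = A.toV (koszulSign k σ deg • A.toAlgAct n o _)
    rw [map_smul, toV_toAlgAct, toV_toAlgAct]
    refine A.act_perm n σ o deg _ fun j => ?_
    rw [toV_hom]
    exact A.p_of_mem (A.val_mem _)
  act_one e x := by
    refine A.toV_injective ?_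
    exact (A.toV_toAlgAct _ _ _).trans (A.act_one e _)
  act_circ n m l a e he o q o' x := by
    refine A.toV_injective ?_
    refine (A.toV_toAlgAct _ _ _).trans ((A.act_circ n m l a e he o q o' _).trans ?_)
    refine Eq.trans ?_ (A.toV_toAlgAct _ _ _).symm
    refine congrArg _ (funext fun b => ?_)
    split_ifs
    · exact (A.toV_toAlgAct _ _ _).symm
    · exact (A.toV_sgn_pow _ _).symm
    · rfl

theorem toV_act (n : ℕ) (o : Tot (O.obj (Fin n))) (x : Fin n → Tot A.cx) :
    A.toV (A.toAlg.act n o x) = A.act n o (fun j => A.toV (x j)) := A.toV_toAlgAct n o x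

/-- A morphism out of the algebra of the homogeneous elements. -/
theorem exists_homOut {B : OpAlg O} (φ : A.V →ₗ[k] Tot B.cx)
    (hp : ∀ i v, φ (A.p i v) = pr B.cx i (φ v)) (hd : ∀ v, φ (A.d v) = diff B.cx (φ v))
    (ha : ∀ n o x, φ (A.act n o x) = B.act n o (fun j => φ (x j))) :
    ∃ f : A.toAlg ⟶ B, ∀ x : Tot A.cx, totMap f.map x = φ (A.toV x) := by
  have h1 : ∀ (i : ℕ) (x : A.cx.X i),
      pr B.cx i ((φ.comp A.toV) (hom A.cx i x)) = (φ.comp A.toV) (hom A.cx i x) := fun i x => by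
    change pr B.cx i (φ (A.toV (hom A.cx i x))) = φ (A.toV (hom A.cx i x))
    rw [← hp, toV_hom, A.p_of_mem (A.val_mem x)]
  have h2 : ∀ x, (φ.comp A.toV) (diff A.cx x) = diff B.cx ((φ.comp A.toV) x) := fun x => by
    change φ (A.toV (diff A.cx x)) = _
    rw [toV_diff, hd]
    rfl
  obtain ⟨f, hf⟩ : ∃ f : A.cx ⟶ B.cx, ∀ x, totMap f x = φ (A.toV x) :=
    ⟨ofTot _ h1 h2, totMap_ofTot _ h1 h2⟩
  exact ⟨⟨f, fun n o x => (hf _).trans ((congrArg φ (A.toV_act n o x)).trans ((ha n o _).trans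
    (congrArg _ (funext fun j => (hf (x j)).symm))))⟩, hf⟩

/-- A morphism into the algebra of the homogeneous elements. -/
theorem exists_homIn {B : OpAlg O} (g : Tot B.cx →ₗ[k] A.V)
    (hp : ∀ i x, g (pr B.cx i x) = A.p i (g x)) (hd : ∀ x, g (diff B.cx x) = A.d (g x))
    (ha : ∀ n o x, g (B.act n o x) = A.act n o (fun j => g (x j))) :
    ∃ f : B ⟶ A.toAlg, ∀ x, A.toV (totMap f.map x) = g x := by
  have hm : ∀ (i : ℕ) (x : B.cx.X i), g (hom B.cx i x) ∈ A.part i := fun i x =>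
    A.mem_part (by rw [← hp, pr_hom]) fun h => by
      subst h
      rw [← hd, diff_hom_zero, map_zero]
  have hr : ∀ x, g x ∈ LinearMap.range A.toV := fun x =>
    tot_induction (S := (LinearMap.range A.toV).comap g) (fun i x => A.mem_range_toV (hm i x)) x
  let φ : Tot B.cx →ₗ[k] Tot A.cx :=
    (LinearEquiv.ofInjective A.toV A.toV_injective).symm.toLinearMap.comp (g.codRestrict _ hr)
  have hφ : ∀ x, A.toV (φ x) = g x := fun x =>
    congrArg Subtype.val ((LinearEquiv.ofInjective A.toV A.toV_injective).apply_symm_apply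
      ⟨g x, hr x⟩)
  have h1 : ∀ (i : ℕ) (x : B.cx.X i), pr A.cx i (φ (hom B.cx i x)) = φ (hom B.cx i x) :=
    fun i x => A.toV_injective (by rw [toV_pr, hφ, ← hp, pr_hom])
  have h2 : ∀ x, φ (diff B.cx x) = diff A.cx (φ x) := fun x =>
    A.toV_injective (by rw [toV_diff, hφ, hφ, hd])
  obtain ⟨f, hf⟩ : ∃ f : B.cx ⟶ A.cx, ∀ x, A.toV (totMap f x) = g x :=
    ⟨ofTot φ h1 h2, fun x => (congrArg A.toV (totMap_ofTot φ h1 h2 x)).trans (hφ x)⟩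
  exact ⟨⟨f, fun n o x => A.toV_injective ((hf _).trans ((ha n o x).trans
    ((congrArg _ (funext fun j => (hf (x j)).symm)).trans (A.toV_act n o _).symm)))⟩, hf⟩

end PreAlg

end Goodwillie

end

/-! ### Algebras of families, modulo eventual equality along a filter. -/

noncomputable section

namespace Goodwillie

open ChPlus Filter

variable {k : Type u} [Field k] {O : ReducedOperad k}

/-! ### Algebras of families, up to eventual equality -/

theorem _root_.OpAlg.act_pr (A : OpAlg O) (n q : ℕ) (o : (O.obj (Fin n)).X q) (deg : Fin n → ℕ)
    (x : Fin n → Tot A.cx) (h : ∀ j, pr A.cx (deg j) (x j) = x j) :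
    pr A.cx (q + ∑ j, deg j) (A.act n (hom _ q o) x) = A.act n (hom _ q o) x := by
  obtain ⟨y, hy⟩ := A.act_mem n q o deg (fun j => x j (deg j))
  have : x = fun j => hom A.cx (deg j) (x j (deg j)) := funext fun j => (h j).symm
  rw [this, ← hy, pr_hom]

/-- The total space of an algebra. -/
def _root_.OpAlg.pre (A : OpAlg O) : PreAlg O where
  V := Tot A.cx
  p := pr A.cx
  d := diff A.cx
  sgn := ChPlus.sgn A.cx
  act := A.act
  p_p := pr_pr
  p_p_ne := pr_pr_ne
  d_d := diff_diff
  p_d := pr_diff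
  sgn_p := sgn_of_pr
  act_p := A.act_pr
  act_diff := A.act_diff
  act_perm n σ o deg x h := by
    have : x = fun j => hom A.cx (deg j) (x j (deg j)) := funext fun j => (h j).symm
    rw [this]
    exact A.act_perm n σ o deg _
  act_one := A.act_one
  act_circ := A.act_circ

variable {Λ : Type*} {L : Filter Λ} {B : Λ → PreAlg O}

variable (L B) in
/-- A set of families of elements of the `B l`, up to eventual equality, that is closed under the
operations. -/
structure Families where
  V : Type u
  e : ∀ l, V → (B l).V
  -- An element is determined by its eventual values, so every identity of the structure can be
  -- checked in almost all `B l`. The filter `⊤` gives a subalgebra of a product, and `atTop` on ℕ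
  -- detects elements of sequential colimits. The carrier stays in `Type u` however large the index
  -- type is.
  ext : ∀ {v w}, (∀ᶠ l in L, e l v = e l w) → v = w
  exists_zero : ∃ z, ∀ᶠ l in L, e l z = 0
  exists_add : ∀ v w, ∃ z, ∀ᶠ l in L, e l z = e l v + e l w
  exists_smul : ∀ (c : k) v, ∃ z, ∀ᶠ l in L, e l z = c • e l v
  exists_p : ∀ i v, ∃ z, ∀ᶠ l in L, e l z = (B l).p i (e l v)
  exists_d : ∀ v, ∃ z, ∀ᶠ l in L, e l z = (B l).d (e l v)
  exists_sgn : ∀ v, ∃ z, ∀ᶠ l in L, e l z = (B l).sgn (e l v)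
  exists_act : ∀ (n : ℕ) (o : Tot (O.obj (Fin n))) (v : Fin n → V), ∃ z, ∀ᶠ l in L, e l z = (B l).act n o (fun j => e l (v j))

namespace Families

variable (R : Families L B)

instance : Zero R.V := ⟨R.exists_zero.choose⟩
instance : Add R.V := ⟨fun v w => (R.exists_add v w).choose⟩
instance : SMul k R.V := ⟨fun c v => (R.exists_smul c v).choose⟩
instance : Neg R.V := ⟨fun v => (-1 : k) • v⟩

theorem e_zero : ∀ᶠ l in L, R.e l 0 = 0 := R.exists_zero.choose_spec

theorem e_add (v w : R.V) : ∀ᶠ l in L, R.e l (v + w) = R.e l v + R.e l w :=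
  (R.exists_add v w).choose_spec

theorem e_smul (c : k) (v : R.V) : ∀ᶠ l in L, R.e l (c • v) = c • R.e l v :=
  (R.exists_smul c v).choose_spec

instance : AddCommGroup R.V :=
  { AddGroup.ofLeftAxioms (G := R.V)
      (fun a b c => R.ext (by
        filter_upwards [R.e_add (a + b) c, R.e_add a b, R.e_add a (b + c), R.e_add b c]
          with l h1 h2 h3 h4
        rw [h1, h2, h3, h4, add_assoc]))
      (fun a => R.ext (by
        filter_upwards [R.e_add 0 a, R.e_zero] with l h1 h2
        rw [h1, h2, zero_add]))
      (fun a => R.ext (by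
        filter_upwards [R.e_add (-a) a, R.e_smul (-1) a, R.e_zero] with l h1 h2 h3
        rw [h1, h3]
        refine (congrArg (· + R.e l a) h2).trans ?_
        rw [neg_one_smul, neg_add_cancel])) with
    add_comm := fun a b => R.ext (by
      filter_upwards [R.e_add a b, R.e_add b a] with l h1 h2
      rw [h1, h2, add_comm]) }

instance : Module k R.V where
  one_smul a := R.ext (by
    filter_upwards [R.e_smul 1 a] with l h1
    rw [h1, one_smul])
  mul_smul c c' a := R.ext (by
    filter_upwards [R.e_smul (c * c') a, R.e_smul c (c' • a), R.e_smul c' a] with l h1 h2 h3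
    rw [h1, h2, h3, mul_smul])
  smul_zero c := R.ext (by
    filter_upwards [R.e_smul c 0, R.e_zero] with l h1 h2
    rw [h1, h2, smul_zero])
  smul_add c a b := R.ext (by
    filter_upwards [R.e_smul c (a + b), R.e_add a b, R.e_add (c • a) (c • b), R.e_smul c a,
      R.e_smul c b] with l h1 h2 h3 h4 h5
    rw [h1, h2, h3, h4, h5, smul_add])
  add_smul c c' a := R.ext (by
    filter_upwards [R.e_smul (c + c') a, R.e_add (c • a) (c' • a), R.e_smul c a, R.e_smul c' a]
      with l h1 h2 h3 h4
    rw [h1, h2, h3, h4, add_smul])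
  zero_smul a := R.ext (by
    filter_upwards [R.e_smul 0 a, R.e_zero] with l h1 h2
    rw [h1, h2, zero_smul])

theorem e_sum {ι : Type*} (s : Finset ι) (v : ι → R.V) :
    ∀ᶠ l in L, R.e l (∑ j ∈ s, v j) = ∑ j ∈ s, R.e l (v j) := by
  classical
  induction s using Finset.induction_on with
  | empty => simpa using R.e_zero
  | insert a s ha ih =>
    rw [Finset.sum_insert ha]
    filter_upwards [ih, R.e_add (v a) (∑ j ∈ s, v j)] with l h1 h2
    rw [h2, h1, Finset.sum_insert ha]

/-- A linear map defined by its values at almost all indices. -/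
def lift (φ : ∀ l, (B l).V →ₗ[k] (B l).V)
    (h : ∀ v, ∃ z, ∀ᶠ l in L, R.e l z = φ l (R.e l v)) : R.V →ₗ[k] R.V where
  toFun v := (h v).choose
  map_add' v w := R.ext (by
    filter_upwards [(h (v + w)).choose_spec, R.e_add v w, R.e_add (h v).choose (h w).choose,
      (h v).choose_spec, (h w).choose_spec] with l h1 h2 h3 h4 h5
    rw [h1, h2, h3, h4, h5, map_add])
  map_smul' c v := R.ext (by
    filter_upwards [(h (c • v)).choose_spec, R.e_smul c v, R.e_smul c (h v).choose,
      (h v).choose_spec] with l h1 h2 h3 h4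
    rw [h1, h2, RingHom.id_apply, h3, h4, map_smul])

theorem e_lift (φ : ∀ l, (B l).V →ₗ[k] (B l).V)
    (h : ∀ v, ∃ z, ∀ᶠ l in L, R.e l z = φ l (R.e l v)) (v : R.V) :
    ∀ᶠ l in L, R.e l (R.lift φ h v) = φ l (R.e l v) := (h v).choose_spec

theorem e_update {n : ℕ} [DecidableEq (Fin n)] (l : Λ) (v : Fin n → R.V) (i : Fin n) (w : R.V) :
    (fun j => R.e l (Function.update v i w j)) =
      Function.update (fun j => R.e l (v j)) i (R.e l w) :=
  funext fun j => Function.apply_update (fun _ => R.e l) v i w j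

/-- The operations. -/
def act (n : ℕ) : Tot (O.obj (Fin n)) →ₗ[k] MultilinearMap k (fun _ : Fin n => R.V) R.V where
  toFun o :=
    { toFun := fun v => (R.exists_act n o v).choose
      map_update_add' := fun v i a b => R.ext (by
        filter_upwards [(R.exists_act n o (Function.update v i (a + b))).choose_spec, R.e_add a b,
          (R.exists_act n o (Function.update v i a)).choose_spec,
          (R.exists_act n o (Function.update v i b)).choose_spec,
          R.e_add (R.exists_act n o (Function.update v i a)).choose
            (R.exists_act n o (Function.update v i b)).choose] with l h1 h2 h3 h4 h5
        rw [h1, h5, h3, h4, e_update, e_update, e_update, h2, MultilinearMap.map_update_add])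
      map_update_smul' := fun v i c a => R.ext (by
        filter_upwards [(R.exists_act n o (Function.update v i (c • a))).choose_spec,
          R.e_smul c a, (R.exists_act n o (Function.update v i a)).choose_spec,
          R.e_smul c (R.exists_act n o (Function.update v i a)).choose] with l h1 h2 h3 h4
        rw [h1, h4, h3, e_update, e_update, h2, MultilinearMap.map_update_smul]) }
  map_add' o o' := MultilinearMap.ext fun v => R.ext (by
    filter_upwards [(R.exists_act n (o + o') v).choose_spec,
      (R.exists_act n o v).choose_spec, (R.exists_act n o' v).choose_spec,
      R.e_add (R.exists_act n o v).choose (R.exists_act n o' v).choose] with l h1 h2 h3 h4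
    refine h1.trans (Eq.trans ?_ h4.symm)
    rw [h2, h3, map_add, add_apply])
  map_smul' c o := MultilinearMap.ext fun v => R.ext (by
    filter_upwards [(R.exists_act n (c • o) v).choose_spec,
      (R.exists_act n o v).choose_spec, R.e_smul c (R.exists_act n o v).choose] with l h1 h2 h3
    refine h1.trans (Eq.trans ?_ h3.symm)
    rw [h2, map_smul, smul_apply])

theorem e_act (n : ℕ) (o : Tot (O.obj (Fin n))) (v : Fin n → R.V) :
    ∀ᶠ l in L, R.e l (R.act n o v) = (B l).act n o (fun j => R.e l (v j)) :=
  (R.exists_act n o v).choose_spec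

/-- The projections. -/
def p (i : ℕ) : R.V →ₗ[k] R.V := R.lift (fun l => (B l).p i) (R.exists_p i)

theorem e_p (i : ℕ) (v : R.V) : ∀ᶠ l in L, R.e l (R.p i v) = (B l).p i (R.e l v) := R.e_lift _ _ v

/-- The differential. -/
def d : R.V →ₗ[k] R.V := R.lift (fun l => (B l).d) R.exists_d

theorem e_d (v : R.V) : ∀ᶠ l in L, R.e l (R.d v) = (B l).d (R.e l v) := R.e_lift _ _ v

/-- The sign involution. -/
def sgn : R.V →ₗ[k] R.V := R.lift (fun l => (B l).sgn) R.exists_sgn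

theorem e_sgn (v : R.V) : ∀ᶠ l in L, R.e l (R.sgn v) = (B l).sgn (R.e l v) := R.e_lift _ _ v

theorem e_sgn_pow (q : ℕ) (v : R.V) :
    ∀ᶠ l in L, R.e l ((R.sgn ^ q) v) = ((B l).sgn ^ q) (R.e l v) := by
  induction q with
  | zero => exact Eventually.of_forall fun _ => rfl
  | succ q ih =>
    filter_upwards [ih, R.e_sgn ((R.sgn ^ q) v)] with l h1 h2
    rw [pow_succ', pow_succ', Module.End.mul_apply, Module.End.mul_apply, h2, h1]

/-- Operations have finitely many arguments, so the eventual conditions on them hold simultaneously.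
-/
theorem e_homogeneous {n : ℕ} {deg : Fin n → ℕ} {v : Fin n → R.V}
    (h : ∀ j, R.p (deg j) (v j) = v j) :
    ∀ᶠ l in L, ∀ j, (B l).p (deg j) (R.e l (v j)) = R.e l (v j) := by
  refine eventually_all.2 fun j => ?_
  filter_upwards [R.e_p (deg j) (v j)] with l h1
  rw [← h1, h j]

/-- The algebra structure on families. -/
def pre : PreAlg O where
  V := R.V
  p := R.p
  d := R.d
  sgn := R.sgn
  act := R.act
  p_p i v := R.ext (by
    filter_upwards [R.e_p i v, R.e_p i (R.p i v)] with l h1 h2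
    rw [h2, h1, PreAlg.p_p])
  p_p_ne {i j} hij v := R.ext (by
    filter_upwards [R.e_p j v, R.e_p i (R.p j v), R.e_zero] with l h1 h2 h3
    rw [h2, h1, h3, PreAlg.p_p_ne _ hij])
  d_d v := R.ext (by
    filter_upwards [R.e_d v, R.e_d (R.d v), R.e_zero] with l h1 h2 h3
    rw [h2, h1, h3, PreAlg.d_d])
  p_d {i v} h := R.ext (by
    filter_upwards [R.e_d v, R.e_p i (R.d v), R.e_p (i + 1) v] with l h1 h2 h3
    rw [h] at h3
    rw [h2, h1, PreAlg.p_d _ h3.symm])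
  sgn_p {i v} h := R.ext (by
    filter_upwards [R.e_sgn v, R.e_smul ((-1) ^ i) v, R.e_p i v] with l h1 h2 h3
    rw [h] at h3
    rw [h2, h1, PreAlg.sgn_p _ h3.symm])
  act_p n q o deg x h := R.ext (by
    filter_upwards [R.e_p (q + ∑ j, deg j) (R.act n (hom _ q o) x), R.e_act n (hom _ q o) x,
      R.e_homogeneous h] with l h1 h2 h3
    rw [h1, h2, PreAlg.act_p _ n q o deg _ h3])
  act_diff n o x := R.ext (by
    have h7 : ∀ᶠ l in L, ∀ j, R.e l (R.sgn (x j)) = (B l).sgn (R.e l (x j)) :=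
      eventually_all.2 fun j => R.e_sgn _
    have h8 : ∀ᶠ l in L, ∀ j, R.e l (R.d (x j)) = (B l).d (R.e l (x j)) :=
      eventually_all.2 fun j => R.e_d _
    filter_upwards [R.e_d (R.act n o x), R.e_act n o x, R.e_act n (diff _ o) x,
      R.e_add (R.act n (diff _ o) x) (∑ j, R.act n (ChPlus.sgn _ o)
        (fun l => if l < j then R.sgn (x l) else if l = j then R.d (x l) else x l)),
      R.e_sum Finset.univ (fun j => R.act n (ChPlus.sgn _ o)
        (fun l => if l < j then R.sgn (x l) else if l = j then R.d (x l) else x l)),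
      eventually_all.2 fun j => R.e_act n (ChPlus.sgn _ o)
        (fun l => if l < j then R.sgn (x l) else if l = j then R.d (x l) else x l), h7, h8]
      with l h1 h2 h3 h4 h5 h6 h7 h8
    rw [h1, h2, PreAlg.act_diff, h4, h3, h5]
    refine congrArg _ (Finset.sum_congr rfl fun j _ => ?_)
    rw [h6]
    refine congrArg _ (funext fun i => ?_)
    split_ifs
    · exact (h7 i).symm
    · exact (h8 i).symm
    · rfl)
  act_perm n σ o deg x h := R.ext (by
    filter_upwards [R.e_act n (totMap (O.map σ) o) x, R.e_smul (koszulSign k σ deg)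
      (R.act n o fun j => x (σ j)), R.e_act n o (fun j => x (σ j)), R.e_homogeneous h]
      with l h1 h2 h3 h4
    rw [h1, h2, h3, PreAlg.act_perm _ n σ o deg _ h4])
  act_one e x := R.ext (by
    filter_upwards [R.e_act 1 (totMap (O.map e) (hom _ 0 O.one)) x] with l h1
    rw [h1, PreAlg.act_one])
  act_circ n m r a e he o q o' x := R.ext (by
    have h2 : ∀ᶠ l in L, ∀ j, R.e l ((R.sgn ^ q) (x j)) = ((B l).sgn ^ q) (R.e l (x j)) :=
      eventually_all.2 fun j => R.e_sgn_pow q _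
    filter_upwards [R.e_act r (totMap (O.map e) (O.circ a o (hom _ q o'))) x, h2,
      R.e_act n o (fun b =>
        if h : b = a then R.act m (hom _ q o') (fun j => x (e (.inr j)))
        else if b < a then (R.sgn ^ q) (x (e (.inl ⟨b, h⟩)))
        else x (e (.inl ⟨b, h⟩))), R.e_act m (hom _ q o') (fun j => x (e (.inr j)))]
      with l h1 h2 h3 h4
    rw [h1, h3, PreAlg.act_circ _ n m r a e he o q o']
    refine congrArg _ (funext fun b => ?_)
    split_ifs
    · exact h4.symm
    · exact (h2 _).symm
    · rfl)

end Families

variable (B) in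
/-- A set of families of elements of the `B l` that is closed under the operations. -/
structure RawFamilies where
  W : Type u
  e : ∀ l, W → (B l).V
  exists_zero : ∃ z, ∀ l, e l z = 0
  exists_add : ∀ v w, ∃ z, ∀ l, e l z = e l v + e l w
  exists_smul : ∀ (c : k) v, ∃ z, ∀ l, e l z = c • e l v
  exists_p : ∀ i v, ∃ z, ∀ l, e l z = (B l).p i (e l v)
  exists_d : ∀ v, ∃ z, ∀ l, e l z = (B l).d (e l v)
  exists_sgn : ∀ v, ∃ z, ∀ l, e l z = (B l).sgn (e l v)
  exists_act : ∀ (n : ℕ) (o : Tot (O.obj (Fin n))) (v : Fin n → W), ∃ z, ∀ l, e l z = (B l).act n o (fun j => e l (v j))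

namespace RawFamilies

variable (R : RawFamilies B)

variable (L) in
/-- Eventual equality. -/
def setoid : Setoid R.W where
  r v w := ∀ᶠ l in L, R.e l v = R.e l w
  iseqv := ⟨fun _ => Eventually.of_forall fun _ => rfl, fun h => h.mono fun _ => Eq.symm,
    fun h h' => by filter_upwards [h, h'] with l e e' using e.trans e'⟩

theorem e_out (w : R.W) :
    ∀ᶠ l in L, R.e l (Quotient.out (Quotient.mk (R.setoid L) w)) = R.e l w :=
  Quotient.exact (Quotient.out_eq (Quotient.mk (R.setoid L) w))

theorem exists_out {φ : ∀ l, (B l).V} (h : ∃ z, ∀ l, R.e l z = φ l) :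
    ∃ z : Quotient (R.setoid L), ∀ᶠ l in L, R.e l z.out = φ l := by
  obtain ⟨z, hz⟩ := h
  exact ⟨Quotient.mk _ z, (R.e_out z).mono fun l hl => hl.trans (hz l)⟩

variable (L) in
/-- The families up to eventual equality. -/
def families : Families L B where
  V := Quotient (R.setoid L)
  e l v := R.e l v.out
  ext {v w} h := by
    rw [← v.out_eq, ← w.out_eq]
    exact Quotient.sound h
  exists_zero := R.exists_out R.exists_zero
  exists_add _ _ := R.exists_out (R.exists_add _ _)
  exists_smul _ _ := R.exists_out (R.exists_smul _ _)
  exists_p _ _ := R.exists_out (R.exists_p _ _)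
  exists_d _ := R.exists_out (R.exists_d _)
  exists_sgn _ := R.exists_out (R.exists_sgn _)
  exists_act _ _ _ := R.exists_out (R.exists_act _ _ _)

end RawFamilies

end Goodwillie

end

/-! ### Homogeneous cycles, generation, and algebras with a universal property. -/

noncomputable section

namespace Goodwillie

open ChPlus Filter

variable {k : Type u} [Field k] {O : ReducedOperad k}

/-! ### Weak equivalences in terms of homogeneous elements -/

section Weq

variable {X Y : ChPlus k}

theorem diff_hom_succ_eq_zero {i : ℕ} {x : X.X (i + 1)} :
    diff X (hom X (i + 1) x) = 0 ↔ X.d (i + 1) i x = 0 := by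
  rw [diff_hom_succ]
  exact ⟨fun h => hom_injective i (h.trans (map_zero _).symm), fun h => by rw [h, map_zero]⟩

/-- On total spaces the differential vanishes in degree 0, so the cycle condition has the same form
in all degrees. -/
theorem weq_iff_homogeneous (f : X ⟶ Y) : WeakEquivalence f ↔ ∀ i : ℕ,
    (∀ x : X.X i, diff X (hom X i x) = 0 → (∃ y, Y.d (i + 1) i y = f.f i x) →
      ∃ z, X.d (i + 1) i z = x) ∧
    (∀ y : Y.X i, diff Y (hom Y i y) = 0 → ∃ x, diff X (hom X i x) = 0 ∧
      ∃ w, y = f.f i x + Y.d (i + 1) i w) := by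
  rw [chPlus_weq_iff]
  have h₀ : Cx.HIso ((chPlusV k).map f) (.negSucc 0) ↔
      (∀ x : X.X 0, diff X (hom X 0 x) = 0 → (∃ y, Y.d (0 + 1) 0 y = f.f 0 x) →
        ∃ z, X.d (0 + 1) 0 z = x) ∧
      (∀ y : Y.X 0, diff Y (hom Y 0 y) = 0 → ∃ x, diff X (hom X 0 x) = 0 ∧
        ∃ w, y = f.f 0 x + Y.d (0 + 1) 0 w) := by
    refine and_congr ⟨fun h x _ => h x rfl, fun h x _ => h x (diff_hom_zero x)⟩ ?_
    refine ⟨fun h y _ => ?_, fun h y _ => ?_⟩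
    · obtain ⟨x, -, w, hw⟩ := h y rfl
      exact ⟨x, diff_hom_zero x, w, hw⟩
    · obtain ⟨x, -, w, hw⟩ := h y (diff_hom_zero y)
      exact ⟨x, rfl, w, hw⟩
  have h₁ : ∀ n : ℕ, Cx.HIso ((chPlusV k).map f) (.ofNat n) ↔
      (∀ x : X.X (n + 1), diff X (hom X (n + 1) x) = 0 →
        (∃ y, Y.d (n + 1 + 1) (n + 1) y = f.f (n + 1) x) → ∃ z, X.d (n + 1 + 1) (n + 1) z = x) ∧
      (∀ y : Y.X (n + 1), diff Y (hom Y (n + 1) y) = 0 → ∃ x, diff X (hom X (n + 1) x) = 0 ∧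
        ∃ w, y = f.f (n + 1) x + Y.d (n + 1 + 1) (n + 1) w) := fun n => by
    simp only [diff_hom_succ_eq_zero]
    rfl
  exact ⟨fun h i => match i with
    | 0 => h₀.1 (h _)
    | n + 1 => (h₁ n).1 (h _), fun h i => match i with
    | .ofNat n => (h₁ n).2 (h _)
    | .negSucc 0 => h₀.2 (h _)
    | .negSucc (n + 1) => ⟨fun _ _ _ => ⟨0, rfl⟩, fun _ _ => ⟨0, rfl, 0, rfl⟩⟩⟩

theorem diff_pr (i : ℕ) (x : Tot X) : diff X (pr X (i + 1) x) = pr X i (diff X x) := by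
  rw [pr_apply, pr_apply, diff_hom_succ, diff_apply]

theorem diff_pr_eq_zero {x : Tot X} (h : diff X x = 0) (i : ℕ) : diff X (pr X i x) = 0 := by
  cases i with
  | zero => exact diff_hom_zero _
  | succ i => rw [diff_pr, h, map_zero]

/-- Projection to a degree is compatible with the differential, so the homology of the total space
is the direct sum of the homologies. -/
theorem weq_of_total (f : X ⟶ Y)
    (h₁ : ∀ x, diff X x = 0 → (∃ y, diff Y y = totMap f x) → ∃ z, diff X z = x)
    (h₂ : ∀ y, diff Y y = 0 → ∃ x, diff X x = 0 ∧ ∃ w, y = totMap f x + diff Y w) :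
    WeakEquivalence f := by
  refine (weq_iff_homogeneous f).2 fun i => ⟨fun x hx ⟨y, hy⟩ => ?_, fun y hy => ?_⟩
  · obtain ⟨z, hz⟩ := h₁ _ hx ⟨hom Y (i + 1) y, by rw [diff_hom_succ, hy, totMap_hom]⟩
    refine ⟨z (i + 1), ?_⟩
    rw [← diff_apply, hz, hom_apply_same]
  · obtain ⟨x, hx, w, hw⟩ := h₂ _ hy
    refine ⟨x i, diff_pr_eq_zero hx i, w (i + 1), ?_⟩
    rw [← diff_apply, ← totMap_apply, ← DirectSum.add_apply, ← hw, hom_apply_same]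

theorem exists_diff_eq {f : X ⟶ Y} (h : WeakEquivalence f) {x : Tot X} (hx : diff X x = 0)
    {y : Tot Y} (hy : diff Y y = totMap f x) : ∃ z, diff X z = x := by
  refine mem_of_pr_mem (S := LinearMap.range (diff X)) fun i => ?_
  obtain ⟨z, hz⟩ := ((weq_iff_homogeneous f).1 h i).1 (x i) (diff_pr_eq_zero hx i)
    ⟨y (i + 1), by rw [← diff_apply, hy, totMap_apply]⟩
  exact ⟨hom X (i + 1) z, by rw [diff_hom_succ, hz]; rfl⟩

theorem exists_cycle_eq {f : X ⟶ Y} (h : WeakEquivalence f) {y : Tot Y} (hy : diff Y y = 0) :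
    ∃ x, diff X x = 0 ∧ ∃ w, y = totMap f x + diff Y w := by
  have : y ∈ (LinearMap.ker (diff X)).map (totMap f) ⊔ LinearMap.range (diff Y) := by
    refine mem_of_pr_mem fun i => ?_
    obtain ⟨x, hx, w, hw⟩ := ((weq_iff_homogeneous f).1 h i).2 (y i) (diff_pr_eq_zero hy i)
    rw [pr_apply, hw, map_add]
    exact Submodule.add_mem_sup ⟨hom X i x, hx, totMap_hom f i x⟩
      ⟨hom Y (i + 1) w, diff_hom_succ i w⟩
  obtain ⟨_, ⟨x, hx, rfl⟩, _, ⟨w, rfl⟩, rfl⟩ := Submodule.mem_sup.1 this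
  exact ⟨x, hx, w, rfl⟩

end Weq

/-! ### Generators -/

section Generators

variable {A Z : OpAlg O}

/-- A subspace that is closed under the operations. -/
structure IsSub (A : OpAlg O) (S : Submodule k (Tot A.cx)) : Prop where
  pr : ∀ i, ∀ z ∈ S, pr A.cx i z ∈ S
  diff : ∀ z ∈ S, diff A.cx z ∈ S
  act : ∀ (n : ℕ) (o : Tot (O.obj (Fin n))) (x : Fin n → Tot A.cx), (∀ j, x j ∈ S) →
    A.act n o x ∈ S

theorem IsSub.sgn {S : Submodule k (Tot A.cx)} (h : IsSub A S) {z : Tot A.cx} (hz : z ∈ S) :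
    ChPlus.sgn A.cx z ∈ S := by
  obtain ⟨s, hs⟩ := exists_sum_hom z
  rw [hs, map_sum]
  refine S.sum_mem fun i _ => ?_
  rw [sgn_hom]
  exact S.smul_mem _ (h.pr i z hz)

/-- The elements `x g` generate the algebra. -/
def Generates {G : Type*} (Z : OpAlg O) {deg : G → ℕ} (x : ∀ g, Z.cx.X (deg g)) : Prop :=
  ∀ S, IsSub Z S → (∀ g, hom Z.cx (deg g) (x g) ∈ S) → ∀ z, z ∈ S

theorem isSub_eqLocus (f g : Z ⟶ A) : IsSub Z (LinearMap.eqLocus (totMap f.map) (totMap g.map)) where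
  pr i z h := by
    change totMap f.map _ = totMap g.map _
    rw [totMap_pr, totMap_pr, show totMap f.map z = totMap g.map z from h]
  diff z h := by
    change totMap f.map _ = totMap g.map _
    rw [totMap_diff, totMap_diff, show totMap f.map z = totMap g.map z from h]
  act n o x h := by
    change totMap f.map _ = totMap g.map _
    rw [f.map_act, g.map_act]
    exact congrArg _ (funext h)

theorem isSub_comap (f : Z ⟶ A) {S : Submodule k (Tot A.cx)} (hS : IsSub A S) :
    IsSub Z (S.comap (totMap f.map)) where
  pr i z h := by
    change totMap f.map _ ∈ S
    rw [totMap_pr]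
    exact hS.pr i _ h
  diff z h := by
    change totMap f.map _ ∈ S
    rw [totMap_diff]
    exact hS.diff _ h
  act n o x h := by
    change totMap f.map _ ∈ S
    rw [f.map_act]
    exact hS.act n o _ h

theorem alg_hom_ext {f g : Z ⟶ A} (h : ∀ i x, f.map.f i x = g.map.f i x) : f = g := by
  refine OpAlg.Hom.ext ?_
  ext i x
  exact h i x

theorem Generates.hom_ext {G : Type*} {deg : G → ℕ} {x : ∀ g, Z.cx.X (deg g)}
    (hx : Generates Z x) {f f' : Z ⟶ A} (h : ∀ g, f.map.f _ (x g) = f'.map.f _ (x g)) : f = f' :=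
  OpAlg.Hom.ext (hom_ext_totMap fun z => hx _ (isSub_eqLocus f f') (fun g => by
    change totMap f.map _ = totMap f'.map _
    rw [totMap_hom, totMap_hom, h]) z)

theorem exists_alg_hom (φ : Tot A.cx →ₗ[k] Tot Z.cx)
    (hp : ∀ i x, pr Z.cx i (φ (hom A.cx i x)) = φ (hom A.cx i x))
    (hd : ∀ x, φ (diff A.cx x) = diff Z.cx (φ x))
    (ha : ∀ n o x, φ (A.act n o x) = Z.act n o (fun j => φ (x j))) :
    ∃ f : A ⟶ Z, ∀ x, totMap f.map x = φ x :=
  ⟨⟨ofTot φ hp hd, fun n o x => by simp only [totMap_ofTot, ha]⟩, totMap_ofTot φ hp hd⟩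

/-- An elementwise assignment is linear and compatible with the operations because it becomes so
after each member of a jointly injective family of morphisms out of Z. -/
theorem exists_hom_of_jointly_injective (x : ∀ i, A.cx.X i → Z.cx.X i)
    (P : ∀ B : OpAlg O, (Z ⟶ B) → (A ⟶ B) → Prop)
    (hP : ∀ B f s, P B f s → ∀ i y, f.map.f i (x i y) = s.map.f i y)
    (inj : ∀ z z' : Tot Z.cx, (∀ B f s, P B f s → totMap f.map z = totMap f.map z') → z = z') :
    ∃ h : A ⟶ Z, ∀ i y, h.map.f i y = x i y := by
  have e : ∀ B f s, P B f s → ∀ i y, totMap f.map (hom Z.cx i (x i y)) =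
      totMap s.map (hom A.cx i y) := fun B f s h i y => by
    rw [totMap_hom, totMap_hom, hP B f s h]
  let φ : Tot A.cx →ₗ[k] Tot Z.cx := DirectSum.toModule k ℕ _ fun i =>
    { toFun := fun y => hom Z.cx i (x i y)
      map_add' := fun y y' => inj _ _ fun B f s h => by
        rw [map_add, e B f s h, e B f s h, e B f s h, map_add, map_add]
      map_smul' := fun c y => inj _ _ fun B f s h => by
        rw [RingHom.id_apply, map_smul, e B f s h, e B f s h, map_smul, map_smul] }
  have hφ : ∀ i y, φ (hom A.cx i y) = hom Z.cx i (x i y) := fun i y => DirectSum.toModule_lof _ _ _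
  have eφ : ∀ B f s, P B f s → ∀ z, totMap f.map (φ z) = totMap s.map z := fun B f s h =>
    tot_ext (f := (totMap f.map).comp φ) (g := totMap s.map) fun i y => by
      rw [LinearMap.comp_apply, hφ, e B f s h]
  obtain ⟨g, hg⟩ := exists_alg_hom φ (fun i y => by rw [hφ, pr_hom])
    (fun y => inj _ _ fun B f s h => by
      rw [eφ B f s h, totMap_diff, totMap_diff, eφ B f s h])
    (fun n o y => inj _ _ fun B f s h => by
      rw [eφ B f s h, s.map_act, f.map_act]
      exact congrArg _ (funext fun j => (eφ B f s h _).symm))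
  exact ⟨g, fun i y => hom_injective i (by rw [← totMap_hom, hg, hφ])⟩

/-- Formal expressions in generators. -/
inductive Expr (O : ReducedOperad k) (G : Type u) : Type u
  | zero : Expr O G
  | add : Expr O G → Expr O G → Expr O G
  | smul : k → Expr O G → Expr O G
  | p : ℕ → Expr O G → Expr O G
  | d : Expr O G → Expr O G
  | sgn : Expr O G → Expr O G
  | act : ∀ n : ℕ, Tot (O.obj (Fin n)) → (Fin n → Expr O G) → Expr O G
  | gen : G → Expr O G

/-- The value of an expression. -/
def Expr.eval {G : Type u} (B : PreAlg O) (ω : G → B.V) : Expr O G → B.V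
  | .zero => 0
  | .add v w => v.eval B ω + w.eval B ω
  | .smul c v => c • v.eval B ω
  | .p i v => B.p i (v.eval B ω)
  | .d v => B.d (v.eval B ω)
  | .sgn v => B.sgn (v.eval B ω)
  | .act n o v => B.act n o (fun j => (v j).eval B ω)
  | .gen g => ω g

/-- The universal algebra is the subalgebra generated by the tautological family inside the product
of all algebras with a good family. The hypothesis `hgood` says that goodness is inherited by an
algebra whose elements are separated by its morphisms to good ones. -/
theorem exists_universal {G : Type u} (deg : G → ℕ)
    (good : ∀ B : OpAlg O, (∀ g, B.cx.X (deg g)) → Prop)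
    (hgood : ∀ (Z : OpAlg O) (x : ∀ g, Z.cx.X (deg g)),
      (∀ z z' : Tot Z.cx, (∀ (B : OpAlg O) (ω : ∀ g, B.cx.X (deg g)), good B ω →
        ∀ f : Z ⟶ B, (∀ g, f.map.f (deg g) (x g) = ω g) → totMap f.map z = totMap f.map z') →
        z = z') →
      (∀ B ω, good B ω → ∃ f : Z ⟶ B, ∀ g, f.map.f (deg g) (x g) = ω g) → good Z x) :
    ∃ (Z : OpAlg O) (x : ∀ g, Z.cx.X (deg g)), good Z x ∧
      (∀ B ω, good B ω → ∃ f : Z ⟶ B, ∀ g, f.map.f (deg g) (x g) = ω g) ∧ Generates Z x := by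
  -- This index type is large, so the product is never formed. Its generated subalgebra is the set
  -- of formal expressions, which is small, modulo equality of all values.
  let Λ : Type (u + 1) := {l : Σ B : OpAlg O, ∀ g, B.cx.X (deg g) // good l.1 l.2}
  let B : Λ → PreAlg O := fun l => l.1.1.pre
  let raw : RawFamilies B :=
    { W := Expr O G
      e := fun l => Expr.eval (B l) fun g => hom l.1.1.cx (deg g) (l.1.2 g)
      exists_zero := ⟨.zero, fun _ => rfl⟩
      exists_add := fun v w => ⟨.add v w, fun _ => rfl⟩
      exists_smul := fun c v => ⟨.smul c v, fun _ => rfl⟩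
      exists_p := fun i v => ⟨.p i v, fun _ => rfl⟩
      exists_d := fun v => ⟨.d v, fun _ => rfl⟩
      exists_sgn := fun v => ⟨.sgn v, fun _ => rfl⟩
      exists_act := fun n o v => ⟨.act n o v, fun _ => rfl⟩ }
  let R := raw.families ⊤
  let mk : Expr O G → R.V := Quotient.mk _
  have e_mk : ∀ l w, R.e l (mk w) = raw.e l w := fun l w => eventually_top.1 (raw.e_out w) l
  have ext : ∀ v w : R.V, (∀ l, R.e l v = R.e l w) → v = w := fun v w h =>
    R.ext (Eventually.of_forall h)
  let A : PreAlg O := R.pre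
  have hx : ∀ g, mk (.gen g) ∈ A.part (deg g) := fun g => A.mem_part
    (ext _ _ fun l => by
      rw [e_mk]
      refine (eventually_top.1 (R.e_p (deg g) (mk (.gen g))) l).trans ?_
      rw [e_mk]
      exact pr_hom _ _)
    fun h0 => ext _ _ fun l => by
      refine (eventually_top.1 (R.e_d (mk (.gen g))) l).trans
        (Eq.trans ?_ (eventually_top.1 R.e_zero l).symm)
      rw [e_mk]
      change ChPlus.diff _ (hom l.1.1.cx (deg g) (l.1.2 g)) = 0
      generalize l.1.2 g = y
      generalize deg g = i at h0 y
      subst h0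
      exact diff_hom_zero y
  let x : ∀ g, A.toAlg.cx.X (deg g) := fun g => ⟨_, hx g⟩
  have hgen : Generates A.toAlg x := by
    intro S hS hxS
    -- Every element is the class of an expression, and expressions are built by operations under
    -- which `S` is closed. In particular no element is lost by passing to homogeneous parts.
    have key : ∀ t : Expr O G, mk t ∈ S.map A.toV := by
      intro t
      induction t with
      | zero =>
        refine ⟨0, S.zero_mem, (map_zero _).trans (ext _ _ fun l => ?_)⟩
        rw [e_mk]
        exact eventually_top.1 R.e_zero l
      | add v w hv hw =>
        obtain ⟨a, ha, ha'⟩ := hv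
        obtain ⟨b, hb, hb'⟩ := hw
        refine ⟨a + b, S.add_mem ha hb, (map_add _ _ _).trans (ext _ _ fun l => ?_)⟩
        rw [ha', hb', e_mk]
        refine (eventually_top.1 (R.e_add (mk v) (mk w)) l).trans ?_
        rw [e_mk, e_mk]
        rfl
      | smul c v hv =>
        obtain ⟨a, ha, ha'⟩ := hv
        refine ⟨c • a, S.smul_mem c ha, (map_smul _ _ _).trans (ext _ _ fun l => ?_)⟩
        rw [ha', e_mk]
        refine (eventually_top.1 (R.e_smul c (mk v)) l).trans ?_
        rw [e_mk]
        rfl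
      | p i v hv =>
        obtain ⟨a, ha, ha'⟩ := hv
        refine ⟨pr _ i a, hS.pr i a ha, (A.toV_pr i a).trans (ext _ _ fun l => ?_)⟩
        rw [ha', e_mk]
        refine (eventually_top.1 (R.e_p i (mk v)) l).trans ?_
        rw [e_mk]
        rfl
      | d v hv =>
        obtain ⟨a, ha, ha'⟩ := hv
        refine ⟨diff _ a, hS.diff a ha, (A.toV_diff a).trans (ext _ _ fun l => ?_)⟩
        rw [ha', e_mk]
        refine (eventually_top.1 (R.e_d (mk v)) l).trans ?_
        rw [e_mk]
        rfl
      | sgn v hv =>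
        obtain ⟨a, ha, ha'⟩ := hv
        refine ⟨ChPlus.sgn _ a, hS.sgn ha, (A.toV_sgn a).trans (ext _ _ fun l => ?_)⟩
        rw [ha', e_mk]
        refine (eventually_top.1 (R.e_sgn (mk v)) l).trans ?_
        rw [e_mk]
        rfl
      | act n o v hv =>
        choose a ha ha' using hv
        refine ⟨A.toAlg.act n o a, hS.act n o a ha, (A.toV_act n o a).trans (ext _ _ fun l => ?_)⟩
        rw [funext ha', e_mk]
        refine (eventually_top.1 (R.e_act n o (fun j => mk (v j))) l).trans ?_
        simp only [e_mk]
        rfl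
      | gen g => exact ⟨_, hxS g, A.toV_hom _ _⟩
    intro z
    obtain ⟨t, ht⟩ := Quotient.exists_rep (A.toV z)
    obtain ⟨a, ha, ha'⟩ := key t
    rwa [A.toV_injective (ha'.trans ht)] at ha
  have hex : ∀ l : Λ, ∃ f : A.toAlg ⟶ l.1.1, ∀ z : Tot A.cx, totMap f.map z = R.e l (A.toV z) := fun l =>
    A.exists_homOut
      { toFun := R.e l
        map_add' := fun v w => eventually_top.1 (R.e_add v w) l
        map_smul' := fun c v => eventually_top.1 (R.e_smul c v) l }
      (fun i v => eventually_top.1 (R.e_p i v) l) (fun v => eventually_top.1 (R.e_d v) l)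
      (fun n o v => eventually_top.1 (R.e_act n o v) l)
  have hfx : ∀ (l : Λ) (f : A.toAlg ⟶ l.1.1),
      (∀ z : Tot A.cx, totMap f.map z = R.e l (A.toV z)) → ∀ g, f.map.f (deg g) (x g) = l.1.2 g :=
    fun l f hf g => hom_injective (deg g) ((totMap_hom _ _ _).symm.trans ((hf _).trans
      ((congrArg (R.e l) (A.toV_hom (deg g) (x g))).trans (e_mk l (.gen g)))))
  have huniv : ∀ B ω, good B ω → ∃ f : A.toAlg ⟶ B, ∀ g, f.map.f (deg g) (x g) = ω g :=
    fun B ω h => by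
      obtain ⟨f, hf⟩ := hex ⟨⟨B, ω⟩, h⟩
      exact ⟨f, hfx ⟨⟨B, ω⟩, h⟩ f hf⟩
  refine ⟨A.toAlg, x, hgood _ _ (fun z z' h => A.toV_injective (ext _ _ fun l => ?_)) huniv,
    huniv, hgen⟩
  obtain ⟨f, hf⟩ := hex l
  exact (hf z).symm.trans ((h _ _ l.2 f (hfx l f hf)).trans (hf z'))

end Generators

end Goodwillie

end

/-! ### Colimits and limits of algebras, and their realization. -/

noncomputable section

namespace Goodwillie

open ChPlus Filter

variable {k : Type u} [Field k] {O : ReducedOperad k}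

/-! ### Colimits of algebras -/

/-- The generators are all homogeneous elements of all F(j), and a family is good when it comes from
a cocone. Generation by the images of the F(j) is recorded because it is used for sequential
colimits. -/
theorem exists_colimit {J : Type} [SmallCategory J] (F : J ⥤ OpAlg O) :
    ∃ c : Cocone F, Nonempty (IsColimit c) ∧ ∀ S, IsSub c.pt S →
      (∀ j i y, hom c.pt.cx i ((c.ι.app j).map.f i y) ∈ S) → ∀ z, z ∈ S := by
  let G : Type u := Σ (j : J) (i : ℕ), (F.obj j).cx.X i
  let good : ∀ B : OpAlg O, (∀ g : G, B.cx.X g.2.1) → Prop := fun B ω =>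
    ∃ s : ∀ j, F.obj j ⟶ B, (∀ (j j' : J) (f : j ⟶ j'), F.map f ≫ s j' = s j) ∧
      ∀ j i y, (s j).map.f i y = ω ⟨j, i, y⟩
  obtain ⟨Z, x, ⟨s, hs, hsx⟩, hu, hg⟩ := exists_universal (O := O) (fun g : G => g.2.1) good
    fun Z x inj hu => by
      have h : ∀ j, ∃ h : F.obj j ⟶ Z, ∀ i y, h.map.f i y = x ⟨j, i, y⟩ := fun j =>
        exists_hom_of_jointly_injective (fun i y => x ⟨j, i, y⟩)
          (fun B f s => (∀ i y, s.map.f i y = f.map.f i (x ⟨j, i, y⟩)) ∧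
            ∃ ω, good B ω ∧ ∀ g, f.map.f g.2.1 (x g) = ω g)
          (fun B f s h i y => (h.1 i y).symm)
          (fun z z' h => inj z z' fun B ω hω f hf => by
            obtain ⟨s, hs, hsω⟩ := hω
            exact h B f (s j) ⟨fun i y => (hsω j i y).trans (hf ⟨j, i, y⟩).symm,
              ω, ⟨s, hs, hsω⟩, hf⟩)
      choose s hs using h
      refine ⟨s, fun j j' f => alg_hom_ext fun i y => hom_injective i (inj _ _ ?_), hs⟩
      intro B ω hω g hg
      obtain ⟨t, ht, htω⟩ := hω
      have e : ∀ j, s j ≫ g = t j := fun j => alg_hom_ext fun i y =>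
        (congrArg (g.map.f i) (hs j i y)).trans ((hg ⟨j, i, y⟩).trans (htω j i y).symm)
      rw [totMap_hom, totMap_hom]
      refine congrArg _ (congrArg (fun m : F.obj j ⟶ B => m.map.f i y) ?_ :
        ((F.map f ≫ s j') ≫ g).map.f i y = (s j ≫ g).map.f i y)
      rw [Category.assoc, e, e, ht]
  let c : Cocone F :=
    { pt := Z
      ι := { app := s, naturality := fun j j' f => by
              rw [hs]
              exact (Category.comp_id _).symm } }
  have huc : ∀ t : Cocone F, ∃ f : Z ⟶ t.pt, ∀ j, s j ≫ f = t.ι.app j := fun t => by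
    obtain ⟨f, hf⟩ := hu t.pt (fun g => (t.ι.app g.1).map.f g.2.1 g.2.2)
      ⟨t.ι.app, fun j j' f => t.w f, fun _ _ _ => rfl⟩
    exact ⟨f, fun j => alg_hom_ext fun i y =>
      (congrArg (f.map.f i) (hsx j i y)).trans (hf ⟨j, i, y⟩)⟩
  choose d hd using huc
  refine ⟨c, ⟨{ desc := d, fac := hd, uniq := fun t m hm => hg.hom_ext fun g => ?_ }⟩, ?_⟩
  · rw [← hsx]
    exact congrArg (fun m : F.obj g.1 ⟶ t.pt => m.map.f g.2.1 g.2.2) ((hm g.1).trans (hd t g.1).symm)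
  · intro S hS h
    refine hg S hS fun g => ?_
    rw [← hsx]
    exact h _ _ _

instance : HasColimitsOfShape WalkingSpan (OpAlg O) where
  has_colimit F := by
    obtain ⟨c, ⟨hc⟩, -⟩ := exists_colimit F
    exact ⟨⟨c, hc⟩⟩

/-! ### Sequential colimits -/

section Sequential

variable (F : ℕ ⥤ OpAlg O)

/-- The sequences of elements. -/
def rawSequences : RawFamilies fun m => (F.obj m).pre where
  W := ∀ m, Tot (F.obj m).cx
  e l v := v l
  exists_zero := ⟨0, fun _ => rfl⟩
  exists_add v w := ⟨v + w, fun _ => rfl⟩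
  exists_smul c v := ⟨c • v, fun _ => rfl⟩
  exists_p i v := ⟨fun m => pr _ i (v m), fun _ => rfl⟩
  exists_d v := ⟨fun m => diff _ (v m), fun _ => rfl⟩
  exists_sgn v := ⟨fun m => ChPlus.sgn _ (v m), fun _ => rfl⟩
  exists_act n o v := ⟨fun m => (F.obj m).act n o (fun j => v j m), fun _ => rfl⟩

/-- The sequences of elements, up to eventual equality. -/
def sequences : Families (atTop : Filter ℕ) fun m => (F.obj m).pre := (rawSequences F).families atTop

/-- The image of an element in the later stages. -/
def later (l : ℕ) (x : Tot (F.obj l).cx) (m : ℕ) : Tot (F.obj m).cx :=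
  if h : l ≤ m then totMap (F.map (homOfLE h)).map x else 0

theorem later_of_le {l m : ℕ} (h : l ≤ m) (x : Tot (F.obj l).cx) :
    later F l x m = totMap (F.map (homOfLE h)).map x := dif_pos h

theorem totMap_alg_comp {X Y Z : OpAlg O} (f : X ⟶ Y) (g : Y ⟶ Z) (x : Tot X.cx) :
    totMap (f ≫ g).map x = totMap g.map (totMap f.map x) := totMap_comp f.map g.map x

theorem totMap_congr {X Y : OpAlg O} {f g : X ⟶ Y} (h : f = g) (x : Tot X.cx) :
    totMap f.map x = totMap g.map x := by rw [h]

theorem exists_sequence (v : ∀ m, Tot (F.obj m).cx) :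
    ∃ z : (sequences F).V, ∀ᶠ m in atTop, (sequences F).e m z = v m :=
  ⟨Quotient.mk _ v, (rawSequences F).e_out v⟩

/-- An element is sent to the sequence of its later images. Whatever is put before stage l is
irrelevant modulo eventual equality, so this is a morphism. -/
theorem exists_toSequences (l : ℕ) : ∃ f : F.obj l ⟶ (sequences F).pre.toAlg, ∀ x,
    ∀ᶠ m in atTop, (sequences F).e m ((sequences F).pre.toV (totMap f.map x)) = later F l x m := by
  choose g hg using fun x => exists_sequence F (later F l x)
  have hg' : ∀ x, ∀ᶠ m in atTop, ∃ h : l ≤ m,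
      (sequences F).e m (g x) = totMap (F.map (homOfLE h)).map x := fun x => by
    filter_upwards [hg x, eventually_ge_atTop l] with m h1 h2
    exact ⟨h2, h1.trans (later_of_le F h2 x)⟩
  let φ : Tot (F.obj l).cx →ₗ[k] (sequences F).pre.V :=
    { toFun := g
      map_add' := fun x y => (sequences F).ext (by
        filter_upwards [hg' (x + y), hg' x, hg' y, (sequences F).e_add (g x) (g y)]
          with m ⟨h, h1⟩ ⟨_, h2⟩ ⟨_, h3⟩ h4
        refine h1.trans (Eq.trans ?_ h4.symm)
        rw [h2, h3, map_add]
        rfl)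
      map_smul' := fun c x => (sequences F).ext (by
        filter_upwards [hg' (c • x), hg' x, (sequences F).e_smul c (g x)]
          with m ⟨h, h1⟩ ⟨_, h2⟩ h4
        refine h1.trans (Eq.trans ?_ h4.symm)
        rw [h2, map_smul]
        rfl) }
  obtain ⟨f, hf⟩ := (sequences F).pre.exists_homIn φ
    (fun i x => (sequences F).ext (by
      filter_upwards [hg' (pr _ i x), hg' x, (sequences F).e_p i (g x)] with m ⟨h, h1⟩ ⟨_, h2⟩ h4
      refine h1.trans (Eq.trans ?_ h4.symm)
      rw [h2, totMap_pr]
      rfl))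
    (fun x => (sequences F).ext (by
      filter_upwards [hg' (diff _ x), hg' x, (sequences F).e_d (g x)] with m ⟨h, h1⟩ ⟨_, h2⟩ h4
      refine h1.trans (Eq.trans ?_ h4.symm)
      rw [h2, totMap_diff]
      rfl))
    (fun n o x => (sequences F).ext (by
      filter_upwards [hg' ((F.obj l).act n o x), eventually_all.2 fun j => hg' (x j),
        (sequences F).e_act n o (fun j => g (x j))] with m ⟨h, h1⟩ h2 h4
      refine h1.trans (Eq.trans ?_ h4.symm)
      rw [(F.map (homOfLE h)).map_act]
      exact congrArg _ (funext fun j => (h2 j).2.symm)))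
  refine ⟨f, fun x => ?_⟩
  rw [hf]
  exact hg x

variable {F} {c : Cocone F} (hc : IsColimit c)

include hc

/-- The maps to sequences form a cocone, so an element that vanishes in the colimit has an
eventually zero sequence of images. -/
theorem exists_map_eq_zero {l : ℕ} {x : Tot (F.obj l).cx} (hx : totMap (c.ι.app l).map x = 0) :
    ∃ (m : ℕ) (f : l ⟶ m), totMap (F.map f).map x = 0 := by
  choose f hf using exists_toSequences F
  have w : ∀ (l l' : ℕ) (g : l ⟶ l'), F.map g ≫ f l' = f l := fun l l' g => by
    refine OpAlg.Hom.ext (hom_ext_totMap fun x => (sequences F).pre.toV_injective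
      ((sequences F).ext ?_))
    filter_upwards [hf l x, hf l' (totMap (F.map g).map x), eventually_ge_atTop l']
      with m h1 h2 h3
    rw [h1, totMap_alg_comp, h2, later_of_le F h3, later_of_le F ((leOfHom g).trans h3),
      ← totMap_alg_comp, ← F.map_comp]
    rfl
  let t : Cocone F :=
    { pt := (sequences F).pre.toAlg
      ι := { app := f, naturality := fun l l' g => (w l l' g).trans (Category.comp_id _).symm } }
  have e : totMap (f l).map x = 0 := by
    refine (totMap_congr (hc.fac t l).symm x).trans ?_
    rw [totMap_alg_comp, hx, map_zero]
  have h := hf l x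
  have e' : (sequences F).pre.toV (totMap (f l).map x) = 0 :=
    (congrArg (sequences F).pre.toV e).trans (map_zero _)
  rw [e'] at h
  obtain ⟨m, h1, h2, h3⟩ :=
    (h.and ((eventually_ge_atTop l).and (sequences F).e_zero)).exists
  exact ⟨m, homOfLE h2, (later_of_le F h2 x).symm.trans (h1.symm.trans h3)⟩

/-- The images of the stages are closed under the operations, as finitely many elements have a
common stage. The colimit constructed in `exists_colimit` is generated by such images, and any other
colimit is isomorphic to it. -/
theorem exists_stage (z : Tot c.pt.cx) : ∃ (l : ℕ) (x : Tot (F.obj l).cx),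
    totMap (c.ι.app l).map x = z := by
  have up : ∀ {l : ℕ} (x : Tot (F.obj l).cx) {m : ℕ} (h : l ≤ m),
      totMap (c.ι.app m).map (totMap (F.map (homOfLE h)).map x) = totMap (c.ι.app l).map x :=
    fun x m h => by rw [← totMap_alg_comp, c.w]
  let S : Submodule k (Tot c.pt.cx) :=
    { carrier := {z | ∃ (l : ℕ) (x : Tot (F.obj l).cx), totMap (c.ι.app l).map x = z}
      zero_mem' := ⟨0, 0, map_zero _⟩
      add_mem' := by
        rintro _ _ ⟨l, x, rfl⟩ ⟨l', x', rfl⟩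
        exact ⟨max l l', _ + _, (map_add _ _ _).trans
          (congrArg₂ _ (up x (le_max_left _ _)) (up x' (le_max_right _ _)))⟩
      smul_mem' := by
        rintro a _ ⟨l, x, rfl⟩
        exact ⟨l, a • x, map_smul _ _ _⟩ }
  have hS : IsSub c.pt S :=
    { pr := by
        rintro i _ ⟨l, x, rfl⟩
        exact ⟨l, pr _ i x, totMap_pr _ _ _⟩
      diff := by
        rintro _ ⟨l, x, rfl⟩
        exact ⟨l, diff _ x, totMap_diff _ _⟩
      act := fun n o x h => by
        choose l y hy using h
        have hl : ∀ j, l j ≤ Finset.univ.sup l := fun j => Finset.le_sup (Finset.mem_univ j)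
        refine ⟨Finset.univ.sup l, (F.obj _).act n o fun j => totMap (F.map (homOfLE (hl j))).map (y j),
          ((c.ι.app _).map_act n o _).trans (congrArg _ (funext fun j => ?_))⟩
        rw [up, hy] }
  obtain ⟨c', ⟨hc'⟩, h'⟩ := exists_colimit F
  have : ∀ y, totMap (hc'.desc c).map y ∈ S := fun y =>
    h' _ (isSub_comap (hc'.desc c) hS) (fun l i x => by
      refine ⟨l, hom _ i x, ?_⟩
      rw [← hc'.fac c l, totMap_alg_comp]
      exact congrArg _ (totMap_hom _ _ _)) y
  have e : hc.desc c' ≫ hc'.desc c = 𝟙 c.pt := hc.hom_ext fun l => by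
    rw [← Category.assoc, hc.fac, hc'.fac, Category.comp_id]
  have h := this (totMap (hc.desc c').map z)
  rw [← totMap_alg_comp, totMap_congr e] at h
  exact (totMap_id c.pt.cx z) ▸ h

theorem exists_stage_homogeneous (i : ℕ) (z : c.pt.cx.X i) : ∃ (l : ℕ) (x : (F.obj l).cx.X i),
    (c.ι.app l).map.f i x = z := by
  obtain ⟨l, x, hx⟩ := exists_stage hc (hom _ i z)
  refine ⟨l, x i, ?_⟩
  rw [← totMap_apply, hx, hom_apply_same]

theorem exists_stage_boundary {i l : ℕ} {x : (F.obj l).cx.X i} {y : c.pt.cx.X (i + 1)}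
    (hy : c.pt.cx.d (i + 1) i y = (c.ι.app l).map.f i x) :
    ∃ (m : ℕ) (f : l ⟶ m) (y' : (F.obj m).cx.X (i + 1)),
      (F.obj m).cx.d (i + 1) i y' = (F.map f).map.f i x := by
  obtain ⟨l', y', rfl⟩ := exists_stage_homogeneous hc (i + 1) y
  let f := homOfLE (le_max_left l l')
  let f' := homOfLE (le_max_right l l')
  have h : totMap (c.ι.app (max l l')).map (diff _ (totMap (F.map f').map (hom _ (i + 1) y')) -
      totMap (F.map f).map (hom _ i x)) = 0 := by
    rw [map_sub, totMap_diff, ← totMap_alg_comp, ← totMap_alg_comp, c.w, c.w, totMap_hom,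
      totMap_hom, sub_eq_zero]
    exact (diff_hom_succ _ _).trans (congrArg (hom c.pt.cx i) hy)
  obtain ⟨m, g, hg⟩ := exists_map_eq_zero hc h
  refine ⟨m, f ≫ g, (F.map (f' ≫ g)).map.f (i + 1) y', hom_injective i ?_⟩
  rw [← diff_hom_succ, ← totMap_hom, ← totMap_hom, F.map_comp, F.map_comp, totMap_alg_comp,
    totMap_alg_comp, ← totMap_diff]
  rw [map_sub] at hg
  exact sub_eq_zero.1 hg

end Sequential

/-! ### The realization of algebras -/

/-- Algebras on one generator represent the homogeneous elements. -/
theorem exists_free (O : ReducedOperad k) (i : ℕ) : ∃ (Z : OpAlg O) (x : Z.cx.X i),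
    (∀ (B : OpAlg O) (y : B.cx.X i), ∃ f : Z ⟶ B, f.map.f i x = y) ∧
    ∀ (B : OpAlg O) (f g : Z ⟶ B), f.map.f i x = g.map.f i x → f = g := by
  obtain ⟨Z, x, -, h, hg⟩ := exists_universal (O := O) (G := PUnit) (fun _ => i)
    (fun _ _ => True) fun _ _ _ _ => trivial
  refine ⟨Z, x ⟨⟩, fun B y => ?_, fun B f g e => hg.hom_ext fun _ => e⟩
  obtain ⟨f, hf⟩ := h B (fun _ => y) trivial
  exact ⟨f, hf ⟨⟩⟩

section Limits

variable {J : Type} [SmallCategory J] {F : J ⥤ OpAlg O} {c : Cone F} (hc : IsLimit c)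

include hc

/-- Homogeneous elements of degree i are the morphisms out of the free algebra on one generator, so
the universal property of the limit applies to them directly. -/
theorem alg_limit_ext (i : ℕ) (x y : c.pt.cx.X i)
    (h : ∀ j, (c.π.app j).map.f i x = (c.π.app j).map.f i y) : x = y := by
  obtain ⟨Z, z, hz, hz'⟩ := exists_free O i
  obtain ⟨f, rfl⟩ := hz c.pt x
  obtain ⟨g, rfl⟩ := hz c.pt y
  rw [hc.hom_ext fun j => hz' _ (f ≫ c.π.app j) (g ≫ c.π.app j) (h j)]

theorem alg_limit_exists (i : ℕ) (y : ∀ j, (F.obj j).cx.X i)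
    (hy : ∀ (j j' : J) (f : j ⟶ j'), (F.map f).map.f i (y j) = y j') :
    ∃ x : c.pt.cx.X i, ∀ j, (c.π.app j).map.f i x = y j := by
  obtain ⟨Z, z, hz, hz'⟩ := exists_free O i
  choose f hf using fun j => hz (F.obj j) (y j)
  let t : Cone F :=
    { pt := Z
      π := { app := f, naturality := fun j j' g => by
              refine (Category.id_comp _).trans (hz' _ _ _ ((hf j').trans ((hy j j' g).symm.trans ?_)))
              exact congrArg ((F.map g).map.f i) (hf j).symm } }
  refine ⟨(hc.lift t).map.f i z, fun j => ?_⟩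
  rw [← hf j]
  exact congrArg (fun m : Z ⟶ F.obj j => m.map.f i z) (hc.fac t j)

end Limits

theorem alg_weq_iff {X Y : OpAlg O} (f : X ⟶ Y) : WeakEquivalence f ↔ WeakEquivalence f.map := by
  rw [weakEquivalence_iff, weakEquivalence_iff]
  rfl

theorem alg_fibration_iff {X Y : OpAlg O} (f : X ⟶ Y) :
    Fibration f ↔ ∀ i : ℕ, 0 < i → Function.Surjective (f.map.f i) := by
  rw [fibration_iff]
  rfl

variable (O) in
/-- The realization of algebras. -/
def opAlgRealization : Realization.{u} (OpAlg O) where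
  V := OpAlg.forget O ⋙ chPlusV k
  S := {i | -2 ≤ i}
  upClosed := (chPlusRealization k).upClosed
  weq_iff f := (alg_weq_iff f).trans (chPlus_weq_iff f.map)
  ex X := (chPlusRealization k).ex X.cx
  map_zero X Y := chPlusV_map_zero k X.cx Y.cx
  surjective f hf i hi := by
    have h := (alg_fibration_iff f).1 hf
    match i with
    | .ofNat n => exact h (n + 1 + 1) (Nat.succ_pos _)
    | .negSucc 0 => exact h 1 Nat.one_pos
    | .negSucc (n + 1) =>
      obtain ⟨j, hj, e⟩ := hi
      change -2 ≤ j at hj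
      omega
  limit_ext hc i := match i with
    | .ofNat n => alg_limit_ext hc n
    | .negSucc n => fun _ _ _ => rfl
  limit_exists hc i := match i with
    | .ofNat n => alg_limit_exists hc n
    | .negSucc n => fun _ _ => ⟨PUnit.unit, fun _ => rfl⟩
  isNull F c hc h := isNull_of_boundary (OpAlg.forget O ⋙ chPlusV k) (fun i x hx =>
    (((alg_weq_iff _).trans (chPlus_weq_iff _)).1 h i).1 x hx
      ⟨0, (map_zero _).trans (chPlusV_map_zero k _ _ _ x).symm⟩) (fun i => match i with
      | .ofNat n => fun l x ⟨y, hy⟩ => exists_stage_boundary hc hy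
      | .negSucc n => fun l x _ => ⟨l, 𝟙 l, 0, rfl⟩) _

end Goodwillie

end

/-! ### Cell attachments and the factorization into a cofibration and an equivalence. -/

noncomputable section

namespace Goodwillie

open ChPlus Filter

variable {k : Type u} [Field k] {O : ReducedOperad k}

/-! ### Attaching cells -/

/-- The algebra obtained from `A` by freely adding elements, some of them with prescribed
boundary. -/
structure Attached (A : OpAlg O) {T : Type u} (deg : T → ℕ) (bd : T → Option (Tot A.cx)) where
  Z : OpAlg O
  j : A ⟶ Z
  x : ∀ t, Z.cx.X (deg t)
  diff_x : ∀ t, ∀ z ∈ bd t, diff Z.cx (hom Z.cx (deg t) (x t)) = totMap j.map z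
  exists_lift : ∀ (B : OpAlg O) (s : A ⟶ B) (ω : ∀ t, B.cx.X (deg t)),
    (∀ t, ∀ z ∈ bd t, diff B.cx (hom B.cx (deg t) (ω t)) = totMap s.map z) →
    ∃ f : Z ⟶ B, j ≫ f = s ∧ ∀ t, f.map.f (deg t) (x t) = ω t
  generates : ∀ S, IsSub Z S → (∀ y, totMap j.map y ∈ S) → (∀ t, hom Z.cx (deg t) (x t) ∈ S) →
    ∀ z, z ∈ S

/-- Another instance of `exists_universal`: good families are a morphism from A with new elements.
For `some z` the boundary of the new element is prescribed, and for `none` it is left free. -/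
theorem exists_attached (A : OpAlg O) {T : Type u} (deg : T → ℕ) (bd : T → Option (Tot A.cx)) :
    Nonempty (Attached A deg bd) := by
  let G : Type u := (Σ i : ℕ, A.cx.X i) ⊕ T
  let dg : G → ℕ := Sum.elim (fun g => g.1) deg
  let good : ∀ B : OpAlg O, (∀ g : G, B.cx.X (dg g)) → Prop := fun B ω =>
    ∃ s : A ⟶ B, (∀ i y, s.map.f i y = ω (.inl ⟨i, y⟩)) ∧
      ∀ t, ∀ z ∈ bd t, diff B.cx (hom B.cx (deg t) (ω (.inr t))) = totMap s.map z
  obtain ⟨Z, x, ⟨j, hj, hx⟩, hu, hg⟩ := exists_universal (O := O) dg good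
    fun Z x inj hu => by
      obtain ⟨h, hh⟩ : ∃ h : A ⟶ Z, ∀ i y, h.map.f i y = x (.inl ⟨i, y⟩) :=
        exists_hom_of_jointly_injective (fun i y => x (.inl ⟨i, y⟩))
          (fun B f s => (∀ i y, s.map.f i y = f.map.f i (x (.inl ⟨i, y⟩))) ∧
            ∃ ω, good B ω ∧ ∀ g, f.map.f (dg g) (x g) = ω g)
          (fun B f s h i y => (h.1 i y).symm)
          (fun z z' h => inj z z' fun B ω hω f hf => by
            obtain ⟨s, hs, hsω⟩ := hω
            exact h B f s ⟨fun i y => (hs i y).trans (hf (.inl ⟨i, y⟩)).symm, ω, ⟨s, hs, hsω⟩, hf⟩)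
      refine ⟨h, hh, fun t z hz => inj _ _ fun B ω hω g hg => ?_⟩
      obtain ⟨s, hs, hsω⟩ := hω
      have e : h ≫ g = s := alg_hom_ext fun i y =>
        (congrArg (g.map.f i) (hh i y)).trans ((hg (.inl ⟨i, y⟩)).trans (hs i y).symm)
      rw [totMap_diff, ← totMap_alg_comp, e, ← hsω t z hz]
      exact congrArg (diff B.cx) ((totMap_hom _ _ _).trans (congrArg _ (hg (.inr t))))
  refine ⟨⟨Z, j, fun t => x (.inr t), hx, fun B s ω h => ?_, fun S hS hA hT => ?_⟩⟩
  · obtain ⟨f, hf⟩ := hu B (fun g => match g with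
      | .inl ⟨i, y⟩ => s.map.f i y
      | .inr t => ω t) ⟨s, fun _ _ => rfl, h⟩
    exact ⟨f, alg_hom_ext fun i y => (congrArg (f.map.f i) (hj i y)).trans (hf (.inl ⟨i, y⟩)),
      fun t => hf (.inr t)⟩
  · refine hg S hS fun g => ?_
    match g with
    | .inl ⟨i, y⟩ =>
      refine (congrArg (hom Z.cx i) (hj i y)) ▸ ?_
      rw [← totMap_hom]
      exact hA _
    | .inr t => exact hT t

/-! ### Trivial fibrations -/

section Lifting

variable {P Q : OpAlg O} {q : P ⟶ Q} (hq : trivialFibrations (OpAlg O) q)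

include hq

theorem surjective_of_trivialFibration (i : ℕ) : Function.Surjective (q.map.f (i + 1)) :=
  (alg_fibration_iff q).1 ⟨hq.1⟩ (i + 1) i.succ_pos

theorem weq_of_trivialFibration : WeakEquivalence q.map := (alg_weq_iff q).1 ⟨hq.2⟩

/-- Fibrations need not be surjective in degree 0. Surjectivity on H_0 together with surjectivity in
degree 1 supplies it for trivial ones. -/
theorem exists_lift_zero (y : Q.cx.X 0) : ∃ x, q.map.f 0 x = y := by
  obtain ⟨x, -, w, rfl⟩ := ((weq_iff_homogeneous q.map).1 (weq_of_trivialFibration hq) 0).2 y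
    (diff_hom_zero y)
  obtain ⟨w, rfl⟩ := surjective_of_trivialFibration hq 0 w
  refine ⟨x + P.cx.d 1 0 w, ?_⟩
  rw [map_add]
  exact congrArg (q.map.f 0 x + ·) (congrArg (fun m => m.hom w) (q.map.comm 1 0).symm)

/-- Lifting against the inclusion of a sphere in a disc: `z` bounds because homology injects, and
the bounding chain is corrected over Q first by a cycle and then by a boundary. -/
theorem exists_lift_succ {i : ℕ} {z : P.cx.X i} (hz : diff P.cx (hom P.cx i z) = 0)
    {y : Q.cx.X (i + 1)} (hy : Q.cx.d (i + 1) i y = q.map.f i z) :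
    ∃ x, P.cx.d (i + 1) i x = z ∧ q.map.f (i + 1) x = y := by
  have h := (weq_iff_homogeneous q.map).1 (weq_of_trivialFibration hq)
  have c : ∀ (j : ℕ) (x : P.cx.X (j + 1)),
      q.map.f j (P.cx.d (j + 1) j x) = Q.cx.d (j + 1) j (q.map.f (j + 1) x) := fun j x =>
    congrArg (fun m => m.hom x) (q.map.comm (j + 1) j).symm
  obtain ⟨x₀, rfl⟩ := (h i).1 z hz ⟨y, hy⟩
  obtain ⟨x₁, hx₁, w, hw⟩ := (h (i + 1)).2 (y - q.map.f (i + 1) x₀) (diff_hom_succ_eq_zero.2 (by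
    rw [map_sub, hy, c, sub_self]))
  obtain ⟨w, rfl⟩ := surjective_of_trivialFibration hq (i + 1) w
  refine ⟨x₀ + x₁ + P.cx.d (i + 1 + 1) (i + 1) w, ?_, ?_⟩
  · have hd : P.cx.d (i + 1) i (P.cx.d (i + 1 + 1) (i + 1) w) = 0 :=
      congrArg (fun m => m.hom w) (P.cx.d_comp_d (i + 1 + 1) (i + 1) i)
    rw [map_add, map_add, diff_hom_succ_eq_zero.1 hx₁, hd, add_zero, add_zero]
  · rw [map_add, map_add, c, add_assoc (q.map.f (i + 1) x₀), ← hw, add_sub_cancel]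

end Lifting

/-! ### The factorization -/

section Factor

variable {Y : OpAlg O}

/-- One round of the small object argument, performed over Y. -/
theorem exists_attach_all_cells (P : Over Y) : ∃ (P' : Over Y) (j : P ⟶ P'),
    (trivialFibrations (OpAlg O)).llp j.left ∧
    (∀ (i : ℕ) (z : P.left.cx.X i) (y : Y.cx.X (i + 1)), diff P.left.cx (hom _ i z) = 0 →
      Y.cx.d (i + 1) i y = P.hom.map.f i z →
      ∃ x, P'.left.cx.d (i + 1) i x = j.left.map.f i z ∧ P'.hom.map.f (i + 1) x = y) ∧
    ∀ y : Y.cx.X 0, ∃ x, P'.hom.map.f 0 x = y := by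
  let A := P.left
  -- A cell for every cycle of A with a chain of Y that bounds its image, and a free generator of
  -- degree 0 for every element of Y in degree 0.
  let T : Type u := {t : Σ i : ℕ, A.cx.X i × Y.cx.X (i + 1) //
    diff A.cx (hom _ t.1 t.2.1) = 0 ∧ Y.cx.d (t.1 + 1) t.1 t.2.2 = P.hom.map.f t.1 t.2.1} ⊕ Y.cx.X 0
  let deg : T → ℕ := Sum.elim (fun t => t.1.1 + 1) fun _ => 0
  let bd : T → Option (Tot A.cx) := Sum.elim (fun t => some (hom _ t.1.1 t.1.2.1)) fun _ => none
  obtain ⟨E⟩ := exists_attached A deg bd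
  obtain ⟨p, hp, hpx⟩ := E.exists_lift Y P.hom (fun t => match t with
    | .inl t => t.1.2.2
    | .inr y => y) (fun t z hz => by
      match t with
      | .inl t =>
        obtain rfl : _ = z := Option.some_inj.1 hz
        refine (diff_hom_succ _ _).trans (Eq.trans ?_ (totMap_hom _ _ _).symm)
        exact congrArg (hom Y.cx t.1.1) t.2.2
      | .inr y => exact (Option.not_mem_none _ hz).elim)
  have hE : ∀ t : {t : Σ i : ℕ, A.cx.X i × Y.cx.X (i + 1) //
      diff A.cx (hom _ t.1 t.2.1) = 0 ∧ Y.cx.d (t.1 + 1) t.1 t.2.2 = P.hom.map.f t.1 t.2.1},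
      E.Z.cx.d (t.1.1 + 1) t.1.1 (E.x (.inl t)) = E.j.map.f t.1.1 t.1.2.1 := fun t =>
    hom_injective t.1.1 ((diff_hom_succ t.1.1 (E.x (.inl t))).symm.trans
      ((E.diff_x (.inl t) _ rfl).trans (totMap_hom _ _ _)))
  refine ⟨Over.mk p, Over.homMk E.j hp, ?_, fun i z y hz hy => ?_, fun y => ?_⟩
  · intro U V q hq
    constructor
    intro a b sq
    have hx : ∀ t : T, ∃ x : U.cx.X (deg t), (∀ z ∈ bd t, diff _ (hom _ (deg t) x) =
        totMap a.map z) ∧ q.map.f (deg t) x = b.map.f (deg t) (E.x t) := by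
      intro t
      match t with
      | .inl t =>
        have hz : diff U.cx (hom U.cx t.1.1 (a.map.f t.1.1 t.1.2.1)) = 0 := by
          rw [← totMap_hom, ← totMap_diff, t.2.1, map_zero]
        have hy : V.cx.d (t.1.1 + 1) t.1.1 (b.map.f (t.1.1 + 1) (E.x (.inl t))) =
            q.map.f t.1.1 (a.map.f t.1.1 t.1.2.1) := by
          refine (congrArg (fun m => m.hom (E.x (.inl t))) (b.map.comm (t.1.1 + 1) t.1.1)).trans ?_
          refine (congrArg (b.map.f t.1.1) (hE t)).trans ?_
          exact congrArg (fun m : A ⟶ V => m.map.f t.1.1 t.1.2.1) sq.w.symm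
        obtain ⟨x, hx, hx'⟩ := exists_lift_succ hq hz hy
        refine ⟨x, fun z h => ?_, hx'⟩
        obtain rfl : _ = z := Option.some_inj.1 h
        refine (diff_hom_succ _ _).trans (Eq.trans ?_ (totMap_hom _ _ _).symm)
        exact congrArg (hom U.cx t.1.1) hx
      | .inr y =>
        obtain ⟨x, hx⟩ := exists_lift_zero hq (b.map.f 0 (E.x (.inr y)))
        exact ⟨x, fun z h => (Option.not_mem_none _ h).elim, hx⟩
    choose ω hω hω' using hx
    obtain ⟨l, hl, hlx⟩ := E.exists_lift U a ω hω
    refine ⟨⟨⟨l, hl, OpAlg.Hom.ext (hom_ext_totMap fun z => E.generates _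
      (isSub_eqLocus (l ≫ q) b) (fun y => ?_) (fun t => ?_) z)⟩⟩⟩
    · change totMap (l ≫ q).map (totMap E.j.map y) = totMap b.map (totMap E.j.map y)
      rw [← totMap_alg_comp, ← totMap_alg_comp, ← Category.assoc, hl]
      exact totMap_congr sq.w y
    · change totMap (l ≫ q).map (hom _ _ _) = totMap b.map (hom _ _ _)
      rw [totMap_hom, totMap_hom, ← hω' t, ← hlx t]
      rfl
  · exact ⟨E.x (.inl ⟨⟨i, z, y⟩, hz, hy⟩), hE ⟨⟨i, z, y⟩, hz, hy⟩, hpx (.inl ⟨⟨i, z, y⟩, hz, hy⟩)⟩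
  · exact ⟨E.x (.inr y), hpx (.inr y)⟩

/-- Countably many rounds suffice, because elements and relations of a sequential colimit already
occur at finite stages. -/
theorem exists_cof_weq_factorization {X : OpAlg O} (f : X ⟶ Y) :
    ∃ (Z : OpAlg O) (i : X ⟶ Z) (p : Z ⟶ Y), Cofibration i ∧ WeakEquivalence p ∧ i ≫ p = f := by
  choose next j hj h₁ h₂ using fun P : Over Y => exists_attach_all_cells P
  let P : ℕ → Over Y := fun n => Nat.rec (Over.mk f) (fun _ => next) n
  let Φ : ℕ ⥤ Over Y := Functor.ofSequence (X := P) fun n => j (P n)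
  let F : ℕ ⥤ OpAlg O := Φ ⋙ Over.forget Y
  obtain ⟨c, ⟨hc⟩, -⟩ := exists_colimit F
  let t : Cocone F :=
    { pt := Y
      ι := { app := fun n => (P n).hom
             naturality := fun m n g => (Over.w (Φ.map g)).trans (Category.comp_id _).symm } }
  let p := hc.desc t
  have hp : ∀ n, c.ι.app n ≫ p = (P n).hom := hc.fac t
  have hs : ∀ n, F.map (homOfLE (Nat.le_add_right n 1)) = (j (P n)).left := fun n =>
    congrArg (fun m : P n ⟶ P (n + 1) => m.left)
      (Functor.ofSequence_map_homOfLE_succ (fun n => j (P n)) n)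
  refine ⟨c.pt, c.ι.app 0, p, ?_, ?_, hp 0⟩
  · refine (cofibration_iff _).2 fun U V q hq => ?_
    refine HasLiftingProperty.transfiniteComposition.hasLiftingProperty_ι_app_bot hc fun n _ => ?_
    have : F.map (homOfLE (Order.le_succ n)) = (j (P n)).left := hs n
    rw [this]
    exact hj (P n) q hq
  · refine (alg_weq_iff p).2 ((weq_iff_homogeneous p.map).2 fun i => ⟨?_, fun y hy => ?_⟩)
    · rintro z hz ⟨y, hy⟩
      obtain ⟨l, x, rfl⟩ := exists_stage_homogeneous hc i z
      have hx : totMap (c.ι.app l).map (diff _ (hom _ i x)) = 0 := by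
        rw [totMap_diff, totMap_hom]
        exact hz
      -- The representative is a cycle only after its boundary has died at stage m. The next round
      -- then attaches a cell that kills it.
      obtain ⟨m, g, hg⟩ := exists_map_eq_zero hc hx
      rw [totMap_diff, totMap_hom] at hg
      have e₁ : (c.ι.app m).map.f i ((F.map g).map.f i x) = (c.ι.app l).map.f i x :=
        congrArg (fun n : F.obj l ⟶ c.pt => n.map.f i x) (c.w g)
      obtain ⟨x', hx'⟩ : ∃ x', x' = (F.map g).map.f i x := ⟨_, rfl⟩
      rw [← hx'] at hg e₁
      rw [← e₁] at hy ⊢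
      obtain ⟨w, hw, -⟩ := h₁ (P m) i x' y hg
        (hy.trans (congrArg (fun n : F.obj m ⟶ Y => n.map.f i x') (hp m)))
      refine ⟨(c.ι.app (m + 1)).map.f (i + 1) w, ?_⟩
      refine (congrArg (fun n => n.hom w) ((c.ι.app (m + 1)).map.comm (i + 1) i)).trans ?_
      refine (congrArg ((c.ι.app (m + 1)).map.f i) hw).trans ?_
      rw [← hs m]
      exact congrArg (fun n : F.obj m ⟶ c.pt => n.map.f i x') (c.w _)
    -- Surjectivity on homology needs one round only: free generators in degree 0, and cells
    -- attached along the zero cycle in positive degrees.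
    · cases i with
      | zero =>
        obtain ⟨x, rfl⟩ := h₂ (P 0) y
        refine ⟨(c.ι.app 1).map.f 0 x, diff_hom_zero _, 0, ?_⟩
        rw [map_zero, add_zero]
        exact congrArg (fun n : F.obj 1 ⟶ Y => n.map.f 0 x) (hp 1).symm
      | succ i =>
        obtain ⟨x, hx, rfl⟩ := h₁ (P 0) i 0 y (by rw [map_zero, map_zero]) (by
          rw [diff_hom_succ_eq_zero.1 hy, map_zero])
        rw [map_zero] at hx
        refine ⟨(c.ι.app 1).map.f (i + 1) x, ?_, 0, ?_⟩
        · refine diff_hom_succ_eq_zero.2 ?_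
          refine (congrArg (fun n => n.hom x) ((c.ι.app 1).map.comm (i + 1) i)).trans ?_
          exact (congrArg ((c.ι.app 1).map.f i) hx).trans (map_zero _)
        · rw [map_zero, add_zero]
          exact congrArg (fun n : F.obj 1 ⟶ Y => n.map.f (i + 1) x) (hp 1).symm

end Factor

end Goodwillie

end

/-! ### Koszul signs and multilinear bookkeeping. -/

noncomputable section

namespace Goodwillie

open ChPlus

variable {k : Type u} [Field k] {O : ReducedOperad k}

/-! ### Signs -/

section Signs

variable {X Y : ChPlus k}

theorem neg_one_pow_mul_self (i : ℕ) : (-1 : k) ^ i * (-1) ^ i = 1 := by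
  rw [← mul_pow, neg_one_mul, neg_neg, one_pow]

theorem sgn_sgn (x : Tot X) : sgn X (sgn X x) = x :=
  tot_ext (f := (sgn X).comp (sgn X)) (g := LinearMap.id) (fun i x => by
    change sgn X (sgn X (hom X i x)) = hom X i x
    rw [sgn_hom, map_smul, sgn_hom, smul_smul, neg_one_pow_mul_self, one_smul]) x

theorem sgn_diff (x : Tot X) : sgn X (diff X x) = -diff X (sgn X x) :=
  tot_ext (f := (sgn X).comp (diff X)) (g := -(diff X).comp (sgn X)) (fun i x => by
    change sgn X (diff X (hom X i x)) = -diff X (sgn X (hom X i x))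
    cases i with
    | zero => rw [sgn_hom, map_smul, diff_hom_zero, map_zero, smul_zero, neg_zero]
    | succ i =>
      rw [sgn_hom, map_smul, diff_hom_succ, sgn_hom, pow_succ, mul_neg_one, neg_smul, neg_neg]) x

theorem sgn_pow_sgn (q : ℕ) (x : Tot X) : (sgn X ^ q) (sgn X x) = sgn X ((sgn X ^ q) x) := by
  rw [← Module.End.mul_apply, ← pow_succ, pow_succ', Module.End.mul_apply]

/-- The degree of a value of an operation is the sum of the degrees involved, so the parity sign is
multiplicative. -/
theorem _root_.OpAlg.sgn_act (A : OpAlg O) (n : ℕ) (o : Tot (O.obj (Fin n)))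
    (x : Fin n → Tot A.cx) :
    sgn A.cx (A.act n o x) = A.act n (sgn _ o) (fun j => sgn A.cx (x j)) := by
  have h : ∀ (q : ℕ) (o : (O.obj (Fin n)).X q) (x : Fin n → Tot A.cx),
      sgn A.cx (A.act n (hom _ q o) x) = A.act n (sgn _ (hom _ q o)) (fun j => sgn A.cx (x j)) := by
    intro q o x
    refine sub_eq_zero.1 ((Submodule.mem_bot k).1 (multilinear_mem
      ((sgn A.cx).compMultilinearMap (A.act n (hom _ q o)) -
        (A.act n (sgn _ (hom _ q o))).compLinearMap fun _ => sgn A.cx) (fun deg x => ?_) x))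
    refine (Submodule.mem_bot k).2 (sub_eq_zero.2 ?_)
    change sgn A.cx (A.act n (hom _ q o) _) = A.act n (sgn _ (hom _ q o)) _
    simp only [LinearMap.coe_comp, Function.comp_apply, sgn_hom]
    rw [MultilinearMap.map_smul_univ, map_smul, smul_apply,
      sgn_of_pr (A.act_pr n q o deg _ fun j => pr_hom _ _), smul_smul, pow_add,
      Finset.prod_pow_eq_pow_sum, mul_comm]
  obtain ⟨s, hs⟩ := exists_sum_hom o
  rw [hs, map_sum, map_sum, map_sum, sum_apply, sum_apply, map_sum]
  exact Finset.sum_congr rfl fun q _ => h q _ x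

theorem _root_.ReducedOperad.sgn_circ (O : ReducedOperad k) {A B : Type} [Finite A] [Finite B]
    (a : A) (x : Tot (O.obj A)) (q : ℕ) (y : (O.obj B).X q) :
    sgn _ (O.circ a x (hom _ q y)) = (-1 : k) ^ q • O.circ a (sgn _ x) (hom _ q y) :=
  tot_ext (f := (sgn _).comp ((O.circ a).flip (hom _ q y)))
    (g := ((-1 : k) ^ q • (O.circ a).flip (hom _ q y)).comp (sgn _)) (fun p x => by
      change sgn _ (O.circ a (hom _ p x) (hom _ q y)) =
        (-1 : k) ^ q • O.circ a (sgn _ (hom _ p x)) (hom _ q y)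
      obtain ⟨z, hz⟩ := O.circ_mem a p q x y
      rw [← hz, sgn_hom, sgn_hom, map_smul, LinearMap.smul_apply, ← hz, smul_smul, pow_add,
        mul_comm]) x

/-- The effect on the Koszul sign of raising one degree. -/
theorem koszulSign_update {n : ℕ} (σ : Equiv.Perm (Fin n)) (deg : Fin n → ℕ) (s : Fin n) :
    koszulSign k σ (Function.update deg (σ s) (deg (σ s) + 1)) *
        ∏ l, (if σ l < σ s then (-1 : k) ^ deg (σ l) else 1) =
      koszulSign k σ deg * ∏ l, (if l < s then (-1 : k) ^ deg (σ l) else 1) := by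
  have h : koszulSign k σ (Function.update deg (σ s) (deg (σ s) + 1)) = koszulSign k σ deg *
      ((∏ l, if s < l ∧ σ l < σ s then (-1 : k) ^ deg (σ l) else 1) *
        ∏ l, if l < s ∧ σ s < σ l then (-1 : k) ^ deg (σ l) else 1) := by
    -- Only the inversions that involve `s` change. Both correcting products are spread over all
    -- pairs so that the identity can be checked pair by pair.
    have e₁ : ∏ l, (if s < l ∧ σ l < σ s then (-1 : k) ^ deg (σ l) else 1) =
        ∏ p : Fin n × Fin n, if p.1 = s then
          (if s < p.2 ∧ σ p.2 < σ s then (-1 : k) ^ deg (σ p.2) else 1) else 1 := by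
      rw [Fintype.prod_prod_type_right]
      refine Finset.prod_congr rfl fun l _ => ?_
      dsimp only
      rw [Finset.prod_ite_eq' Finset.univ s, if_pos (Finset.mem_univ s)]
    have e₂ : ∏ l, (if l < s ∧ σ s < σ l then (-1 : k) ^ deg (σ l) else 1) =
        ∏ p : Fin n × Fin n, if p.2 = s then
          (if p.1 < s ∧ σ s < σ p.1 then (-1 : k) ^ deg (σ p.1) else 1) else 1 := by
      rw [Fintype.prod_prod_type]
      refine Finset.prod_congr rfl fun l _ => ?_
      dsimp only
      rw [Finset.prod_ite_eq' Finset.univ s, if_pos (Finset.mem_univ s)]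
    rw [e₁, e₂, koszulSign, koszulSign, ← Finset.prod_mul_distrib, ← Finset.prod_mul_distrib]
    refine Finset.prod_congr rfl fun p _ => ?_
    obtain ⟨a, b⟩ := p
    dsimp only
    by_cases hab : a < b ∧ σ b < σ a
    · rw [if_pos hab, if_pos hab]
      by_cases ha : a = s
      · subst ha
        have hb : b ≠ a := hab.1.ne'
        rw [if_pos rfl, if_pos hab, if_neg hb, mul_one, Function.update_self,
          Function.update_of_ne (σ.injective.ne hb), add_mul, one_mul, pow_add]
      · rw [if_neg ha, one_mul, Function.update_of_ne (σ.injective.ne ha)]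
        by_cases hb : b = s
        · subst hb
          rw [if_pos rfl, if_pos hab, Function.update_self, mul_add, mul_one, pow_add]
        · rw [if_neg hb, mul_one, Function.update_of_ne (σ.injective.ne hb)]
    · rw [if_neg hab, if_neg hab, one_mul]
      have h₁ : (if a = s then (if s < b ∧ σ b < σ s then (-1 : k) ^ deg (σ b) else 1) else 1) = 1 := by
        split_ifs with h h' <;> first | rfl | (subst h; exact (hab h').elim)
      have h₂ : (if b = s then (if a < s ∧ σ s < σ a then (-1 : k) ^ deg (σ a) else 1) else 1) = 1 := by
        split_ifs with h h' <;> first | rfl | (subst h; exact (hab h').elim)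
      rw [h₁, h₂, one_mul]
  rw [h, mul_assoc, ← Finset.prod_mul_distrib, ← Finset.prod_mul_distrib]
  refine congrArg _ (Finset.prod_congr rfl fun l _ => ?_)
  -- The two weights of `l` differ exactly when `l` and `s` form an inversion, and then the
  -- correction compensates for the difference.
  rcases lt_trichotomy l s with hl | rfl | hl
  · rcases lt_trichotomy (σ l) (σ s) with h' | h' | h'
    · simp [hl, h', hl.not_gt, h'.not_gt]
    · exact (hl.ne (σ.injective h')).elim
    · simp [hl, h', hl.not_gt, h'.not_gt]
  · simp
  · rcases lt_trichotomy (σ l) (σ s) with h' | h' | h'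
    · simp [hl, h', hl.not_gt, h'.not_gt, neg_one_pow_mul_self]
    · exact (hl.ne' (σ.injective h')).elim
    · simp [hl, h', hl.not_gt, h'.not_gt]

end Signs

/-! ### Multilinear maps at one argument -/

section Multilinear

variable {n : ℕ} {V M : Type*} [AddCommGroup V] [Module k V] [AddCommGroup M] [Module k M]
  (f : MultilinearMap k (fun _ : Fin n => V) M)

/-- Linearity in a single argument, stated by agreement away from it, so that argument lists defined
by cases need not be written as updates. -/
theorem multilinear_sum_at {ι : Type*} (s : Finset ι) {X : Fin n → V} (Y : ι → Fin n → V) (i : Fin n)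
    (h : ∀ j ∈ s, ∀ l, l ≠ i → X l = Y j l) (hi : X i = ∑ j ∈ s, Y j i) :
    f X = ∑ j ∈ s, f (Y j) := by
  rw [← Function.update_eq_self i X, hi, MultilinearMap.map_update_sum]
  refine Finset.sum_congr rfl fun j hj => congrArg f (funext fun l => ?_)
  by_cases hl : l = i
  · subst hl
    rw [Function.update_self]
  · rw [Function.update_of_ne hl, h j hj l hl]

theorem multilinear_smul_at (c : k) {X : Fin n → V} (Y : Fin n → V) (i : Fin n)
    (h : ∀ l, l ≠ i → X l = Y l) (hi : X i = c • Y i) : f X = c • f Y := by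
  rw [← Function.update_eq_self i X, hi, MultilinearMap.map_update_smul]
  refine congrArg (fun z => c • f z) (funext fun l => ?_)
  by_cases hl : l = i
  · subst hl
    rw [Function.update_self]
  · rw [Function.update_of_ne hl, h l hl]

theorem multilinear_neg_at {X : Fin n → V} (Y : Fin n → V) (i : Fin n)
    (h : ∀ l, l ≠ i → X l = Y l) (hi : X i = -Y i) : f X = -f Y := by
  rw [multilinear_smul_at f (-1) Y i h (by rw [hi, neg_one_smul]), neg_one_smul]

theorem multilinear_sub_at {X : Fin n → V} (Y Z : Fin n → V) (i : Fin n)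
    (h : ∀ l, l ≠ i → X l = Y l) (h' : ∀ l, l ≠ i → X l = Z l) (hi : X i = Y i - Z i) :
    f X = f Y - f Z := by
  rw [← Function.update_eq_self i X, hi, MultilinearMap.map_update_sub]
  refine congrArg₂ (fun z w => f z - f w) (funext fun l => ?_) (funext fun l => ?_) <;>
  · by_cases hl : l = i
    · subst hl
      rw [Function.update_self]
    · rw [Function.update_of_ne hl]
      first | exact h l hl | exact h' l hl

end Multilinear

end Goodwillie

end

/-! ### The algebra of triples, which encodes a null-homotopic derivation. -/

noncomputable section

namespace Goodwillie

open ChPlus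

variable {k : Type u} [Field k] {O : ReducedOperad k}

/-! ### The algebra of a homotopy of derivations -/

namespace Dual

/-- Triples `(b, c, e)`, where `c` is the value of a derivation at `b` and `e` that of a derivation
of degree `1`. -/
abbrev Triple (A : OpAlg O) : Type u := Tot A.cx × Tot A.cx × Tot A.cx

variable (A : OpAlg O)

/-- The arguments of the operations in the `t`-th summand of the second component. -/
def cArg {n : ℕ} (t l : Fin n) : Triple A →ₗ[k] Tot A.cx :=
  if l = t then (LinearMap.fst k _ _).comp (LinearMap.snd k _ _) else LinearMap.fst k _ _

/-- The arguments of the operations in the `t`-th summand of the third component. -/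
def eArg {n : ℕ} (t l : Fin n) : Triple A →ₗ[k] Tot A.cx :=
  if l < t then (sgn A.cx).comp (LinearMap.fst k _ _)
  else if l = t then (LinearMap.snd k _ _).comp (LinearMap.snd k _ _) else LinearMap.fst k _ _

variable {A}

theorem cArg_self {n : ℕ} (t : Fin n) (x : Triple A) : cArg A t t x = x.2.1 := by
  rw [cArg, if_pos rfl]; rfl

theorem cArg_ne {n : ℕ} {t l : Fin n} (h : l ≠ t) (x : Triple A) : cArg A t l x = x.1 := by
  rw [cArg, if_neg h]; rfl

theorem eArg_self {n : ℕ} (t : Fin n) (x : Triple A) : eArg A t t x = x.2.2 := by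
  rw [eArg, if_neg (lt_irrefl t), if_pos rfl]; rfl

theorem eArg_lt {n : ℕ} {t l : Fin n} (h : l < t) (x : Triple A) :
    eArg A t l x = sgn A.cx x.1 := by
  rw [eArg, if_pos h]; rfl

theorem eArg_gt {n : ℕ} {t l : Fin n} (h : t < l) (x : Triple A) : eArg A t l x = x.1 := by
  rw [eArg, if_neg h.not_gt, if_neg h.ne']; rfl

variable (A)

/-- The second component of the operations. -/
def actC (n : ℕ) (o : Tot (O.obj (Fin n))) : MultilinearMap k (fun _ : Fin n => Triple A) (Tot A.cx) :=
  ∑ t, (A.act n o).compLinearMap (cArg A t)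

/-- The third component of the operations. -/
def actE (n : ℕ) (o : Tot (O.obj (Fin n))) : MultilinearMap k (fun _ : Fin n => Triple A) (Tot A.cx) :=
  ∑ t, (A.act n (sgn _ o)).compLinearMap (eArg A t)

theorem actC_apply (n : ℕ) (o : Tot (O.obj (Fin n))) (x : Fin n → Triple A) :
    actC A n o x = ∑ t, A.act n o (fun l => cArg A t l (x l)) := by
  rw [actC, sum_apply]; rfl

theorem actE_apply (n : ℕ) (o : Tot (O.obj (Fin n))) (x : Fin n → Triple A) :
    actE A n o x = ∑ t, A.act n (sgn _ o) (fun l => eArg A t l (x l)) := by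
  rw [actE, sum_apply]; rfl

/-- The operations. -/
def act (n : ℕ) : Tot (O.obj (Fin n)) →ₗ[k] MultilinearMap k (fun _ : Fin n => Triple A) (Triple A) where
  toFun o := ((A.act n o).compLinearMap fun _ => LinearMap.fst k _ _).prod
    ((actC A n o).prod (actE A n o))
  map_add' o o' := MultilinearMap.ext fun x => by
    refine Prod.ext ?_ (Prod.ext ?_ ?_)
    · change A.act n (o + o') _ = A.act n o _ + A.act n o' _
      rw [map_add, add_apply]
    · change actC A n (o + o') x = actC A n o x + actC A n o' x
      simp only [actC_apply, map_add, add_apply, Finset.sum_add_distrib]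
    · change actE A n (o + o') x = actE A n o x + actE A n o' x
      simp only [actE_apply, map_add, add_apply, Finset.sum_add_distrib]
  map_smul' c o := MultilinearMap.ext fun x => by
    refine Prod.ext ?_ (Prod.ext ?_ ?_)
    · change A.act n (c • o) _ = c • A.act n o _
      rw [map_smul, smul_apply]
    · change actC A n (c • o) x = c • actC A n o x
      simp only [actC_apply, map_smul, smul_apply, Finset.smul_sum]
    · change actE A n (c • o) x = c • actE A n o x
      simp only [actE_apply, map_smul, smul_apply, Finset.smul_sum]

theorem act_eq (n : ℕ) (o : Tot (O.obj (Fin n))) (x : Fin n → Triple A) :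
    act A n o x = (A.act n o (fun l => (x l).1), ∑ t, A.act n o (fun l => cArg A t l (x l)),
      ∑ t, A.act n (sgn _ o) (fun l => eArg A t l (x l))) :=
  Prod.ext rfl (Prod.ext (actC_apply A n o x) (actE_apply A n o x))

/-- The projections. -/
def p (i : ℕ) : Triple A →ₗ[k] Triple A :=
  (pr A.cx i).prodMap ((pr A.cx i).prodMap (pr A.cx (i + 1)))

/-- The sign involution. -/
def sg : Triple A →ₗ[k] Triple A := (sgn A.cx).prodMap ((sgn A.cx).prodMap (-sgn A.cx))

/-- The differential. -/
def d : Triple A →ₗ[k] Triple A where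
  -- Up to signs, (b, c, e) is b + cε + eη in a square-zero extension with ε of degree 0, η of
  -- degree -1 and dε = η. A morphism to triples over the identity is thus a derivation θ with a
  -- derivation s of degree 1 such that θ = ds + sd.
  toFun x := (diff A.cx x.1, diff A.cx x.2.1, x.2.1 - diff A.cx x.2.2)
  map_add' x y := by
    refine Prod.ext (map_add _ _ _) (Prod.ext (map_add _ _ _) ?_)
    change x.2.1 + y.2.1 - diff A.cx (x.2.2 + y.2.2) = x.2.1 - _ + (y.2.1 - _)
    rw [map_add]
    abel
  map_smul' c x := by
    refine Prod.ext (map_smul _ _ _) (Prod.ext (map_smul _ _ _) ?_)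
    change c • x.2.1 - diff A.cx (c • x.2.2) = c • (x.2.1 - _)
    rw [map_smul, smul_sub]

variable {A}

theorem p_eq_iff {i : ℕ} {x : Triple A} : p A i x = x ↔
    pr A.cx i x.1 = x.1 ∧ pr A.cx i x.2.1 = x.2.1 ∧ pr A.cx (i + 1) x.2.2 = x.2.2 := by
  rw [Prod.ext_iff, Prod.ext_iff]
  rfl

theorem sg_pow (q : ℕ) (x : Triple A) : (sg A ^ q) x =
    ((sgn A.cx ^ q) x.1, (sgn A.cx ^ q) x.2.1, (-1 : k) ^ q • (sgn A.cx ^ q) x.2.2) := by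
  induction q with
  | zero => 
    rw [pow_zero (-1 : k), one_smul]
    rfl
  | succ q ih =>
    rw [pow_succ', Module.End.mul_apply, ih]
    refine Prod.ext ?_ (Prod.ext ?_ ?_)
    · change _ = (sgn A.cx ^ (q + 1)) x.1
      rw [pow_succ', Module.End.mul_apply]; rfl
    · change _ = (sgn A.cx ^ (q + 1)) x.2.1
      rw [pow_succ', Module.End.mul_apply]; rfl
    · change -sgn A.cx ((-1 : k) ^ q • (sgn A.cx ^ q) x.2.2) = (-1 : k) ^ (q + 1) •
        (sgn A.cx ^ (q + 1)) x.2.2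
      rw [pow_succ' (sgn A.cx), Module.End.mul_apply, map_smul, pow_succ, mul_neg_one, neg_smul]

theorem act_p (n q : ℕ) (o : (O.obj (Fin n)).X q) (deg : Fin n → ℕ) (x : Fin n → Triple A)
    (h : ∀ j, p A (deg j) (x j) = x j) :
    p A (q + ∑ j, deg j) (act A n (hom _ q o) x) = act A n (hom _ q o) x := by
  simp only [p_eq_iff] at h
  rw [p_eq_iff, act_eq]
  refine ⟨A.act_pr n q o deg _ fun j => (h j).1, ?_, ?_⟩
  · dsimp only
    rw [map_sum]
    refine Finset.sum_congr rfl fun t _ => A.act_pr n q o deg _ fun j => ?_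
    by_cases hj : j = t
    · subst hj
      rw [cArg_self]
      exact (h j).2.1
    · rw [cArg_ne hj]
      exact (h j).1
  · dsimp only
    rw [map_sum]
    refine Finset.sum_congr rfl fun t _ => ?_
    rw [sgn_hom, map_smul, smul_apply, map_smul]
    have hs : q + ∑ j, deg j + 1 = q + ∑ j, Function.update deg t (deg t + 1) j := by
      rw [Finset.sum_update_of_mem (Finset.mem_univ t), ← Finset.add_sum_erase _ _ (Finset.mem_univ t),
        Finset.sdiff_singleton_eq_erase]
      omega
    rw [hs, A.act_pr n q o _ _ fun j => ?_]
    rcases lt_trichotomy j t with hj | rfl | hj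
    · rw [Function.update_of_ne hj.ne, eArg_lt hj, sgn_of_pr (h j).1, map_smul, (h j).1]
    · rw [Function.update_self, eArg_self]
      exact (h j).2.2
    · rw [Function.update_of_ne hj.ne', eArg_gt hj]
      exact (h j).1

/-- The first two components are the Leibniz rule of A. In the third, the degree 1 derivation
anticommutes with the differential, except that differentiating its own slot also produces the
corresponding term of the second component. -/
theorem act_diff (n : ℕ) (o : Tot (O.obj (Fin n))) (x : Fin n → Triple A) :
    d A (act A n o x) = act A n (diff _ o) x +
      ∑ j, act A n (sgn _ o)
        (fun l => if l < j then sg A (x l) else if l = j then d A (x l) else x l) := by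
  let w : Fin n → Fin n → Triple A := fun j l =>
    if l < j then sg A (x l) else if l = j then d A (x l) else x l
  have w_lt : ∀ {j l}, l < j → w j l = sg A (x l) := fun h => if_pos h
  have w_self : ∀ j, w j j = d A (x j) := fun j => (if_neg (lt_irrefl j)).trans (if_pos rfl)
  have w_gt : ∀ {j l}, j < l → w j l = x l := fun h => (if_neg h.not_gt).trans (if_neg h.ne')
  have hs : ∀ f : Fin n → Triple A, (∑ j, f j) = (∑ j, (f j).1, ∑ j, (f j).2.1, ∑ j, (f j).2.2) :=
    fun f => Prod.ext Prod.fst_sum (Prod.ext ((congrArg Prod.fst Prod.snd_sum).trans Prod.fst_sum)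
      ((congrArg Prod.snd Prod.snd_sum).trans Prod.snd_sum))
  change d A (act A n o x) = act A n (diff _ o) x + ∑ j, act A n (sgn _ o) (w j)
  simp only [act_eq, hs]
  refine Prod.ext ?_ (Prod.ext ?_ ?_)
  · change diff A.cx (A.act n o fun l => (x l).1) = A.act n (diff _ o) (fun l => (x l).1) +
      ∑ j, A.act n (sgn _ o) fun l => (w j l).1
    rw [A.act_diff]
    refine congrArg _ (Finset.sum_congr rfl fun j _ => congrArg _ (funext fun l => ?_))
    rcases lt_trichotomy l j with h | rfl | h
    · rw [if_pos h, w_lt h]; rfl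
    · rw [if_neg (lt_irrefl l), if_pos rfl, w_self]; rfl
    · rw [if_neg h.not_gt, if_neg h.ne', w_gt h]
  · change diff A.cx (∑ t, A.act n o fun l => cArg A t l (x l)) =
      (∑ t, A.act n (diff _ o) fun l => cArg A t l (x l)) +
        ∑ j, ∑ t, A.act n (sgn _ o) fun l => cArg A t l (w j l)
    rw [map_sum, Finset.sum_comm, ← Finset.sum_add_distrib]
    refine Finset.sum_congr rfl fun t _ => (A.act_diff n o _).trans
      (congrArg _ (Finset.sum_congr rfl fun j _ => congrArg _ (funext fun l => ?_)))
    by_cases ht : l = t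
    · subst ht
      rw [cArg_self, cArg_self]
      rcases lt_trichotomy l j with h | rfl | h
      · rw [if_pos h, w_lt h]; rfl
      · rw [if_neg (lt_irrefl l), if_pos rfl, w_self]; rfl
      · rw [if_neg h.not_gt, if_neg h.ne', w_gt h]
    · rw [cArg_ne ht, cArg_ne ht]
      rcases lt_trichotomy l j with h | rfl | h
      · rw [if_pos h, w_lt h]; rfl
      · rw [if_neg (lt_irrefl l), if_pos rfl, w_self]; rfl
      · rw [if_neg h.not_gt, if_neg h.ne', w_gt h]
  · change (∑ t, A.act n o fun l => cArg A t l (x l)) -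
        diff A.cx (∑ t, A.act n (sgn _ o) fun l => eArg A t l (x l)) =
      (∑ t, A.act n (sgn _ (diff _ o)) fun l => eArg A t l (x l)) +
        ∑ j, ∑ t, A.act n (sgn _ (sgn _ o)) fun l => eArg A t l (w j l)
    -- Here `t` is the slot of the third component and `j` that of the differential. For `j ≠ t`
    -- exactly one extra sign arises, in slot `j` or in slot `t`; for `j = t` the summand with c
    -- appears.
    have key : ∀ t j, A.act n (sgn _ (sgn _ o)) (fun l => eArg A t l (w j l)) =
        (if j = t then A.act n o (fun l => cArg A t l (x l)) else 0) -
        A.act n (sgn _ (sgn _ o)) (fun l => if l < j then sgn A.cx (eArg A t l (x l)) else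
          if l = j then diff A.cx (eArg A t l (x l)) else eArg A t l (x l)) := by
      intro t j
      rcases lt_trichotomy j t with hjt | rfl | hjt
      · rw [if_neg hjt.ne, zero_sub]
        refine multilinear_neg_at _ _ j (fun l hl => ?_) ?_
        · rcases lt_trichotomy l j with h | h | h
          · rw [if_pos h, w_lt h, eArg_lt (h.trans hjt), eArg_lt (h.trans hjt)]; rfl
          · exact (hl h).elim
          · rw [if_neg h.not_gt, if_neg hl, w_gt h]
        · rw [if_neg (lt_irrefl j), if_pos rfl, w_self, eArg_lt hjt, eArg_lt hjt]
          exact sgn_diff _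
      · rw [if_pos rfl, sgn_sgn]
        refine multilinear_sub_at _ _ _ j (fun l hl => ?_) (fun l hl => ?_) ?_
        · rw [cArg_ne hl]
          rcases lt_trichotomy l j with h | h | h
          · rw [w_lt h, eArg_lt h]
            exact sgn_sgn _
          · exact (hl h).elim
          · rw [w_gt h, eArg_gt h]
        · rcases lt_trichotomy l j with h | h | h
          · rw [if_pos h, w_lt h, eArg_lt h, eArg_lt h]; rfl
          · exact (hl h).elim
          · rw [if_neg h.not_gt, if_neg hl, w_gt h]
        · rw [if_neg (lt_irrefl j), if_pos rfl, w_self, eArg_self, eArg_self, cArg_self]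
          rfl
      · rw [if_neg hjt.ne', zero_sub]
        refine multilinear_neg_at _ _ t (fun l hl => ?_) ?_
        · rcases lt_trichotomy l j with h | h | h
          · rw [if_pos h, w_lt h]
            rcases lt_trichotomy l t with h' | h' | h'
            · rw [eArg_lt h', eArg_lt h']; rfl
            · exact (hl h').elim
            · rw [eArg_gt h', eArg_gt h']; rfl
          · subst h
            rw [if_neg (lt_irrefl l), if_pos rfl, w_self, eArg_gt hjt, eArg_gt hjt]; rfl
          · rw [if_neg h.not_gt, if_neg h.ne', w_gt h]
        · rw [if_pos hjt, w_lt hjt, eArg_self, eArg_self]; rfl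
    rw [map_sum, Finset.sum_comm]
    simp only [key, A.act_diff, Finset.sum_sub_distrib, Finset.sum_add_distrib, sgn_diff, map_neg,
      neg_apply, Finset.sum_neg_distrib, Finset.sum_ite_eq', Finset.mem_univ, if_true]
    abel

/-- In the third component the marked argument has its degree raised by one, so the Koszul sign is
that of the modified degrees; `koszulSign_update` absorbs the difference into the signs of the
arguments before it. -/
theorem act_perm (n : ℕ) (σ : Equiv.Perm (Fin n)) (o : Tot (O.obj (Fin n))) (deg : Fin n → ℕ)
    (x : Fin n → Triple A) (h : ∀ j, p A (deg j) (x j) = x j) :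
    act A n (totMap (O.map σ) o) x = koszulSign k σ deg • act A n o (fun j => x (σ j)) := by
  simp only [p_eq_iff] at h
  rw [act_eq, act_eq]
  refine Prod.ext (A.pre.act_perm n σ o deg _ fun j => (h j).1) (Prod.ext ?_ ?_)
  · change ∑ t, A.act n (totMap (O.map σ) o) (fun l => cArg A t l (x l)) =
      koszulSign k σ deg • ∑ t, A.act n o (fun l => cArg A t l (x (σ l)))
    rw [Finset.smul_sum, ← Equiv.sum_comp σ]
    refine Finset.sum_congr rfl fun t _ => (A.pre.act_perm n σ o deg _ fun j => ?_).trans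
      (congrArg _ (congrArg _ (funext fun l => ?_)))
    · change pr A.cx _ _ = _
      by_cases hj : j = σ t
      · rw [hj, cArg_self]
        exact (h _).2.1
      · rw [cArg_ne hj]
        exact (h _).1
    · by_cases hl : l = t
      · rw [hl, cArg_self, cArg_self]
      · rw [cArg_ne hl, cArg_ne (σ.injective.ne hl)]
  · change ∑ t, A.act n (sgn _ (totMap (O.map σ) o)) (fun l => eArg A t l (x l)) =
      koszulSign k σ deg • ∑ t, A.act n (sgn _ o) (fun l => eArg A t l (x (σ l)))
    rw [Finset.smul_sum, ← Equiv.sum_comp σ]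
    refine Finset.sum_congr rfl fun t _ => ?_
    rw [← totMap_sgn]
    refine (A.pre.act_perm n σ (sgn _ o) (Function.update deg (σ t) (deg (σ t) + 1)) _
      fun j => ?_).trans ?_
    · change pr A.cx _ _ = _
      rcases lt_trichotomy j (σ t) with hj | rfl | hj
      · rw [Function.update_of_ne hj.ne, eArg_lt hj, sgn_of_pr (h j).1, map_smul, (h j).1]
      · rw [Function.update_self, eArg_self]
        exact (h _).2.2
      · rw [Function.update_of_ne hj.ne', eArg_gt hj]
        exact (h j).1
    -- Both sides are reduced to the same arguments, without signs, and the scalars are compared.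
    · let Y : Fin n → Tot A.cx := fun l => if l = t then (x (σ l)).2.2 else (x (σ l)).1
      have h₁ : (fun l => eArg A (σ t) (σ l) (x (σ l))) =
          fun l => (if σ l < σ t then (-1 : k) ^ deg (σ l) else 1) • Y l := funext fun l => by
        rcases lt_trichotomy (σ l) (σ t) with hl | hl | hl
        · rw [eArg_lt hl, if_pos hl, sgn_of_pr (h _).1]
          exact congrArg _ (if_neg fun e => hl.ne (congrArg σ e)).symm
        · obtain rfl := σ.injective hl
          rw [eArg_self, if_neg (lt_irrefl _), one_smul]
          exact (if_pos rfl).symm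
        · rw [eArg_gt hl, if_neg hl.not_gt, one_smul]
          exact (if_neg fun e => hl.ne' (congrArg σ e)).symm
      have h₂ : (fun l => eArg A t l (x (σ l))) =
          fun l => (if l < t then (-1 : k) ^ deg (σ l) else 1) • Y l := funext fun l => by
        rcases lt_trichotomy l t with hl | rfl | hl
        · rw [eArg_lt hl, if_pos hl, sgn_of_pr (h _).1]
          exact congrArg _ (if_neg hl.ne).symm
        · rw [eArg_self, if_neg (lt_irrefl _), one_smul]
          exact (if_pos rfl).symm
        · rw [eArg_gt hl, if_neg hl.not_gt, one_smul]
          exact (if_neg hl.ne').symm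
      change koszulSign k σ _ • A.act n (sgn _ o) (fun l => eArg A (σ t) (σ l) (x (σ l))) = _
      rw [h₁, h₂, MultilinearMap.map_smul_univ, MultilinearMap.map_smul_univ, smul_smul, smul_smul,
        koszulSign_update]

theorem act_one (e : Unit ≃ Fin 1) (x : Fin 1 → Triple A) :
    act A 1 (totMap (O.map e) (hom _ 0 O.one)) x = x 0 := by
  rw [act_eq, ← totMap_sgn, sgn_hom, pow_zero, one_smul, A.act_one, Fin.sum_univ_one,
    Fin.sum_univ_one, A.act_one, A.act_one, cArg_self, eArg_self]

/-- The marked input of a composite belongs either to the inner operation or to the remaining inputs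
of the outer one. The sum over marked inputs splits accordingly, which is the chain rule for
derivations. -/
theorem act_circ (n m r : ℕ) (a : Fin n) (e : Ins (Fin n) a (Fin m) ≃ Fin r)
    (he : IsOrderedInsertion a e) (o : Tot (O.obj (Fin n))) (q : ℕ) (o' : (O.obj (Fin m)).X q)
    (x : Fin r → Triple A) :
    act A r (totMap (O.map e) (O.circ a o (hom _ q o'))) x =
      act A n o (fun b =>
        if h : b = a then act A m (hom _ q o') (fun j => x (e (.inr j)))
        else if b < a then (sg A ^ q) (x (e (.inl ⟨b, h⟩)))
        else x (e (.inl ⟨b, h⟩))) := by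
  let w : Fin n → Triple A := fun b =>
    if h : b = a then act A m (hom _ q o') (fun j => x (e (.inr j)))
    else if b < a then (sg A ^ q) (x (e (.inl ⟨b, h⟩))) else x (e (.inl ⟨b, h⟩))
  have w_self : w a = act A m (hom _ q o') (fun j => x (e (.inr j))) := dif_pos rfl
  have w_lt : ∀ {b} (h : b < a), w b = (sg A ^ q) (x (e (.inl ⟨b, h.ne⟩))) := fun h =>
    (dif_neg h.ne).trans (if_pos h)
  have w_gt : ∀ {b} (h : a < b), w b = x (e (.inl ⟨b, h.ne'⟩)) := fun h =>
    (dif_neg h.ne').trans (if_neg h.not_gt)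
  have inl_lt : ∀ b b' : {b : Fin n // b ≠ a}, e (.inl b) < e (.inl b') ↔ b.1 < b'.1 := fun b b' => by
    refine ⟨fun h => ?_, he.1 b b'⟩
    by_contra h'
    rcases (not_lt.1 h').lt_or_eq with h' | h'
    · exact h.not_gt (he.1 b' b h')
    · rw [Subtype.ext h'] at h
      exact lt_irrefl _ h
  have inr_lt : ∀ j j' : Fin m, e (.inr j) < e (.inr j') ↔ j < j' := fun j j' => by
    refine ⟨fun h => ?_, he.2.1 j j'⟩
    by_contra h'
    rcases (not_lt.1 h').lt_or_eq with h' | h'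
    · exact h.not_gt (he.2.1 j' j h')
    · rw [h'] at h
      exact lt_irrefl _ h
  change _ = act A n o w
  rw [act_eq, act_eq]
  refine Prod.ext ?_ (Prod.ext ?_ ?_)
  · change A.act r _ (fun l => (x l).1) = A.act n o fun l => (w l).1
    rw [A.act_circ n m r a e he]
    refine congrArg _ (funext fun b => ?_)
    rcases lt_trichotomy b a with h | rfl | h
    · rw [dif_neg h.ne, if_pos h, w_lt h, sg_pow]
    · rw [dif_pos rfl, w_self]; rfl
    · rw [dif_neg h.ne', if_neg h.not_gt, w_gt h]
  · change ∑ t, A.act r _ (fun l => cArg A t l (x l)) = ∑ t, A.act n o fun l => cArg A t l (w l)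
    rw [← Equiv.sum_comp e, Fintype.sum_sum_type, Fintype.sum_eq_add_sum_subtype_ne _ a, add_comm]
    refine congrArg₂ _ ?_ (Finset.sum_congr rfl fun β _ => ?_)
    · refine (Finset.sum_congr rfl fun j _ => A.act_circ n m r a e he o q o' _).trans
        (multilinear_sum_at (A.act n o) Finset.univ _ a (fun j _ b hb => ?_) ?_).symm
      · rw [dif_neg hb, cArg_ne hb, cArg_ne (e.injective.ne Sum.inl_ne_inr)]
        rcases hb.lt_or_gt with h | h
        · rw [if_pos h, w_lt h, sg_pow]
        · rw [if_neg h.not_gt, w_gt h]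
      · rw [cArg_self, w_self, act_eq]
        dsimp only
        refine Finset.sum_congr rfl fun j _ => ?_
        rw [dif_pos rfl]
        refine congrArg _ (funext fun j' => ?_)
        by_cases hj : j' = j
        · rw [hj, cArg_self, cArg_self]
        · rw [cArg_ne hj, cArg_ne (e.injective.ne (Sum.inr_injective.ne hj))]
    · rw [A.act_circ n m r a e he]
      refine congrArg _ (funext fun b => ?_)
      by_cases hb : b = β.1
      · obtain rfl := hb
        rw [dif_neg β.2, cArg_self, cArg_self]
        rcases β.2.lt_or_gt with h | h
        · rw [if_pos h, w_lt h, sg_pow]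
        · rw [if_neg h.not_gt, w_gt h]
      · rw [cArg_ne hb]
        by_cases hba : b = a
        · subst hba
          rw [dif_pos rfl, w_self, act_eq]
          refine congrArg _ (funext fun j => ?_)
          rw [cArg_ne (e.injective.ne Sum.inr_ne_inl)]
        · rw [dif_neg hba, cArg_ne (e.injective.ne (Sum.inl_injective.ne fun h =>
            hb (congrArg Subtype.val h)))]
          rcases Ne.lt_or_gt hba with h | h
          · rw [if_pos h, w_lt h, sg_pow]
          · rw [if_neg h.not_gt, w_gt h]
  · change ∑ t, A.act r (sgn _ (totMap _ _)) (fun l => eArg A t l (x l)) =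
      ∑ t, A.act n (sgn _ o) fun l => eArg A t l (w l)
    -- Extracting the parity of the inner operation gives the factor (-1)^q, which must be recovered
    -- on the other side in each of the cases below.
    have hc : ∀ y : Fin r → Tot A.cx,
        A.act r (sgn _ (totMap (O.map e) (O.circ a o (hom _ q o')))) y = (-1 : k) ^ q •
          A.act n (sgn _ o) (fun b =>
            if h : b = a then A.act m (hom _ q o') (fun j => y (e (.inr j)))
            else if b < a then (sgn A.cx ^ q) (y (e (.inl ⟨b, h⟩)))
            else y (e (.inl ⟨b, h⟩))) := fun y => by
      rw [← totMap_sgn, O.sgn_circ, map_smul, map_smul, smul_apply, A.act_circ n m r a e he]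
    simp only [hc]
    rw [← Equiv.sum_comp e, Fintype.sum_sum_type, Fintype.sum_eq_add_sum_subtype_ne _ a, add_comm]
    refine congrArg₂ _ ?_ (Finset.sum_congr rfl fun β _ => ?_)
    · rw [← Finset.smul_sum]
      refine Eq.symm ((multilinear_smul_at _ ((-1 : k) ^ q) (fun b =>
        if b = a then ∑ j, A.act m (hom _ q o') (fun j' => eArg A j j' (x (e (.inr j'))))
        else eArg A a b (w b)) a (fun b hb => (if_neg hb).symm) ?_).trans (congrArg _
        (multilinear_sum_at _ Finset.univ _ a (fun j _ b hb => ?_) ?_)))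
      · rw [if_pos rfl, eArg_self, w_self, act_eq, Finset.smul_sum]
        dsimp only
        refine Finset.sum_congr rfl fun j _ => ?_
        rw [sgn_hom, map_smul, smul_apply]
      · rw [if_neg hb, dif_neg hb]
        rcases hb.lt_or_gt with h | h
        · rw [if_pos h, eArg_lt h, w_lt h, sg_pow, eArg_lt (he.2.2.1 ⟨b, hb⟩ j h), sgn_pow_sgn]
        · rw [if_neg h.not_gt, eArg_gt h, w_gt h, eArg_gt (he.2.2.2 ⟨b, hb⟩ j h)]
      · rw [if_pos rfl]
        refine Finset.sum_congr rfl fun j _ => ?_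
        rw [dif_pos rfl]
        refine congrArg _ (funext fun j' => ?_)
        rcases lt_trichotomy j' j with h | rfl | h
        · rw [eArg_lt h, eArg_lt ((inr_lt _ _).2 h)]
        · rw [eArg_self, eArg_self]
        · rw [eArg_gt h, eArg_gt ((inr_lt _ _).2 h)]
    · obtain ⟨β, hβ⟩ := β
      dsimp only
      have off : ∀ b, b ≠ a → b ≠ β → eArg A β b (w b) =
          (if h : b = a then A.act m (hom _ q o')
              (fun j => eArg A (e (.inl ⟨β, hβ⟩)) (e (.inr j)) (x (e (.inr j))))
            else if b < a then (sgn A.cx ^ q)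
              (eArg A (e (.inl ⟨β, hβ⟩)) (e (.inl ⟨b, h⟩)) (x (e (.inl ⟨b, h⟩))))
            else eArg A (e (.inl ⟨β, hβ⟩)) (e (.inl ⟨b, h⟩)) (x (e (.inl ⟨b, h⟩)))) := by
        intro b hba hb
        rw [dif_neg hba]
        rcases hba.lt_or_gt with h | h
        · rw [if_pos h, w_lt h]
          rcases Ne.lt_or_gt hb with h' | h'
          · rw [eArg_lt h', eArg_lt ((inl_lt ⟨b, hba⟩ ⟨β, hβ⟩).2 h'), sg_pow, sgn_pow_sgn]
          · rw [eArg_gt h', eArg_gt ((inl_lt ⟨β, hβ⟩ ⟨b, hba⟩).2 h'), sg_pow]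
        · rw [if_neg h.not_gt, w_gt h]
          rcases Ne.lt_or_gt hb with h' | h'
          · rw [eArg_lt h', eArg_lt ((inl_lt ⟨b, hba⟩ ⟨β, hβ⟩).2 h')]
          · rw [eArg_gt h', eArg_gt ((inl_lt ⟨β, hβ⟩ ⟨b, hba⟩).2 h')]
      -- Before `a` the factor (-1)^q comes from the third component of the marked argument, which
      -- the inner operation has passed. After `a` it comes from the parity sign applied to the
      -- inner value.
      rcases hβ.lt_or_gt with hlt | hlt
      · refine Eq.symm (multilinear_smul_at _ _ _ β (fun b hb => ?_) ?_)
        · by_cases hba : b = a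
          · subst hba
            rw [dif_pos rfl, eArg_gt hlt, w_self, act_eq]
            refine congrArg _ (funext fun j => ?_)
            rw [eArg_gt (he.2.2.1 ⟨β, hβ⟩ j hlt)]
          · exact off b hba hb
        · rw [dif_neg hβ, if_pos hlt, eArg_self, eArg_self, w_lt hlt, sg_pow]
      · refine Eq.symm (multilinear_smul_at _ _ _ a (fun b hb => ?_) ?_)
        · by_cases hb' : b = β
          · subst hb'
            rw [dif_neg hβ, if_neg hlt.not_gt, eArg_self, eArg_self, w_gt hlt]
          · exact off b hb hb'
        · rw [dif_pos rfl, eArg_lt hlt, w_self, act_eq]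
          refine (A.sgn_act _ _ _).trans ?_
          rw [sgn_hom, map_smul, smul_apply]
          refine congrArg _ (congrArg _ (funext fun j => ?_))
          rw [eArg_lt (he.2.2.2 ⟨β, hβ⟩ j hlt)]

variable (A) in
/-- The algebra of triples. -/
def pre : PreAlg O where
  V := Triple A
  p := p A
  d := d A
  sgn := sg A
  act := act A
  p_p i v := Prod.ext (pr_pr _ _) (Prod.ext (pr_pr _ _) (pr_pr _ _))
  p_p_ne h v := Prod.ext (pr_pr_ne h _) (Prod.ext (pr_pr_ne h _) (pr_pr_ne (by omega) _))
  d_d v := by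
    refine Prod.ext (diff_diff _) (Prod.ext (diff_diff _) ?_)
    change diff A.cx v.2.1 - diff A.cx (v.2.1 - diff A.cx v.2.2) = 0
    rw [map_sub, diff_diff, sub_zero, sub_self]
  p_d {i v} h := by
    rw [p_eq_iff] at h ⊢
    refine ⟨pr_diff h.1, pr_diff h.2.1, ?_⟩
    change pr A.cx (i + 1) (v.2.1 - diff A.cx v.2.2) = v.2.1 - diff A.cx v.2.2
    rw [map_sub, h.2.1, pr_diff h.2.2]
  sgn_p {i v} h := by
    rw [p_eq_iff] at h
    refine Prod.ext (sgn_of_pr h.1) (Prod.ext (sgn_of_pr h.2.1) ?_)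
    change -sgn A.cx v.2.2 = (-1 : k) ^ i • v.2.2
    rw [sgn_of_pr h.2.2, pow_succ, mul_neg_one, neg_smul, neg_neg]
  act_p := act_p
  act_diff := act_diff
  act_perm := act_perm
  act_one := act_one
  act_circ := act_circ

end Dual

end Goodwillie

end

/-! ### Free acyclic extensions in characteristic zero, and pushouts of trivial cofibrations. -/

noncomputable section

namespace Goodwillie

open ChPlus

variable {k : Type u} [Field k] {O : ReducedOperad k}

/-! ### Free extensions by acyclic complexes -/

theorem multilinear_mem_of_iSup {n : ℕ} {V M : Type*} [AddCommGroup V] [Module k V]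
    [AddCommGroup M] [Module k M] (f : MultilinearMap k (fun _ : Fin n => V) M)
    (N : ℕ → Submodule k V) {S : Submodule k M}
    (h : ∀ (m : Fin n → ℕ) (x : Fin n → V), (∀ j, x j ∈ N (m j)) → f x ∈ S)
    (x : Fin n → V) (hx : ∀ j, x j ∈ ⨆ m, N m) : f x ∈ S := by
  choose g hg hgx using fun j => (Submodule.mem_iSup_iff_exists_finsupp N (x j)).1 (hx j)
  have : x = fun j => ∑ i ∈ (g j).support, g j i := funext fun j => (hgx j).symm
  rw [this, MultilinearMap.map_sum_finset]
  exact S.sum_mem fun r _ => h r _ fun j => hg j (r j)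

section Free

variable {A : OpAlg O} {T : Type u} {deg : T → ℕ}

/-- A homotopy between an endomorphism that acts on `A` by zero and on the new generators by the
identity, and zero. -/
theorem exists_derivations (E : Attached A (fun t : T => deg t + 1) fun _ => none) :
    ∃ Ψ : Tot E.Z.cx →ₗ[k] Dual.Triple E.Z,
      (∀ i z, Ψ (pr _ i z) = Dual.p E.Z i (Ψ z)) ∧ (∀ z, Ψ (diff _ z) = Dual.d E.Z (Ψ z)) ∧
      (∀ n o x, Ψ (E.Z.act n o x) = Dual.act E.Z n o (fun j => Ψ (x j))) ∧
      (∀ y, Ψ (totMap E.j.map y) = (totMap E.j.map y, 0, 0)) ∧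
      (∀ t, (Ψ (hom _ _ (E.x t))).2.1 = hom _ _ (E.x t)) ∧ ∀ z, (Ψ z).1 = z := by
  let D := Dual.pre E.Z
  obtain ⟨g, hg⟩ := D.exists_homIn (B := A) ((LinearMap.inl k _ _).comp (totMap E.j.map))
    (fun i x => Prod.ext (totMap_pr _ _ _) (Prod.ext (map_zero _).symm (map_zero _).symm))
    (fun x => Prod.ext (totMap_diff _ _) (Prod.ext (map_zero _).symm (by
      change 0 = 0 - diff _ (0 : Tot E.Z.cx)
      rw [map_zero, sub_zero])))
    (fun n o x => by
      refine Eq.trans ?_ (Dual.act_eq _ _ _ _).symm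
      refine Prod.ext (E.j.map_act n o x) (Prod.ext ?_ ?_)
      · refine Eq.symm (Finset.sum_eq_zero (s := Finset.univ) (f := fun t => E.Z.act n o fun l =>
          Dual.cArg E.Z t l (totMap E.j.map (x l), 0, 0)) fun t _ =>
          (E.Z.act n o).map_coord_zero t ?_)
        rw [Dual.cArg_self]
      · refine Eq.symm (Finset.sum_eq_zero (s := Finset.univ) (f := fun t => E.Z.act n (sgn _ o)
          fun l => Dual.eArg E.Z t l (totMap E.j.map (x l), 0, 0)) fun t _ =>
          (E.Z.act n _).map_coord_zero t ?_)
        rw [Dual.eArg_self])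
  -- On a new generator θ is the identity and s is zero; dx then has s(dx) = x. The degree is
  -- positive, so no cycle condition is imposed on the triple.
  have hω : ∀ t, ∃ w : D.cx.X (deg t + 1), D.val _ w =
      (hom E.Z.cx _ (E.x t), hom E.Z.cx _ (E.x t), (0 : Tot E.Z.cx)) := fun t =>
    D.exists_val (D.mem_part (Dual.p_eq_iff.2 ⟨pr_hom _ _, pr_hom _ _, map_zero _⟩)
      fun h => (Nat.succ_ne_zero _ h).elim)
  choose ω hω using hω
  obtain ⟨φ, hφ, hφx⟩ := E.exists_lift D.toAlg g ω fun t z hz => (Option.not_mem_none _ hz).elim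
  let τ : Tot E.Z.cx →ₗ[k] Tot D.cx := totMap φ.map
  let Ψ : Tot E.Z.cx →ₗ[k] Dual.Triple E.Z := (show Tot D.cx →ₗ[k] Dual.Triple E.Z from D.toV).comp τ
  have hp : ∀ i z, Ψ (pr _ i z) = Dual.p E.Z i (Ψ z) := fun i z =>
    (congrArg D.toV (totMap_pr φ.map i z)).trans (D.toV_pr i (τ z))
  have hd : ∀ z, Ψ (diff _ z) = Dual.d E.Z (Ψ z) := fun z =>
    (congrArg D.toV (totMap_diff φ.map z)).trans (D.toV_diff (τ z))
  have ha : ∀ n o x, Ψ (E.Z.act n o x) = Dual.act E.Z n o (fun j => Ψ (x j)) := fun n o x =>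
    (congrArg D.toV (φ.map_act n o x)).trans (D.toV_act n o _)
  have hj : ∀ y, Ψ (totMap E.j.map y) = (totMap E.j.map y, 0, 0) := fun y =>
    (congrArg D.toV ((totMap_alg_comp E.j φ y).symm.trans (totMap_congr hφ y))).trans (hg y)
  have hx : ∀ t, Ψ (hom _ _ (E.x t)) =
      (hom E.Z.cx _ (E.x t), hom E.Z.cx _ (E.x t), (0 : Tot E.Z.cx)) := fun t =>
    (congrArg D.toV ((totMap_hom φ.map _ _).trans (congrArg _ (hφx t)))).trans
      ((D.toV_hom _ _).trans (hω t))
  refine ⟨Ψ, hp, hd, ha, hj, fun t => by rw [hx], ?_⟩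
  refine E.generates (LinearMap.eqLocus ((LinearMap.fst k _ _).comp Ψ) LinearMap.id) ?_ ?_ ?_
  · refine ⟨fun i z hz => ?_, fun z hz => ?_, fun n o x h => ?_⟩
    · change (Ψ _).1 = _
      rw [hp]
      exact congrArg (pr E.Z.cx i) hz
    · change (Ψ _).1 = _
      rw [hd]
      exact congrArg (diff E.Z.cx) hz
    · change (Ψ _).1 = _
      rw [ha, Dual.act_eq]
      exact congrArg (E.Z.act n o) (funext h)
  · intro y
    change (Ψ _).1 = _
    rw [hj]
    rfl
  · intro t
    change (Ψ _).1 = _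
    rw [hx]
    rfl

/-- Attaching x with a free boundary adjoins the disc spanned by x and dx. The derivation θ
multiplies a product with m new generators by m and is null-homotopic through s, so for m ≠ 0 the
homology of weight m vanishes once m is invertible. -/
theorem weq_of_attached_free [CharZero k]
    (E : Attached A (fun t : T => deg t + 1) fun _ => none) : WeakEquivalence E.j := by
  obtain ⟨r, hr, -⟩ := E.exists_lift A (𝟙 A) (fun _ => 0) fun t z hz =>
    (Option.not_mem_none _ hz).elim
  have hr' : ∀ y, totMap r.map (totMap E.j.map y) = y := fun y => by
    rw [← totMap_alg_comp, hr]
    exact totMap_id _ _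
  obtain ⟨Ψ, hp, hd, ha, hj, hx, h1⟩ := exists_derivations E
  let θ : Tot E.Z.cx →ₗ[k] Tot E.Z.cx :=
    ((LinearMap.fst k _ _).comp (LinearMap.snd k _ _)).comp Ψ
  let s : Tot E.Z.cx →ₗ[k] Tot E.Z.cx :=
    ((LinearMap.snd k _ _).comp (LinearMap.snd k _ _)).comp Ψ
  have θp : ∀ i z, θ (pr _ i z) = pr _ i (θ z) := fun i z =>
    congrArg (fun v : Dual.Triple E.Z => v.2.1) (hp i z)
  have θd : ∀ z, θ (diff _ z) = diff _ (θ z) := fun z =>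
    congrArg (fun v : Dual.Triple E.Z => v.2.1) (hd z)
  have sd : ∀ z, s (diff _ z) = θ z - diff _ (s z) := fun z =>
    congrArg (fun v : Dual.Triple E.Z => v.2.2) (hd z)
  have θj : ∀ y, θ (totMap E.j.map y) = 0 := fun y =>
    congrArg (fun v : Dual.Triple E.Z => v.2.1) (hj y)
  -- Weight 0 is taken to be the image of A rather than the kernel of θ, so that a weight 0 element
  -- comes from A by definition. An operation of total weight 0 has all its arguments there.
  let N : ℕ → Submodule k (Tot E.Z.cx)
    | 0 => LinearMap.range (totMap E.j.map)
    | m + 1 => LinearMap.eqLocus θ (((m + 1 : ℕ) : k) • LinearMap.id)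
  have hN : ∀ m z, z ∈ N m → θ z = (m : k) • z := fun m z h => by
    cases m with
    | zero =>
      obtain ⟨y, rfl⟩ := h
      rw [θj, Nat.cast_zero, zero_smul]
    | succ m => exact h
  have hact : ∀ (n : ℕ) (o : Tot (O.obj (Fin n))) (m : Fin n → ℕ) (x : Fin n → Tot E.Z.cx),
      (∀ j, x j ∈ N (m j)) → θ (E.Z.act n o x) = ((∑ j, m j : ℕ) : k) • E.Z.act n o x := by
    intro n o m x h
    have e := congrArg (fun v : Dual.Triple E.Z => v.2.1) ((ha n o x).trans (Dual.act_eq _ _ _ _))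
    refine e.trans ?_
    rw [Nat.cast_sum, Finset.sum_smul]
    dsimp only
    refine Finset.sum_congr rfl fun t _ =>
      multilinear_smul_at (E.Z.act n o) (m t : k) x t (fun l hl => ?_) ?_
    · rw [Dual.cArg_ne hl, h1]
    · rw [Dual.cArg_self]
      exact hN _ _ (h t)
  have hS : IsSub E.Z (⨆ m, N m) := by
    refine ⟨fun i z hz => ?_, fun z hz => ?_, fun n o x h => ?_⟩
    · have : (⨆ m, N m) ≤ (⨆ m, N m).comap (pr E.Z.cx i) := iSup_le fun m z hz => by
        refine Submodule.mem_iSup_of_mem m ?_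
        cases m with
        | zero =>
          obtain ⟨y, rfl⟩ := hz
          exact ⟨pr _ i y, totMap_pr _ _ _⟩
        | succ m =>
          change θ _ = ((m + 1 : ℕ) : k) • _
          rw [θp, hN (m + 1) _ hz, map_smul]
          rfl
      exact this hz
    · have : (⨆ m, N m) ≤ (⨆ m, N m).comap (diff E.Z.cx) := iSup_le fun m z hz => by
        refine Submodule.mem_iSup_of_mem m ?_
        cases m with
        | zero =>
          obtain ⟨y, rfl⟩ := hz
          exact ⟨diff _ y, totMap_diff _ _⟩
        | succ m =>
          change θ _ = ((m + 1 : ℕ) : k) • _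
          rw [θd, hN (m + 1) _ hz, map_smul]
          rfl
      exact this hz
    · refine multilinear_mem_of_iSup (E.Z.act n o) N (fun m x hx => ?_) x h
      refine Submodule.mem_iSup_of_mem (∑ j, m j) ?_
      have hw := hact n o m x hx
      generalize hM : ∑ j, m j = M at hw
      cases M with
      | zero =>
        have hm : ∀ j, m j = 0 := fun j => Finset.sum_eq_zero_iff.1 hM j (Finset.mem_univ j)
        have hx' : ∀ j, ∃ y, totMap E.j.map y = x j := fun j => by
          have := hx j
          rw [hm j] at this
          exact this
        choose y hy using hx'
        refine ⟨A.act n o y, (E.j.map_act n o y).trans ?_⟩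
        rw [funext hy]
      | succ M => exact hw
  have hall : ∀ z, z ∈ ⨆ m, N m := E.generates _ hS
    (fun y => Submodule.mem_iSup_of_mem 0 ⟨y, rfl⟩)
    (fun t => Submodule.mem_iSup_of_mem 1 (by
      change θ _ = ((0 + 1 : ℕ) : k) • _
      rw [zero_add, Nat.cast_one, one_smul]
      exact hx t))
  -- For a cycle y with top weight n+1, θ y is the boundary of s y. Subtracting θ y / (n+1) cancels
  -- the top weight and rescales the others, which leaves a homologous cycle of smaller weight.
  have key : ∀ (n : ℕ) (v : ℕ → Tot E.Z.cx), (∀ m, v m ∈ N m) →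
      diff _ (∑ m ∈ Finset.range (n + 1), v m) = 0 →
      ∃ a w, ∑ m ∈ Finset.range (n + 1), v m = totMap E.j.map a + diff _ w := by
    intro n
    induction n with
    | zero =>
      intro v hv _
      obtain ⟨a, ha⟩ := hv 0
      refine ⟨a, 0, ?_⟩
      rw [map_zero, add_zero, ha, zero_add, Finset.sum_range_one]
    | succ n ih =>
      intro v hv h
      let c : k := ((n + 1 : ℕ) : k)⁻¹
      have hc : c * ((n + 1 : ℕ) : k) = 1 := inv_mul_cancel₀ (Nat.cast_ne_zero.2 n.succ_ne_zero)
      let y := ∑ m ∈ Finset.range (n + 1 + 1), v m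
      have hy : θ y = diff _ (s y) := by
        have := sd y
        rw [show diff _ y = 0 from h, map_zero] at this
        exact (sub_eq_zero.1 this.symm)
      have e : ∑ m ∈ Finset.range (n + 1), (1 - c * (m : k)) • v m = y - c • θ y := by
        change _ = (∑ m ∈ Finset.range (n + 1 + 1), v m) -
          c • θ (∑ m ∈ Finset.range (n + 1 + 1), v m)
        rw [map_sum, Finset.smul_sum, ← Finset.sum_sub_distrib,
          Finset.sum_range_succ _ (n + 1), hN (n + 1) _ (hv (n + 1)), smul_smul, hc, one_smul, sub_self,
          add_zero]
        refine Finset.sum_congr rfl fun m _ => ?_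
        rw [hN m _ (hv m), sub_smul, one_smul, smul_smul]
      obtain ⟨a, w, haw⟩ := ih (fun m => (1 - c * (m : k)) • v m)
        (fun m => Submodule.smul_mem _ _ (hv m)) (by
          rw [e, map_sub, map_smul, hy, diff_diff, smul_zero, sub_zero]
          exact h)
      refine ⟨a, w + c • s y, ?_⟩
      rw [map_add, map_smul, ← hy, ← add_assoc, ← haw, e]
      exact (sub_add_cancel _ _).symm
  -- Injectivity comes from the retraction `r` that sends the new generators to zero; the same
  -- retraction shows that the part in A of a cycle is a cycle.
  refine (alg_weq_iff _).2 (weq_of_total _ (fun x hx ⟨y, hy⟩ => ⟨totMap r.map y, ?_⟩) fun y hy => ?_)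
  · rw [← totMap_diff, hy, hr']
  · obtain ⟨g, hg, rfl⟩ := (Submodule.mem_iSup_iff_exists_finsupp N y).1 (hall y)
    have hsum : (g.sum fun _ z => z) = ∑ m ∈ Finset.range (g.support.sup id + 1), g m :=
      Finsupp.sum_of_support_subset g (fun m hm => Finset.mem_range_succ_iff.2
        (Finset.le_sup (f := id) hm)) _ fun _ _ => rfl
    rw [hsum] at hy ⊢
    obtain ⟨a, w, haw⟩ := key _ g hg hy
    refine ⟨a, ?_, w, haw⟩
    rw [haw, map_add, diff_diff, add_zero] at hy
    rw [← hr' (diff _ a), totMap_diff, hy, map_zero]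

/-- A free disc for every element of B of positive degree makes the map to B a fibration, and
lifting against fibrations only asks for preimages of the disc generators. -/
theorem exists_anodyne_factorization [CharZero k] {B : OpAlg O} (f : A ⟶ B) :
    ∃ (Z : OpAlg O) (j : A ⟶ Z) (q : Z ⟶ B), (fibrations (OpAlg O)).llp j ∧ Fibration q ∧
      WeakEquivalence j ∧ j ≫ q = f := by
  let T : Type u := Σ i : ℕ, B.cx.X (i + 1)
  obtain ⟨E⟩ := exists_attached A (T := T) (fun t => t.1 + 1) fun _ => none
  obtain ⟨q, hq, hqx⟩ := E.exists_lift B f (fun t => t.2) fun t z hz =>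
    (Option.not_mem_none _ hz).elim
  refine ⟨E.Z, E.j, q, ?_, (alg_fibration_iff q).2 fun i hi y => ?_, weq_of_attached_free E, hq⟩
  · intro U V p hp
    constructor
    intro a b sq
    have hs := (alg_fibration_iff p).1 ⟨hp⟩
    choose ω hω using fun t : T => hs (t.1 + 1) t.1.succ_pos (b.map.f (t.1 + 1) (E.x t))
    obtain ⟨l, hl, hlx⟩ := E.exists_lift U a ω fun t z hz => (Option.not_mem_none _ hz).elim
    refine ⟨⟨⟨l, hl, OpAlg.Hom.ext (hom_ext_totMap fun z => E.generates _
      (isSub_eqLocus (l ≫ p) b) (fun y => ?_) (fun t => ?_) z)⟩⟩⟩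
    · change totMap (l ≫ p).map (totMap E.j.map y) = totMap b.map (totMap E.j.map y)
      rw [← totMap_alg_comp, ← totMap_alg_comp, ← Category.assoc, hl]
      exact totMap_congr sq.w y
    · change totMap (l ≫ p).map (hom _ _ _) = totMap b.map (hom _ _ _)
      rw [totMap_hom, totMap_hom, ← hω t, ← hlx t]
      rfl
  · obtain ⟨i, rfl⟩ := Nat.exists_eq_succ_of_ne_zero hi.ne'
    exact ⟨E.x ⟨i, y⟩, hqx ⟨i, y⟩⟩

end Free

/-! ### Pushouts of trivial cofibrations -/

theorem alg_weq_comp_right {X Y Z : OpAlg O} {f : X ⟶ Y} {g : Y ⟶ Z} (hf : WeakEquivalence f)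
    (hfg : WeakEquivalence (f ≫ g)) : WeakEquivalence g := by
  rw [alg_weq_iff] at *
  exact (isCofCat_chPlus k).weq_right f.map g.map hf hfg

/-- Lifting in the factorization makes `i` a retract of a weak equivalence; the retract argument is
carried out on cycles. -/
theorem weq_of_llp_fibrations [CharZero k] {X Y : OpAlg O} {i : X ⟶ Y}
    (hi : (fibrations (OpAlg O)).llp i) : WeakEquivalence i := by
  obtain ⟨Z, j, q, -, hq, hw, e⟩ := exists_anodyne_factorization i
  have := hi q hq.mem
  have sq : CommSq j i q (𝟙 Y) := ⟨by rw [e, Category.comp_id]⟩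
  have h₁ : i ≫ sq.lift = j := sq.fac_left
  have h₂ : sq.lift ≫ q = 𝟙 Y := sq.fac_right
  have hw' := (alg_weq_iff j).1 hw
  refine (alg_weq_iff i).2 (weq_of_total _ (fun x hx ⟨y, hy⟩ => ?_) fun y hy => ?_)
  · refine exists_diff_eq hw' hx (y := totMap sq.lift.map y) ?_
    rw [← totMap_diff, hy, ← totMap_alg_comp, h₁]
  · obtain ⟨x, hx, w, hxw⟩ := exists_cycle_eq hw' (y := totMap sq.lift.map y) (by
      rw [← totMap_diff, hy, map_zero])
    refine ⟨x, hx, totMap q.map w, ?_⟩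
    have := congrArg (totMap q.map) hxw
    rw [map_add, ← totMap_alg_comp, ← totMap_alg_comp, totMap_congr h₂, totMap_diff,
      totMap_congr e] at this
    exact (totMap_id _ y).symm.trans this

/-- The usual retract argument: by two-out-of-three the second factor is a trivial fibration, so `f`
is a retract of the first. -/
theorem llp_fibrations_of_trivialCofibration [CharZero k] {A B : OpAlg O} {f : A ⟶ B}
    (hf : Cofibration f) (hw : WeakEquivalence f) : (fibrations (OpAlg O)).llp f := by
  obtain ⟨Z, j, q, hj, hq, hjw, e⟩ := exists_anodyne_factorization f
  have hqw : WeakEquivalence q := alg_weq_comp_right hjw (by rwa [e])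
  have := hf.mem q ⟨hq.mem, hqw.mem⟩
  have sq : CommSq j f q (𝟙 B) := ⟨by rw [e, Category.comp_id]⟩
  refine MorphismProperty.of_retract (P := (fibrations (OpAlg O)).llp) (f := f) (g := j) ?_ hj
  exact
    { i := Arrow.homMk (𝟙 A) sq.lift (by simp)
      r := Arrow.homMk (𝟙 A) q (by simp [e])
      retract := by ext <;> simp }

variable (O) in
theorem isCofCat_opAlg (h : CharZero k ∨ IsModelStructure (OpAlg O)) : IsCofCat (OpAlg O) := by
  refine IsCofCat.of_functor (OpAlg.forget O ⋙ chPlusV k)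
    (fun f => (alg_weq_iff f).trans (chPlus_weq_iff f.map)) inferInstance ?_ ?_ ?_ ?_
    exists_cof_weq_factorization
  · intro X Y f _
    exact (cofibration_iff f).2 fun U V q _ => inferInstance
  · intro X Y Z f g hf hg
    rw [cofibration_iff] at *
    exact MorphismProperty.comp_mem (trivialFibrations (OpAlg O)).llp f g hf hg
  · intro A B X Y f g h i s hf
    rw [cofibration_iff] at *
    exact MorphismProperty.of_isPushout (P := (trivialFibrations (OpAlg O)).llp) s.flip hf
  · intro A B X Y f g h' i s hf hw
    -- In both cases trivial cofibrations lift against all fibrations, a property stable under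
    -- pushout, and maps with this lifting property are weak equivalences.
    rcases h with h | h
    · exact weq_of_llp_fibrations (MorphismProperty.of_isPushout
        (P := (fibrations (OpAlg O)).llp) s.flip (llp_fibrations_of_trivialCofibration hf hw))
    · have hi : trivialCofibrations (OpAlg O) i := by
        rw [← h.2.llp] at *
        refine MorphismProperty.of_isPushout (P := (fibrations (OpAlg O)).llp) s.flip ?_
        rw [h.2.llp]
        exact ⟨hf.mem, hw.mem⟩
      exact ⟨hi.2⟩

end Goodwillie

end

noncomputable section

namespace Goodwillie

variable {k : Type u} [Field k] (O : ReducedOperad k)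

theorem isCofCat_setting : ∀ (s : Setting),
    (s = Setting.alg → CharZero k ∨ IsModelStructure (OpAlg O)) → IsCofCat (s.Obj O)
  | .alg, h => isCofCat_opAlg O (h rfl)
  | .chPlus, _ => isCofCat_chPlus k
  | .ch, _ => isCofCat_ch k

/-- The realizations of the three settings. -/
def settingRealization : ∀ s : Setting, Realization.{u} (s.Obj O)
  | .alg => opAlgRealization O
  | .chPlus => chPlusRealization k
  | .ch => chRealization k

end Goodwillie

end

theorem mainTheorem8 {k : Type u} [Field k] (O : ReducedOperad k) (C D : Setting)
    (hO : C = Setting.alg ∨ D = Setting.alg → CharZero k ∨ IsModelStructure (OpAlg O))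
    (n : ℕ) (hn : 1 ≤ n) :
    (∀ H : C.Obj O ⥤ D.Obj O, Goodwillie.IsHomotopyFunctor H → Goodwillie.IsReduced H →
      Goodwillie.IsExcisive n H → Goodwillie.HasContractibleCrossEffect n H →
      Goodwillie.IsExcisive (n - 1) H) ∧
    (∀ (F G : C.Obj O ⥤ D.Obj O) (J : F ⟶ G), Goodwillie.IsHomogeneous n F →
      Goodwillie.IsHomogeneous n G → Goodwillie.IsCrossEffectEquivalence n J →
      ∀ X : C.Obj O, WeakEquivalence (J.app X)) := by
  have hC := Goodwillie.isCofCat_setting O C fun h => hO (Or.inl h)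
  have R := Goodwillie.settingRealization O D
  obtain ⟨m, rfl⟩ : ∃ m, n = m + 1 := ⟨n - 1, by omega⟩
  exact ⟨fun H hH _ he hcr => Goodwillie.isExcisive_of_hasContractibleCrossEffect hC R hH he hcr,
    fun F G J hF hG hJ => Goodwillie.weq_of_isCrossEffectEquivalence hC R J hF hG hJ⟩
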